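/- Let $(\mathfrak M,+,0)$ be a commutative monoid in the category of separated schemes locally of finite type over $\mathbb C$. A variety over $\mathfrak M$ is a separated $\mathbb C$-scheme $X$ of finite type with a morphism $X\to\mathfrak M$ over $\mathbb{C}$. Let $K_0(\mathrm{Var}/\mathfrak M)$ be the free abelian group on isomorphism classes of varieties over $\mathfrak M$ modulo $[X\to\mathfrak M]=[Z\to\mathfrak M]+[X\setminus Z\to\mathfrak M]$ for $Z\subset X$ closed, with the product $[X\to\mathfrak M]\cdot[Y\to\mathfrak M]=[X\times Y\to\mathfrak M\times\mathfrak M\xrightarrow{+}\mathfrak M]$. Put $\mathbb L=[\mathbb A^1\to 0\in\mathfrak M]$; let $K_0(\mathrm{Var}/\mathfrak M)[\mathbb L^{-1}]$ be the localization, and let $K_0(\mathrm{Var}/\mathfrak M)[\mathbb L^{-1/2}]$ be obtained from it by formally adjoining a square root $\mathbb L^{1/2}$ of $\mathbb L$. For $n\ge 1$ let $n_*$ be the additive map with $n_*[X\xrightarrow{p}\mathfrak M]=[X\xrightarrow{n\cdot p}\mathfrak M]$, extended to both rings linearly over the powers of $\mathbb L$, respectively $\mathbb L^{1/2}$. A power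 structure on a commutative ring $R$ is a map $(1+tR[[t]])\times R\to 1+tR[[t]]$, $(A(t),r)\mapsto A(t)^r$, such that $A^0=1$, $A^1=A$, $(AB)^r=A^rB^r$, $A^{r+s}=A^rA^s$ and $A^{rs}=(A^r)^s$. Write $\zeta_a(t)=(1+t+t^2+\cdots)^a$. It is finitely determined if for every $r\in R$ and every $N$ there is a $k$ such that $A(t)^r$ modulo $t^N$ depends only on $A(t)$ modulo $t^k$. There is a unique power structure on $K_0(\mathrm{Var}/\mathfrak M)$ for which, for all varieties $M$ and $A_i$ ($i\ge1$) over $\mathfrak M$ and all $n$, the coefficient of $t^n$ in $\bigl(1+\sum_{i\ge1}[A_i]t^i\bigr)^{[M]}$ is $\sum_{\alpha\vdash n}[B_\alpha\to\mathfrak M]$ whenever the quotients $$B_\alpha=\Bigl(\bigl(\textstyle\prod_{i} M^{b_i(\alpha)}\setminus\Delta\bigr)\times\prod_i A_i^{b_i(\alpha)}\Bigr)\Big/\textstyle\prod_i S_{b_i(\alpha)}$$ exist as schemes. Here $b_i(\alpha)$ is the number of parts of $\alpha$ of size $i$, $\Delta$ is the large diagonal, and $B_\alpha\to\mathfrak M$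 is induced by the sum, over the parts of $\alpha$, of $i\cdot p_M+p_{A_i}$ ($i$ the size of the part). Moreover: (a) There is a unique power structure on $K_0(\mathrm{Var}/\mathfrak M)[\mathbb L^{-1}]$ which extends this one, is finitely determined, satisfies $A(t^n)^{r}=\bigl(A(t)^{n_*r}\bigr)\big|_{t\mapsto t^n}$ for all $A(t)$, $r$ and $n\ge 1$, and satisfies $$\zeta_{a}(t)^{\mathbb L^k}=\zeta_{\mathbb L^k a}(t)=\zeta_{a}(\mathbb L^k t)$$ for all $a$ in the ring and all $k\in\mathbb Z$. (b) There is a unique power structure on $K_0(\mathrm{Var}/\mathfrak M)[\mathbb L^{-1/2}]$ which extends the one on $K_0(\mathrm{Var}/\mathfrak M)$, is finitely determined, satisfies the same substitution rule for $t\mapsto t^n$, and satisfies the same zeta identities for all $a$ in the ring and all $k\in\frac12\mathbb Z$; it also extends the power structure of (a). -/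

import Mathlib

open CategoryTheory AlgebraicGeometry MonoidalCategory CartesianMonoidalCategory
open scoped MonObj AddMonObj

noncomputable section

namespace MotivicPower

/-! ### Varieties over a commutative monoid scheme and their Grothendieck ring -/

/-- Schemes over `ℂ`. -/
abbrev CSch : Type 1 := Over (Spec (.of ℂ))

/-- A variety over `𝔐`: a separated `ℂ`-scheme of finite type with a `ℂ`-morphism to `𝔐`.
Non-reduced schemes are allowed; the cut and paste relations identify them with their
reductions. -/
structure RelVar (𝔐 : CSch) where
  /-- the total space -/
  X : CSch
  /-- the structure morphism to `𝔐` -/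
  p : X ⟶ 𝔐
  [lft : LocallyOfFiniteType X.hom]
  [qc : QuasiCompact X.hom]
  [sep : IsSeparated X.hom]

attribute [instance] RelVar.lft RelVar.qc RelVar.sep

section Ring

variable {𝔐 : CSch}

/-- Isomorphism of varieties over `𝔐`. -/
def RelVar.Iso (V W : RelVar 𝔐) : Prop := ∃ e : V.X ≅ W.X, e.hom ≫ W.p = V.p

instance RelVar.setoid (𝔐 : CSch) : Setoid (RelVar 𝔐) where
  r := RelVar.Iso
  iseqv :=
    { refl := fun V => ⟨Iso.refl _, by simp⟩
      symm := fun {V W} ⟨e, h⟩ => ⟨e.symm, by simp [← h]⟩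
      trans := fun {U V W} ⟨e, h⟩ ⟨f, k⟩ => ⟨e ≪≫ f, by simp [h, k]⟩ }

/-- Isomorphism classes of varieties over `𝔐`. -/
def IsoClass (𝔐 : CSch) : Type 1 := Quotient (RelVar.setoid 𝔐)

/-- `V` is cut into a closed subscheme `Z` and its open complement `U`. -/
def IsCut (V Z U : RelVar 𝔐) : Prop :=
  ∃ (i : Z.X ⟶ V.X) (j : U.X ⟶ V.X), i ≫ V.p = Z.p ∧ j ≫ V.p = U.p ∧
    IsClosedImmersion i.left ∧ IsOpenImmersion j.left ∧
    Set.range j.left = (Set.range i.left)ᶜ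

variable [AddMonObj 𝔐]

/-- `X × Y ⟶ 𝔐 × 𝔐 ⟶ 𝔐`, the last map being the addition. -/
def RelVar.mul (V W : RelVar 𝔐) : RelVar 𝔐 where
  X := V.X ⊗ W.X
  p := fst V.X W.X ≫ V.p + snd V.X W.X ≫ W.p
  lft := by dsimp; infer_instance
  qc := by dsimp; infer_instance
  sep := by dsimp; infer_instance

/-- The point `Spec ℂ`, mapped to `0 ∈ 𝔐`. -/
def RelVar.pt (𝔐 : CSch) [AddMonObj 𝔐] : RelVar 𝔐 where
  X := 𝟙_ CSch
  p := 0
  lft := by dsimp; infer_instance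
  qc := by dsimp; infer_instance
  sep := by dsimp; infer_instance

/-- The affine line, mapped to `0 ∈ 𝔐`. -/
def RelVar.affineLine (𝔐 : CSch) [AddMonObj 𝔐] : RelVar 𝔐 where
  X := Over.mk (𝔸(PUnit; Spec (.of ℂ)) ↘ Spec (.of ℂ))
  p := 0
  lft := by dsimp; infer_instance
  qc := by dsimp; infer_instance
  sep := by dsimp; infer_instance

variable [IsCommAddMonObj 𝔐]

/-- `n_* V`: the same space, with its map to `𝔐` followed by multiplication by `n`. -/
def RelVar.push (n : ℕ) (V : RelVar 𝔐) : RelVar 𝔐 where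
  X := V.X
  p := n • V.p

instance IsoClass.commMonoid : CommMonoid (IsoClass 𝔐) where
  mul := Quotient.map₂ RelVar.mul (by
    rintro V V' ⟨e, he⟩ W W' ⟨f, hf⟩
    exact ⟨e ⊗ᵢ f, by simp [RelVar.mul, AddMonObj.comp_add, he, hf]⟩)
  one := Quotient.mk _ (RelVar.pt 𝔐)
  mul_assoc := by
    rintro ⟨U⟩ ⟨V⟩ ⟨W⟩
    exact Quotient.sound ⟨α_ _ _ _, by
      simp [RelVar.mul, AddMonObj.comp_add, add_assoc]⟩
  one_mul := by
    rintro ⟨V⟩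
    exact Quotient.sound ⟨λ_ _, by
      simp [RelVar.mul, RelVar.pt, leftUnitor_hom]⟩
  mul_one := by
    rintro ⟨V⟩
    exact Quotient.sound ⟨ρ_ _, by
      simp [RelVar.mul, RelVar.pt, rightUnitor_hom]⟩
  mul_comm := by
    rintro ⟨V⟩ ⟨W⟩
    exact Quotient.sound ⟨β_ _ _, by
      simp [RelVar.mul, AddMonObj.comp_add, add_comm]⟩

/-- The ideal of cut and paste relations `[V] = [Z] + [U]` in the free abelian group on
isomorphism classes, which is a ring under the product of varieties over `𝔐`. -/
def cutIdeal (𝔐 : CSch) [AddMonObj 𝔐] [IsCommAddMonObj 𝔐] :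
    Ideal (FreeAbelianGroup (IsoClass 𝔐)) :=
  Ideal.span {x | ∃ V Z U : RelVar 𝔐, IsCut V Z U ∧
    x = FreeAbelianGroup.of (Quotient.mk _ V) -
      (FreeAbelianGroup.of (Quotient.mk _ Z) + FreeAbelianGroup.of (Quotient.mk _ U))}

/-- The Grothendieck ring `K₀(Var/𝔐)`. -/
abbrev K0 (𝔐 : CSch) [AddMonObj 𝔐] [IsCommAddMonObj 𝔐] : Type 1 :=
  FreeAbelianGroup (IsoClass 𝔐) ⧸ cutIdeal 𝔐

/-- The class `[X ⟶ 𝔐]`. -/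
def cls (V : RelVar 𝔐) : K0 𝔐 :=
  Ideal.Quotient.mk (cutIdeal 𝔐) (FreeAbelianGroup.of (Quotient.mk _ V))

/-- The Lefschetz motive `𝕃 = [𝔸¹ ⟶ 0 ∈ 𝔐]`. -/
def lef (𝔐 : CSch) [AddMonObj 𝔐] [IsCommAddMonObj 𝔐] : K0 𝔐 := cls (RelVar.affineLine 𝔐)

/-- `K₀(Var/𝔐)[𝕃⁻¹]`. -/
abbrev K0Loc (𝔐 : CSch) [AddMonObj 𝔐] [IsCommAddMonObj 𝔐] : Type 1 :=
  Localization.Away (lef 𝔐)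

/-- `𝕃` as a unit of `K₀(Var/𝔐)[𝕃⁻¹]`. -/
def lefUnit (𝔐 : CSch) [AddMonObj 𝔐] [IsCommAddMonObj 𝔐] : (K0Loc 𝔐)ˣ :=
  (IsLocalization.Away.algebraMap_isUnit (S := K0Loc 𝔐) (lef 𝔐)).unit

/-- `K₀(Var/𝔐)[𝕃^{-1/2}]`: a square root of `𝕃` is adjoined formally
to `K₀(Var/𝔐)[𝕃⁻¹]`. -/
abbrev K0Half (𝔐 : CSch) [AddMonObj 𝔐] [IsCommAddMonObj 𝔐] : Type 1 :=
  AdjoinRoot (Polynomial.X ^ 2 - Polynomial.C (lefUnit 𝔐 : K0Loc 𝔐))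

/-- The adjoined root squares to `𝕃`. -/
theorem root_mul_root (𝔐 : CSch) [AddMonObj 𝔐] [IsCommAddMonObj 𝔐] :
    (AdjoinRoot.root (Polynomial.X ^ 2 - Polynomial.C (lefUnit 𝔐 : K0Loc 𝔐)) : K0Half 𝔐) *
      AdjoinRoot.root _ = AdjoinRoot.of _ (lefUnit 𝔐 : K0Loc 𝔐) := by
  have h := AdjoinRoot.eval₂_root (Polynomial.X ^ 2 - Polynomial.C (lefUnit 𝔐 : K0Loc 𝔐))
  simpa [sub_eq_zero, pow_two] using h

/-- `𝕃^{1/2}` as a unit of `K₀(Var/𝔐)[𝕃^{-1/2}]`. -/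
def lefHalfUnit (𝔐 : CSch) [AddMonObj 𝔐] [IsCommAddMonObj 𝔐] : (K0Half 𝔐)ˣ where
  val := AdjoinRoot.root _
  inv := AdjoinRoot.root _ * AdjoinRoot.of _ (((lefUnit 𝔐)⁻¹ : (K0Loc 𝔐)ˣ) : K0Loc 𝔐)
  val_inv := by
    rw [← mul_assoc, root_mul_root, ← map_mul, Units.mul_inv, map_one]
  inv_val := by
    rw [mul_right_comm, root_mul_root, ← map_mul, Units.mul_inv, map_one]

end Ring

/-! ### Power structures -/

section PowerStructure

open PowerSeries

/-- `1 + t R[[t]]`, as a multiplicative monoid. -/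
def oneSeries (R : Type*) [CommRing R] : Submonoid R⟦X⟧ :=
  MonoidHom.mker (constantCoeff (R := R))

variable {R S : Type*} [CommRing R] [CommRing S]

/-- The series `1 + ∑_{i ≥ 1} a i * t ^ i`. -/
def mkOne (a : ℕ → R) : oneSeries R :=
  ⟨PowerSeries.mk fun i => if i = 0 then 1 else a i, by simp [oneSeries, MonoidHom.mem_mker]⟩

/-- Apply a ring homomorphism to the coefficients. -/
def mapOne (φ : R →+* S) (A : oneSeries R) : oneSeries S :=
  ⟨PowerSeries.map φ A.1, by
    have h : constantCoeff A.1 = 1 := A.2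
    change constantCoeff (PowerSeries.map φ A.1) = 1
    rw [← coeff_zero_eq_constantCoeff_apply, coeff_map, coeff_zero_eq_constantCoeff_apply, h,
      map_one]⟩

/-- `A(t) ↦ A(c t)`. -/
def scaleOne (c : R) (A : oneSeries R) : oneSeries R :=
  ⟨PowerSeries.rescale c A.1, by
    have h : constantCoeff A.1 = 1 := A.2
    change constantCoeff (PowerSeries.rescale c A.1) = 1
    rw [← coeff_zero_eq_constantCoeff_apply, coeff_rescale]
    simp [h]⟩

/-- `A(t) ↦ A(t ^ n)`, for `n ≠ 0`. -/
def expandOne (n : ℕ) (hn : n ≠ 0) (A : oneSeries R) : oneSeries R :=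
  ⟨PowerSeries.expand n hn A.1, by
    have h : constantCoeff A.1 = 1 := A.2
    simp [oneSeries, MonoidHom.mem_mker, h]⟩

/-- A power structure on a commutative ring: a map
`(1 + t R[[t]]) × R → 1 + t R[[t]]`, `(A(t), r) ↦ A(t) ^ r`, with the five axioms. -/
@[ext]
structure PowerStructure (R : Type*) [CommRing R] where
  /-- the map `(A(t), r) ↦ A(t) ^ r` -/
  pow : oneSeries R → R → oneSeries R
  pow_zero : ∀ A, pow A 0 = 1
  pow_one : ∀ A, pow A 1 = A
  mul_pow : ∀ A B r, pow (A * B) r = pow A r * pow B r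
  pow_add : ∀ A r s, pow A (r + s) = pow A r * pow A s
  pow_mul : ∀ A r s, pow A (r * s) = pow (pow A r) s

namespace PowerStructure

/-- `ζ_a(t) = (1 + t + t² + ⋯) ^ a`. -/
def zeta (P : PowerStructure R) (a : R) : oneSeries R := P.pow (mkOne fun _ => 1) a

/-- `Q` extends `P` along the ring homomorphism `φ`. -/
def Extends (φ : R →+* S) (P : PowerStructure R) (Q : PowerStructure S) : Prop :=
  ∀ A r, Q.pow (mapOne φ A) (φ r) = mapOne φ (P.pow A r)

/-- Finitely determined: each finite truncation of `A(t) ^ r` depends, for fixed `r`, only on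
some finite truncation of `A(t)`. -/
def FinitelyDetermined (P : PowerStructure R) : Prop :=
  ∀ (r : R) (N : ℕ), ∃ k : ℕ, ∀ A B : oneSeries R,
    (∀ i < k, coeff i A.1 = coeff i B.1) →
      ∀ i < N, coeff i (P.pow A r).1 = coeff i (P.pow B r).1

/-- `ζ_a(t) ^ (u ^ k) = ζ_{u ^ k a}(t) = ζ_a(u ^ k t)` for all integers `k`. -/
def ZetaProperty (P : PowerStructure R) (u : Rˣ) : Prop :=
  ∀ (a : R) (k : ℤ),
    P.pow (P.zeta a) ((u ^ k : Rˣ) : R) = P.zeta (((u ^ k : Rˣ) : R) * a) ∧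
      P.zeta (((u ^ k : Rˣ) : R) * a) = scaleOne ((u ^ k : Rˣ) : R) (P.zeta a)

end PowerStructure

end PowerStructure

/-! ### The geometric power structure -/

section Geometric

/-- `π : Y ⟶ B` is the (geometric) quotient of `Y` by the finite family of automorphisms `ρ`,
the family being the elements of a finite group acting on `Y`: it is finite, surjective and
invariant, its fibres are the orbits, and the functions on `B` are the invariant
functions on `Y`. -/
structure IsQuotient {G : Type} {Y B : Scheme.{0}} (ρ : G → (Y ⟶ Y)) (π : Y ⟶ B) : Prop where
  finite : IsFinite π
  surjective : Function.Surjective π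
  invariant : ∀ g, ρ g ≫ π = π
  orbit : ∀ x y : Y, π x = π y → ∃ g, ρ g x = y
  descend : ∀ (U : B.Opens) (s : Γ(Y, π ⁻¹ᵁ U)),
    (∀ (g : G) (e : π ⁻¹ᵁ U ≤ ρ g ⁻¹ᵁ (π ⁻¹ᵁ U)), (ρ g).appLE (π ⁻¹ᵁ U) (π ⁻¹ᵁ U) e s = s) →
      ∃! b : Γ(B, U), π.app U b = s

variable {𝔐 : CSch}

/-- The set of parts of a partition `α` of `n`: the part sizes are `i + 1` for `i : Fin n`,
and there are `b_{i+1}(α)` parts of size `i + 1`. -/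
abbrev Parts {n : ℕ} (α : n.Partition) : Type := Σ i : Fin n, Fin (α.parts.count ((i : ℕ) + 1))

/-- The group `S_α = ∏_i S_{b_i(α)}`. -/
abbrev SGroup {n : ℕ} (α : n.Partition) : Type :=
  ∀ i : Fin n, Equiv.Perm (Fin (α.parts.count ((i : ℕ) + 1)))

variable (A : ℕ → RelVar 𝔐) (M : RelVar 𝔐) {n : ℕ} (α : n.Partition)

/-- `∏_i M ^ {b_i(α)} × ∏_i A_i ^ {b_i(α)}`, arranged as the product over the
parts of `α` of `M × A_i`, `i` the size of the part. -/
def labelled : CSch := ∏ᶜ fun q : Parts α => M.X ⊗ (A (q.1 + 1)).X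

/-- The position in `M` of the particle with index `q`. -/
def position (q : Parts α) : labelled A M α ⟶ M.X :=
  Limits.Pi.π (fun q : Parts α => M.X ⊗ (A (q.1 + 1)).X) q ≫ fst _ _

/-- The internal state in `A_i` of the particle with index `q`. -/
def state (q : Parts α) : labelled A M α ⟶ (A (q.1 + 1)).X :=
  Limits.Pi.π (fun q : Parts α => M.X ⊗ (A (q.1 + 1)).X) q ≫ snd _ _

/-- The action of `S_α` by permuting the factors. -/
def permute (g : SGroup α) : labelled A M α ⟶ labelled A M α :=
  Limits.Pi.lift fun q : Parts α =>
    Limits.Pi.π (fun q : Parts α => M.X ⊗ (A (q.1 + 1)).X) ⟨q.1, g q.1 q.2⟩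

/-- The large diagonal `Δ`: two of the positions in `M` agree. -/
def largeDiagonal : Set (labelled A M α).left :=
  {x | ∃ q r : Parts α, q ≠ r ∧
    (lift (position A M α q) (position A M α r)).left x ∈
      Set.range (lift (𝟙 M.X) (𝟙 M.X)).left}

/-- The total weight `∑ (i p_M + p_{A_i})`, the sum being over the parts of `α`. -/
def weight [AddMonObj 𝔐] [IsCommAddMonObj 𝔐] : labelled A M α ⟶ 𝔐 :=
  ∑ q : Parts α, (((q.1 : ℕ) + 1) • (position A M α q ≫ M.p) +
    state A M α q ≫ (A (q.1 + 1)).p)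

/-- A variety `B_α = (∏_i M ^ {b_i} ∖ Δ) ×_{S_α} ∏_i A_i ^ {b_i}` over `𝔐`. -/
structure ConfigQuotient [AddMonObj 𝔐] [IsCommAddMonObj 𝔐] where
  /-- the complement of the large diagonal, as an open subscheme -/
  Y : CSch
  /-- its inclusion -/
  incl : Y ⟶ labelled A M α
  incl_open : IsOpenImmersion incl.left
  incl_range : Set.range incl.left = (largeDiagonal A M α)ᶜ
  /-- the action of `S_α` on it -/
  act : SGroup α → (Y ⟶ Y)
  act_comp : ∀ g, act g ≫ incl = incl ≫ permute A M α g
  /-- the quotient, with its map to `𝔐` -/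
  B : RelVar 𝔐
  /-- the quotient morphism -/
  proj : Y ⟶ B.X
  quotient : IsQuotient (fun g => (act g).left) proj.left
  weight_eq : proj ≫ B.p = incl ≫ weight A M α

end Geometric

variable {𝔐 : CSch} [AddMonObj 𝔐] [IsCommAddMonObj 𝔐]

/-- `P` is given on effective classes by the geometric construction: the coefficient of `t ^ n`
in `(1 + ∑_{i ≥ 1} [A_i] t ^ i) ^ [M]` is the sum of the classes `[B_α]` over the
partitions `α` of `n`. -/
def PowerStructure.IsGeometric (P : PowerStructure (K0 𝔐)) : Prop :=
  ∀ (A : ℕ → RelVar 𝔐) (M : RelVar 𝔐) (n : ℕ) (Q : ∀ α : n.Partition, ConfigQuotient A M α),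
    PowerSeries.coeff n (P.pow (mkOne fun i => cls (A i)) (cls M)).1 =
      ∑ α : n.Partition, cls (Q α).B

/-- `A(t ^ n) ^ r = A(t) ^ (n_* r)` with `t` replaced by `t ^ n`, for `r = u ^ k [V]`, where
`n_* (u ^ k [V]) = u ^ k [n_* V]`. Here `R` is an extension of `K₀(Var/𝔐)` by
powers of `u`, so that the elements `u ^ k [V]` span `R` additively. -/
def PowerStructure.PushProperty {R : Type*} [CommRing R] (P : PowerStructure R)
    (φ : K0 𝔐 →+* R) (u : Rˣ) : Prop :=
  ∀ (n : ℕ) (hn : n ≠ 0) (A : oneSeries R) (V : RelVar 𝔐) (k : ℤ),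
    P.pow (expandOne n hn A) (((u ^ k : Rˣ) : R) * φ (cls V)) =
      expandOne n hn (P.pow A (((u ^ k : Rˣ) : R) * φ (cls (V.push n))))

/-- `P` is an extension of the power structure `P₀` of `K₀(Var/𝔐)` to `R`: it restricts to `P₀`,
is finitely determined and compatible with the substitutions `t ↦ t ^ n`,
and has the zeta function property for the powers of `u`. -/
structure PowerStructure.IsZetaExtension {R : Type*} [CommRing R] (P : PowerStructure R)
    (φ : K0 𝔐 →+* R) (u : Rˣ) (P₀ : PowerStructure (K0 𝔐)) : Prop where
  extends_base : PowerStructure.Extends φ P₀ P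
  finitelyDetermined : P.FinitelyDetermined
  push : P.PushProperty φ u
  zeta : P.ZetaProperty u

/-- `K₀(Var/𝔐) → K₀(Var/𝔐)[𝕃⁻¹]`. -/
def toLoc (𝔐 : CSch) [AddMonObj 𝔐] [IsCommAddMonObj 𝔐] : K0 𝔐 →+* K0Loc 𝔐 :=
  algebraMap (K0 𝔐) (K0Loc 𝔐)

/-- `K₀(Var/𝔐)[𝕃⁻¹] → K₀(Var/𝔐)[𝕃^{-1/2}]`. -/
def locToHalf (𝔐 : CSch) [AddMonObj 𝔐] [IsCommAddMonObj 𝔐] : K0Loc 𝔐 →+* K0Half 𝔐 :=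
  AdjoinRoot.of _

end MotivicPower

end

/-! Everything is read off from complex points. A `DefType` is a finite union of constructible sets
of complex points modulo a constructible equivalence relation; by Chevalley's theorem, definable
predicates are closed under first order formulas. In characteristic zero, a jointly bijective family
of varieties over `W` has, over a nonempty open piece of the reduction of `W`, a section
(`exists_section`). Noetherian induction then shows that definable bijections preserving the map to
`𝔐` preserve classes in `K0 𝔐` (`sum_cls_eq_of_bijective`, `HasClass.unique`). Hence `K0 𝔐` is the
group completion of the semiring `SK 𝔐` of weighted definable types up to definable bijection
(`toK0_eq_iff`), and identities between classes become first order bijections of sets.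

A configuration is a finitely supported labelling of the points of `M` by elements of the `A_i`, of
total degree `n`. Orbits of tuples with distinct positions are configurations, so the `B_α` with `α
⊢ n` together have the class of the space of configurations (`hasClass_conf`). Splitting the space
of positions, overlaying two labellings and taking `M` to be a point give `A^{r+s} = A^r A^s`,
`(AB)^r = A^r B^r` and `A^1 = A` (`confSer_add`, `confSer_mul`, `confSer_one`). Currying a
multiplicity function on `M × X` gives `ζ_x(t^k)^m = ζ_{k_*(m) x}(t^k)` (`confSer_expandSer`); the
factor `k` on the weight of `M` is the source of `k_*`.

On the algebraic side, every series in `1 + tR[[t]]` is uniquely a product of the `ζ_{a_k}(t^k)`, `k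
≥ 1`. If the `ψ_k` are ring endomorphisms, then replacing each `a_k` by `ψ_k(r) a_k` defines a power
structure (`ZetaRing.power`), and `ψ_{mk} = ψ_m ψ_k` gives the substitution rule. With `ψ_k = k_*`
this is the geometric structure, since both sides are continuous homomorphisms in `A` which agree on
the factors (`confHom_eq_pow`). It is unique because every effective class has an affine
representative, for which the quotients exist (`SK.exists_affine`, `nonempty_configQuotient`), while
every series is a quotient of effective series and every exponent a difference of effective classes.

The extensions rest on `ζ_{𝕃a}(t) = ζ_a(𝕃t)`, that is, on `[Sym^n(X × 𝔸¹)] = [Sym^n X] 𝕃^n`, which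
is Hermite interpolation at the points of an element of `Sym^n X` (`coeff_symSer_complex_mul`). It
makes `ζ_{a/𝕃^n}(t) = ζ_a(𝕃^{-n}t)` and `ζ_{a + b𝕃^{1/2}}(t) = ζ_a(t) ζ_b(𝕃^{1/2}t)` consistent
definitions, and the `ψ_k` extend by fixing the powers of `𝕃^{1/2}`. Conversely these formulas are
forced on the additive generators `u^k [V]`; the substitution rule and finite determinacy then force
the rest (`isZetaExtension_unique`). -/

noncomputable section

set_option linter.unusedSectionVars false

namespace MotivicPower

/-! ### Complex points and constructible sets of complex points -/

/-- Separated schemes of finite type over `ℂ`. -/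
class IsVar (X : CSch) : Prop where
  lft : LocallyOfFiniteType X.hom
  qc : QuasiCompact X.hom
  sep : IsSeparated X.hom

attribute [instance] IsVar.lft IsVar.qc IsVar.sep

instance {𝔐 : CSch} (V : RelVar 𝔐) : IsVar V.X := ⟨V.lft, V.qc, V.sep⟩

instance (X Y : CSch) [IsVar X] [IsVar Y] : IsVar (X ⊗ Y) :=
  ⟨by dsimp; infer_instance, by dsimp; infer_instance, by dsimp; infer_instance⟩

instance : IsVar (𝟙_ CSch) :=
  ⟨by dsimp; infer_instance, by dsimp; infer_instance, by dsimp; infer_instance⟩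

instance (X : CSch) [IsVar X] : IsNoetherian X.left where
  toIsLocallyNoetherian := LocallyOfFiniteType.isLocallyNoetherian X.hom
  toCompactSpace := QuasiCompact.compactSpace_of_compactSpace X.hom

instance (X : CSch) [LocallyOfFiniteType X.hom] : JacobsonSpace X.left :=
  LocallyOfFiniteType.jacobsonSpace X.hom

instance {X Y : CSch} [LocallyOfFiniteType X.hom] (f : X ⟶ Y) : LocallyOfFiniteType f.left := by
  have : LocallyOfFiniteType (f.left ≫ Y.hom) := by rw [Over.w]; infer_instance
  exact locallyOfFiniteType_of_comp f.left Y.hom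

instance {X Y : CSch} [IsSeparated X.hom] (f : X ⟶ Y) : IsSeparated f.left := by
  have : IsSeparated (f.left ≫ Y.hom) := by rw [Over.w]; infer_instance
  exact IsSeparated.of_comp f.left Y.hom

instance {X Y : CSch} [IsVar X] [IsVar Y] (f : X ⟶ Y) : LocallyOfFinitePresentation f.left :=
  LocallyOfFinitePresentation.iff_locallyOfFiniteType.mpr inferInstance

/-- The complex points of a scheme over `ℂ`. -/
abbrev pts (X : CSch) : Type := 𝟙_ CSch ⟶ X

/-- The point of the underlying space given by a complex point. -/
def topPt {X : CSch} (x : pts X) : X.left := x.left (IsLocalRing.closedPoint ℂ)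

theorem topPt_comp {X Y : CSch} (x : pts X) (f : X ⟶ Y) :
    topPt (x ≫ f) = f.left (topPt x) := by
  simp [topPt]
  rfl

theorem topPt_inj {X : CSch} [LocallyOfFiniteType X.hom] {x y : pts X}
    (h : topPt x = topPt y) : x = y := by
  ext1
  exact ext_of_apply_closedPoint_eq X.hom (Over.w x) (Over.w y) h

theorem isClosed_topPt {X : CSch} [LocallyOfFiniteType X.hom] (x : pts X) :
    IsClosed {topPt x} :=
  (pointEquivClosedPoint X.hom ⟨x.left, Over.w x⟩).2

theorem exists_topPt {X : CSch} [LocallyOfFiniteType X.hom] {x : X.left}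
    (hx : IsClosed {x}) : ∃ y : pts X, topPt y = x :=
  ⟨Over.homMk (pointOfClosedPoint X.hom x hx) (by exact pointOfClosedPoint_comp X.hom x hx),
    pointOfClosedPoint_apply X.hom x hx _⟩

open Topology

/-- A constructible set is a union of parts of a finite partition into locally closed sets. -/
theorem exists_partition_of_isConstructible {X : Type*} [TopologicalSpace X] {s : Set X}
    (hs : IsConstructible s) : ∃ (I : Type) (_ : Fintype I) (c : X → I) (t : Set I),
      (∀ i, IsLocallyClosed (c ⁻¹' {i})) ∧ s = c ⁻¹' t := by
  classical
  induction hs using IsConstructible.empty_union_induction with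
  | open_retrocompact U hU hc =>
    refine ⟨Prop, inferInstance, fun x => x ∈ U, {True}, fun i => ?_, by ext; simp⟩
    by_cases h : i
    · have : (fun x => x ∈ U) ⁻¹' {i} = U := by ext; simp [h]
      rw [this]; exact hU.isLocallyClosed
    · have : (fun x => x ∈ U) ⁻¹' {i} = Uᶜ := by ext; simp [h]
      rw [this]; exact hU.isClosed_compl.isLocallyClosed
  | union s hs t ht h₁ h₂ =>
    obtain ⟨I₁, _, c₁, t₁, hc₁, rfl⟩ := h₁
    obtain ⟨I₂, _, c₂, t₂, hc₂, rfl⟩ := h₂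
    refine ⟨I₁ × I₂, inferInstance, fun x => (c₁ x, c₂ x), {p | p.1 ∈ t₁ ∨ p.2 ∈ t₂},
      fun i => ?_, by ext; simp⟩
    have : (fun x => (c₁ x, c₂ x)) ⁻¹' {i} = c₁ ⁻¹' {i.1} ∩ c₂ ⁻¹' {i.2} := by
      ext; simp [Prod.ext_iff]
    rw [this]; exact (hc₁ _).inter (hc₂ _)
  | compl s hs h =>
    obtain ⟨I, _, c, t, hc, rfl⟩ := h
    exact ⟨I, inferInstance, c, tᶜ, hc, by simp⟩

/-- One of the locally closed parts making up the set is nonempty; it contains a closed point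
because the space is Jacobson, and closed points are complex points by the Nullstellensatz. This is
the bridge from topology to complex points. -/
theorem exists_pts_of_isConstructible {X : CSch} [LocallyOfFiniteType X.hom] {s : Set X.left}
    (hs : IsConstructible s) (hne : s.Nonempty) : ∃ x : pts X, topPt x ∈ s := by
  obtain ⟨I, _, c, t, hc, rfl⟩ := exists_partition_of_isConstructible hs
  obtain ⟨z, hz⟩ := hne
  obtain ⟨y, hy, hy'⟩ := nonempty_inter_closedPoints (Z := c ⁻¹' {c z}) ⟨z, by simp⟩ (hc _)
  obtain ⟨x, rfl⟩ := exists_topPt hy'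
  refine ⟨x, ?_⟩
  have : c (topPt x) = c z := hy
  simpa [this] using hz

theorem eq_univ_of_forall_topPt {X : CSch} [LocallyOfFiniteType X.hom] {s : Set X.left}
    (hs : IsConstructible s) (h : ∀ x : pts X, topPt x ∈ s) : s = Set.univ := by
  by_contra hne
  obtain ⟨x, hx⟩ := exists_pts_of_isConstructible hs.compl (Set.nonempty_compl.mpr hne)
  exact hx (h x)

theorem isConstructible_of_isOpen {X : CSch} [IsVar X] {s : Set X.left} (hs : IsOpen s) :
    IsConstructible s :=
  IsCompact.isConstructible (TopologicalSpace.NoetherianSpace.isCompact s) hs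

theorem isConstructible_of_isClosed {X : CSch} [IsVar X] {s : Set X.left} (hs : IsClosed s) :
    IsConstructible s := by
  simpa using (isConstructible_of_isOpen hs.isOpen_compl).compl

/-- Constructible sets of complex points. -/
def Constr {X : CSch} (s : Set (pts X)) : Prop :=
  ∃ Z : Set X.left, IsConstructible Z ∧ s = topPt ⁻¹' Z

namespace Constr

variable {X Y : CSch} {s t : Set (pts X)}

theorem of_iff (hs : Constr s) (h : ∀ x, x ∈ s ↔ x ∈ t) : Constr t := by
  rwa [← Set.ext h]

theorem univ : Constr (Set.univ : Set (pts X)) := ⟨_, .univ, by simp⟩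

theorem empty : Constr (∅ : Set (pts X)) := ⟨_, .empty, by simp⟩

theorem inter (hs : Constr s) (ht : Constr t) : Constr (s ∩ t) := by
  obtain ⟨Z, hZ, rfl⟩ := hs
  obtain ⟨W, hW, rfl⟩ := ht
  exact ⟨_, hZ.inter hW, by simp⟩

theorem compl (hs : Constr s) : Constr sᶜ := by
  obtain ⟨Z, hZ, rfl⟩ := hs
  exact ⟨_, hZ.compl, by simp⟩

theorem iUnion {I : Type*} [Finite I] {s : I → Set (pts X)} (hs : ∀ i, Constr (s i)) :
    Constr (⋃ i, s i) := by
  choose Z hZ h using hs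
  exact ⟨_, IsConstructible.iUnion hZ, by simp [h]⟩

theorem preimage {s : Set (pts Y)} (hs : Constr s) (f : X ⟶ Y) :
    Constr {x : pts X | x ≫ f ∈ s} := by
  obtain ⟨Z, hZ, rfl⟩ := hs
  refine ⟨_, f.left.isConstructible_preimage hZ, ?_⟩
  ext x
  simp [topPt_comp]

/-- Chevalley's theorem. The image on the underlying spaces has the right complex points because the
fibre over a closed point, intersected with the set, is constructible and nonempty and so contains a
complex point. -/
theorem image [IsVar X] [IsVar Y] (hs : Constr s) (f : X ⟶ Y) :
    Constr {y : pts Y | ∃ x ∈ s, x ≫ f = y} := by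
  obtain ⟨Z, hZ, rfl⟩ := hs
  refine ⟨_, f.left.isConstructible_image hZ, ?_⟩
  ext y
  constructor
  · rintro ⟨x, hx, rfl⟩
    exact ⟨_, hx, (topPt_comp x f).symm⟩
  · rintro ⟨z, hz, hzy⟩
    have hc : IsConstructible (Z ∩ f.left ⁻¹' {topPt y}) :=
      hZ.inter (isConstructible_of_isClosed
        ((isClosed_topPt y).preimage f.left.continuous))
    obtain ⟨x, hx, hx'⟩ := exists_pts_of_isConstructible hc ⟨z, hz, hzy⟩
    exact ⟨x, hx, topPt_inj (by rw [topPt_comp]; exact hx')⟩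

/-- The equalizer is the preimage under `(f, g)` of the diagonal, which is the image of a morphism.
-/
theorem eqOn [IsVar Y] (f g : X ⟶ Y) : Constr {x : pts X | x ≫ f = x ≫ g} := by
  have h := (Constr.univ.image (lift (𝟙 Y) (𝟙 Y))).preimage (lift f g)
  convert h using 1
  ext x
  constructor
  · intro hx
    refine ⟨x ≫ f, trivial, ?_⟩
    have hx : x ≫ f = x ≫ g := hx
    ext1 <;> simp [hx]
  · rintro ⟨y, -, hy⟩
    have h₁ := congrArg (fun f => f ≫ fst _ _) hy
    have h₂ := congrArg (fun f => f ≫ snd _ _) hy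
    simp at h₁ h₂
    exact h₁.symm.trans h₂

end Constr

/-- Two morphisms from a reduced scheme that agree on complex points are equal. -/
theorem hom_ext_of_pts {X Y : CSch} [LocallyOfFiniteType X.hom] [IsReduced X.left]
    [LocallyOfFiniteType Y.hom] [IsSeparated Y.hom] {f g : X ⟶ Y}
    (h : ∀ x : pts X, x ≫ f = x ≫ g) : f = g := by
  ext1
  have : LocallyOfFiniteType (f.left ≫ Y.hom) := by rw [Over.w]; infer_instance
  refine ext_of_apply_eq Y.hom Set.univ isClosed_univ.isLocallyClosed dense_univ ?_ ?_
  · intro x _ hx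
    obtain ⟨y, rfl⟩ := exists_topPt hx
    rw [← topPt_comp, ← topPt_comp, h]
  · exact (Over.w f).trans (Over.w g).symm

/-- A morphism that is surjective on complex points is surjective. -/
theorem surjective_of_pts {X Y : CSch} [IsVar X] [IsVar Y] (f : X ⟶ Y)
    (h : ∀ y : pts Y, ∃ x : pts X, x ≫ f = y) : Function.Surjective f.left := by
  have hc := f.left.isConstructible_image (IsConstructible.univ (X := X.left))
  rw [← Set.range_eq_univ, ← Set.image_univ]
  refine eq_univ_of_forall_topPt hc fun y => ?_
  obtain ⟨x, rfl⟩ := h y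
  exact ⟨_, trivial, (topPt_comp x f).symm⟩

theorem isEmpty_of_pts {X : CSch} [LocallyOfFiniteType X.hom] (h : IsEmpty (pts X)) :
    IsEmpty X.left := by
  by_contra hne
  rw [not_isEmpty_iff] at hne
  obtain ⟨x, -⟩ := exists_pts_of_isConstructible (X := X) IsConstructible.univ
    (Set.univ_nonempty)
  exact h.false x

end MotivicPower

namespace MotivicPower

/-! ### Subvarieties and fibre products -/

/-- A variety over a variety. -/
theorem IsVar.of_hom {X Y : CSch} [IsVar Y] (f : X ⟶ Y) [LocallyOfFiniteType f.left]
    [QuasiCompact f.left] [IsSeparated f.left] : IsVar X where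
  lft := by rw [← Over.w f]; infer_instance
  qc := by rw [← Over.w f]; infer_instance
  sep := by rw [← Over.w f]; infer_instance

/-- The open subscheme on `U`. -/
def openSub (X : CSch) (U : X.left.Opens) : CSch := Over.mk (U.ι ≫ X.hom)

/-- The inclusion of an open subscheme. -/
def openIncl (X : CSch) (U : X.left.Opens) : openSub X U ⟶ X := Over.homMk U.ι rfl

instance (X : CSch) (U : X.left.Opens) : IsOpenImmersion (openIncl X U).left :=
  inferInstanceAs (IsOpenImmersion U.ι)

theorem range_openIncl (X : CSch) (U : X.left.Opens) : Set.range (openIncl X U).left = U :=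
  U.range_ι

theorem IsVar.of_isOpenImmersion {X Y : CSch} [IsVar Y] (f : X ⟶ Y) [IsOpenImmersion f.left] :
    IsVar X :=
  have : IsLocallyNoetherian X.left := isLocallyNoetherian_of_isOpenImmersion f.left
  have : CompactSpace X.left := by
    have := f.left.isOpenEmbedding.isInducing.noetherianSpace
    infer_instance
  have : IsNoetherian X.left := {}
  .of_hom f

instance (X : CSch) [IsVar X] (U : X.left.Opens) : IsVar (openSub X U) :=
  .of_isOpenImmersion (openIncl X U)

/-- The reduced closed subscheme on `Z`. -/
def closedSub (X : CSch) (Z : TopologicalSpace.Closeds X.left) : CSch :=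
  Over.mk ((Scheme.IdealSheafData.vanishingIdeal Z).subschemeι ≫ X.hom)

/-- The inclusion of a reduced closed subscheme. -/
def closedIncl (X : CSch) (Z : TopologicalSpace.Closeds X.left) : closedSub X Z ⟶ X :=
  Over.homMk (Scheme.IdealSheafData.vanishingIdeal Z).subschemeι rfl

instance (X : CSch) (Z : TopologicalSpace.Closeds X.left) :
    IsClosedImmersion (closedIncl X Z).left :=
  inferInstanceAs (IsClosedImmersion (Scheme.IdealSheafData.vanishingIdeal Z).subschemeι)

theorem range_closedIncl (X : CSch) (Z : TopologicalSpace.Closeds X.left) :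
    Set.range (closedIncl X Z).left = Z :=
  (Scheme.IdealSheafData.vanishingIdeal Z).range_subschemeι

/-- Stalks are computed on the affine cover of the subscheme, whose rings are quotients by radical
ideals. -/
instance (X : CSch) (Z : TopologicalSpace.Closeds X.left) : IsReduced (closedSub X Z).left := by
  change IsReduced (Scheme.IdealSheafData.vanishingIdeal Z).subscheme
  have hrad (U : X.left.affineOpens) :
      ((Scheme.IdealSheafData.vanishingIdeal Z).ideal U).IsRadical := by
    rw [Scheme.IdealSheafData.vanishingIdeal_ideal]
    exact PrimeSpectrum.isRadical_vanishingIdeal _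
  generalize Scheme.IdealSheafData.vanishingIdeal Z = I at hrad
  have h (x : I.subscheme) : _root_.IsReduced (I.subscheme.presheaf.stalk x) := by
    obtain ⟨y, hy⟩ := I.subschemeCover.covers x
    generalize I.subschemeCover.idx x = U at y hy
    have hred : IsReduced (Spec (I.subschemeCover.X U)) := by
      have : _root_.IsReduced (I.subschemeCover.X U) := by
        change _root_.IsReduced (_ ⧸ I.ideal U)
        rw [← Ideal.isRadical_iff_quotient_reduced]
        exact hrad U
      infer_instance
    have e := (asIso ((I.subschemeCover.f U).stalkMap y)).commRingCatIsoToRingEquiv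
    rw [← hy]
    exact isReduced_of_injective e e.injective
  exact isReduced_of_isReduced_stalk _

theorem IsVar.of_isClosedImmersion {X Y : CSch} [IsVar Y] (f : X ⟶ Y)
    [IsClosedImmersion f.left] : IsVar X := .of_hom f

instance (X : CSch) [IsVar X] (Z : TopologicalSpace.Closeds X.left) : IsVar (closedSub X Z) :=
  .of_isClosedImmersion (closedIncl X Z)

/-- The fibre product. -/
def fib {T Z W : CSch} (f : T ⟶ W) (g : Z ⟶ W) : CSch :=
  Over.mk (Limits.pullback.fst f.left g.left ≫ T.hom)

/-! ### Fibre products over `ℂ`. -/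

section fib

variable {T Z W : CSch} (f : T ⟶ W) (g : Z ⟶ W)

/-- The first projection. -/
def fibFst : fib f g ⟶ T := Over.homMk (Limits.pullback.fst f.left g.left) rfl

/-- The second projection. -/
def fibSnd : fib f g ⟶ Z := Over.homMk (Limits.pullback.snd f.left g.left) (by
  change Limits.pullback.snd f.left g.left ≫ Z.hom =
    Limits.pullback.fst f.left g.left ≫ T.hom
  rw [← Over.w f, ← Over.w g, Limits.pullback.condition_assoc])

theorem fib_condition : fibFst f g ≫ f = fibSnd f g ≫ g := by
  ext1
  exact Limits.pullback.condition

/-- The universal property of the fibre product. -/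
def fibLift {Y : CSch} (a : Y ⟶ T) (b : Y ⟶ Z) (h : a ≫ f = b ≫ g) : Y ⟶ fib f g :=
  Over.homMk (Limits.pullback.lift a.left b.left (congrArg Over.Hom.left h)) (by
    change Limits.pullback.lift _ _ _ ≫ Limits.pullback.fst f.left g.left ≫ T.hom = _
    rw [Limits.pullback.lift_fst_assoc, Over.w])

@[simp]
theorem fibLift_fst {Y : CSch} (a : Y ⟶ T) (b : Y ⟶ Z) (h : a ≫ f = b ≫ g) :
    fibLift f g a b h ≫ fibFst f g = a := by
  ext1
  exact Limits.pullback.lift_fst _ _ _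

@[simp]
theorem fibLift_snd {Y : CSch} (a : Y ⟶ T) (b : Y ⟶ Z) (h : a ≫ f = b ≫ g) :
    fibLift f g a b h ≫ fibSnd f g = b := by
  ext1
  exact Limits.pullback.lift_snd _ _ _

theorem fib_hom_ext {Y : CSch} {a b : Y ⟶ fib f g} (h₁ : a ≫ fibFst f g = b ≫ fibFst f g)
    (h₂ : a ≫ fibSnd f g = b ≫ fibSnd f g) : a = b := by
  ext1
  exact Limits.pullback.hom_ext (congrArg Over.Hom.left h₁) (congrArg Over.Hom.left h₂)

instance [IsVar T] [IsVar Z] [IsVar W] : IsVar (fib f g) := by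
  have h₁ : LocallyOfFiniteType (fibFst f g).left :=
    inferInstanceAs (LocallyOfFiniteType (Limits.pullback.fst f.left g.left))
  have h₂ : QuasiCompact (fibFst f g).left :=
    inferInstanceAs (QuasiCompact (Limits.pullback.fst f.left g.left))
  have h₃ : IsSeparated (fibFst f g).left :=
    inferInstanceAs (IsSeparated (Limits.pullback.fst f.left g.left))
  exact .of_hom (fibFst f g)

instance [IsClosedImmersion g.left] : IsClosedImmersion (fibFst f g).left :=
  inferInstanceAs (IsClosedImmersion (Limits.pullback.fst f.left g.left))

instance [IsOpenImmersion g.left] : IsOpenImmersion (fibFst f g).left :=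
  inferInstanceAs (IsOpenImmersion (Limits.pullback.fst f.left g.left))

theorem range_fibFst : Set.range (fibFst f g).left = f.left ⁻¹' Set.range g.left :=
  Scheme.Pullback.range_fst f.left g.left

end fib

/-- A morphism of varieties that is injective on complex points is universally injective. -/
theorem universallyInjective_of_pts {X Y : CSch} [IsVar X] [IsVar Y] (f : X ⟶ Y)
    (h : ∀ x y : pts X, x ≫ f = y ≫ f → x = y) : UniversallyInjective f.left := by
  rw [UniversallyInjective.iff_diagonal]
  -- Surjectivity of the diagonal is tested on complex points: a pair with equal images is a pair of
  -- equal points.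
  refine ⟨surjective_of_pts (fibLift f f (𝟙 X) (𝟙 X) rfl) fun z => ?_⟩
  refine ⟨z ≫ fibFst f f, ?_⟩
  have := h (z ≫ fibFst f f) (z ≫ fibSnd f f) (by simp [fib_condition])
  apply fib_hom_ext
  · simp
  · simpa using this

/-! ### Classes in the Grothendieck ring -/

section Classes

variable {𝔐 : CSch} [AddMonObj 𝔐] [IsCommAddMonObj 𝔐]

/-- A variety with a morphism to `𝔐`. -/
def rel (X : CSch) [IsVar X] (p : X ⟶ 𝔐) : RelVar 𝔐 where
  X := X
  p := p

theorem cls_of_cut {V Z U : RelVar 𝔐} (h : IsCut V Z U) : cls V = cls Z + cls U := by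
  rw [cls, cls, cls, ← map_add]
  exact (Ideal.Quotient.eq).mpr (Ideal.subset_span ⟨V, Z, U, h, rfl⟩)

/-- The empty variety is cut into two copies of itself, so its class equals its double. -/
theorem cls_of_isEmpty (V : RelVar 𝔐) [IsEmpty V.X.left] : cls V = 0 := by
  have : IsCut V V V := ⟨𝟙 _, 𝟙 _, by simp, by simp, by dsimp; infer_instance,
    by dsimp; infer_instance, by ext x; exact (IsEmpty.false x).elim⟩
  have := cls_of_cut this
  simpa using this

theorem cls_of_pts_isEmpty (V : RelVar 𝔐) (h : IsEmpty (pts V.X)) : cls V = 0 :=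
  have := isEmpty_of_pts h
  cls_of_isEmpty V

theorem cls_closed_add_open {X Z U : CSch} [IsVar X] [IsVar Z] [IsVar U] (p : X ⟶ 𝔐) (i : Z ⟶ X)
    (j : U ⟶ X) [IsClosedImmersion i.left] [IsOpenImmersion j.left]
    (h : Set.range j.left = (Set.range i.left)ᶜ) :
    cls (rel X p) = cls (rel Z (i ≫ p)) + cls (rel U (j ≫ p)) :=
  cls_of_cut (V := rel X p) (Z := rel Z (i ≫ p)) (U := rel U (j ≫ p))
    ⟨i, j, rfl, rfl, ‹_›, ‹_›, h⟩

/-- The open complement is empty. This allows a variety to be replaced by its reduction. -/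
theorem cls_of_surjective_closed {X Z : CSch} [IsVar X] [IsVar Z] (p : X ⟶ 𝔐) (i : Z ⟶ X)
    [IsClosedImmersion i.left] (h : Function.Surjective i.left) :
    cls (rel X p) = cls (rel Z (i ≫ p)) := by
  have hr : Set.range (openIncl X ⊥).left = (Set.range i.left)ᶜ := by
    rw [range_openIncl, h.range_eq]; simp
  rw [cls_closed_add_open p i (openIncl X ⊥) hr]
  have : IsEmpty (openSub X ⊥).left := ⟨fun x => x.2⟩
  have : IsEmpty (rel (openSub X ⊥) (openIncl X ⊥ ≫ p)).X.left := this
  rw [cls_of_isEmpty (rel (openSub X ⊥) _), add_zero]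

/-- Over a dense open piece of a component of a reduced variety, a jointly bijective family
of morphisms has a section. -/
theorem exists_section {W : CSch} [IsVar W] [IsReduced W.left] [Nonempty W.left] {I : Type}
    [Finite I] (T : I → CSch) [∀ i, IsVar (T i)] (f : ∀ i, T i ⟶ W)
    (hinj : ∀ i, ∀ x y : pts (T i), x ≫ f i = y ≫ f i → x = y)
    (hsurj : ∀ w : pts W, ∃ i, ∃ x : pts (T i), x ≫ f i = w) :
    ∃ (U : W.left.Opens) (_ : (U : Set W.left).Nonempty) (i : I) (s : openSub W U ⟶ T i),
      s ≫ f i = openIncl W U := by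
  obtain ⟨w⟩ := ‹Nonempty W.left›
  have hirr := isIrreducible_irreducibleComponent (x := w)
  have hcl := isClosed_irreducibleComponent (x := w)
  -- The section is constructed at the generic point of an irreducible component and then spread
  -- out.
  set x := hirr.genericPoint with hx
  have hxs : closure {x} = irreducibleComponent w := by
    have := hirr.isGenericPoint_genericPoint_closure
    rw [hcl.closure_eq] at this
    exact this
  have hxc : closure {x} ∈ irreducibleComponents W.left := by
    rw [hxs]; exact irreducibleComponent_mem_irreducibleComponents w
  obtain ⟨i, τ, hτ⟩ : ∃ i, ∃ τ : (T i).left, (f i).left τ = x := by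
    have hc : Topology.IsConstructible (⋃ i, (f i).left '' Set.univ) :=
      .iUnion fun i => (f i).left.isConstructible_image .univ
    have := eq_univ_of_forall_topPt hc (fun y => by
      obtain ⟨i, z, rfl⟩ := hsurj y
      exact Set.mem_iUnion.mpr ⟨i, _, trivial, (topPt_comp z (f i)).symm⟩)
    have hx := this.ge (Set.mem_univ x)
    simpa using hx
  -- Reducedness of `W` enters here: its local ring at a generic point is a field.
  have hF : IsField (W.left.presheaf.stalk ((f i).left τ)) := by
    rw [hτ]; exact isField_stalk_of_closure_mem_irreducibleComponents _ x hxc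
  have hui := universallyInjective_of_pts (f i) (hinj i)
  have htf : UniversallyInjective (f i).left ↔ Function.Injective (f i).left ∧
      ∀ x, ((f i).left.residueFieldMap x).hom.IsPurelyInseparable :=
    (tfae_universallyInjective (f i).left).out 0 2
  have hpi := (htf.mp hui).2 τ
  -- Injectivity on complex points makes the residue extension purely inseparable, and in
  -- characteristic zero such an extension is trivial.
  have h₁ : IsIso ((f i).left.residueFieldMap τ) := by
    rw [ConcreteCategory.isIso_iff_bijective]
    algebraize [((f i).left.residueFieldMap τ).hom]
    have : CharZero (W.left.residueField ((f i).left τ)) := by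
      let e : ℂ →+* W.left.residueField ((f i).left τ) :=
        (Spec.preimage (W.left.fromSpecResidueField ((f i).left τ) ≫ W.hom)).hom
      exact charZero_of_injective_ringHom e.injective
    have : IsPurelyInseparable (W.left.residueField ((f i).left τ))
        ((T i).left.residueField τ) := hpi
    exact IsPurelyInseparable.bijective_algebraMap_of_isSeparable
      (W.left.residueField ((f i).left τ)) ((T i).left.residueField τ)
  have h₂ : IsIso (W.left.residue ((f i).left τ)) := by
    rw [ConcreteCategory.isIso_iff_bijective]
    let := hF.toField
    exact ⟨RingHom.injective (W.left.residue ((f i).left τ)).hom, Ideal.Quotient.mk_surjective⟩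
  -- The local ring and its residue field coincide, as do the two residue fields, so `τ` gives a
  -- section over the spectrum of the local ring, which extends to an open neighbourhood.
  obtain ⟨U, hU, s, -, hs⟩ := spread_out_of_isGermInjective' (𝟙 W.left) (f i).left
    (x := (f i).left τ)
    (inv (Spec.map (W.left.residue ((f i).left τ))) ≫
      inv (Spec.map ((f i).left.residueFieldMap τ)) ≫ (T i).left.fromSpecResidueField τ) (by
    rw [Category.assoc, Category.assoc,
      ← (f i).left.SpecMap_residueFieldMap_fromSpecResidueField τ]
    simp [Scheme.fromSpecResidueField])
  refine ⟨U, ⟨_, hU⟩, i, Over.homMk s ?_, ?_⟩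
  · change s ≫ (T i).hom = U.ι ≫ W.hom
    rw [← Over.w (f i), reassoc_of% hs]
  · ext1
    change s ≫ (f i).left = U.ι
    simpa using hs

/-- A finite family of varieties that is jointly bijective on complex points over a variety
decomposes its class. -/
theorem sum_cls_eq_of_bijective {W : CSch} [IsVar W] (p : W ⟶ 𝔐) {I : Type} [Fintype I]
    (T : I → CSch) [∀ i, IsVar (T i)] (f : ∀ i, T i ⟶ W)
    (h : ∀ w : pts W, ∃! q : Σ i, pts (T i), q.2 ≫ f q.1 = w) :
    ∑ i, cls (rel (T i) (f i ≫ p)) = cls (rel W p) := by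
  -- Noetherian induction on a closed subset of the fixed space `W`. The statement allows any closed
  -- subscheme `V` supported on it, so that non-reduced structures and new families over smaller
  -- closed sets are covered.
  suffices H : ∀ Z : TopologicalSpace.Closeds W.left, ∀ (V : CSch) [IsVar V] (q : V ⟶ 𝔐)
      (c : V ⟶ W) [IsClosedImmersion c.left] (_ : Set.range c.left = Z)
      (T : I → CSch) [∀ i, IsVar (T i)] (f : ∀ i, T i ⟶ V)
      (_ : ∀ w : pts V, ∃! q : Σ i, pts (T i), q.2 ≫ f q.1 = w),
      ∑ i, cls (rel (T i) (f i ≫ q)) = cls (rel V q) by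
    have : IsClosedImmersion (𝟙 W : W ⟶ W).left := by dsimp; infer_instance
    exact H ⊤ W p (𝟙 W) (by simp) T f h
  clear * -
  intro Z
  induction Z using WellFoundedLT.induction with
  | ind Z IH =>
  have red : ∀ (V : CSch) [IsVar V] [IsReduced V.left] (q : V ⟶ 𝔐)
      (c : V ⟶ W) [IsClosedImmersion c.left] (_ : Set.range c.left = Z)
      (T : I → CSch) [∀ i, IsVar (T i)] (f : ∀ i, T i ⟶ V)
      (_ : ∀ w : pts V, ∃! q : Σ i, pts (T i), q.2 ≫ f q.1 = w),
      ∑ i, cls (rel (T i) (f i ≫ q)) = cls (rel V q) := by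
    intro V _ _ q c _ hc T _ f h
    rcases isEmpty_or_nonempty V.left with hV | hV
    · have : IsEmpty (rel V q).X.left := hV
      rw [cls_of_isEmpty (rel V q)]
      refine Finset.sum_eq_zero fun i _ => ?_
      have : IsEmpty (rel (T i) (f i ≫ q)).X.left := ⟨fun x => hV.false ((f i).left x)⟩
      exact cls_of_isEmpty _
    · obtain ⟨U, hU, i₀, s, hs⟩ := exists_section T f
        (fun i x y hxy => by
          have := (h (y ≫ f i)).unique (y₁ := ⟨i, x⟩) (y₂ := ⟨i, y⟩) hxy rfl
          simpa using this)
        (fun w => by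
          obtain ⟨⟨i, x⟩, hx, -⟩ := h w
          exact ⟨i, x, hx⟩)
      let Z' : TopologicalSpace.Closeds V.left := ⟨(U : Set V.left)ᶜ, U.2.isClosed_compl⟩
      have hr : Set.range (openIncl V U).left = (Set.range (closedIncl V Z').left)ᶜ := by
        rw [range_openIncl, range_closedIncl]; simp [Z']
      rw [cls_closed_add_open q (closedIncl V Z') (openIncl V U) hr]
      have hT (i : I) : cls (rel (T i) (f i ≫ q)) =
          cls (rel (fib (f i) (closedIncl V Z')) (fibSnd _ _ ≫ closedIncl V Z' ≫ q)) +
          cls (rel (fib (f i) (openIncl V U)) (fibSnd _ _ ≫ openIncl V U ≫ q)) := by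
        rw [cls_closed_add_open (f i ≫ q) (fibFst (f i) (closedIncl V Z'))
          (fibFst (f i) (openIncl V U)) (by rw [range_fibFst, range_fibFst, hr]; rfl)]
        simp only [← Category.assoc, fib_condition]
      simp only [hT, Finset.sum_add_distrib]
      congr 1
      -- Away from `U` the induction hypothesis applies: the image in `W` shrinks strictly because
      -- `U` is nonempty.
      · have hcomp : IsClosedImmersion (closedIncl V Z' ≫ c).left := by dsimp; infer_instance
        let Z'' : TopologicalSpace.Closeds W.left :=
          ⟨Set.range (closedIncl V Z' ≫ c).left,
            (closedIncl V Z' ≫ c).left.isClosedEmbedding.isClosed_range⟩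
        refine IH Z'' ?_ _ _ (closedIncl V Z' ≫ c) rfl _ (fun i => fibSnd (f i) _) ?_
        · have hrr : (Z'' : Set W.left) = c.left '' (U : Set V.left)ᶜ := by
            change Set.range (closedIncl V Z' ≫ c).left = _
            have : Set.range (closedIncl V Z').left = (U : Set V.left)ᶜ := range_closedIncl V Z'
            rw [← this, ← Set.range_comp]
            simp
          refine lt_of_le_of_ne ?_ ?_
          · rw [← SetLike.coe_subset_coe, hrr, ← hc]
            exact Set.image_subset_range _ _
          · intro heq
            obtain ⟨u, hu⟩ := hU
            have h1 : c.left u ∈ (Z'' : Set W.left) := by rw [heq, ← hc]; exact ⟨u, rfl⟩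
            rw [hrr] at h1
            obtain ⟨v, hv, hvu⟩ := h1
            exact hv (c.left.isClosedEmbedding.injective hvu ▸ hu)
        · intro w
          obtain ⟨⟨i, x⟩, hx, hux⟩ := h (w ≫ closedIncl V Z')
          refine ⟨⟨i, fibLift _ _ x w hx⟩, by simp, ?_⟩
          rintro ⟨j, y⟩ hy
          have := hux ⟨j, y ≫ fibFst _ _⟩ (by
            simp only [Category.assoc, fib_condition]
            rw [← hy]; simp)
          obtain ⟨rfl, hyx⟩ := Sigma.mk.inj_iff.mp this
          congr 1
          apply fib_hom_ext
          · simpa using hyx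
          · simpa using hy
      -- Over `U` the section already meets every fibre, so by bijectivity only the index `i₀` has
      -- points. The section is a closed immersion, as a section of a separated morphism, and it is
      -- surjective, so it identifies the classes.
      · rw [Finset.sum_eq_single i₀]
        · let t : openSub V U ⟶ fib (f i₀) (openIncl V U) :=
            fibLift _ _ s (𝟙 _) (by rw [hs]; simp)
          have ht : t ≫ fibSnd _ _ = 𝟙 _ := fibLift_snd _ _ _ _ _
          have : IsClosedImmersion t.left := by
            have : IsClosedImmersion (t.left ≫ (fibSnd (f i₀) (openIncl V U)).left) := by
              rw [← Over.comp_left, ht]; dsimp; infer_instance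
            exact IsClosedImmersion.of_comp t.left (fibSnd (f i₀) (openIncl V U)).left
          rw [cls_of_surjective_closed _ t]
          · simp only [← Category.assoc, ht, Category.id_comp]
          · refine surjective_of_pts t fun y => ⟨y ≫ fibSnd _ _, ?_⟩
            have hy := (h (y ≫ fibFst _ _ ≫ f i₀)).unique
              (y₁ := ⟨i₀, y ≫ fibFst _ _⟩) (y₂ := ⟨i₀, y ≫ fibSnd _ _ ≫ s⟩) (by simp)
              (by simp [hs, fib_condition])
            apply fib_hom_ext
            · simpa [t] using hy.symm
            · simp [t]
        · intro i _ hi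
          refine cls_of_pts_isEmpty _ ⟨fun y => hi ?_⟩
          have y : pts (fib (f i) (openIncl V U)) := y
          have hy := (h (y ≫ fibFst _ _ ≫ f i)).unique
              (y₁ := ⟨i, y ≫ fibFst _ _⟩) (y₂ := ⟨i₀, y ≫ fibSnd _ _ ≫ s⟩) (by simp)
              (by simp [hs, fib_condition])
          exact congrArg Sigma.fst hy
        · simp
  intro V _ q c _ hc T _ f h
  -- The general case passes to the reduced structure on `V` and to the base change of the family to
  -- it.
  have hsurj : Function.Surjective (closedIncl V ⊤).left := by
    rw [← Set.range_eq_univ, range_closedIncl]; rfl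
  rw [cls_of_surjective_closed q (closedIncl V ⊤) hsurj]
  have hcomp : IsClosedImmersion (closedIncl V ⊤ ≫ c).left := by dsimp; infer_instance
  rw [← red (closedSub V ⊤) (closedIncl V ⊤ ≫ q) (closedIncl V ⊤ ≫ c)
    (by rw [← hc, Over.comp_left, Scheme.Hom.comp_base, TopCat.coe_comp, hsurj.range_comp])
    (fun i => fib (f i) (closedIncl V ⊤)) (fun i => fibSnd _ _) (by
      intro w
      obtain ⟨⟨i, x⟩, hx, hux⟩ := h (w ≫ closedIncl V ⊤)
      refine ⟨⟨i, fibLift _ _ x w hx⟩, by simp, ?_⟩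
      rintro ⟨j, y⟩ hy
      have := hux ⟨j, y ≫ fibFst _ _⟩ (by
        simp only [Category.assoc, fib_condition]
        rw [← hy]; simp)
      obtain ⟨rfl, hyx⟩ := Sigma.mk.inj_iff.mp this
      congr 1
      apply fib_hom_ext
      · simpa using hyx
      · simpa using hy)]
  refine Finset.sum_congr rfl fun i _ => ?_
  rw [cls_of_surjective_closed (f i ≫ q) (fibFst (f i) (closedIncl V ⊤))
    (by rw [← Set.range_eq_univ, range_fibFst, hsurj.range_eq]; simp)]
  simp only [← Category.assoc, fib_condition]

end Classes

end MotivicPower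

namespace MotivicPower

/-! ### Definable types -/

/-- A definable type: a quotient of a finite disjoint union of constructible sets of complex
points by a constructible equivalence relation. The relation `code` says that a complex point
represents an element of the type. -/
class DefType (S : Type) where
  I : Type
  [fin : Finite I]
  C : I → CSch
  [var : ∀ i, IsVar (C i)]
  code : ∀ i, pts (C i) → S → Prop
  code_unique : ∀ {i c s s'}, code i c s → code i c s' → s = s'
  code_surj : ∀ s, ∃ i c, code i c s
  code_ker : ∀ i j, Constr {z : pts (C i ⊗ C j) |
    ∃ s, code i (z ≫ fst _ _) s ∧ code j (z ≫ snd _ _) s}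

attribute [instance] DefType.fin DefType.var

open DefType

/-- Definable predicates. -/
def IsDef {S : Type} [DefType S] (p : S → Prop) : Prop :=
  ∀ i, Constr {c : pts (C (S := S) i) | ∃ s, code i c s ∧ p s}

/-! ### Definable predicates and definable maps. -/

section IsDef

variable {S T U : Type} [DefType S] [DefType T] [DefType U] {p q : S → Prop}

theorem IsDef.congr (h : ∀ s, p s ↔ q s) (hp : IsDef p) : IsDef q := by
  have : p = q := funext fun s => propext (h s)
  exact this ▸ hp

/-- A complex point need not represent anything, so even this case has content: the domain of `code`
is the restriction of the kernel relation to the diagonal. -/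
theorem IsDef.true : IsDef (fun _ : S => True) := fun i => by
  convert (code_ker (S := S) i i).preimage (lift (𝟙 _) (𝟙 _)) using 1
  ext c
  simp

theorem IsDef.and (hp : IsDef p) (hq : IsDef q) : IsDef (fun s => p s ∧ q s) := fun i => by
  refine Constr.of_iff ((hp i).inter (hq i)) fun c => ?_
  symm
  constructor
  · rintro ⟨s, hs, h₁, h₂⟩
    exact ⟨⟨s, hs, h₁⟩, s, hs, h₂⟩
  · rintro ⟨⟨s, hs, h₁⟩, s', hs', h₂⟩
    obtain rfl := code_unique hs hs'
    exact ⟨s, hs, h₁, h₂⟩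

/-- The complement is taken inside the set of points that represent an element. -/
theorem IsDef.not (hp : IsDef p) : IsDef (fun s => ¬ p s) := fun i => by
  convert (IsDef.true i).inter (hp i).compl using 1
  ext c
  constructor
  · rintro ⟨s, hs, h⟩
    refine ⟨⟨s, hs, trivial⟩, ?_⟩
    rintro ⟨s', hs', h'⟩
    exact h (code_unique hs' hs ▸ h')
  · rintro ⟨⟨s, hs, -⟩, h⟩
    exact ⟨s, hs, fun h' => h ⟨s, hs, h'⟩⟩

theorem IsDef.or (hp : IsDef p) (hq : IsDef q) : IsDef (fun s => p s ∨ q s) :=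
  (hp.not.and hq.not).not.congr fun s => by tauto

theorem IsDef.imp (hp : IsDef p) (hq : IsDef q) : IsDef (fun s => p s → q s) :=
  (hp.not.or hq).congr fun s => by tauto

theorem IsDef.iff (hp : IsDef p) (hq : IsDef q) : IsDef (fun s => p s ↔ q s) :=
  ((hp.imp hq).and (hq.imp hp)).congr fun s => by tauto

theorem IsDef.const (P : Prop) : IsDef (fun _ : S => P) := by
  by_cases h : P
  · exact IsDef.true.congr fun s => by simp [h]
  · exact IsDef.true.not.congr fun s => by simp [h]

theorem IsDef.iEx {J : Type*} [Finite J] {p : J → S → Prop} (hp : ∀ j, IsDef (p j)) :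
    IsDef (fun s => ∃ j, p j s) := fun i => by
  convert Constr.iUnion fun j => hp j i using 1
  ext c
  simp only [Set.mem_iUnion, Set.mem_ofPred_eq]
  tauto

theorem IsDef.iAll {J : Type*} [Finite J] {p : J → S → Prop} (hp : ∀ j, IsDef (p j)) :
    IsDef (fun s => ∀ j, p j s) :=
  (IsDef.iEx fun j => (hp j).not).not.congr fun s => by simp

/-- A map given on representatives by morphisms. -/
def Tracked (f : T → S) : Prop :=
  ∀ i : DefType.I T, ∃ (j : DefType.I S) (m : C (S := T) i ⟶ C (S := S) j),
    ∀ c t, code i c t → code j (c ≫ m) (f t)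

/-- The preimage under the tracking morphism is cut down to the domain of `code`, since that
morphism may send points representing nothing to points representing something. -/
theorem IsDef.comp_tracked (hp : IsDef p) {f : T → S} (hf : Tracked f) :
    IsDef (fun t => p (f t)) := fun i => by
  obtain ⟨j, m, hm⟩ := hf i
  convert (IsDef.true i).inter ((hp j).preimage m) using 1
  ext c
  constructor
  · rintro ⟨t, ht, h⟩
    exact ⟨⟨t, ht, trivial⟩, _, hm c t ht, h⟩
  · rintro ⟨⟨t, ht, -⟩, s, hs, h⟩
    refine ⟨t, ht, ?_⟩
    have := code_unique hs (hm c t ht)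
    subst this
    exact h

instance : DefType (S × T) where
  I := DefType.I S × DefType.I T
  C i := C i.1 ⊗ C i.2
  code i c s := code i.1 (c ≫ fst _ _) s.1 ∧ code i.2 (c ≫ snd _ _) s.2
  code_unique h h' := Prod.ext (code_unique h.1 h'.1) (code_unique h.2 h'.2)
  code_surj s := by
    obtain ⟨i, c, h⟩ := code_surj s.1
    obtain ⟨j, d, h'⟩ := code_surj s.2
    exact ⟨(i, j), lift c d, by simpa using h, by simpa using h'⟩
  code_ker i j := by
    convert ((code_ker (S := S) i.1 j.1).preimage
      (lift (fst _ _ ≫ fst _ _) (snd _ _ ≫ fst _ _))).inter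
      ((code_ker (S := T) i.2 j.2).preimage (lift (fst _ _ ≫ snd _ _) (snd _ _ ≫ snd _ _))) using 1
    ext z
    simp only [Set.mem_ofPred_eq, Set.mem_inter_iff, Category.assoc, lift_fst, lift_snd, Prod.exists]
    constructor
    · rintro ⟨s, t, ⟨h₁, h₂⟩, h₃, h₄⟩
      exact ⟨⟨s, h₁, h₃⟩, t, h₂, h₄⟩
    · rintro ⟨⟨s, h₁, h₃⟩, t, h₂, h₄⟩
      exact ⟨s, t, ⟨h₁, h₂⟩, h₃, h₄⟩

theorem Tracked.id : Tracked (id : S → S) := fun i => ⟨i, 𝟙 _, by simp⟩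

theorem Tracked.fst : Tracked (Prod.fst : S × T → S) := fun i => ⟨i.1, CartesianMonoidalCategory.fst _ _, fun _ _ h => h.1⟩

theorem Tracked.snd : Tracked (Prod.snd : S × T → T) := fun i => ⟨i.2, CartesianMonoidalCategory.snd _ _, fun _ _ h => h.2⟩

theorem Tracked.comp {g : S → U} {f : T → S} (hg : Tracked g) (hf : Tracked f) :
    Tracked (fun t => g (f t)) := fun i => by
  obtain ⟨j, m, hm⟩ := hf i
  obtain ⟨k, n, hn⟩ := hg j
  exact ⟨k, m ≫ n, fun c t h => by simpa using hn _ _ (hm c t h)⟩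

theorem Tracked.prodMk {f : U → S} {g : U → T} (hf : Tracked f) (hg : Tracked g) :
    Tracked (fun u => (f u, g u)) := fun i => by
  obtain ⟨j, m, hm⟩ := hf i
  obtain ⟨k, n, hn⟩ := hg i
  exact ⟨(j, k), lift m n, fun c t h => ⟨by simpa using hm c t h, by simpa using hn c t h⟩⟩

/-- Elimination of the existential quantifier: the set is a finite union of images under
projections, constructible by Chevalley's theorem. -/
theorem IsDef.ex {p : S → T → Prop} (hp : IsDef (fun z : S × T => p z.1 z.2)) :
    IsDef (fun s => ∃ t, p s t) := fun i => by
  refine Constr.of_iff (Constr.iUnion (s := fun j => {y | ∃ x ∈ {c | ∃ s : S × T,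
    code (S := S × T) (i, j) c s ∧ p s.1 s.2},
      x ≫ CartesianMonoidalCategory.fst (C i) (C j) = y})
    fun j => (hp (i, j)).image (CartesianMonoidalCategory.fst (C i) (C j))) fun c => ?_
  symm
  simp only [Set.mem_iUnion, Set.mem_ofPred_eq]
  constructor
  · rintro ⟨s, hs, t, h⟩
    obtain ⟨j, d, hd⟩ := code_surj t
    exact ⟨j, lift c d, ⟨(s, t), ⟨by simpa using hs, by simpa using hd⟩, h⟩, by simp⟩
  · rintro ⟨j, z, ⟨⟨s, t⟩, ⟨hs, ht⟩, h⟩, rfl⟩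
    exact ⟨s, hs, t, h⟩

theorem IsDef.all {p : S → T → Prop} (hp : IsDef (fun z : S × T => p z.1 z.2)) :
    IsDef (fun s => ∀ t, p s t) :=
  (IsDef.ex (p := fun s t => ¬ p s t) hp.not).not.congr fun s => by simp

theorem IsDef.diag : IsDef (fun z : S × S => z.1 = z.2) := fun i => by
  refine Constr.of_iff (code_ker (S := S) i.1 i.2) fun z => ?_
  symm
  constructor
  · rintro ⟨⟨s, s'⟩, ⟨h₁, h₂⟩, h⟩
    obtain rfl : s = s' := h
    exact ⟨s, h₁, h₂⟩
  · rintro ⟨s, h₁, h₂⟩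
    exact ⟨(s, s), ⟨h₁, h₂⟩, rfl⟩

/-- Definable maps. -/
def DefMap (f : S → T) : Prop := IsDef (fun z : S × T => f z.1 = z.2)

theorem Tracked.defMap {f : S → T} (hf : Tracked f) : DefMap f :=
  IsDef.diag.comp_tracked ((hf.comp .fst).prodMk .snd)

/-- A definable map need not be given by morphisms on representatives; the composite is instead
rewritten as `∃ s, f t = s ∧ p s`. -/
theorem IsDef.comp {f : T → S} (hp : IsDef p) (hf : DefMap f) : IsDef (fun t => p (f t)) :=
  (IsDef.ex (p := fun t s => f t = s ∧ p s)
    (hf.and (hp.comp_tracked .snd))).congr fun s => by simp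

namespace DefMap

theorem id : DefMap (fun s : S => s) := Tracked.id.defMap

theorem fst : DefMap (Prod.fst : S × T → S) := Tracked.fst.defMap

theorem snd : DefMap (Prod.snd : S × T → T) := Tracked.snd.defMap

theorem prodMk {f : U → S} {g : U → T} (hf : DefMap f) (hg : DefMap g) :
    DefMap (fun u => (f u, g u)) :=
  ((IsDef.comp_tracked hf (Tracked.fst.prodMk (Tracked.fst.comp .snd))).and
    (IsDef.comp_tracked hg (Tracked.fst.prodMk (Tracked.snd.comp .snd)))).congr fun z => by
      simp [Prod.ext_iff]

theorem comp {g : S → U} {f : T → S} (hg : DefMap g) (hf : DefMap f) :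
    DefMap (fun t => g (f t)) :=
  (IsDef.ex (p := fun (z : T × U) s => f z.1 = s ∧ g s = z.2)
    ((IsDef.comp_tracked hf ((Tracked.fst.comp .fst).prodMk .snd)).and
    (IsDef.comp_tracked hg (Tracked.snd.prodMk (Tracked.snd.comp .fst))))).congr fun z => by simp

/-- A single element is definable because its codes form the slice of the kernel relation at one
chosen complex point representing it. -/
theorem const (t : T) : DefMap (fun _ : S => t) := by
  obtain ⟨j, d, hd⟩ := code_surj t
  have : IsDef (fun t' : T => t = t') := fun i => by
    convert (code_ker (S := T) j i).preimage (lift (toUnit _ ≫ d) (𝟙 _)) using 1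
    ext c
    have : c ≫ toUnit _ ≫ d = d := by
      rw [← Category.assoc, toUnit_unique (c ≫ toUnit _) (𝟙 _), Category.id_comp]
    simp only [Set.mem_ofPred_eq, comp_lift, lift_fst, lift_snd, this, Category.comp_id]
    constructor
    · rintro ⟨s, hs, rfl⟩
      exact ⟨_, hd, hs⟩
    · rintro ⟨s, h₁, h₂⟩
      exact ⟨s, h₂, code_unique hd h₁⟩
  exact this.comp_tracked .snd

theorem inv {f : S → T} {g : T → S} (hf : DefMap f) (h₁ : ∀ s, g (f s) = s)
    (h₂ : ∀ t, f (g t) = t) : DefMap g :=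
  (IsDef.comp_tracked hf (Tracked.snd.prodMk .fst)).congr fun z =>
    ⟨fun h => by rw [← show f z.2 = z.1 from h]; exact h₁ _,
      fun h => by rw [← h]; exact h₂ _⟩

theorem symm {e : S ≃ T} (he : DefMap e) : DefMap e.symm :=
  he.inv e.symm_apply_apply e.apply_symm_apply

theorem ite' {c : S → Prop} [DecidablePred c] {f g : S → T} (hc : IsDef c) (hf : DefMap f)
    (hg : DefMap g) : DefMap (fun s => if c s then f s else g s) :=
  (((hc.comp fst).and hf).or ((hc.comp fst).not.and hg)).congr fun z => by
    by_cases h : c z.1 <;> simp [h]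

end DefMap

theorem IsDef.eq {f g : S → T} (hf : DefMap f) (hg : DefMap g) : IsDef (fun s => f s = g s) :=
  IsDef.diag.comp (hf.prodMk hg)

/-- Definable structure transported along a partial surjection. -/
@[reducible]
def DefType.ofRel (R : T → U' → Prop) (h₁ : ∀ {t s s'}, R t s → R t s' → s = s')
    (h₂ : ∀ s, ∃ t, R t s) (h₃ : IsDef (fun z : T × T => ∃ s, R z.1 s ∧ R z.2 s)) :
    DefType U' where
  I := DefType.I T
  C := C
  code i c s := ∃ t, code i c t ∧ R t s
  code_unique := by
    rintro i c s s' ⟨t, ht, h⟩ ⟨t', ht', h'⟩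
    obtain rfl := code_unique ht ht'
    exact h₁ h h'
  code_surj s := by
    obtain ⟨t, ht⟩ := h₂ s
    obtain ⟨i, c, hc⟩ := code_surj t
    exact ⟨i, c, t, hc, ht⟩
  code_ker i j := by
    refine Constr.of_iff (h₃ (i, j)) fun z => ?_
    symm
    constructor
    · rintro ⟨s, ⟨t, ht, h⟩, t', ht', h'⟩
      exact ⟨(t, t'), ⟨ht, ht'⟩, s, h, h'⟩
    · rintro ⟨⟨t, t'⟩, ⟨ht, ht'⟩, s, h, h'⟩
      exact ⟨s, ⟨t, ht, h⟩, t', ht', h'⟩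

end IsDef

/-! ### Definable structures on complex points, disjoint unions and finite products. -/

section Instances

instance (X : CSch) [IsVar X] : DefType (pts X) where
  I := Unit
  C _ := X
  code _ c s := c = s
  code_unique h h' := h.symm.trans h'
  code_surj s := ⟨(), s, rfl⟩
  code_ker _ _ := by
    convert Constr.eqOn (fst X X) (snd X X) using 1
    ext z
    exact ⟨fun ⟨s, h, h'⟩ => h.trans h'.symm, fun h => ⟨_, h, rfl⟩⟩

theorem isDef_pts_iff {X : CSch} [IsVar X] {p : pts X → Prop} : IsDef p ↔ Constr {x | p x} := by
  refine ⟨fun h => ?_, fun h _ => ?_⟩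
  · exact Constr.of_iff (h ()) fun x =>
      ⟨fun ⟨y, h, h'⟩ => (show x = y from h) ▸ h', fun h => ⟨x, rfl, h⟩⟩
  · exact Constr.of_iff h fun x =>
      ⟨fun h => ⟨x, rfl, h⟩, fun ⟨y, h, h'⟩ => (show x = y from h) ▸ h'⟩

theorem Tracked.hom {X Y : CSch} [IsVar X] [IsVar Y] (f : X ⟶ Y) :
    Tracked (fun x : pts X => (x ≫ f : pts Y)) :=
  fun _ => ⟨(), f, fun c t h => by rw [show c = t from h]; rfl⟩

theorem Tracked.pair {X Y : CSch} [IsVar X] [IsVar Y] :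
    Tracked (fun z : pts X × pts Y => (lift z.1 z.2 : pts (X ⊗ Y))) :=
  fun _ => ⟨(), 𝟙 _, fun c t h => by
    change c ≫ 𝟙 _ = lift t.1 t.2
    have h₁ : c ≫ CartesianMonoidalCategory.fst _ _ = t.1 := h.1
    have h₂ : c ≫ CartesianMonoidalCategory.snd _ _ = t.2 := h.2
    rw [← h₁, ← h₂]
    exact CartesianMonoidalCategory.hom_ext _ _
      (by rw [Category.comp_id]; exact (lift_fst _ _).symm)
      (by rw [Category.comp_id]; exact (lift_snd _ _).symm)⟩

instance : DefType Unit where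
  I := Unit
  C _ := 𝟙_ CSch
  code _ _ _ := True
  code_unique _ _ := rfl
  code_surj _ := ⟨(), 𝟙 _, trivial⟩
  code_ker _ _ := by simpa using Constr.univ

variable {J : Type} {S : J → Type} [∀ j, DefType (S j)]

instance [Finite J] : DefType (Σ j, S j) where
  I := Σ j, DefType.I (S j)
  C i := C i.2
  code i c s := ∃ t, s = ⟨i.1, t⟩ ∧ code i.2 c t
  code_unique := by
    rintro i c s s' ⟨t, rfl, h⟩ ⟨t', rfl, h'⟩
    rw [code_unique h h']
  code_surj := by
    rintro ⟨j, s⟩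
    obtain ⟨i, c, h⟩ := code_surj s
    exact ⟨⟨j, i⟩, c, s, rfl, h⟩
  code_ker := by
    rintro ⟨j, i⟩ ⟨j', i'⟩
    by_cases h : j = j'
    · subst h
      convert code_ker (S := S j) i i' using 1
      ext z
      simp
    · convert Constr.empty using 1
      ext z
      simp [h]

theorem isDef_sigma_iff [Finite J] {p : (Σ j, S j) → Prop} :
    IsDef p ↔ ∀ j, IsDef (fun s => p ⟨j, s⟩) := by
  have (j : J) (i : DefType.I (S j)) : {c : pts (C (S := S j) i) | ∃ s, code i c s ∧ p ⟨j, s⟩} =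
      {c | ∃ s, code (S := Σ j, S j) (⟨j, i⟩ : Σ j, DefType.I (S j)) c s ∧ p s} := by
    ext c
    constructor
    · rintro ⟨s, h, h'⟩
      exact ⟨⟨j, s⟩, ⟨s, rfl, h⟩, h'⟩
    · rintro ⟨s, ⟨t, rfl, h⟩, h'⟩
      exact ⟨t, h, h'⟩
  constructor
  · intro h j i
    rw [this]
    exact h ⟨j, i⟩
  · rintro h ⟨j, i⟩
    rw [← this]
    exact h j i

theorem isDef_sigma_prod_iff [Finite J] {T : Type} [DefType T] {p : (Σ j, S j) × T → Prop} :
    IsDef p ↔ ∀ j, IsDef (fun z : S j × T => p (⟨j, z.1⟩, z.2)) := by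
  have (j : J) (i : DefType.I (S j)) (k : DefType.I T) : {c | ∃ s, code (S := S j × T) (i, k) c s ∧ p (⟨j, s.1⟩, s.2)} =
      {c | ∃ s, code (S := (Σ j, S j) × T) (⟨j, i⟩, k) c s ∧ p s} := by
    ext c
    constructor
    · rintro ⟨⟨s, t⟩, ⟨h₁, h₂⟩, h'⟩
      exact ⟨(⟨j, s⟩, t), ⟨⟨s, rfl, h₁⟩, h₂⟩, h'⟩
    · rintro ⟨⟨s, t⟩, ⟨⟨s', hs, h₁⟩, h₂⟩, h'⟩
      obtain rfl : s = _ := hs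
      exact ⟨(s', t), ⟨h₁, h₂⟩, h'⟩
  constructor
  · rintro h j ⟨i, k⟩
    rw [this]
    exact h (⟨j, i⟩, k)
  · rintro h ⟨⟨j, i⟩, k⟩
    rw [← this]
    exact h j (i, k)

theorem Tracked.sigmaMk [Finite J] (j : J) : Tracked (Sigma.mk j : S j → Σ j, S j) :=
  fun i => ⟨⟨j, i⟩, 𝟙 _, fun c t h => ⟨t, rfl, by simpa using h⟩⟩

theorem defMap_sigma_iff [Finite J] {T : Type} [DefType T] {f : (Σ j, S j) → T} :
    DefMap f ↔ ∀ j, DefMap (fun s => f ⟨j, s⟩) := isDef_sigma_prod_iff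

theorem isVar_of_iso {X Y : CSch} [IsVar X] (e : X ≅ Y) : IsVar Y :=
  have : IsIso e.inv.left := inferInstanceAs (IsIso ((Over.forget _).map e.inv))
  .of_hom e.inv

open Limits in
instance isVar_pi [Finite J] (X : J → CSch) [∀ j, IsVar (X j)] : IsVar (∏ᶜ X) := by
  suffices H : ∀ (X : J → CSch) [HasProduct X] [∀ j, IsVar (X j)], IsVar (∏ᶜ X) from H X
  refine Finite.induction_empty_option
    (P := fun J => ∀ (X : J → CSch) [HasProduct X] [∀ j, IsVar (X j)], IsVar (∏ᶜ X)) ?_ ?_ ?_ J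
  · intro α β e h X _ _
    have : HasProduct fun a => X (e a) := hasProduct_of_equiv_of_iso X _ e fun _ => Iso.refl _
    have := h (fun a => X (e a))
    exact isVar_of_iso (Pi.whiskerEquiv e (fun _ => Iso.refl _))
  · intro X _ _
    exact isVar_of_iso (X := 𝟙_ CSch)
      ⟨Pi.lift (fun j => j.elim), toUnit _, toUnit_unique _ _, Pi.hom_ext _ _ (fun j => j.elim)⟩
  · intro α _ h X _ _
    have := Fintype.finite ‹Fintype α›
    have := h (fun a => X (some a))
    refine isVar_of_iso (X := X none ⊗ ∏ᶜ fun a => X (some a))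
      ⟨Pi.lift (fun o => match o with
        | none => CartesianMonoidalCategory.fst _ _
        | some a => CartesianMonoidalCategory.snd _ _ ≫ Pi.π _ a),
      lift (Pi.π _ none) (Pi.lift fun a => Pi.π _ (some a)), ?_, ?_⟩
    · ext1
      · simp
      · apply Pi.hom_ext; intro a; simp
    · apply Pi.hom_ext
      rintro (_ | a) <;> simp

open Limits in
instance [Finite J] : DefType (∀ j, S j) where
  I := ∀ j, DefType.I (S j)
  fin := Pi.finite
  C i := ∏ᶜ fun j => C (i j)
  code i c s := ∀ j, code (i j) (c ≫ Pi.π _ j) (s j)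
  code_unique h h' := funext fun j => code_unique (h j) (h' j)
  code_surj s := by
    choose i c h using fun j => code_surj (s j)
    exact ⟨i, Pi.lift c, fun j => by simpa using h j⟩
  code_ker i i' := by
    have : Constr (⋃ j, {z : pts ((∏ᶜ fun j => C (i j)) ⊗ ∏ᶜ fun j => C (i' j)) |
        ∃ s : S j, code (i j) (z ≫ fst _ _ ≫ Pi.π _ j) s ∧
          code (i' j) (z ≫ snd _ _ ≫ Pi.π _ j) s}ᶜ) := by
      refine Constr.iUnion fun j => Constr.compl ?_
      refine Constr.of_iff ((code_ker (S := S j) (i j) (i' j)).preimage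
        (lift (fst _ _ ≫ Pi.π (fun j => C (i j)) j) (snd _ _ ≫ Pi.π (fun j => C (i' j)) j)))
        fun z => ?_
      simp
    convert this.compl using 1
    ext z
    simp only [Category.assoc, Set.mem_ofPred_eq, Set.compl_iUnion, compl_compl, Set.mem_iInter]
    constructor
    · rintro ⟨s, h, h'⟩ j
      exact ⟨s j, h j, h' j⟩
    · intro h
      choose s h using h
      exact ⟨s, fun j => (h j).1, fun j => (h j).2⟩

theorem Tracked.eval [Finite J] (j : J) : Tracked (fun s : ∀ j, S j => s j) :=
  fun i => ⟨i j, Limits.Pi.π _ j, fun _ _ h => h j⟩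

theorem DefMap.eval [Finite J] (j : J) : DefMap (fun s : ∀ j, S j => s j) :=
  (Tracked.eval j).defMap

theorem DefMap.pi [Finite J] {T : Type} [DefType T] {f : T → ∀ j, S j}
    (h : ∀ j, DefMap (fun t => f t j)) : DefMap f :=
  (IsDef.iAll fun j => (IsDef.comp_tracked (h j)
    (Tracked.fst.prodMk ((Tracked.eval j).comp .snd)))).congr fun z => by
      simp [funext_iff]

end Instances

end MotivicPower

namespace MotivicPower

/-! ### Classes of weighted definable types -/

/-- The fibre over a complex point is closed, and when nonempty it contains a complex point. -/
theorem exists_lift_of_mem_range {X Y : CSch} [IsVar X] [IsVar Y] (f : X ⟶ Y) {y : pts Y}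
    (h : topPt y ∈ Set.range f.left) : ∃ x : pts X, x ≫ f = y := by
  obtain ⟨z, hz⟩ := h
  have hc : Topology.IsConstructible (f.left ⁻¹' {topPt y}) :=
    isConstructible_of_isClosed ((isClosed_topPt y).preimage f.left.continuous)
  obtain ⟨x, hx⟩ := exists_pts_of_isConstructible hc ⟨z, hz⟩
  exact ⟨x, topPt_inj (by rw [topPt_comp]; exact hx)⟩

theorem pts_comp_injective {X Y : CSch} [IsVar X] (f : X ⟶ Y)
    (h : Function.Injective f.left) {x x' : pts X} (hx : x ≫ f = x' ≫ f) : x = x' :=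
  topPt_inj (h (by rw [← topPt_comp, ← topPt_comp, hx]))

/-- A constructible set of complex points is the disjoint union of the complex points of
finitely many reduced varieties. -/
theorem Constr.exists_family {X : CSch} [IsVar X] {s : Set (pts X)} (hs : Constr s) :
    ∃ (I : Type) (_ : Fintype I) (T : I → CSch) (_ : ∀ i, IsVar (T i))
      (_ : ∀ i, IsReduced (T i).left) (f : ∀ i, T i ⟶ X),
      (∀ x, x ∈ s ↔ ∃ q : Σ i, pts (T i), q.2 ≫ f q.1 = x) ∧
      ∀ q q' : Σ i, pts (T i), q.2 ≫ f q.1 = q'.2 ≫ f q'.1 → q = q' := by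
  classical
  obtain ⟨Z, hZ, rfl⟩ := hs
  obtain ⟨I, _, c, t, hc, rfl⟩ := exists_partition_of_isConstructible hZ
  -- Each part is the intersection of an open `U i` and a closed `K i`, and is realized by the
  -- corresponding open subscheme of `K i` with its reduced structure.
  choose U K hU hK hUK using hc
  let V (i : I) : (closedSub X ⟨K i, hK i⟩).left.Opens :=
    (closedIncl X ⟨K i, hK i⟩).left ⁻¹ᵁ ⟨U i, hU i⟩
  let f (i : I) : openSub (closedSub X ⟨K i, hK i⟩) (V i) ⟶ X :=
    openIncl _ (V i) ≫ closedIncl X ⟨K i, hK i⟩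
  have hf (i : I) : Set.range (f i).left = c ⁻¹' {i} := by
    have h₁ : Set.range (openIncl _ (V i)).left =
      (closedIncl X ⟨K i, hK i⟩).left ⁻¹' (U i) := range_openIncl _ (V i)
    have h₂ : Set.range (closedIncl X ⟨K i, hK i⟩).left = K i := range_closedIncl _ _
    calc Set.range (f i).left = (closedIncl X ⟨K i, hK i⟩).left ''
          Set.range (openIncl _ (V i)).left := by
            rw [← Set.range_comp]; simp [f]
      _ = U i ∩ Set.range (closedIncl X ⟨K i, hK i⟩).left := by
            rw [h₁, Set.image_preimage_eq_inter_range]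
      _ = c ⁻¹' {i} := by rw [h₂, hUK]
  have hinj (i : I) : Function.Injective (f i).left := by
    have := (closedIncl X ⟨K i, hK i⟩).left.isClosedEmbedding.injective.comp
      (openIncl _ (V i)).left.isOpenEmbedding.injective
    simpa [f] using this
  have hcol (i : I) (x : pts (openSub (closedSub X ⟨K i, hK i⟩) (V i))) :
      c (topPt (x ≫ f i)) = i := by
    have : topPt (x ≫ f i) ∈ c ⁻¹' {i} := by rw [← hf, topPt_comp]; exact ⟨_, rfl⟩
    exact this
  refine ⟨t, inferInstance, fun i => openSub (closedSub X ⟨K i, hK i⟩) (V i), inferInstance,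
    fun i => inferInstanceAs (IsReduced (V i).toScheme), fun i => f i, fun x => ⟨fun hx => ?_, ?_⟩, ?_⟩
  · obtain ⟨y, hy⟩ := exists_lift_of_mem_range (f (c (topPt x))) (y := x) (by rw [hf]; rfl)
    exact ⟨⟨⟨_, hx⟩, y⟩, hy⟩
  · rintro ⟨⟨⟨i, hi⟩, y⟩, rfl⟩
    change c (topPt (y ≫ f i)) ∈ t
    rw [hcol]; exact hi
  · rintro ⟨⟨i, hi⟩, y⟩ ⟨⟨j, hj⟩, y'⟩ h
    have h : y ≫ f i = y' ≫ f j := h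
    obtain rfl : i = j := by rw [← hcol i y, ← hcol j y', h]
    congr 1
    exact pts_comp_injective (f i) (hinj i) h

section

variable {𝔐 : CSch} [AddMonObj 𝔐] [IsCommAddMonObj 𝔐]

theorem cls_mul (V W : RelVar 𝔐) : cls (V.mul W) = cls V * cls W := by
  rw [cls, cls, cls, ← map_mul]
  rfl

/-- The weighted definable type `S` has the class `x`: it is in definable bijection with a finite
disjoint union of varieties over `𝔐` of total class `x`. -/
def HasClass (S : Type) [DefType S] (w : S → pts 𝔐) (x : K0 𝔐) : Prop :=
  ∃ (J : Type) (_ : Fintype J) (V : J → RelVar 𝔐) (f : (Σ j, pts (V j).X) → S),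
    f.Bijective ∧ DefMap f ∧ (∀ j v, w (f ⟨j, v⟩) = v ≫ (V j).p) ∧ ∑ j, cls (V j) = x

variable {S T : Type} [DefType S] [DefType T] {w : S → pts 𝔐} {w' : T → pts 𝔐} {x y : K0 𝔐}

/-- Two presentations are compared through their graph `{f = g}` in the products `V j × W k`. Its
constructible pieces are finite unions of reduced varieties, which map jointly bijectively on
complex points to each `V j` and to each `W k`; both totals therefore equal the sum of the classes
of the pieces. -/
theorem HasClass.unique [LocallyOfFiniteType 𝔐.hom] [IsSeparated 𝔐.hom]
    (hx : HasClass S w x) (hy : HasClass S w y) : x = y := by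
  obtain ⟨J, _, V, f, hf, hfd, hfw, rfl⟩ := hx
  obtain ⟨K, _, W, g, hg, hgd, hgw, rfl⟩ := hy
  have hΓ (j : J) (k : K) : Constr {z : pts ((V j).X ⊗ (W k).X) |
      f ⟨j, z ≫ fst _ _⟩ = g ⟨k, z ≫ snd _ _⟩} :=
    isDef_pts_iff.mp (IsDef.eq
      (hfd.comp ((Tracked.sigmaMk (S := fun j => pts (V j).X) j).comp
        (Tracked.hom (fst _ _))).defMap)
      (hgd.comp ((Tracked.sigmaMk (S := fun k => pts (W k).X) k).comp
        (Tracked.hom (snd _ _))).defMap))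
  choose I hI T hT hTr h hmem hinj using fun j k => (hΓ j k).exists_family
  have hV (j : J) : cls (V j) = ∑ k, ∑ i, cls (rel (T j k i) (h j k i ≫ fst _ _ ≫ (V j).p)) := by
    have := sum_cls_eq_of_bijective (V j).p (I := Σ k, I j k) (fun i => T j i.1 i.2)
      (fun i => h j i.1 i.2 ≫ fst _ _) (fun v => by
        obtain ⟨⟨k, u⟩, hu⟩ := hg.2 (f ⟨j, v⟩)
        obtain ⟨⟨i, t⟩, ht⟩ := (hmem j k (lift v u)).mp (by simp [hu])
        refine ⟨⟨⟨k, i⟩, t⟩, by simp [reassoc_of% ht], ?_⟩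
        rintro ⟨⟨k', i'⟩, t'⟩ ht'
        have ht' : t' ≫ h j k' i' ≫ fst _ _ = v := ht'
        have hm := (hmem j k' (t' ≫ h j k' i')).mpr ⟨⟨i', t'⟩, rfl⟩
        have hm : f ⟨j, (t' ≫ h j k' i') ≫ fst _ _⟩ = g ⟨k', (t' ≫ h j k' i') ≫ snd _ _⟩ := hm
        rw [Category.assoc, ht', ← hu] at hm
        obtain ⟨rfl, hu'⟩ := Sigma.mk.inj_iff.mp (hg.1 hm)
        have := hinj j k ⟨i', t'⟩ ⟨i, t⟩ (by
          dsimp only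
          rw [ht]
          refine CartesianMonoidalCategory.hom_ext _ _ ?_ ?_
          · simpa using ht'
          · simpa using (eq_of_heq hu').symm)
        obtain ⟨rfl, ht''⟩ := Sigma.mk.inj_iff.mp this
        rw [eq_of_heq ht''])
    rw [Fintype.sum_sigma] at this
    simp only [Category.assoc] at this
    exact this.symm
  have hW (k : K) : cls (W k) = ∑ j, ∑ i, cls (rel (T j k i) (h j k i ≫ snd _ _ ≫ (W k).p)) := by
    have := sum_cls_eq_of_bijective (W k).p (I := Σ j, I j k) (fun i => T i.1 k i.2)
      (fun i => h i.1 k i.2 ≫ snd _ _) (fun u => by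
        obtain ⟨⟨j, v⟩, hu⟩ := hf.2 (g ⟨k, u⟩)
        obtain ⟨⟨i, t⟩, ht⟩ := (hmem j k (lift v u)).mp (by simp [hu])
        refine ⟨⟨⟨j, i⟩, t⟩, by simp [reassoc_of% ht], ?_⟩
        rintro ⟨⟨j', i'⟩, t'⟩ ht'
        have ht' : t' ≫ h j' k i' ≫ snd _ _ = u := ht'
        have hm := (hmem j' k (t' ≫ h j' k i')).mpr ⟨⟨i', t'⟩, rfl⟩
        have hm : f ⟨j', (t' ≫ h j' k i') ≫ fst _ _⟩ = g ⟨k, (t' ≫ h j' k i') ≫ snd _ _⟩ := hm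
        rw [Category.assoc _ _ (snd _ _), ht', ← hu] at hm
        obtain ⟨rfl, hu'⟩ := Sigma.mk.inj_iff.mp (hf.1 hm)
        have := hinj j' k ⟨i', t'⟩ ⟨i, t⟩ (by
          dsimp only
          rw [ht]
          refine CartesianMonoidalCategory.hom_ext _ _ ?_ ?_
          · simpa using (eq_of_heq hu')
          · simpa using ht')
        obtain ⟨rfl, ht''⟩ := Sigma.mk.inj_iff.mp this
        rw [eq_of_heq ht''])
    rw [Fintype.sum_sigma] at this
    simp only [Category.assoc] at this
    exact this.symm
  simp only [hV, hW]
  rw [Finset.sum_comm]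
  refine Finset.sum_congr rfl fun k _ => Finset.sum_congr rfl fun j _ =>
    Finset.sum_congr rfl fun i _ => ?_
  congr 2
  -- The two maps of a piece to `𝔐` agree on complex points because both compute the weight. The
  -- piece is reduced and `𝔐` is separated, so they agree as morphisms.
  refine hom_ext_of_pts fun t => ?_
  have hm : f ⟨j, (t ≫ h j k i) ≫ fst _ _⟩ = g ⟨k, (t ≫ h j k i) ≫ snd _ _⟩ :=
    (hmem j k (t ≫ h j k i)).mpr ⟨⟨i, t⟩, rfl⟩
  have := congrArg w hm
  rw [hfw, hgw] at this
  simpa using this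

theorem HasClass.of_bijective {g : S → T} (hx : HasClass S w x) (hg : g.Bijective)
    (hgd : DefMap g) (hw : ∀ s, w' (g s) = w s) : HasClass T w' x := by
  obtain ⟨J, _, V, f, hf, hfd, hfw, rfl⟩ := hx
  exact ⟨J, inferInstance, V, g ∘ f, hg.comp hf, hgd.comp hfd, fun j v => by simp [hw, hfw], rfl⟩

theorem HasClass.relVar (V : RelVar 𝔐) : HasClass (pts V.X) (fun v => v ≫ V.p) (cls V) :=
  ⟨Unit, inferInstance, fun _ => V, fun z => z.2,
    ⟨fun a b h => by cases a; cases b; congr, fun v => ⟨⟨(), v⟩, rfl⟩⟩,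
    defMap_sigma_iff.mpr fun _ => DefMap.id, fun _ _ => rfl, by simp⟩

theorem HasClass.sigma {J : Type} [Fintype J] {S : J → Type} [∀ j, DefType (S j)]
    {w : ∀ j, S j → pts 𝔐} {x : J → K0 𝔐} (h : ∀ j, HasClass (S j) (w j) (x j)) :
    HasClass (Σ j, S j) (fun z => w z.1 z.2) (∑ j, x j) := by
  choose I hI V f hf hfd hfw hx using h
  refine ⟨Σ j, I j, inferInstance, fun i => V i.1 i.2, fun z => ⟨z.1.1, f _ ⟨z.1.2, z.2⟩⟩,
    ⟨?_, ?_⟩, ?_, ?_, ?_⟩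
  · rintro ⟨⟨j, i⟩, v⟩ ⟨⟨j', i'⟩, v'⟩ h
    obtain ⟨rfl, h⟩ := Sigma.mk.inj_iff.mp h
    obtain ⟨rfl, h⟩ := Sigma.mk.inj_iff.mp ((hf _).1 (eq_of_heq h))
    obtain rfl := eq_of_heq h
    rfl
  · rintro ⟨j, s⟩
    obtain ⟨⟨i, v⟩, rfl⟩ := (hf j).2 s
    exact ⟨⟨⟨j, i⟩, v⟩, rfl⟩
  · exact defMap_sigma_iff.mpr fun i => (Tracked.sigmaMk (S := S) i.1).defMap.comp
      ((defMap_sigma_iff.mp (hfd i.1)) i.2)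
  · exact fun i v => hfw _ _ _
  · rw [Fintype.sum_sigma]
    exact Finset.sum_congr rfl fun j _ => hx j

theorem HasClass.prod (hx : HasClass S w x) (hy : HasClass T w' y) :
    HasClass (S × T) (fun z => w z.1 + w' z.2) (x * y) := by
  obtain ⟨J, _, V, f, hf, hfd, hfw, rfl⟩ := hx
  obtain ⟨K, _, W, g, hg, hgd, hgw, rfl⟩ := hy
  refine ⟨J × K, inferInstance, fun i => (V i.1).mul (W i.2),
    fun z => (f ⟨z.1.1, z.2 ≫ fst _ _⟩, g ⟨z.1.2, z.2 ≫ snd _ _⟩), ⟨?_, ?_⟩, ?_, ?_, ?_⟩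
  · rintro ⟨⟨j, k⟩, v⟩ ⟨⟨j', k'⟩, v'⟩ h
    obtain ⟨rfl, h₁⟩ := Sigma.mk.inj_iff.mp (hf.1 (congrArg Prod.fst h))
    obtain ⟨rfl, h₂⟩ := Sigma.mk.inj_iff.mp (hg.1 (congrArg Prod.snd h))
    congr 1
    exact CartesianMonoidalCategory.hom_ext _ _ (eq_of_heq h₁) (eq_of_heq h₂)
  · rintro ⟨s, t⟩
    obtain ⟨⟨j, v⟩, rfl⟩ := hf.2 s
    obtain ⟨⟨k, u⟩, rfl⟩ := hg.2 t
    exact ⟨⟨⟨j, k⟩, lift v u⟩, Prod.ext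
      (congrArg (fun v => f ⟨j, v⟩) (lift_fst v u)) (congrArg (fun u => g ⟨k, u⟩) (lift_snd v u))⟩
  · refine defMap_sigma_iff.mpr fun i => DefMap.prodMk ?_ ?_
    · exact hfd.comp ((Tracked.sigmaMk (S := fun j => pts (V j).X) i.1).comp
        (Tracked.hom (fst (V i.1).X (W i.2).X))).defMap
    · exact hgd.comp ((Tracked.sigmaMk (S := fun j => pts (W j).X) i.2).comp
        (Tracked.hom (snd (V i.1).X (W i.2).X))).defMap
  · rintro ⟨j, k⟩ v
    change w (f _) + w' (g _) = _
    rw [hfw, hgw]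
    refine Eq.trans ?_ (AddMonObj.comp_add v (fst _ _ ≫ (V j).p) (snd _ _ ≫ (W k).p)).symm
    exact congrArg₂ (· + ·) (Category.assoc _ _ _) (Category.assoc _ _ _)
  · simp only [cls_mul, Fintype.sum_prod_type, Finset.sum_mul_sum]

theorem HasClass.of_isEmpty [IsEmpty S] : HasClass S w 0 :=
  ⟨Empty, inferInstance, fun e => e.elim, fun z => z.1.elim, ⟨fun z => z.1.elim,
    fun s => isEmptyElim s⟩, defMap_sigma_iff.mpr fun e => e.elim, fun e => e.elim, by simp⟩

theorem HasClass.of_unique [Unique S] (h : ∀ s, w s = 0) : HasClass S w 1 := by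
  refine (HasClass.relVar (RelVar.pt 𝔐)).of_bijective (g := fun _ => default) ⟨?_, ?_⟩
    (DefMap.const _) ?_
  · exact fun a b _ => toUnit_unique a b
  · exact fun s => ⟨𝟙 _, Subsingleton.elim _ _⟩
  · intro s
    rw [h]
    exact (AddMonObj.comp_zero s).symm

end

end MotivicPower

namespace MotivicPower

/-! ### Configurations of labelled points -/

theorem sum_parts {n : ℕ} (α : n.Partition) : ∑ q : Parts α, ((q.1 : ℕ) + 1) = n := by
  rw [Fintype.sum_sigma]
  simp only [Finset.sum_const, Finset.card_univ, Fintype.card_fin]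
  rw [Fin.sum_univ_eq_sum_range (fun i => α.parts.count (i + 1) • (i + 1)) n]
  conv_rhs => rw [← α.parts_sum]
  rw [Finset.sum_multiset_count_of_subset α.parts ((Finset.range n).image (· + 1)),
    Finset.sum_image (by simp)]
  intro i hi
  rw [Multiset.mem_toFinset] at hi
  have h₁ := α.parts_pos hi
  have h₂ := Nat.Partition.le_of_mem_parts hi
  exact Finset.mem_image.mpr ⟨i - 1, by simp; omega, by omega⟩

section Raw

variable {𝒜 : ℕ → Type} [Unique (𝒜 0)] {M : Type}

theorem label_eq_of_fst_eq_zero {a : Σ i, 𝒜 i} (h : a.1 = 0) : a = ⟨0, default⟩ := by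
  obtain ⟨i, a⟩ := a
  obtain rfl : i = 0 := h
  rw [Subsingleton.elim a default]

/-- Labelled tuples indexed by the parts of a partition. -/
abbrev Tup (𝒜 : ℕ → Type) (M : Type) (n : ℕ) : Type :=
  Σ α : n.Partition, ∀ q : Parts α, M × 𝒜 (q.1 + 1)

/-- The function `f` takes the labels of the tuple at its points and is trivial elsewhere. -/
structure Rep {n : ℕ} (t : Tup 𝒜 M n) (f : M → Σ i, 𝒜 i) : Prop where
  inj : Function.Injective fun q => (t.2 q).1
  apply_eq : ∀ q, f (t.2 q).1 = ⟨q.1 + 1, (t.2 q).2⟩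
  apply_fst : ∀ x, (∀ q, (t.2 q).1 ≠ x) → (f x).1 = 0

variable {n : ℕ} {t : Tup 𝒜 M n} {f g : M → Σ i, 𝒜 i}

theorem Rep.exists_of_ne (h : Rep t f) {x : M} (hx : (f x).1 ≠ 0) : ∃ q, (t.2 q).1 = x := by
  by_contra hne
  push Not at hne
  exact hx (h.apply_fst x hne)

theorem Rep.unique (hf : Rep t f) (hg : Rep t g) : f = g := by
  funext x
  by_cases h : ∃ q, (t.2 q).1 = x
  · obtain ⟨q, rfl⟩ := h
    rw [hf.apply_eq, hg.apply_eq]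
  · push Not at h
    rw [label_eq_of_fst_eq_zero (hf.apply_fst x h), label_eq_of_fst_eq_zero (hg.apply_fst x h)]

theorem Rep.finsum {N : Type*} [AddCommMonoid N] (h : Rep t f) (φ : M → (Σ i, 𝒜 i) → N)
    (hφ : ∀ x, φ x ⟨0, default⟩ = 0) :
    ∑ᶠ x, φ x (f x) = ∑ q, φ (t.2 q).1 ⟨q.1 + 1, (t.2 q).2⟩ := by
  classical
  rw [finsum_eq_sum_of_support_subset (s := Finset.univ.map ⟨fun q => (t.2 q).1, h.inj⟩)]
  · rw [Finset.sum_map]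
    exact Finset.sum_congr rfl fun q _ => by simp [h.apply_eq]
  · intro x hx
    by_cases hx' : (f x).1 = 0
    · rw [Function.mem_support, label_eq_of_fst_eq_zero hx', hφ] at hx
      exact (hx rfl).elim
    · obtain ⟨q, rfl⟩ := h.exists_of_ne hx'
      simp

theorem Rep.finite (h : Rep t f) : (Function.support fun x => (f x).1).Finite :=
  (Set.finite_range fun q => (t.2 q).1).subset fun x hx => by
    obtain ⟨q, rfl⟩ := h.exists_of_ne hx
    exact ⟨q, rfl⟩

theorem exists_rep (t : Tup 𝒜 M n) (ht : Function.Injective fun q => (t.2 q).1) :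
    ∃ f, Rep t f := by
  classical
  refine ⟨fun x => if h : ∃ q, (t.2 q).1 = x then ⟨h.choose.1 + 1, (t.2 h.choose).2⟩
    else ⟨0, default⟩, ht, fun q => ?_, fun x hx => ?_⟩
  · have h : ∃ q', (t.2 q').1 = (t.2 q).1 := ⟨q, rfl⟩
    rw [dif_pos h]
    have : h.choose = q := ht h.choose_spec
    rw [this]
  · rw [dif_neg (by push Not; exact hx)]

/-- The partition consists of the nonzero degrees of `f`. For each size, the points where it occurs
are enumerated arbitrarily, and the labels are read off from `f`. -/
theorem exists_tup (hf : (Function.support fun x => (f x).1).Finite)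
    (hn : ∑ᶠ x, (f x).1 = n) : ∃ t : Tup 𝒜 M n, Rep t f := by
  classical
  let F := hf.toFinset
  have hF (x : M) : x ∈ F ↔ (f x).1 ≠ 0 := by simp [F]
  let α : n.Partition :=
    { parts := F.val.map fun x => (f x).1
      parts_pos := by
        intro i hi
        obtain ⟨x, hx, rfl⟩ := Multiset.mem_map.mp hi
        exact Nat.pos_of_ne_zero ((hF x).mp hx)
      parts_sum := by rw [← hn, finsum_eq_sum _ hf]; rfl }
  have hcard (i : Fin n) : (F.filter fun x => (f x).1 = i + 1).card =
      α.parts.count ((i : ℕ) + 1) := by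
    change _ = Multiset.count _ (Multiset.map _ _)
    rw [Multiset.count_map, Finset.card_def, Finset.filter_val]
    congr 1
    exact Multiset.filter_congr fun x _ => eq_comm
  let e (i : Fin n) := (Finset.equivFinOfCardEq (hcard i)).symm
  have hdeg (q : Parts α) : (f (e q.1 q.2)).1 = q.1 + 1 :=
    (Finset.mem_filter.mp (e q.1 q.2).2).2
  refine ⟨⟨α, fun q => (e q.1 q.2, hdeg q ▸ (f (e q.1 q.2)).2)⟩, ?_, ?_, ?_⟩
  · rintro ⟨i, k⟩ ⟨j, l⟩ h
    have h : (e i k : M) = e j l := h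
    have hi := hdeg ⟨i, k⟩
    have hj := hdeg ⟨j, l⟩
    dsimp only at hi hj
    rw [h, hj] at hi
    obtain rfl : i = j := Fin.ext (by omega)
    rw [(e i).injective (Subtype.ext h)]
  · intro q
    refine Sigma.ext (hdeg q) ?_
    dsimp only
    exact (eqRec_heq _ _).symm
  · intro x hx
    by_contra hne
    have hxF : x ∈ F := (hF x).mpr hne
    have hle : (f x).1 ≤ n := by
      rw [← hn, finsum_eq_sum _ hf]
      exact Finset.single_le_sum (f := fun x => (f x).1) (fun _ _ => Nat.zero_le _) hxF
    have hx' : x ∈ F.filter fun y => (f y).1 = (f x).1 - 1 + 1 :=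
      Finset.mem_filter.mpr ⟨hxF, by omega⟩
    refine hx ⟨⟨(f x).1 - 1, by omega⟩, (e ⟨(f x).1 - 1, by omega⟩).symm ⟨x, hx'⟩⟩ ?_
    simp

end Raw

/-- Configurations of total degree `n`: functions with values in a graded type of labels which
are trivial away from finitely many points. -/
def Conf (𝒜 : ℕ → Type) (M : Type) (n : ℕ) : Type :=
  {f : M → Σ i, 𝒜 i // (Function.support fun x => (f x).1).Finite ∧ ∑ᶠ x, (f x).1 = n}

namespace Conf

variable {𝒜 : ℕ → Type} [∀ i, DefType (𝒜 i)] [Unique (𝒜 0)] {M : Type} [DefType M] {n : ℕ}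

theorem le (f : Conf 𝒜 M n) (x : M) : (f.1 x).1 ≤ n := by
  by_cases h : (f.1 x).1 = 0
  · omega
  · conv_rhs => rw [← f.2.2, finsum_eq_sum _ f.2.1]
    exact Finset.single_le_sum (f := fun x => (f.1 x).1) (fun _ _ => Nat.zero_le _)
      (by simpa using h)

/-- The labels of degree at most `n`. -/
abbrev Lab (𝒜 : ℕ → Type) (n : ℕ) : Type := Σ i : Fin (n + 1), 𝒜 i

/-- The label at a point. -/
def ev (f : Conf 𝒜 M n) (x : M) : Lab 𝒜 n := ⟨⟨(f.1 x).1, Nat.lt_succ_of_le (f.le x)⟩, (f.1 x).2⟩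

theorem ev_eq_iff {f : Conf 𝒜 M n} {x : M} {l : Lab 𝒜 n} :
    f.ev x = l ↔ f.1 x = ⟨l.1, l.2⟩ := by
  obtain ⟨⟨i, hi⟩, a⟩ := l
  rw [ev]
  generalize_proofs h
  revert h
  rcases f.1 x with ⟨j, b⟩
  intro h
  constructor
  · intro he
    obtain ⟨h₁, h₂⟩ := Sigma.mk.inj_iff.mp he
    obtain rfl : j = i := congrArg Fin.val h₁
    exact Sigma.ext rfl h₂
  · intro he
    obtain ⟨rfl, h₂⟩ := Sigma.mk.inj_iff.mp he
    exact Sigma.ext rfl h₂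

theorem ext {f g : Conf 𝒜 M n} (h : ∀ x, f.ev x = g.ev x) : f = g := by
  refine Subtype.ext (funext fun x => ?_)
  rw [ev_eq_iff.mp (h x)]
  rfl

theorem isDef_inj : IsDef (fun t : Tup 𝒜 M n => Function.Injective fun q => (t.2 q).1) :=
  isDef_sigma_iff.mpr fun α => by
    change IsDef fun s : ∀ q : Parts α, M × 𝒜 (q.1 + 1) => ∀ q q', (s q).1 = (s q').1 → q = q'
    exact IsDef.iAll fun q => IsDef.iAll fun q' =>
      (IsDef.eq (DefMap.fst.comp (DefMap.eval q)) (DefMap.fst.comp (DefMap.eval q'))).imp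
        (IsDef.const (q = q'))

/-- The trivial label. -/
def zeroLab : Lab 𝒜 n := ⟨⟨0, Nat.succ_pos n⟩, (default : 𝒜 0)⟩

/-- The label of a tuple. -/
def tupLab {α : n.Partition} (t : ∀ q : Parts α, M × 𝒜 (q.1 + 1)) (q : Parts α) : Lab 𝒜 n :=
  ⟨⟨q.1 + 1, by omega⟩, (t q).2⟩

theorem defMap_tupLab {α : n.Partition} (q : Parts α) :
    DefMap (fun t : ∀ q : Parts α, M × 𝒜 (q.1 + 1) => tupLab t q) :=
  (Tracked.sigmaMk (S := fun i : Fin (n + 1) => 𝒜 i) ⟨q.1 + 1, by omega⟩).defMap.comp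
    (DefMap.snd.comp (DefMap.eval q))

/-- A tuple with distinct positions represents exactly one configuration, so here existence and
universality over the represented configurations can be exchanged. -/
theorem exists_rep_iff {t : Tup 𝒜 M n} {p : Conf 𝒜 M n → Prop} :
    (∃ f : Conf 𝒜 M n, Rep t f.1 ∧ p f) ↔
      (Function.Injective fun q => (t.2 q).1) ∧ ∀ f : Conf 𝒜 M n, Rep t f.1 → p f := by
  constructor
  · rintro ⟨f, hf, hp⟩
    refine ⟨hf.inj, fun g hg => ?_⟩
    obtain rfl : f = g := Subtype.ext (hf.unique hg)
    exact hp
  · rintro ⟨h, hp⟩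
    obtain ⟨f, hf⟩ := exists_rep t h
    have hn : ∑ᶠ x, (f x).1 = n := by
      rw [hf.finsum (fun _ a => a.1) (fun _ => rfl)]
      exact sum_parts t.1
    exact ⟨⟨f, hf.finite, hn⟩, hf, hp _ hf⟩

/-- This turns evaluation at a point into a first order formula in the representing tuple. -/
theorem rep_ev_iff {t : Tup 𝒜 M n} {x : M} {l : Lab 𝒜 n} :
    (∃ f : Conf 𝒜 M n, Rep t f.1 ∧ f.ev x = l) ↔ (Function.Injective fun q => (t.2 q).1) ∧
      ((∃ q, (t.2 q).1 = x ∧ tupLab t.2 q = l) ∨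
        ((∀ q, (t.2 q).1 ≠ x) ∧ zeroLab = l)) := by
  rw [exists_rep_iff]
  refine and_congr_right fun hinj => ?_
  obtain ⟨f, hf, -⟩ := exists_rep_iff (p := fun _ => True).mpr ⟨hinj, fun _ _ => trivial⟩
  have : (∀ g : Conf 𝒜 M n, Rep t g.1 → g.ev x = l) ↔ f.ev x = l :=
    ⟨fun h => h f hf, fun h g hg => by rwa [show g = f from Subtype.ext (hg.unique hf)]⟩
  rw [this]
  by_cases h : ∃ q, (t.2 q).1 = x
  · obtain ⟨q, rfl⟩ := h
    have h1 : f.ev (t.2 q).1 = tupLab t.2 q := ev_eq_iff.mpr (hf.apply_eq q)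
    rw [h1]
    constructor
    · exact fun h => Or.inl ⟨q, rfl, h⟩
    · rintro (⟨q', hq', h⟩ | ⟨h, -⟩)
      · rwa [hinj hq'] at h
      · exact (h q rfl).elim
  · have h1 : f.ev x = zeroLab :=
      ev_eq_iff.mpr (label_eq_of_fst_eq_zero (hf.apply_fst x (by push Not at h; exact h)))
    rw [h1]
    constructor
    · exact fun h' => Or.inr ⟨by push Not at h; exact h, h'⟩
    · rintro (⟨q', hq', -⟩ | ⟨-, h⟩)
      · exact (h ⟨q', hq'⟩).elim
      · exact h

theorem isDef_rep_ev : IsDef (fun z : Tup 𝒜 M n × M × Lab 𝒜 n =>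
    ∃ f : Conf 𝒜 M n, Rep z.1 f.1 ∧ f.ev z.2.1 = z.2.2) := by
  simp only [rep_ev_iff]
  refine (isDef_inj.comp DefMap.fst).and (isDef_sigma_prod_iff.mpr fun α => ?_)
  change IsDef fun z : (∀ q : Parts α, M × 𝒜 (q.1 + 1)) × M × Lab 𝒜 n =>
    (∃ q, (z.1 q).1 = z.2.1 ∧ tupLab z.1 q = z.2.2) ∨
      ((∀ q, (z.1 q).1 ≠ z.2.1) ∧ zeroLab = z.2.2)
  refine IsDef.or (IsDef.iEx fun q => ?_) ((IsDef.iAll fun q => ?_).and ?_)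
  · exact (IsDef.eq (DefMap.fst.comp ((DefMap.eval q).comp DefMap.fst))
      (DefMap.fst.comp DefMap.snd)).and
      (IsDef.eq ((defMap_tupLab q).comp DefMap.fst) (DefMap.snd.comp DefMap.snd))
  · exact (IsDef.eq (DefMap.fst.comp ((DefMap.eval q).comp DefMap.fst))
      (DefMap.fst.comp DefMap.snd)).not
  · exact IsDef.eq (DefMap.const _) (DefMap.snd.comp DefMap.snd)

/-- Configurations are coded by tuples with distinct positions. Two such tuples represent the same
configuration exactly when all evaluations agree; this is a first order condition, so the kernel
relation is constructible and no scheme-theoretic quotient is needed. -/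
instance : DefType (Conf 𝒜 M n) :=
  DefType.ofRel (fun (t : Tup 𝒜 M n) f => Rep t f.1)
    (fun h h' => Subtype.ext (h.unique h')) (fun f => exists_tup f.2.1 f.2.2) (by
    have : IsDef (fun z : Tup 𝒜 M n × Tup 𝒜 M n =>
      ((Function.Injective fun q => (z.1.2 q).1) ∧ (Function.Injective fun q => (z.2.2 q).1)) ∧
        ∀ (x : M) (l : Lab 𝒜 n), (∃ f : Conf 𝒜 M n, Rep z.1 f.1 ∧ f.ev x = l) ↔
          (∃ f : Conf 𝒜 M n, Rep z.2 f.1 ∧ f.ev x = l)) := by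
      refine ((isDef_inj.comp DefMap.fst).and (isDef_inj.comp DefMap.snd)).and
        (IsDef.all (IsDef.all (IsDef.iff ?_ ?_)))
      · exact isDef_rep_ev.comp ((DefMap.fst.comp (DefMap.fst.comp DefMap.fst)).prodMk
          ((DefMap.snd.comp DefMap.fst).prodMk DefMap.snd))
      · exact isDef_rep_ev.comp ((DefMap.snd.comp (DefMap.fst.comp DefMap.fst)).prodMk
          ((DefMap.snd.comp DefMap.fst).prodMk DefMap.snd))
    refine this.congr fun z => ⟨?_, ?_⟩
    · rintro ⟨⟨h₁, h₂⟩, h⟩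
      obtain ⟨f, hf, -⟩ := exists_rep_iff (p := fun _ => True).mpr ⟨h₁, fun _ _ => trivial⟩
      obtain ⟨g, hg, -⟩ := exists_rep_iff (p := fun _ => True).mpr ⟨h₂, fun _ _ => trivial⟩
      have : f = g := Conf.ext fun x => by
        obtain ⟨g', hg', h'⟩ := (h x (f.ev x)).mp ⟨f, hf, rfl⟩
        rw [← h', show g' = g from Subtype.ext (hg'.unique hg)]
      exact ⟨f, hf, this ▸ hg⟩
    · rintro ⟨f, hf, hf'⟩
      refine ⟨⟨hf.inj, hf'.inj⟩, fun x l => ⟨?_, ?_⟩⟩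
      · rintro ⟨g, hg, rfl⟩
        exact ⟨f, hf', by rw [show f = g from Subtype.ext (hf.unique hg)]⟩
      · rintro ⟨g, hg, rfl⟩
        exact ⟨f, hf, by rw [show f = g from Subtype.ext (hf'.unique hg)]⟩)

/-- The sets of codes on the two sides are literally equal, since a code of a configuration is a
code of a representing tuple. -/
theorem isDef_prod_iff {T : Type} [DefType T] {p : Conf 𝒜 M n × T → Prop} :
    IsDef p ↔ IsDef (fun z : Tup 𝒜 M n × T => ∃ f : Conf 𝒜 M n, Rep z.1 f.1 ∧ p (f, z.2)) := by
  refine forall_congr' fun i => iff_of_eq (congrArg Constr ?_)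
  ext c
  constructor
  · rintro ⟨⟨f, s⟩, ⟨⟨t, ht, hf⟩, hs⟩, hp⟩
    exact ⟨(t, s), ⟨ht, hs⟩, f, hf, hp⟩
  · rintro ⟨⟨t, s⟩, ⟨ht, hs⟩, f, hf, hp⟩
    exact ⟨(f, s), ⟨⟨t, ht, hf⟩, hs⟩, hp⟩

theorem defMap_ev : DefMap (fun z : Conf 𝒜 M n × M => z.1.ev z.2) := by
  have h : IsDef (fun z : Conf 𝒜 M n × M × Lab 𝒜 n => z.1.ev z.2.1 = z.2.2) :=
    isDef_prod_iff.mpr isDef_rep_ev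
  exact h.comp ((DefMap.fst.comp DefMap.fst).prodMk
    ((DefMap.snd.comp DefMap.fst).prodMk DefMap.snd))

theorem defMap_ev' {T : Type} [DefType T] {f : T → Conf 𝒜 M n} {g : T → M} (hf : DefMap f)
    (hg : DefMap g) : DefMap (fun t => (f t).ev (g t)) := defMap_ev.comp (hf.prodMk hg)

/-- Equality of configurations is equality of all evaluations, so the graph of `g` is obtained from
the evaluations by one universal quantifier over positions. -/
theorem defMap_of_ev {T : Type} [DefType T] {g : T → Conf 𝒜 M n}
    (h : IsDef (fun z : (T × M) × Lab 𝒜 n => (g z.1.1).ev z.1.2 = z.2)) : DefMap g := by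
  have : DefMap (fun z : T × M => (g z.1).ev z.2) := h
  refine (IsDef.all (p := fun (z : T × Conf 𝒜 M n) (x : M) => (g z.1).ev x = z.2.ev x)
    (IsDef.eq ?_ ?_)).congr fun z => ?_
  · exact this.comp ((DefMap.fst.comp DefMap.fst).prodMk DefMap.snd)
  · exact defMap_ev' (DefMap.snd.comp DefMap.fst) DefMap.snd
  · exact ⟨fun h => Conf.ext h, fun h x => by rw [h]⟩

end Conf

end MotivicPower

namespace MotivicPower

/-! ### Weights and operations on configurations -/

theorem finsum_sum_type {Z U N : Type*} [AddCommMonoid N] {h : Z ⊕ U → N}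
    (hf : h.support.Finite) :
    ∑ᶠ s, h s = ∑ᶠ z, h (.inl z) + ∑ᶠ u, h (.inr u) := by
  classical
  have h₁ : (fun z => h (.inl z)).support.Finite :=
    (hf.preimage Sum.inl_injective.injOn).subset fun z hz => hz
  have h₂ : (fun z => h (.inr z)).support.Finite :=
    (hf.preimage Sum.inr_injective.injOn).subset fun z hz => hz
  rw [finsum_eq_sum _ h₁, finsum_eq_sum _ h₂,
    finsum_eq_sum_of_support_subset (s := h₁.toFinset.disjSum h₂.toFinset), Finset.sum_disjSum]
  rintro (z | u) hz <;> simpa using hz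

/-- The pairs of natural numbers with sum `n`. -/
abbrev anti (n : ℕ) : Finset (ℕ × ℕ) := Finset.HasAntidiagonal.antidiagonal n

namespace Conf

/-! ### Total weights. -/

section Weight

variable {𝒜 : ℕ → Type} [Unique (𝒜 0)] {M : Type} {n : ℕ} {N : Type*} [AddCommMonoid N]

theorem finite_support (f : Conf 𝒜 M n) {φ : M → (Σ i, 𝒜 i) → N}
    (hφ : ∀ x, φ x ⟨0, default⟩ = 0) : (Function.support fun x => φ x (f.1 x)).Finite :=
  f.2.1.subset fun x hx hx' => hx (by
    dsimp only
    rw [label_eq_of_fst_eq_zero hx', hφ])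

/-- The total weight of a configuration. -/
def wt (w : M → N) (wA : ∀ i, 𝒜 i → N) (f : Conf 𝒜 M n) : N :=
  ∑ᶠ x, ((f.1 x).1 • w x + wA _ (f.1 x).2)

end Weight

/-! ### Functoriality in the labels and in the positions. -/

section Map

variable {𝒜 ℬ : ℕ → Type} [∀ i, DefType (𝒜 i)] [Unique (𝒜 0)] [∀ i, DefType (ℬ i)]
  [Unique (ℬ 0)] {M M' : Type} [DefType M] [DefType M'] {n : ℕ} {N : Type*} [AddCommMonoid N]

/-- Change of labels. -/
def mapLab (h : ∀ i, 𝒜 i → ℬ i) (f : Conf 𝒜 M n) : Conf ℬ M n :=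
  ⟨fun x => ⟨(f.1 x).1, h _ (f.1 x).2⟩, f.2⟩

/-- Surjectivity above degree `n` is not needed, since no label of a configuration of total degree
`n` exceeds that degree. -/
theorem mapLab_bijective {h : ∀ i, 𝒜 i → ℬ i} (hi : ∀ i, (h i).Injective)
    (hs : ∀ i ≤ n, (h i).Surjective) :
    (mapLab (M := M) (n := n) h).Bijective := by
  constructor
  · intro f g hfg
    refine Subtype.ext (funext fun x => ?_)
    have := congrFun (congrArg Subtype.val hfg) x
    obtain ⟨h₁, h₂⟩ := Sigma.mk.inj_iff.mp this
    revert h₁ h₂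
    generalize f.1 x = a
    generalize g.1 x = b
    obtain ⟨i, a⟩ := a
    obtain ⟨j, b⟩ := b
    rintro (rfl : i = j) h₂
    exact congrArg _ (hi i (eq_of_heq h₂))
  · intro g
    choose k hk using hs
    refine ⟨⟨fun x => ⟨(g.1 x).1, k _ (g.le x) (g.1 x).2⟩, g.2⟩, Subtype.ext (funext fun x => ?_)⟩
    exact Sigma.ext rfl (heq_of_eq (hk _ _ _))

theorem defMap_mapLab {h : ∀ i, 𝒜 i → ℬ i} (hh : ∀ i, DefMap (h i)) :
    DefMap (mapLab (M := M) (n := n) h) := by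
  refine defMap_of_ev (?_ : DefMap fun z : Conf 𝒜 M n × M => (mapLab h z.1).ev z.2)
  have hL : DefMap (fun l : Lab 𝒜 n => (⟨l.1, h _ l.2⟩ : Lab ℬ n)) :=
    defMap_sigma_iff.mpr fun i =>
      (Tracked.sigmaMk (S := fun i : Fin (n + 1) => ℬ i) i).defMap.comp (hh i)
  exact hL.comp defMap_ev

theorem wt_mapLab {h : ∀ i, 𝒜 i → ℬ i} {w : M → N} {wA : ∀ i, 𝒜 i → N} {wB : ∀ i, ℬ i → N}
    (hw : ∀ i a, wB i (h i a) = wA i a) (f : Conf 𝒜 M n) : (mapLab h f).wt w wB = f.wt w wA :=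
  finsum_congr fun x => by simp [mapLab, hw]

/-- Transport along a bijection of the spaces of positions. -/
def mapPos (e : M ≃ M') (f : Conf 𝒜 M n) : Conf 𝒜 M' n :=
  ⟨fun x => f.1 (e.symm x), f.2.1.preimage e.symm.injective.injOn, by
    rw [finsum_comp_equiv e.symm (f := fun x => (f.1 x).1)]; exact f.2.2⟩

theorem mapPos_bijective (e : M ≃ M') : (mapPos (𝒜 := 𝒜) (n := n) e).Bijective := by
  refine Function.bijective_iff_has_inverse.mpr ⟨mapPos e.symm, fun f => ?_, fun f => ?_⟩ <;>
  exact Subtype.ext (funext fun x => by simp [mapPos])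

theorem defMap_mapPos {e : M ≃ M'} (he : DefMap e) : DefMap (mapPos (𝒜 := 𝒜) (n := n) e) :=
  defMap_of_ev (show DefMap fun z : Conf 𝒜 M n × M' => z.1.ev (e.symm z.2) from
    defMap_ev' DefMap.fst (he.symm.comp DefMap.snd))

theorem wt_mapPos {e : M ≃ M'} {w : M → N} {w' : M' → N} {wA : ∀ i, 𝒜 i → N}
    (hw : ∀ x, w' (e x) = w x) (f : Conf 𝒜 M n) : (mapPos e f).wt w' wA = f.wt w wA := by
  rw [wt, ← finsum_comp_equiv e]
  refine finsum_congr fun x => ?_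
  change (f.1 (e.symm (e x))).1 • w' (e x) + wA _ (f.1 (e.symm (e x))).2 = _
  rw [e.symm_apply_apply, hw]

end Map

/-! ### Configurations on a disjoint union of position spaces. -/

section Join

variable {𝒜 : ℕ → Type} [∀ i, DefType (𝒜 i)] [Unique (𝒜 0)] {M Z U : Type} [DefType M]
  [DefType Z] [DefType U] {n : ℕ} {N : Type*} [AddCommMonoid N]

/-- The inclusion of the labels of bounded degree. -/
def labLE {m : ℕ} (h : m ≤ n) (l : Lab 𝒜 m) : Lab 𝒜 n := ⟨⟨l.1, by omega⟩, l.2⟩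

theorem defMap_labLE {m : ℕ} (h : m ≤ n) : DefMap (labLE (𝒜 := 𝒜) h) :=
  defMap_sigma_iff.mpr fun i => (Tracked.sigmaMk (S := fun i : Fin (n + 1) => 𝒜 i)
    (⟨i, by omega⟩ : Fin (n + 1))).defMap

/-- Configurations on the two parts of a decomposition of the space of positions. -/
abbrev Pair (𝒜 ℬ : ℕ → Type) (Z U : Type) (n : ℕ) : Type :=
  Σ p : anti n, Conf 𝒜 Z p.1.1 × Conf ℬ U p.1.2

theorem pair_ext {ℬ : ℕ → Type} {s t : Pair 𝒜 ℬ Z U n} (h₁ : s.2.1.1 = t.2.1.1)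
    (h₂ : s.2.2.1 = t.2.2.1) : s = t := by
  obtain ⟨⟨⟨a, b⟩, h⟩, ⟨f, hf⟩, ⟨g, hg⟩⟩ := s
  obtain ⟨⟨⟨a', b'⟩, h'⟩, ⟨f', hf'⟩, ⟨g', hg'⟩⟩ := t
  obtain rfl : f = f' := h₁
  obtain rfl : g = g' := h₂
  obtain rfl : a = a' := hf.2.symm.trans hf'.2
  obtain rfl : b = b' := hg.2.symm.trans hg'.2
  rfl

theorem finsum_join (e : Z ⊕ U ≃ M) (f : Z → Σ i, 𝒜 i) (g : U → Σ i, 𝒜 i)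
    (φ : M → (Σ i, 𝒜 i) → N) (hf : (Function.support fun x => φ (e (.inl x)) (f x)).Finite)
    (hg : (Function.support fun x => φ (e (.inr x)) (g x)).Finite) :
    ∑ᶠ x, φ x (Sum.elim f g (e.symm x)) =
      ∑ᶠ z, φ (e (.inl z)) (f z) + ∑ᶠ u, φ (e (.inr u)) (g u) := by
  rw [← finsum_comp_equiv e, finsum_sum_type]
  · simp
  · refine ((hf.image Sum.inl).union (hg.image Sum.inr)).subset ?_
    rintro (z | u) hz
    · exact .inl ⟨z, by simpa using hz, rfl⟩
    · exact .inr ⟨u, by simpa using hz, rfl⟩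

/-- The union of configurations on two parts. -/
def join (e : Z ⊕ U ≃ M) (t : Pair 𝒜 𝒜 Z U n) : Conf 𝒜 M n :=
  ⟨fun x => Sum.elim t.2.1.1 t.2.2.1 (e.symm x), by
    refine ((t.2.1.2.1.image (e ∘ Sum.inl)).union (t.2.2.2.1.image (e ∘ Sum.inr))).subset ?_
    intro x hx
    obtain ⟨y, rfl⟩ := e.surjective x
    rcases y with z | u
    · exact .inl ⟨z, by simpa using hx, rfl⟩
    · exact .inr ⟨u, by simpa using hx, rfl⟩, by
    rw [finsum_join e t.2.1.1 t.2.2.1 (fun _ a => a.1) t.2.1.2.1 t.2.2.2.1, t.2.1.2.2, t.2.2.2.2]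
    exact Finset.HasAntidiagonal.mem_antidiagonal.mp t.1.2⟩

theorem join_bijective (e : Z ⊕ U ≃ M) : (join (𝒜 := 𝒜) (n := n) e).Bijective := by
  constructor
  · intro s t h
    have h (x : M) := congrFun (congrArg Subtype.val h) x
    exact pair_ext (funext fun z => by simpa [join] using h (e (.inl z)))
      (funext fun z => by simpa [join] using h (e (.inr z)))
  · intro f
    have h₁ : (Function.support fun z => (f.1 (e (.inl z))).1).Finite :=
      f.2.1.preimage (e.injective.comp Sum.inl_injective).injOn
    have h₂ : (Function.support fun z => (f.1 (e (.inr z))).1).Finite :=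
      f.2.1.preimage (e.injective.comp Sum.inr_injective).injOn
    have hel (x : M) :
        Sum.elim (fun z => f.1 (e (.inl z))) (fun z => f.1 (e (.inr z))) (e.symm x) = f.1 x := by
      obtain ⟨y, rfl⟩ := e.surjective x
      rcases y with z | u <;> simp
    refine ⟨⟨⟨(∑ᶠ z, (f.1 (e (.inl z))).1, ∑ᶠ z, (f.1 (e (.inr z))).1), ?_⟩,
      ⟨fun z => f.1 (e (.inl z)), h₁, rfl⟩, ⟨fun z => f.1 (e (.inr z)), h₂, rfl⟩⟩, ?_⟩
    · rw [Finset.HasAntidiagonal.mem_antidiagonal, ← finsum_join e (fun z => f.1 (e (.inl z)))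
        (fun z => f.1 (e (.inr z))) (fun _ a => a.1) h₁ h₂]
      simp only [hel]
      exact f.2.2
    · exact Subtype.ext (funext hel)

theorem defMap_join {e : Z ⊕ U ≃ M} (h₁ : DefMap fun z => e (.inl z))
    (h₂ : DefMap fun z => e (.inr z)) : DefMap (join (𝒜 := 𝒜) (n := n) e) := by
  refine defMap_sigma_iff.mpr fun p => defMap_of_ev ?_
  have hp := Finset.HasAntidiagonal.mem_antidiagonal.mp p.2
  -- The inverse of `e` is replaced by an existential quantifier over the points mapping to `x`.
  have key (t : Conf 𝒜 Z p.1.1 × Conf 𝒜 U p.1.2) (x : M) (l : Lab 𝒜 n) :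
      (join e (⟨p, t⟩ : Pair 𝒜 𝒜 Z U n)).ev x = l ↔
        (∃ z, e (.inl z) = x ∧ labLE (by omega) (t.1.ev z) = l) ∨
        (∃ z, e (.inr z) = x ∧ labLE (by omega) (t.2.ev z) = l) := by
    obtain ⟨y, rfl⟩ := e.surjective x
    rcases y with z | u
    · have : (join e (⟨p, t⟩ : Pair 𝒜 𝒜 Z U n)).ev (e (.inl z)) =
          labLE (by omega) (t.1.ev z) := by
        rw [ev_eq_iff]; simp [join, labLE, ev]
      simp [this]
    · have : (join e (⟨p, t⟩ : Pair 𝒜 𝒜 Z U n)).ev (e (.inr u)) =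
          labLE (by omega) (t.2.ev u) := by
        rw [ev_eq_iff]; simp [join, labLE, ev]
      simp [this]
  simp only [key]
  refine IsDef.or (IsDef.ex (IsDef.and ?_ ?_)) (IsDef.ex (IsDef.and ?_ ?_))
  · exact IsDef.eq (h₁.comp DefMap.snd) (DefMap.snd.comp (DefMap.fst.comp DefMap.fst))
  · exact IsDef.eq ((defMap_labLE _).comp (defMap_ev' (DefMap.fst.comp (DefMap.fst.comp
      (DefMap.fst.comp DefMap.fst))) DefMap.snd)) (DefMap.snd.comp DefMap.fst)
  · exact IsDef.eq (h₂.comp DefMap.snd) (DefMap.snd.comp (DefMap.fst.comp DefMap.fst))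
  · exact IsDef.eq ((defMap_labLE _).comp (defMap_ev' (DefMap.snd.comp (DefMap.fst.comp
      (DefMap.fst.comp DefMap.fst))) DefMap.snd)) (DefMap.snd.comp DefMap.fst)

theorem wt_join (e : Z ⊕ U ≃ M) {w : M → N} {wA : ∀ i, 𝒜 i → N} (hA : wA 0 default = 0)
    (t : Pair 𝒜 𝒜 Z U n) : (join e t).wt w wA =
      t.2.1.wt (fun z => w (e (.inl z))) wA + t.2.2.wt (fun z => w (e (.inr z))) wA :=
  finsum_join e _ _ (fun x a => a.1 • w x + wA a.1 a.2)
    (t.2.1.finite_support (φ := fun x a => a.1 • w (e (.inl x)) + wA a.1 a.2) (by simp [hA]))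
    (t.2.2.finite_support (φ := fun x a => a.1 • w (e (.inr x)) + wA a.1 a.2) (by simp [hA]))

end Join

/-! ### Overlaying configurations, and the Cauchy product of labels. -/

section Star

/-- The Cauchy product of graded types. -/
abbrev Star (𝒜 ℬ : ℕ → Type) (k : ℕ) : Type := Σ p : anti k, 𝒜 p.1.1 × ℬ p.1.2

variable {𝒜 ℬ : ℕ → Type} [∀ i, DefType (𝒜 i)] [Unique (𝒜 0)] [∀ i, DefType (ℬ i)]
  [Unique (ℬ 0)] {M : Type} [DefType M] {n : ℕ} {N : Type*} [AddCommMonoid N]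

instance : Unique (Star 𝒜 ℬ 0) where
  default := ⟨⟨(0, 0), by simp⟩, default, default⟩
  uniq := by
    rintro ⟨⟨⟨a, b⟩, h⟩, x, y⟩
    obtain ⟨rfl, rfl⟩ : a = 0 ∧ b = 0 := by simpa using h
    rw [Subsingleton.elim x default, Subsingleton.elim y default]

/-- Pairs of labels are labels of the Cauchy product. -/
def starEquiv : (Σ i, 𝒜 i) × (Σ i, ℬ i) ≃ Σ k, Star 𝒜 ℬ k where
  toFun z := ⟨z.1.1 + z.2.1, ⟨(z.1.1, z.2.1), by simp⟩, z.1.2, z.2.2⟩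
  invFun l := (⟨l.2.1.1.1, l.2.2.1⟩, ⟨l.2.1.1.2, l.2.2.2⟩)
  left_inv _ := rfl
  right_inv := by
    rintro ⟨k, ⟨⟨a, b⟩, h⟩, x, y⟩
    obtain rfl : a + b = k := Finset.HasAntidiagonal.mem_antidiagonal.mp h
    rfl

/-- Overlay of two configurations. -/
def overlay (t : Pair 𝒜 ℬ M M n) : Conf (Star 𝒜 ℬ) M n :=
  ⟨fun x => starEquiv (t.2.1.1 x, t.2.2.1 x), by
    refine (t.2.1.2.1.union t.2.2.2.1).subset fun x hx => ?_
    by_contra hne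
    rw [Set.mem_union, not_or] at hne
    simp only [Function.mem_support, not_not] at hne
    exact hx (by simp [starEquiv, hne.1, hne.2]), by
    change ∑ᶠ x, ((t.2.1.1 x).1 + (t.2.2.1 x).1) = n
    rw [finsum_add_distrib t.2.1.2.1 t.2.2.2.1, t.2.1.2.2, t.2.2.2.2]
    exact Finset.HasAntidiagonal.mem_antidiagonal.mp t.1.2⟩

theorem overlay_bijective : (overlay (𝒜 := 𝒜) (ℬ := ℬ) (M := M) (n := n)).Bijective := by
  constructor
  · intro s t h
    have h (x : M) := Prod.ext_iff.mp (starEquiv.injective (congrFun (congrArg Subtype.val h) x))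
    exact pair_ext (funext fun x => (h x).1) (funext fun x => (h x).2)
  · intro f
    have hd (x : M) : (f.1 x).1 = (starEquiv.symm (f.1 x)).1.1 + (starEquiv.symm (f.1 x)).2.1 := by
      have hs (z : (Σ i, 𝒜 i) × (Σ i, ℬ i)) : (starEquiv z).1 = z.1.1 + z.2.1 := rfl
      exact (congrArg Sigma.fst (starEquiv.apply_symm_apply (f.1 x))).symm.trans (hs _)
    have h₁ : (Function.support fun x => (starEquiv.symm (f.1 x)).1.1).Finite :=
      f.2.1.subset fun x hx => by
        simp only [Function.mem_support] at hx ⊢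
        rw [hd]; omega
    have h₂ : (Function.support fun x => (starEquiv.symm (f.1 x)).2.1).Finite :=
      f.2.1.subset fun x hx => by
        simp only [Function.mem_support] at hx ⊢
        rw [hd]; omega
    refine ⟨⟨⟨(∑ᶠ x, (starEquiv.symm (f.1 x)).1.1, ∑ᶠ x, (starEquiv.symm (f.1 x)).2.1), ?_⟩,
      ⟨fun x => (starEquiv.symm (f.1 x)).1, h₁, rfl⟩,
      ⟨fun x => (starEquiv.symm (f.1 x)).2, h₂, rfl⟩⟩, ?_⟩
    · rw [Finset.HasAntidiagonal.mem_antidiagonal, ← finsum_add_distrib h₁ h₂]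
      simp only [← hd]
      exact f.2.2
    · exact Subtype.ext (funext fun x => starEquiv.apply_symm_apply (f.1 x))

/-- Pairs of labels of bounded degree. -/
def starLab (p : anti n) (z : Lab 𝒜 p.1.1 × Lab ℬ p.1.2) : Lab (Star 𝒜 ℬ) n :=
  ⟨⟨z.1.1 + z.2.1, by have := Finset.HasAntidiagonal.mem_antidiagonal.mp p.2; omega⟩,
    ⟨(z.1.1, z.2.1), by simp⟩, z.1.2, z.2.2⟩

theorem defMap_swap {S T U : Type} [DefType S] [DefType T] [DefType U] {f : S × T → U}
    (h : DefMap fun z : T × S => f (z.2, z.1)) : DefMap f :=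
  h.comp (DefMap.snd.prodMk DefMap.fst)

theorem defMap_sigma_prod_iff {J : Type} [Finite J] {S : J → Type} [∀ j, DefType (S j)]
    {T U : Type} [DefType T] [DefType U] {f : (Σ j, S j) × T → U}
    (h : ∀ j, DefMap (fun z : S j × T => f (⟨j, z.1⟩, z.2))) : DefMap f := by
  have : DefMap (fun z : Σ j, S j × T => f (⟨z.1, z.2.1⟩, z.2.2)) := defMap_sigma_iff.mpr h
  have hg : DefMap (fun z : Σ j, S j × T => ((⟨z.1, z.2.1⟩, z.2.2) : (Σ j, S j) × T)) :=
    defMap_sigma_iff.mpr fun j =>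
      ((Tracked.sigmaMk (S := S) j).defMap.comp DefMap.fst).prodMk DefMap.snd
  exact this.comp (hg.inv (g := fun z => ⟨z.1.1, z.1.2, z.2⟩) (fun _ => rfl) (fun _ => rfl))

theorem defMap_starLab (p : anti n) : DefMap (starLab (𝒜 := 𝒜) (ℬ := ℬ) p) := by
  refine defMap_sigma_prod_iff fun i => defMap_swap (defMap_sigma_prod_iff fun j => ?_)
  have hp := Finset.HasAntidiagonal.mem_antidiagonal.mp p.2
  refine (Tracked.sigmaMk (S := fun i : Fin (n + 1) => Star 𝒜 ℬ i)
    (⟨i + j, by omega⟩ : Fin (n + 1))).defMap.comp ((Tracked.sigmaMk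
      (S := fun q : anti ((i : ℕ) + j) => 𝒜 q.1.1 × ℬ q.1.2)
      ⟨(i, j), by simp⟩).defMap.comp (f := fun z : ℬ j × 𝒜 i => (z.2, z.1))
      (DefMap.snd.prodMk DefMap.fst))

theorem defMap_overlay : DefMap (overlay (𝒜 := 𝒜) (ℬ := ℬ) (M := M) (n := n)) :=
  defMap_sigma_iff.mpr fun p => defMap_of_ev
    (show DefMap fun z : (Conf 𝒜 M p.1.1 × Conf ℬ M p.1.2) × M =>
      starLab p (z.1.1.ev z.2, z.1.2.ev z.2) from
    (defMap_starLab p).comp ((defMap_ev' (DefMap.fst.comp DefMap.fst) DefMap.snd).prodMk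
      (defMap_ev' (DefMap.snd.comp DefMap.fst) DefMap.snd)))

theorem wt_overlay {w : M → N} {wA : ∀ i, 𝒜 i → N} {wB : ∀ i, ℬ i → N}
    (hA : wA 0 default = 0) (hB : wB 0 default = 0) (t : Pair 𝒜 ℬ M M n) :
    (overlay t).wt w (fun _ z => wA z.1.1.1 z.2.1 + wB z.1.1.2 z.2.2) = t.2.1.wt w wA + t.2.2.wt w wB := by
  refine Eq.trans (finsum_congr fun x => ?_) (finsum_add_distrib
    (t.2.1.finite_support (φ := fun x a => a.1 • w x + wA a.1 a.2) (by simp [hA]))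
    (t.2.2.finite_support (φ := fun x a => a.1 • w x + wB a.1 a.2) (by simp [hB])))
  change ((t.2.1.1 x).1 + (t.2.2.1 x).1) • w x + (_ + _) = _
  rw [add_smul, add_add_add_comm]
  rfl

end Star

/-! ### Symmetric powers and currying. -/

section Sym

/-- Trivial labels. -/
abbrev Pt : ℕ → Type := fun _ => Unit

instance {𝒜 : ℕ → Type} [Unique (𝒜 0)] {M : Type} : Unique (Conf 𝒜 M 0) where
  default := ⟨fun _ => ⟨0, default⟩, by simp, by simp⟩
  uniq f := Subtype.ext (funext fun x => label_eq_of_fst_eq_zero (Nat.le_zero.mp (by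
    by_cases h : (f.1 x).1 = 0
    · omega
    · conv_rhs => rw [← f.2.2, finsum_eq_sum _ f.2.1]
      exact Finset.single_le_sum (f := fun x => (f.1 x).1) (fun _ _ => Nat.zero_le _)
        (by simpa using h))))

/-- Symmetric powers, with degrees multiplied by `k`. -/
abbrev SymL (k : ℕ) (X : Type) (j : ℕ) : Type :=
  Σ m : {m : Fin (j + 1) // k * m = j}, Conf Pt X m

variable {M X : Type} [DefType M] [DefType X] {k : ℕ} [NeZero k] {j : ℕ} {N : Type*}
  [AddCommMonoid N]

instance : Unique (SymL k X 0) where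
  default := ⟨⟨0, by simp⟩, (default : Conf Pt X 0)⟩
  uniq := by
    rintro ⟨⟨⟨m, hm⟩, h⟩, f⟩
    obtain rfl : m = 0 := by omega
    exact congrArg (fun f : Conf Pt X 0 => (⟨⟨0, by simp⟩, f⟩ : SymL k X 0))
      (Subsingleton.elim (α := Conf Pt X 0) f default)

/-- The multiplicity function determines its total `m`, and this determines the degree `k * m`. -/
theorem symL_ext {X : Type} {a b : Σ j, SymL k X j} (h : ∀ y, (a.2.2.1 y).1 = (b.2.2.1 y).1) :
    a = b := by
  obtain ⟨i, ⟨⟨m, hm⟩, h₁⟩, f, hf⟩ := a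
  obtain ⟨i', ⟨⟨m', hm'⟩, h₁'⟩, f', hf'⟩ := b
  obtain rfl : f = f' := funext fun y => Sigma.ext (h y) (heq_of_eq rfl)
  obtain rfl : m = m' := hf.2.symm.trans hf'.2
  obtain rfl : k * m = i := h₁
  obtain rfl : k * m = i' := h₁'
  rfl

theorem finite_support_curry {m : ℕ} (f : Conf Pt (M × X) m) (x : M) :
    (Function.support fun y => (f.1 (x, y)).1).Finite :=
  f.2.1.preimage (Prod.mk_right_injective x).injOn

/-- The label of the curried configuration. -/
def curryLab (k : ℕ) [NeZero k] {m : ℕ} (f : Conf Pt (M × X) m) (x : M) : Σ j, SymL k X j :=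
  ⟨k * ∑ᶠ y, (f.1 (x, y)).1, ⟨⟨∑ᶠ y, (f.1 (x, y)).1, Nat.lt_succ_of_le
    (Nat.le_mul_of_pos_left _ (NeZero.pos k))⟩, rfl⟩, fun y => f.1 (x, y),
    finite_support_curry f x, rfl⟩

theorem finite_support_curryLab {m : ℕ} (f : Conf Pt (M × X) m) :
    (Function.support fun x => (curryLab k f x).1).Finite := by
  refine (f.2.1.image Prod.fst).subset fun x hx => ?_
  by_contra hne
  refine hx ?_
  have : (fun y => (f.1 (x, y)).1) = fun _ => 0 := funext fun y => by
    by_contra hy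
    exact hne ⟨(x, y), hy, rfl⟩
  simp [curryLab, this]

/-- A multiplicity function on a product as a configuration labelled by symmetric powers. -/
def curry (t : Σ m : {m : Fin (j + 1) // k * m = j}, Conf Pt (M × X) m) : Conf (SymL k X) M j :=
  ⟨curryLab k t.2, finite_support_curryLab t.2, by
    change ∑ᶠ x, k * ∑ᶠ y, (t.2.1 (x, y)).1 = j
    rw [← mul_finsum _ _, ← finsum_curry _ t.2.2.1, t.2.2.2]
    exact t.1.2⟩

/-- The inverse uncurries. Its finiteness of support uses `k ≠ 0`: a position whose label has degree
zero then carries no multiplicity. -/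
theorem curry_bijective : (curry (M := M) (X := X) (k := k) (j := j)).Bijective := by
  constructor
  · rintro ⟨⟨⟨m, hm⟩, h⟩, f, hf⟩ ⟨⟨⟨m', hm'⟩, h'⟩, f', hf'⟩ he
    obtain rfl : f = f' := by
      funext ⟨x, y⟩
      have := congrFun (congrArg Subtype.val he) x
      have h2 : ∀ a b : Σ j, SymL k X j, a = b → a.2.2.1 y = b.2.2.1 y := by rintro a _ rfl; rfl
      exact h2 _ _ this
    obtain rfl : m = m' := hf.2.symm.trans hf'.2
    rfl
  · intro g
    let f (z : M × X) : Σ _ : ℕ, Unit := (g.1 z.1).2.2.1 z.2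
    have hk : 0 < k := NeZero.pos k
    have hg (x : M) : k * ∑ᶠ y, (f (x, y)).1 = (g.1 x).1 := by
      change k * ∑ᶠ y, ((g.1 x).2.2.1 y).1 = _
      rw [(g.1 x).2.2.2.2]
      exact (g.1 x).2.1.2
    have hf : (Function.support fun z => (f z).1).Finite := by
      refine (g.2.1.biUnion (t := fun x => Prod.mk x '' (Function.support fun y => (f (x, y)).1))
        fun x _ => ((g.1 x).2.2.2.1).image _).subset ?_
      rintro ⟨x, y⟩ hz
      refine Set.mem_biUnion (x := x) ?_ ⟨y, hz, rfl⟩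
      intro h0
      have h0 : (g.1 x).1 = 0 := h0
      have h1 : ∑ᶠ y, (f (x, y)).1 = 0 := by
        have := hg x
        rw [h0] at this
        exact (Nat.mul_eq_zero.mp this).resolve_left hk.ne'
      rw [finsum_eq_sum _ (g.1 x).2.2.2.1] at h1
      exact hz (Finset.sum_eq_zero_iff.mp h1 y ((Set.Finite.mem_toFinset _).mpr hz))
    have hj : k * ∑ᶠ z, (f z).1 = j := by
      rw [finsum_curry _ hf, mul_finsum _ _]
      simp only [hg]
      exact g.2.2
    refine ⟨⟨⟨⟨∑ᶠ z, (f z).1, ?_⟩, hj⟩, f, hf, rfl⟩, Subtype.ext (funext fun x => ?_)⟩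
    · exact Nat.lt_succ_of_le (by conv_rhs => rw [← hj]
                                  exact Nat.le_mul_of_pos_left _ hk)
    · exact symL_ext fun y => rfl

theorem defMap_curry : DefMap (curry (M := M) (X := X) (k := k) (j := j)) := by
  refine defMap_sigma_iff.mpr fun m => defMap_of_ev ?_
  -- By `symL_ext`, a label is tested through its multiplicities at all points `y`, which keeps the
  -- infinite sum defining the degree out of the formula.
  have key (f : Conf Pt (M × X) m) (x : M) (l : Lab (SymL k X) j) :
      (curry (⟨m, f⟩ : Σ m : {m : Fin (j + 1) // k * m = j}, Conf Pt (M × X) m)).ev x = l ↔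
        ∀ y, ((f.ev (x, y)).1 : ℕ) = (l.2.2.ev y).1 := by
    rw [ev_eq_iff]
    constructor
    · intro h y
      have h2 : ∀ a b : Σ j, SymL k X j, a = b → (a.2.2.1 y).1 = (b.2.2.1 y).1 := by
        rintro a _ rfl; rfl
      exact h2 _ _ h
    · exact fun h => symL_ext fun y => h y
  simp only [key]
  refine IsDef.all (T := X) ?_
  have hd {a b : ℕ} : IsDef (fun z : Lab Pt a × Lab Pt b => (z.1.1 : ℕ) = z.2.1) := by
    refine isDef_sigma_prod_iff.mpr fun i => ?_
    have h2 : IsDef (fun z : Lab Pt b × Unit => (i : ℕ) = z.1.1) :=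
      isDef_sigma_prod_iff.mpr fun i' => IsDef.const ((i : ℕ) = i')
    exact h2.comp
      (f := fun z : Unit × Lab Pt b => (z.2, z.1)) (DefMap.snd.prodMk DefMap.fst)
  suffices H : IsDef (fun z : Lab (SymL k X) j × ((Conf Pt (M × X) m × M) × X) =>
      ((z.2.1.1.ev (z.2.1.2, z.2.2)).1 : ℕ) = (z.1.2.2.ev z.2.2).1) from
    H.comp (f := fun z : ((Conf Pt (M × X) m × M) × Lab (SymL k X) j) × X =>
      (z.1.2, (z.1.1, z.2))) ((DefMap.snd.comp DefMap.fst).prodMk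
        ((DefMap.fst.comp DefMap.fst).prodMk DefMap.snd))
  refine isDef_sigma_prod_iff.mpr fun i => isDef_sigma_prod_iff.mpr fun m' => ?_
  exact hd.comp (f := fun z : Conf Pt X m' × ((Conf Pt (M × X) m × M) × X) =>
      (z.2.1.1.ev (z.2.1.2, z.2.2), z.1.ev z.2.2))
    ((defMap_ev' (DefMap.fst.comp (DefMap.fst.comp DefMap.snd))
      ((DefMap.snd.comp (DefMap.fst.comp DefMap.snd)).prodMk
        (DefMap.snd.comp DefMap.snd))).prodMk
      (defMap_ev' DefMap.fst (DefMap.snd.comp DefMap.snd)))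

/-- A point `(x, y)` of multiplicity `d` contributes degree `k * d` to the label at `x`, so the
weight of `x` is counted `k` times. This is where the operation `k_*` on the exponent comes from. -/
theorem wt_curry {w : M → N} {w' : X → N}
    (t : Σ m : {m : Fin (j + 1) // k * m = j}, Conf Pt (M × X) m) :
    (curry t).wt w (fun _ z => z.2.wt w' fun _ _ => 0) =
      t.2.wt (fun z => k • w z.1 + w' z.2) fun _ _ => 0 := by
  change ∑ᶠ x, ((k * ∑ᶠ y, (t.2.1 (x, y)).1) • w x + ∑ᶠ y, ((t.2.1 (x, y)).1 • w' y + 0)) =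
    ∑ᶠ z, ((t.2.1 z).1 • (k • w z.1 + w' z.2) + 0)
  simp only [add_zero]
  have h0 {φ : M × X → N} : (Function.support fun z => (t.2.1 z).1 • φ z).Finite :=
    t.2.2.1.subset fun z hz h => hz (by
      have h : (t.2.1 z).1 = 0 := h
      simp [h])
  have h1 (x : M) {φ : X → N} : (Function.support fun y => (t.2.1 (x, y)).1 • φ y).Finite :=
    (finite_support_curry t.2 x).subset fun z hz h => hz (by
      have h : (t.2.1 (x, z)).1 = 0 := h
      simp [h])
  rw [finsum_curry _ h0]
  refine finsum_congr fun x => ?_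
  simp only [smul_add]
  rw [finsum_add_distrib (h1 x) (h1 x)]
  congr 1
  simp only [smul_smul, mul_comm _ k]
  rw [mul_finsum _ _, finsum_smul']
  exact (finite_support_curry t.2 x).subset fun y hy h => hy (by
    have h : (t.2.1 (x, y)).1 = 0 := h
    simp [h])

end Sym

end Conf

end MotivicPower

namespace MotivicPower

/-! ### Quotients by finite groups -/

open TopologicalSpace Opposite

theorem appLE_congr_hom {X Y : Scheme.{0}} {f g : X ⟶ Y} (h : f = g) {U : Y.Opens} {V : X.Opens}
    (e : V ≤ f ⁻¹ᵁ U) : f.appLE U V e = g.appLE U V (h ▸ e) := by subst h; rfl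

section Quotient

variable {G : Type} {Y B T : Scheme.{0}} {ρ : G → (Y ⟶ Y)} {π : Y ⟶ B}

theorem appLE_app_of_invariant {g : Y ⟶ Y} (hg : g ≫ π = π) (U : B.Opens)
    (e : π ⁻¹ᵁ U ≤ g ⁻¹ᵁ (π ⁻¹ᵁ U)) (b : Γ(B, U)) :
    g.appLE (π ⁻¹ᵁ U) (π ⁻¹ᵁ U) e (π.app U b) = π.app U b := by
  rw [← CommRingCat.comp_apply, Scheme.Hom.app_eq_appLE, Scheme.Hom.appLE_comp_appLE,
    appLE_congr_hom hg]

theorem IsQuotient.app_injective (h : IsQuotient ρ π) (U : B.Opens) :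
    Function.Injective (π.app U) := by
  intro b b' hb
  obtain ⟨c, -, hc⟩ := h.descend U (π.app U b) fun g e =>
    appLE_app_of_invariant (h.invariant g) U e b
  rw [hc b rfl, hc b' hb.symm]

/-- Surjectivity determines the map on points, and injectivity on sections determines the pullback
of functions. -/
theorem epi_of_app_injective (hs : Function.Surjective π)
    (hπ : ∀ U, Function.Injective (π.app U)) {u v : B ⟶ T} (h : π ≫ u = π ≫ v) : u = v := by
  have hb : u.base = v.base := by
    ext b
    obtain ⟨y, rfl⟩ := hs b
    exact congrArg (fun f : Y ⟶ T => f y) h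
  refine Scheme.Hom.ext hb fun U => ?_
  ext s
  refine hπ _ ?_
  have hle : v ⁻¹ᵁ U ≤ u ⁻¹ᵁ U := by
    intro x hx
    change u.base x ∈ U
    rw [hb]
    exact hx
  change (π.app (v ⁻¹ᵁ U)) ((u.app U ≫ B.presheaf.map (homOfLE hle).op) s) = _
  rw [← CommRingCat.comp_apply, ← CommRingCat.comp_apply]
  change (u.appLE U (v ⁻¹ᵁ U) hle ≫ π.app (v ⁻¹ᵁ U)) s = _
  rw [Scheme.Hom.app_eq_appLE, Scheme.Hom.app_eq_appLE, Scheme.Hom.appLE_comp_appLE,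
    Scheme.Hom.appLE_comp_appLE, appLE_congr_hom h]

/-- The map descends topologically because a finite surjection is a closed quotient map whose fibres
are the orbits. Functions descend because their pullbacks to `Y` are invariant, and injectivity on
sections makes the descended assignment a map of sheaves of rings. -/
theorem IsQuotient.exists_desc (h : IsQuotient ρ π) (f : Y ⟶ T) (hf : ∀ g, ρ g ≫ f = f) :
    ∃ k : B ⟶ T, π ≫ k = f := by
  have := h.finite
  have hq : Topology.IsQuotientMap π :=
    (IsClosedMap.isQuotientMap π.isClosedMap π.continuous h.surjective)
  have hfib (x y : Y) (hxy : π x = π y) : f x = f y := by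
    obtain ⟨g, rfl⟩ := h.orbit x y hxy
    conv_lhs => rw [← hf g]
    simp
  let β₀ : B → T := fun b => f (Function.surjInv h.surjective b)
  have hβ₀ (y : Y) : β₀ (π y) = f y := hfib _ _ (Function.surjInv_eq h.surjective _)
  have hcont : Continuous β₀ := by
    rw [hq.continuous_iff, show β₀ ∘ π = f from funext hβ₀]
    exact f.continuous
  let β : B.toTopCat ⟶ T.toTopCat := TopCat.ofHom ⟨β₀, hcont⟩
  have hle (U : T.Opens) : π ⁻¹ᵁ ((Opens.map β).obj U) ≤ f ⁻¹ᵁ U := fun y hy => by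
    change f y ∈ U
    rw [← hβ₀]
    exact hy
  have hex (U : T.Opens) (s : Γ(T, U)) : ∃ b : Γ(B, (Opens.map β).obj U),
      π.app _ b = f.appLE U _ (hle U) s := by
    obtain ⟨b, hb, -⟩ := h.descend ((Opens.map β).obj U) (f.appLE U _ (hle U) s) (by
      intro g e
      rw [← CommRingCat.comp_apply, Scheme.Hom.appLE_comp_appLE, appLE_congr_hom (hf g)])
    exact ⟨b, hb⟩
  choose c hc using hex
  let cU (U : T.Opens) : Γ(T, U) ⟶ Γ(B, (Opens.map β).obj U) := CommRingCat.ofHom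
    { toFun := c U
      map_one' := h.app_injective _ (by rw [hc, map_one, map_one])
      map_mul' := fun s t => h.app_injective _ (by rw [hc, map_mul, map_mul, hc, hc])
      map_zero' := h.app_injective _ (by rw [hc, map_zero, map_zero])
      map_add' := fun s t => h.app_injective _ (by rw [hc, map_add, map_add, hc, hc]) }
  have hcU (U : T.Opens) : cU U ≫ π.app _ = f.appLE U _ (hle U) := by
    ext s
    exact hc U s
  let F : B.toPresheafedSpace ⟶ T.toPresheafedSpace :=
    { base := β
      c :=
        { app := fun U => cU U.unop
          naturality := by
            intro U V i
            ext s
            refine h.app_injective ((Opens.map β).obj V.unop) ?_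
            change (T.presheaf.map i ≫ cU V.unop ≫ π.app _) s =
              (cU U.unop ≫ B.presheaf.map ((Opens.map β).map i.unop).op ≫ π.app _) s
            rw [hcU, Scheme.Hom.map_appLE, Scheme.Hom.app_eq_appLE, Scheme.Hom.map_appLE,
              ← Scheme.Hom.appLE_map (f := π) (U := (Opens.map β).obj U.unop)
              (V := π ⁻¹ᵁ (Opens.map β).obj U.unop) (V' := π ⁻¹ᵁ (Opens.map β).obj V.unop)
              le_rfl ((Opens.map π.base).map ((Opens.map β).map i.unop)).op,
              Scheme.Hom.appLE_eq_app, reassoc_of% (hcU U.unop), Scheme.Hom.appLE_map] } }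
  have hF : π.toLRSHom.toHom ≫ F = f.toLRSHom.toHom := by
    refine PresheafedSpace.ext _ _ ?_ ?_
    · ext y
      exact hβ₀ y
    · ext U s
      change (Y.presheaf.map _) ((cU U ≫ π.app _) s) = f.app U s
      rw [hcU, Scheme.Hom.app_eq_appLE, ← CommRingCat.comp_apply]
      have key (i : op (π ⁻¹ᵁ (Opens.map β).obj U) ⟶ op (f ⁻¹ᵁ U)) :
          (f.appLE U _ (hle U) ≫ Y.presheaf.map i) s = f.appLE U (f ⁻¹ᵁ U) le_rfl s := by
        rw [Scheme.Hom.appLE_map]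
      exact key _
  -- The stalk map of `f` factors through that of `F`; since the composite is local, so is its first
  -- factor.
  have hloc (x : B) : IsLocalHom (F.stalkMap x).hom := by
    obtain ⟨y, rfl⟩ := h.surjective x
    have h1 : ∀ k : Y.toPresheafedSpace ⟶ T.toPresheafedSpace, k = f.toLRSHom.toHom →
        IsLocalHom (PresheafedSpace.Hom.stalkMap k y).hom := by
      rintro k rfl
      exact f.toLRSHom.prop y
    have h2 : IsLocalHom ((PresheafedSpace.Hom.stalkMap π.toLRSHom.toHom y).hom.comp
        (PresheafedSpace.Hom.stalkMap F (π y)).hom) := by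
      have := h1 _ hF
      rw [PresheafedSpace.stalkMap.comp] at this
      exact this
    exact isLocalHom_of_comp _ (PresheafedSpace.Hom.stalkMap π.toLRSHom.toHom y).hom
  refine ⟨⟨⟨F, hloc⟩⟩, ?_⟩
  apply Scheme.Hom.ext'
  apply LocallyRingedSpace.Hom.ext'
  exact hF

/-- All conditions are local on the base: sections over an open `U` of `B'` and over its preimage in
`Y'` are identified with sections over the images of these sets in `B` and `Y`. -/
theorem IsQuotient.restrict (h : IsQuotient ρ π) {Y' B' : Scheme.{0}} {i : Y' ⟶ Y}
    {π' : Y' ⟶ B'} {j : B' ⟶ B} (hp : IsPullback i π' π j) [IsOpenImmersion j]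
    {ρ' : G → (Y' ⟶ Y')} (hρ : ∀ g, ρ' g ≫ i = i ≫ ρ g) : IsQuotient ρ' π' := by
  have := h.finite
  have hi : IsOpenImmersion i := MorphismProperty.of_isPullback hp.flip ‹IsOpenImmersion j›
  have hinv (g : G) : ρ' g ≫ π' = π' := by
    rw [← cancel_mono j, Category.assoc, ← hp.w, ← Category.assoc, hρ, Category.assoc,
      h.invariant]
  have hsurj : Surjective π' := MorphismProperty.of_isPullback hp ⟨h.surjective⟩
  have hcomm (y : Y') : π (i y) = j (π' y) := congrArg (fun f : Y' ⟶ B => f y) hp.w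
  refine ⟨MorphismProperty.of_isPullback hp h.finite, hsurj.surj, hinv, fun x y hxy => ?_,
    fun U s hs => ?_⟩
  · obtain ⟨g, hg⟩ := h.orbit (i x) (i y) (by rw [hcomm, hcomm, hxy])
    refine ⟨g, i.isOpenEmbedding.injective ?_⟩
    rw [← hg]
    exact congrArg (fun f : Y' ⟶ Y => f x) (hρ g)
  have himg : i ''ᵁ (π' ⁻¹ᵁ U) = π ⁻¹ᵁ (j ''ᵁ U) := by
    ext y
    constructor
    · rintro ⟨x, hx, rfl⟩
      exact ⟨π' x, hx, (hcomm x).symm⟩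
    · rintro ⟨b, hb, hy⟩
      obtain ⟨x, hx⟩ : y ∈ Set.range i := by
        obtain ⟨z, hz, -⟩ := Scheme.exists_preimage_of_isPullback hp y b hy.symm
        exact ⟨z, hz⟩
      refine ⟨x, ?_, hx⟩
      change π' x ∈ U
      rwa [j.isOpenEmbedding.injective ((hcomm x).symm.trans (by rw [hx]; exact hy.symm))]
  have hjU : U ≤ j ⁻¹ᵁ (j ''ᵁ U) := (Scheme.Hom.preimage_image_eq j U).ge
  have hiU : π' ⁻¹ᵁ U ≤ i ⁻¹ᵁ (π ⁻¹ᵁ (j ''ᵁ U)) := by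
    rw [← himg]
    exact (Scheme.Hom.preimage_image_eq i _).ge
  have bij_j : Function.Bijective (j.appLE (j ''ᵁ U) U hjU) := by
    rw [← Scheme.Hom.appIso_hom']
    exact (ConcreteCategory.bijective_of_isIso (j.appIso U).hom)
  have bij_i : Function.Bijective (i.appLE (π ⁻¹ᵁ (j ''ᵁ U)) (π' ⁻¹ᵁ U) hiU) := by
    have := ConcreteCategory.bijective_of_isIso (i.appIso (π' ⁻¹ᵁ U)).hom
    rw [Scheme.Hom.appIso_hom'] at this
    revert hiU
    rw [← himg]
    exact fun _ => this
  have hsq (b : Γ(B, j ''ᵁ U)) : π'.app U (j.appLE (j ''ᵁ U) U hjU b) =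
      i.appLE _ _ hiU (π.app (j ''ᵁ U) b) := by
    rw [← CommRingCat.comp_apply, ← CommRingCat.comp_apply, Scheme.Hom.app_eq_appLE,
      Scheme.Hom.app_eq_appLE, Scheme.Hom.appLE_comp_appLE, Scheme.Hom.appLE_comp_appLE,
      appLE_congr_hom hp.w]
  obtain ⟨s', rfl⟩ := bij_i.2 s
  have hst (g : G) : π' ⁻¹ᵁ U ≤ ρ' g ⁻¹ᵁ (π' ⁻¹ᵁ U) := by
    intro y hy
    change π' (ρ' g y) ∈ U
    have : π' (ρ' g y) = π' y := congrArg (fun f : Y' ⟶ B' => f y) (hinv g)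
    rw [this]
    exact hy
  obtain ⟨b, hb, hb'⟩ := h.descend (j ''ᵁ U) s' (by
    intro g e
    apply bij_i.1
    rw [← hs g (hst g), ← CommRingCat.comp_apply, ← CommRingCat.comp_apply,
      Scheme.Hom.appLE_comp_appLE, Scheme.Hom.appLE_comp_appLE, appLE_congr_hom (hρ g)])
  refine ⟨j.appLE (j ''ᵁ U) U hjU b, by dsimp only; rw [hsq, hb], fun c hc => ?_⟩
  obtain ⟨c, rfl⟩ := bij_j.2 c
  rw [hb' c]
  dsimp only at hc ⊢
  rw [hsq] at hc
  exact bij_i.1 hc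

/-! ### From invariant global functions to invariant functions over open sets. -/

section Affine

variable [IsAffine Y] [IsAffine B]

theorem exists_pow_mul_of_basicOpen {X : Scheme.{0}} [IsAffine X] (r : Γ(X, ⊤))
    {D : X.Opens} (hD : D = X.basicOpen r) (x : Γ(X, D)) :
    ∃ (n : ℕ) (y : Γ(X, ⊤)), X.presheaf.map (homOfLE le_top).op y =
      (X.presheaf.map (homOfLE (le_top : D ≤ ⊤)).op r) ^ n * x := by
  subst hD
  exact exists_eq_pow_mul_of_isAffineOpen X ⊤ (isAffineOpen_top X) r x

theorem exists_pow_mul_eq_zero {X : Scheme.{0}} [IsAffine X] (r : Γ(X, ⊤))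
    {D : X.Opens} (hD : D = X.basicOpen r) (x : Γ(X, ⊤))
    (h : X.presheaf.map (homOfLE (le_top : D ≤ ⊤)).op x = 0) : ∃ n : ℕ, r ^ n * x = 0 := by
  subst hD
  exact exists_pow_mul_eq_zero_of_res_basicOpen_eq_zero_of_isAffineOpen X (isAffineOpen_top X) x r h

theorem isUnit_res {X : Scheme.{0}} (r : Γ(X, ⊤)) :
    IsUnit (X.presheaf.map (homOfLE (le_top : X.basicOpen r ≤ ⊤)).op r) :=
  RingedSpace.isUnit_res_basicOpen X.toRingedSpace r

theorem app_res (π : Y ⟶ B) {U V : B.Opens} (i : U ≤ V) (b : Γ(B, V)) :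
    π.app U (B.presheaf.map (homOfLE i).op b) =
      Y.presheaf.map ((Opens.map π.base).map (homOfLE i)).op (π.app V b) :=
  congrArg (fun f => f.hom b) (π.naturality (homOfLE i).op)

/-- Localization of an injective ring map: denominators are cleared before global injectivity is
applied. -/
theorem app_injective_basicOpen (hinj : Function.Injective π.appTop) (r : Γ(B, ⊤)) :
    Function.Injective (π.app (B.basicOpen r)) := by
  rw [injective_iff_map_eq_zero]
  intro b hb
  have hD := Scheme.preimage_basicOpen_top π r
  obtain ⟨n, c, hc⟩ := exists_pow_mul_of_basicOpen r rfl b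
  have h1 := congrArg (π.app (B.basicOpen r)) hc
  rw [map_mul, hb, mul_zero, app_res] at h1
  obtain ⟨m, hm⟩ := exists_pow_mul_eq_zero (π.appTop r) hD (π.appTop c) h1
  rw [← map_pow, ← map_mul] at hm
  have hm : r ^ m * c = 0 := hinj (by rw [hm, map_zero])
  have h2 := congrArg (B.presheaf.map (homOfLE (le_top : B.basicOpen r ≤ ⊤)).op) hm
  rw [map_mul, map_pow, map_zero, hc, ← mul_assoc, ← pow_add] at h2
  exact ((isUnit_res r).pow _).mul_right_eq_zero.mp h2

theorem app_injective_of_appTop (hinj : Function.Injective π.appTop) (U : B.Opens) :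
    Function.Injective (π.app U) := by
  intro b b' hb
  refine B.IsSheaf.section_ext fun x hx => ?_
  obtain ⟨_, ⟨_, ⟨r, rfl⟩, rfl⟩, hxr, hr⟩ :=
    (isBasis_basicOpen B).exists_subset_of_mem_open hx U.2
  have hr' : B.basicOpen r ≤ U := hr
  refine ⟨B.basicOpen r, hr', hxr, app_injective_basicOpen hinj r ?_⟩
  exact (app_res π hr' b).trans ((congrArg _ hb).trans (app_res π hr' b').symm)

/-- Invariants commute with inverting the invariant function `r`. A numerator of `s` is invariant up
to powers of `r`; multiplied by a large power of `r` it is a global invariant, which descends and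
can be divided back. -/
theorem exists_app_eq_basicOpen [Finite G] (hρ : ∀ g, ρ g ≫ π = π)
    (hinv : ∀ s : Γ(Y, ⊤), (∀ g, (ρ g).appTop s = s) → ∃ b, π.appTop b = s)
    (r : Γ(B, ⊤)) (s : Γ(Y, π ⁻¹ᵁ (B.basicOpen r)))
    (hs : ∀ (g : G) (e : π ⁻¹ᵁ (B.basicOpen r) ≤ ρ g ⁻¹ᵁ (π ⁻¹ᵁ (B.basicOpen r))),
      (ρ g).appLE _ _ e s = s) : ∃ b, π.app (B.basicOpen r) b = s := by
  have hD := Scheme.preimage_basicOpen_top π r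
  obtain ⟨n, a, ha⟩ := exists_pow_mul_of_basicOpen (π.appTop r) hD s
  have hst (g : G) : π ⁻¹ᵁ (B.basicOpen r) ≤ ρ g ⁻¹ᵁ (π ⁻¹ᵁ (B.basicOpen r)) := by
    intro y hy
    change π (ρ g y) ∈ B.basicOpen r
    have : π (ρ g y) = π y := congrArg (fun f : Y ⟶ B => f y) (hρ g)
    rw [this]
    exact hy
  have hr (g : G) : (ρ g).appTop (π.appTop r) = π.appTop r := by
    rw [← CommRingCat.comp_apply, ← Scheme.Hom.comp_appTop, hρ]
  have hres (g : G) (x : Γ(Y, ⊤)) : Y.presheaf.map (homOfLE (le_top :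
      π ⁻¹ᵁ (B.basicOpen r) ≤ ⊤)).op ((ρ g).appTop x) =
      (ρ g).appLE _ _ (hst g) (Y.presheaf.map (homOfLE le_top).op x) := by
    rw [← CommRingCat.comp_apply, ← CommRingCat.comp_apply, Scheme.Hom.map_appLE]
    rfl
  have hz (g : G) : ∃ m, (π.appTop r) ^ m * ((ρ g).appTop a - a) = 0 := by
    refine exists_pow_mul_eq_zero _ hD _ ?_
    rw [map_sub, hres, ha, map_mul, map_pow, hs g, ← hres, hr, sub_self]
  choose m hm using hz
  -- One exponent works for every group element, by finiteness of the group.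
  obtain ⟨K, hK⟩ : ∃ K, ∀ g, m g ≤ K := by
    cases nonempty_fintype G
    exact ⟨Finset.univ.sup m, fun g => Finset.le_sup (Finset.mem_univ g)⟩
  obtain ⟨c, hc⟩ := hinv ((π.appTop r) ^ K * a) (by
    intro g
    rw [map_mul, map_pow, hr, ← sub_eq_zero, ← mul_sub, ← Nat.sub_add_cancel (hK g), pow_add,
      mul_assoc, hm, mul_zero])
  obtain ⟨v, hv⟩ := ((isUnit_res r).pow (K + n)).exists_left_inv
  refine ⟨v * B.presheaf.map (homOfLE le_top).op c, ?_⟩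
  have hc' : π.app (B.basicOpen r) (B.presheaf.map (homOfLE le_top).op c) =
      π.app (B.basicOpen r) ((B.presheaf.map (homOfLE le_top).op r) ^ (K + n)) * s := by
    rw [app_res]
    change Y.presheaf.map _ (π.appTop c) = _
    rw [hc, map_mul, map_pow, pow_add, map_mul, map_pow, map_pow, mul_assoc, app_res]
    congr 1
  rw [map_mul, hc', ← mul_assoc, ← map_mul, hv, map_one, one_mul]

/-- The descended functions on basic open sets glue, because injectivity on sections forces them to
agree on overlaps. -/
theorem exists_app_eq [Finite G] (hρ : ∀ g, ρ g ≫ π = π)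
    (hinj : Function.Injective π.appTop)
    (hinv : ∀ s : Γ(Y, ⊤), (∀ g, (ρ g).appTop s = s) → ∃ b, π.appTop b = s)
    (U : B.Opens) (s : Γ(Y, π ⁻¹ᵁ U))
    (hs : ∀ (g : G) (e : π ⁻¹ᵁ U ≤ ρ g ⁻¹ᵁ (π ⁻¹ᵁ U)), (ρ g).appLE _ _ e s = s) :
    ∃ b, π.app U b = s := by
  let J := {r : Γ(B, ⊤) // B.basicOpen r ≤ U}
  have hst (U : B.Opens) (g : G) : π ⁻¹ᵁ U ≤ ρ g ⁻¹ᵁ (π ⁻¹ᵁ U) := by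
    intro y hy
    change π (ρ g y) ∈ U
    have : π (ρ g y) = π y := congrArg (fun f : Y ⟶ B => f y) (hρ g)
    rw [this]
    exact hy
  have hloc (r : J) : ∃ b, π.app (B.basicOpen r.1) b =
      Y.presheaf.map ((Opens.map π.base).map (homOfLE r.2)).op s := by
    refine exists_app_eq_basicOpen hρ hinv r.1 _ fun g e => ?_
    conv_rhs => rw [← hs g (hst U g)]
    rw [← CommRingCat.comp_apply, ← CommRingCat.comp_apply, Scheme.Hom.map_appLE,
      Scheme.Hom.appLE_map]
  choose b hb using hloc
  have hcov : U ≤ ⨆ r : J, B.basicOpen r.1 := by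
    intro x hx
    obtain ⟨_, ⟨_, ⟨r, rfl⟩, rfl⟩, hxr, hr⟩ :=
      (isBasis_basicOpen B).exists_subset_of_mem_open hx U.2
    exact Opens.mem_iSup.mpr ⟨⟨r, hr⟩, hxr⟩
  obtain ⟨c, hc, -⟩ := B.sheaf.existsUnique_gluing' (fun r : J => B.basicOpen r.1) U
    (fun r => homOfLE r.2) hcov b (by
      intro r r'
      apply app_injective_of_appTop hinj
      change π.app _ (B.presheaf.map (homOfLE _).op _) = π.app _ (B.presheaf.map (homOfLE _).op _)
      rw [app_res, app_res, hb, hb, ← CommRingCat.comp_apply, ← CommRingCat.comp_apply,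
        ← Functor.map_comp, ← Functor.map_comp]
      rfl)
  refine ⟨c, Y.IsSheaf.section_ext fun y hy => ?_⟩
  obtain ⟨r, hr⟩ := Opens.mem_iSup.mp (hcov hy)
  refine ⟨π ⁻¹ᵁ (B.basicOpen r.1), fun z hz => r.2 hz, hr, ?_⟩
  have h1 := hb r
  rw [← hc r] at h1
  exact (app_res π r.2 c).symm.trans h1

end Affine

end Quotient

end MotivicPower

namespace MotivicPower

/-! ### Existence of quotients of affine varieties -/

open TopologicalSpace Opposite

/-- The ring is integral over its invariants, which gives surjectivity, and the group acts
transitively on the primes over a given one, which identifies the fibres with the orbits. -/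
theorem isQuotient_SpecMap {S R G : Type} [CommRing S] [CommRing R] [Algebra S R] [Group G]
    [Finite G] [MulSemiringAction G R] [SMulCommClass G S R] [Algebra.IsInvariant S R G]
    [Module.Finite S R] (hinj : Function.Injective (algebraMap S R)) :
    IsQuotient (fun g : G => Spec.map (CommRingCat.ofHom (MulSemiringAction.toRingHom G R g)))
      (Spec.map (CommRingCat.ofHom (algebraMap S R))) := by
  have hI : Algebra.IsIntegral S R := Algebra.IsInvariant.isIntegral S R G
  have hρ (g : G) : Spec.map (CommRingCat.ofHom (MulSemiringAction.toRingHom G R g)) ≫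
      Spec.map (CommRingCat.ofHom (algebraMap S R)) =
      Spec.map (CommRingCat.ofHom (algebraMap S R)) := by
    rw [← Spec.map_comp]
    congr 1
    ext s
    exact smul_algebraMap g s
  have htop (f : CommRingCat.of S ⟶ CommRingCat.of R) (b) :
      (Scheme.ΓSpecIso (.of R)).hom ((Spec.map f).appTop b) =
        f ((Scheme.ΓSpecIso (.of S)).hom b) :=
    congrArg (fun k => k.hom b) (Scheme.ΓSpecIso_naturality f)
  have htop' (f : CommRingCat.of R ⟶ CommRingCat.of R) (b) :
      (Scheme.ΓSpecIso (.of R)).hom ((Spec.map f).appTop b) =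
        f ((Scheme.ΓSpecIso (.of R)).hom b) :=
    congrArg (fun k => k.hom b) (Scheme.ΓSpecIso_naturality f)
  have bijS := ConcreteCategory.bijective_of_isIso (Scheme.ΓSpecIso (CommRingCat.of S)).hom
  have bijR := ConcreteCategory.bijective_of_isIso (Scheme.ΓSpecIso (CommRingCat.of R)).hom
  have hinj' : Function.Injective (Spec.map (CommRingCat.ofHom (algebraMap S R))).appTop := by
    intro b b' h
    have h1 := congrArg (Scheme.ΓSpecIso (.of R)).hom h
    rw [htop, htop] at h1
    exact bijS.1 (hinj h1)
  refine ⟨(IsFinite.SpecMap_iff _).mpr (RingHom.finite_algebraMap.mpr inferInstance),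
    (algebraMap_isIntegral_iff.mpr hI).comap_surjective hinj, hρ, fun x y hxy => ?_, fun U s hs => ?_⟩
  · have hx : (PrimeSpectrum.asIdeal x).IsPrime := PrimeSpectrum.isPrime x
    have hy : (PrimeSpectrum.asIdeal y).IsPrime := PrimeSpectrum.isPrime y
    obtain ⟨g, hg⟩ := Algebra.IsInvariant.exists_smul_of_under_eq S R G
      (PrimeSpectrum.asIdeal x) (PrimeSpectrum.asIdeal y)
      (congrArg PrimeSpectrum.asIdeal hxy)
    -- The inverse appears because `Spec.map` of the action of `g⁻¹` is the preimage of ideals under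
    -- `g⁻¹`, which is translation by `g`.
    refine ⟨g⁻¹, PrimeSpectrum.ext ?_⟩
    rw [hg]
    ext r
    rw [Ideal.mem_pointwise_smul_iff_inv_smul_mem]
    rfl
  · obtain ⟨b, hb⟩ := exists_app_eq hρ hinj' (fun s hs => by
      obtain ⟨a, ha⟩ := Algebra.IsInvariant.isInvariant (A := S) (G := G)
        ((Scheme.ΓSpecIso (.of R)).hom s) (fun g => by
          conv_rhs => rw [← hs g]
          rw [htop']
          rfl)
      obtain ⟨b, rfl⟩ := bijS.2 a
      exact ⟨b, bijR.1 ((htop _ _).trans ha)⟩) U s hs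
    exact ⟨b, hb, fun c hc => app_injective_of_appTop hinj' U (hc.trans hb.symm)⟩

/-- The quotient is the spectrum of the ring `S` of invariants of the coordinate ring `R`.
Integrality and finite type together make `R` a finite `S`-module. -/
theorem exists_affine_quotient (L : CSch) [IsVar L] [IsAffine L.left] {G : Type} [Group G]
    [Finite G] (ρ : G → (L ⟶ L)) (h1 : ρ 1 = 𝟙 L) (hmul : ∀ g h, ρ g ≫ ρ h = ρ (g * h)) :
    ∃ (B : CSch) (_ : IsVar B) (π : L ⟶ B), IsQuotient (fun g => (ρ g).left) π.left := by
  let K : CommRingCat := Γ(Spec (.of ℂ), ⊤)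
  let R : CommRingCat := Γ(L.left, ⊤)
  let φ : K ⟶ R := L.hom.appTop
  let act : MulSemiringAction G R :=
    { smul := fun g r => (ρ g).left.appTop r
      one_smul := fun r => by
        change (ρ 1).left.appTop r = r
        rw [h1]
        simp
      mul_smul := fun g h r => by
        change (ρ (g * h)).left.appTop r = (ρ g).left.appTop ((ρ h).left.appTop r)
        rw [← hmul, ← CommRingCat.comp_apply, ← Scheme.Hom.comp_appTop]
        rfl
      smul_zero := fun g => map_zero _
      smul_add := fun g => map_add _
      smul_one := fun g => map_one _
      smul_mul := fun g => map_mul _ }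
  have hsmul (g : G) (r : R) : g • r = (ρ g).left.appTop r := rfl
  let S := FixedPoints.subring R G
  have hφ (k : K) : φ k ∈ S := fun g => by
    rw [hsmul]
    change (L.hom.appTop ≫ (ρ g).left.appTop) k = _
    rw [← Scheme.Hom.comp_appTop, Over.w]
  let ψ : K →+* S := φ.hom.codRestrict S hφ
  let : Algebra K S := ψ.toAlgebra
  let : Algebra K R := φ.hom.toAlgebra
  have : IsScalarTower K S R := IsScalarTower.of_algebraMap_eq fun _ => rfl
  have : Algebra.IsInvariant S R G := ⟨fun b hb => ⟨⟨b, hb⟩, rfl⟩⟩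
  have : Algebra.IsIntegral S R := Algebra.IsInvariant.isIntegral S R G
  have : IsNoetherianRing K := by
    let e : (CommRingCat.of ℂ) ≃+* K := (Scheme.ΓSpecIso (.of ℂ)).symm.commRingCatIsoToRingEquiv
    have : IsNoetherianRing (CommRingCat.of ℂ) := inferInstanceAs (IsNoetherianRing ℂ)
    exact isNoetherianRing_of_ringEquiv _ e
  have hft : Algebra.FiniteType K R := by
    have : LocallyOfFiniteType L.hom := inferInstance
    rw [HasRingHomProperty.iff_of_isAffine (P := @LocallyOfFiniteType)] at this
    exact this
  have : Algebra.FiniteType S R := Algebra.FiniteType.of_restrictScalars_finiteType K S R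
  have : Module.Finite S R := Algebra.IsIntegral.finite
  have hS : Algebra.FiniteType K S :=
    -- The Artin–Tate lemma: `R` is of finite type over the Noetherian ring `K` and finite over `S`,
    -- so `S` is of finite type over `K`.
    ⟨fg_of_fg_of_fg K S R hft.out Module.Finite.fg_top Subtype.val_injective⟩
  have hq := isQuotient_SpecMap (S := S) (R := R) (G := G) Subtype.val_injective
  let p : L.left ⟶ Spec (.of S) := L.left.toSpecΓ ≫ Spec.map (CommRingCat.ofHom (algebraMap S R))
  let B : CSch := Over.mk (Spec.map (CommRingCat.ofHom ψ) ≫ (Spec (.of ℂ)).isoSpec.inv)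
  have hlft : LocallyOfFiniteType (Spec.map (CommRingCat.ofHom ψ)) := by
    rw [HasRingHomProperty.Spec_iff (P := @LocallyOfFiniteType)]
    exact hS
  have hB : IsVar B :=
    { lft := by
        change LocallyOfFiniteType (Spec.map (CommRingCat.ofHom ψ) ≫ (Spec (.of ℂ)).isoSpec.inv)
        infer_instance
      qc := by
        change QuasiCompact (Spec.map (CommRingCat.ofHom ψ) ≫ (Spec (.of ℂ)).isoSpec.inv)
        infer_instance
      sep := by
        change IsSeparated (Spec.map (CommRingCat.ofHom ψ) ≫ (Spec (.of ℂ)).isoSpec.inv)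
        infer_instance }
  have hp : p ≫ B.hom = L.hom := by
    change (L.left.toSpecΓ ≫ Spec.map (CommRingCat.ofHom (algebraMap S R))) ≫
      Spec.map (CommRingCat.ofHom ψ) ≫ (Spec (.of ℂ)).isoSpec.inv = L.hom
    rw [Category.assoc, ← Spec.map_comp_assoc]
    have : CommRingCat.ofHom ψ ≫ CommRingCat.ofHom (algebraMap S R) = L.hom.appTop := rfl
    rw [this, ← Scheme.toSpecΓ_naturality_assoc]
    simp [Scheme.isoSpec]
  refine ⟨B, hB, Over.homMk p hp, ?_⟩
  -- The quotient of the spectrum of global sections is transported along the isomorphism from `L`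
  -- to it, viewed as a pullback square over an identity.
  refine hq.restrict (i := L.left.toSpecΓ) (j := 𝟙 _) (π' := p)
    (IsPullback.of_horiz_isIso ⟨by simp [p]⟩) fun g => ?_
  exact Scheme.toSpecΓ_naturality _

/-- Factoring through an open immersion. -/
theorem exists_openLift {X Y Z : CSch} (j : Y ⟶ Z) [IsOpenImmersion j.left] (f : X ⟶ Z)
    (h : Set.range f.left ⊆ Set.range j.left) : ∃ k : X ⟶ Y, k ≫ j = f := by
  refine ⟨Over.homMk (IsOpenImmersion.lift j.left f.left h) ?_, ?_⟩
  · rw [← Over.w j, IsOpenImmersion.lift_fac_assoc, Over.w]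
  · ext1
    exact IsOpenImmersion.lift_fac _ _ _

/-! ### Existence of the quotients `B_α` for affine varieties. -/

section Config

variable {𝔐 : CSch} (A : ℕ → RelVar 𝔐) (M : RelVar 𝔐) {n : ℕ} (α : n.Partition)

instance : IsVar (labelled A M α) := by
  unfold labelled
  infer_instance

instance isAffine_tensor (X Y : CSch) [IsAffine X.left] [IsAffine Y.left] :
    IsAffine (X ⊗ Y).left :=
  inferInstanceAs (IsAffine (Limits.pullback X.hom Y.hom))

theorem isAffine_of_over_iso {X Y : CSch} [IsAffine X.left] (e : X ≅ Y) : IsAffine Y.left :=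
  have : IsIso e.inv.left := inferInstanceAs (IsIso ((Over.forget _).map e.inv))
  .of_isIso e.inv.left

open Limits in
theorem isAffine_pi {J : Type} [Finite J] (X : J → CSch) [∀ j, IsAffine (X j).left] :
    IsAffine (∏ᶜ X).left := by
  suffices H : ∀ (X : J → CSch) [HasProduct X] [∀ j, IsAffine (X j).left], IsAffine (∏ᶜ X).left
    from H X
  refine Finite.induction_empty_option (P := fun J => ∀ (X : J → CSch) [HasProduct X]
    [∀ j, IsAffine (X j).left], IsAffine (∏ᶜ X).left) ?_ ?_ ?_ J
  · intro α β e h X _ _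
    have : HasProduct fun a => X (e a) := hasProduct_of_equiv_of_iso X _ e fun _ => Iso.refl _
    have := h (fun a => X (e a))
    exact isAffine_of_over_iso (Pi.whiskerEquiv e (fun _ => Iso.refl _))
  · intro X _ _
    have : IsAffine (𝟙_ CSch).left := inferInstanceAs (IsAffine (Spec (.of ℂ)))
    exact isAffine_of_over_iso (X := 𝟙_ CSch)
      ⟨Pi.lift (fun j => j.elim), toUnit _, toUnit_unique _ _, Pi.hom_ext _ _ (fun j => j.elim)⟩
  · intro α _ h X _ _
    have := Fintype.finite ‹Fintype α›
    have := h (fun a => X (some a))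
    refine isAffine_of_over_iso (X := X none ⊗ ∏ᶜ fun a => X (some a))
      ⟨Pi.lift (fun o => match o with
        | none => CartesianMonoidalCategory.fst _ _
        | some a => CartesianMonoidalCategory.snd _ _ ≫ Pi.π _ a),
      lift (Pi.π _ none) (Pi.lift fun a => Pi.π _ (some a)), ?_, ?_⟩
    · ext1
      · simp
      · apply Pi.hom_ext; intro a; simp
    · apply Pi.hom_ext
      rintro (_ | a) <;> simp

/-- The action of `S_α` on the set of parts. -/
def permPart (g : SGroup α) (q : Parts α) : Parts α := ⟨q.1, g q.1 q.2⟩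

theorem permPart_injective (g : SGroup α) : Function.Injective (permPart α g) := by
  rintro ⟨i, a⟩ ⟨j, b⟩ h
  obtain ⟨h₁, h₂⟩ := Sigma.mk.inj_iff.mp h
  obtain rfl : i = j := h₁
  exact congrArg _ ((g i).injective (eq_of_heq h₂))

theorem permute_π (g : SGroup α) (q : Parts α) :
    permute A M α g ≫ Limits.Pi.π (fun q : Parts α => M.X ⊗ (A (q.1 + 1)).X) q =
      Limits.Pi.π (fun q : Parts α => M.X ⊗ (A (q.1 + 1)).X) (permPart α g q) :=
  Limits.Pi.lift_π _ _

theorem permute_position (g : SGroup α) (q : Parts α) :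
    permute A M α g ≫ position A M α q = position A M α (permPart α g q) :=
  (Category.assoc _ _ _).symm.trans (congrArg (· ≫ fst _ _) (permute_π A M α g q))

theorem permute_state (g : SGroup α) (q : Parts α) :
    permute A M α g ≫ state A M α q = state A M α (permPart α g q) :=
  (Category.assoc _ _ _).symm.trans (congrArg (· ≫ snd _ _) (permute_π A M α g q))

theorem permute_one : permute A M α 1 = 𝟙 _ :=
  Limits.Pi.hom_ext _ _ fun q => (permute_π A M α 1 q).trans (Category.id_comp _).symm

theorem permute_mul (g h : SGroup α) :
    permute A M α g ≫ permute A M α h = permute A M α (g * h) :=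
  Limits.Pi.hom_ext _ _ fun q => by
    refine (Category.assoc _ _ _).trans ?_
    refine (congrArg (permute A M α g ≫ ·) (permute_π A M α h q)).trans ?_
    exact (permute_π A M α g _).trans (permute_π A M α (g * h) q).symm

theorem permute_weight [AddMonObj 𝔐] [IsCommAddMonObj 𝔐] (g : SGroup α) :
    permute A M α g ≫ weight A M α = weight A M α := by
  have h (f : Parts α → (labelled A M α ⟶ 𝔐)) :
      permute A M α g ≫ ∑ q, f q = ∑ q, permute A M α g ≫ f q :=
    map_sum ({ toFun := fun k => permute A M α g ≫ k
               map_zero' := AddMonObj.comp_zero _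
               map_add' := fun a b => AddMonObj.comp_add _ a b } :
      (labelled A M α ⟶ 𝔐) →+ (labelled A M α ⟶ 𝔐)) f Finset.univ
  have hs (k : ℕ) (f : labelled A M α ⟶ 𝔐) : permute A M α g ≫ (k • f) =
      k • (permute A M α g ≫ f) :=
    map_nsmul ({ toFun := fun k => permute A M α g ≫ k
                 map_zero' := AddMonObj.comp_zero _
                 map_add' := fun a b => AddMonObj.comp_add _ a b } :
      (labelled A M α ⟶ 𝔐) →+ (labelled A M α ⟶ 𝔐)) k f
  rw [weight, h]
  refine Fintype.sum_bijective (permPart α g)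
    (Finite.injective_iff_bijective.mp (permPart_injective α g)) _ _ fun q => ?_
  rw [AddMonObj.comp_add, hs, ← Category.assoc, permute_position, ← Category.assoc, permute_state]
  rfl

theorem permute_mem_largeDiagonal {g : SGroup α} {x : (labelled A M α).left}
    (hx : x ∈ largeDiagonal A M α) : (permute A M α g).left x ∈ largeDiagonal A M α := by
  obtain ⟨q, r, hqr, h⟩ := hx
  have hinv (q : Parts α) : permPart α g (permPart α g⁻¹ q) = q :=
    congrArg (Sigma.mk q.1) ((g q.1).apply_symm_apply q.2)
  refine ⟨permPart α g⁻¹ q, permPart α g⁻¹ r,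
    fun h => hqr (permPart_injective α _ h), ?_⟩
  have : permute A M α g ≫ lift (position A M α (permPart α g⁻¹ q))
      (position A M α (permPart α g⁻¹ r)) = lift (position A M α q) (position A M α r) := by
    rw [comp_lift, permute_position, permute_position, hinv, hinv]
  have h2 : (lift (position A M α (permPart α g⁻¹ q))
      (position A M α (permPart α g⁻¹ r))).left ((permute A M α g).left x) =
      (lift (position A M α q) (position A M α r)).left x := by
    rw [← this]
    rfl
  rw [h2]
  exact h

theorem isClosed_largeDiagonal : IsClosed (largeDiagonal A M α) := by
  have hd : IsClosed (Set.range (lift (𝟙 M.X) (𝟙 M.X)).left) := by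
    have : IsClosedImmersion (lift (𝟙 M.X) (𝟙 M.X)).left :=
      inferInstanceAs (IsClosedImmersion (Limits.pullback.diagonal M.X.hom))
    exact (lift (𝟙 M.X) (𝟙 M.X)).left.isClosedEmbedding.isClosed_range
  have : largeDiagonal A M α = ⋃ (q : Parts α) (r : Parts α) (_ : q ≠ r),
      (lift (position A M α q) (position A M α r)).left ⁻¹'
        Set.range (lift (𝟙 M.X) (𝟙 M.X)).left := by
    ext x
    simp only [largeDiagonal, Set.mem_iUnion, Set.mem_preimage, exists_prop]
    rfl
  rw [this]
  exact isClosed_iUnion_of_finite fun q => isClosed_iUnion_of_finite fun r =>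
    isClosed_iUnion_of_finite fun _ => hd.preimage (Scheme.Hom.continuous _)

/-- The quotient is taken first on the whole affine product and then restricted to the open
complement of the image of the large diagonal. The weight, being symmetric, descends to it. -/
theorem nonempty_configQuotient [AddMonObj 𝔐] [IsCommAddMonObj 𝔐] [IsAffine M.X.left]
    [∀ i, IsAffine (A i).X.left] : Nonempty (ConfigQuotient A M α) := by
  have : IsAffine (labelled A M α).left := by
    unfold labelled
    exact isAffine_pi _
  obtain ⟨B₀, _, π, hπ⟩ := exists_affine_quotient (labelled A M α) (permute A M α)
    (permute_one A M α) (permute_mul A M α)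
  have := hπ.finite
  -- The image of the diagonal is closed because the quotient map is finite. Since the diagonal is
  -- stable under the group and fibres are orbits, the preimage of `V` is exactly the complement of
  -- the diagonal.
  let V : B₀.left.Opens := ⟨(π.left '' largeDiagonal A M α)ᶜ,
    (π.left.isClosedMap _ (isClosed_largeDiagonal A M α)).isOpen_compl⟩
  have hV : ((π.left ⁻¹ᵁ V : (labelled A M α).left.Opens) : Set _) = (largeDiagonal A M α)ᶜ := by
    ext y
    constructor
    · exact fun hy hy' => hy ⟨y, hy', rfl⟩
    · rintro hy ⟨z, hz, hzy⟩
      obtain ⟨g, rfl⟩ := hπ.orbit z y hzy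
      exact hy (permute_mem_largeDiagonal A M α hz)
  let Y := openSub (labelled A M α) (π.left ⁻¹ᵁ V)
  let i : Y ⟶ labelled A M α := openIncl _ _
  have hi : Set.range i.left = (largeDiagonal A M α)ᶜ := (range_openIncl _ _).trans hV
  have hact (g : SGroup α) : ∃ k : Y ⟶ Y, k ≫ i = i ≫ permute A M α g := by
    refine exists_openLift i _ ?_
    rw [hi]
    rintro _ ⟨y, rfl⟩ hy
    have h1 : i.left y ∈ (largeDiagonal A M α)ᶜ := by rw [← hi]; exact ⟨y, rfl⟩
    refine h1 ?_
    have := permute_mem_largeDiagonal A M α (g := g⁻¹) hy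
    have h2 : (permute A M α g⁻¹).left ((i ≫ permute A M α g).left y) = i.left y := by
      have : (i ≫ permute A M α g) ≫ permute A M α g⁻¹ = i := by
        rw [Category.assoc, permute_mul, mul_inv_cancel, permute_one, Category.comp_id]
      conv_rhs => rw [← this]
      simp
    rwa [h2] at this
  choose act hact using hact
  let B := openSub B₀ V
  let p : Y ⟶ B := Over.homMk (π.left ∣_ V) (by
    change (π.left ∣_ V) ≫ V.ι ≫ B₀.hom = (π.left ⁻¹ᵁ V).ι ≫ (labelled A M α).hom
    rw [morphismRestrict_ι_assoc, Over.w])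
  have hp : IsQuotient (fun g => (act g).left) p.left :=
    hπ.restrict (i := i.left) (j := V.ι) (isPullback_morphismRestrict π.left V).flip
      fun g => congrArg Over.Hom.left (hact g)
  obtain ⟨k, hk⟩ := hp.exists_desc (i ≫ weight A M α).left fun g => by
    have : act g ≫ i ≫ weight A M α = i ≫ weight A M α := by
      rw [← Category.assoc, hact, Category.assoc, permute_weight]
    exact congrArg Over.Hom.left this
  -- Descent gives only a morphism of schemes; that it lies over `ℂ` follows because the quotient
  -- map is an epimorphism.
  have hkw : k ≫ 𝔐.hom = B.hom := by
    refine epi_of_app_injective hp.surjective hp.app_injective ?_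
    rw [← Category.assoc, hk, Over.w, Over.w]
  exact ⟨{
    Y := Y
    incl := i
    incl_open := inferInstanceAs (IsOpenImmersion (openIncl _ _).left)
    incl_range := hi
    act := act
    act_comp := hact
    B := rel B (Over.homMk k hkw)
    proj := p
    quotient := hp
    weight_eq := by
      ext1
      exact hk }⟩

end Config

end MotivicPower

namespace MotivicPower

/-! ### The class of a space of configurations -/

/-! ### Tuples representing the same configuration. -/

section Rep

variable {𝒜 : ℕ → Type} [Unique (𝒜 0)] {M : Type} {n : ℕ} {f : M → Σ i, 𝒜 i}

/-- Every position of `t'` occurs in `t` with the same degree and label. The resulting maps of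
indices are injective self-maps of finite sets, hence permutations, one for each part size. -/
theorem Rep.exists_perm {α : n.Partition} {t t' : ∀ q : Parts α, M × 𝒜 (q.1 + 1)}
    (h : Rep ⟨α, t⟩ f) (h' : Rep ⟨α, t'⟩ f) :
    ∃ g : SGroup α, ∀ q, t' q = t (permPart α g q) := by
  have hex (i : Fin n) (a : Fin (α.parts.count ((i : ℕ) + 1))) : ∃ b, t' ⟨i, a⟩ = t ⟨i, b⟩ := by
    have h1 : f (t' ⟨i, a⟩).1 = ⟨(i : ℕ) + 1, (t' ⟨i, a⟩).2⟩ := h'.apply_eq ⟨i, a⟩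
    obtain ⟨⟨j, b⟩, hb⟩ := h.exists_of_ne (x := (t' ⟨i, a⟩).1) (by rw [h1]; simp)
    have hb : (t ⟨j, b⟩).1 = (t' ⟨i, a⟩).1 := hb
    have h2 : f (t ⟨j, b⟩).1 = ⟨(j : ℕ) + 1, (t ⟨j, b⟩).2⟩ := h.apply_eq ⟨j, b⟩
    rw [hb, h1] at h2
    obtain ⟨h3, h4⟩ := Sigma.mk.inj_iff.mp h2
    obtain rfl : i = j := Fin.ext (by omega)
    exact ⟨b, Prod.ext hb.symm (eq_of_heq h4)⟩
  choose sg hsg using hex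
  have hinj (i : Fin n) : Function.Injective (sg i) := by
    intro a a' haa
    have : (⟨i, a⟩ : Parts α) = ⟨i, a'⟩ := h'.inj (by
      change (t' ⟨i, a⟩).1 = (t' ⟨i, a'⟩).1
      rw [hsg, hsg, haa])
    exact eq_of_heq (Sigma.mk.inj_iff.mp this).2
  exact ⟨fun i => Equiv.ofBijective (sg i) (Finite.injective_iff_bijective.mp (hinj i)),
    fun q => hsg q.1 q.2⟩

theorem Rep.of_perm {α : n.Partition} {t : ∀ q : Parts α, M × 𝒜 (q.1 + 1)} (g : SGroup α)
    (h : Rep ⟨α, fun q => t (permPart α g q)⟩ f) : Rep ⟨α, t⟩ f := by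
  have hex (q : Parts α) : ∃ q', permPart α g q' = q :=
    ⟨permPart α g⁻¹ q, congrArg (Sigma.mk q.1) ((g q.1).apply_symm_apply q.2)⟩
  refine ⟨fun q r hqr => ?_, fun q => ?_, fun x hx => h.apply_fst x fun q => hx _⟩
  · obtain ⟨q, rfl⟩ := hex q
    obtain ⟨r, rfl⟩ := hex r
    rw [h.inj hqr]
  · obtain ⟨q, rfl⟩ := hex q
    exact h.apply_eq q

theorem Rep.count_le {t t' : Tup 𝒜 M n} (h : Rep t f) (h' : Rep t' f) (i : Fin n) :
    t.1.parts.count ((i : ℕ) + 1) ≤ t'.1.parts.count ((i : ℕ) + 1) := by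
  have hex (a : Fin (t.1.parts.count ((i : ℕ) + 1))) :
      ∃ b : Fin (t'.1.parts.count ((i : ℕ) + 1)), (t.2 ⟨i, a⟩).1 = (t'.2 ⟨i, b⟩).1 := by
    have h1 : f (t.2 ⟨i, a⟩).1 = ⟨(i : ℕ) + 1, (t.2 ⟨i, a⟩).2⟩ := h.apply_eq ⟨i, a⟩
    obtain ⟨⟨j, b⟩, hb⟩ := h'.exists_of_ne (x := (t.2 ⟨i, a⟩).1) (by rw [h1]; simp)
    have h2 : f (t'.2 ⟨j, b⟩).1 = ⟨(j : ℕ) + 1, (t'.2 ⟨j, b⟩).2⟩ := h'.apply_eq ⟨j, b⟩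
    rw [hb, h1] at h2
    obtain ⟨h3, h4⟩ := Sigma.mk.inj_iff.mp h2
    obtain rfl : i = j := Fin.ext (by omega)
    exact ⟨b, hb.symm⟩
  choose sg hsg using hex
  have hinj : Function.Injective sg := by
    intro a a' haa
    have : (⟨i, a⟩ : Parts t.1) = ⟨i, a'⟩ := h.inj (by
      change (t.2 ⟨i, a⟩).1 = (t.2 ⟨i, a'⟩).1
      rw [hsg, hsg, haa])
    exact eq_of_heq (Sigma.mk.inj_iff.mp this).2
  simpa using Fintype.card_le_of_injective sg hinj

/-- The multiplicity of each part size is bounded in both directions by `Rep.count_le`. -/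
theorem Rep.fst_eq {t t' : Tup 𝒜 M n} (h : Rep t f) (h' : Rep t' f) : t.1 = t'.1 := by
  refine Nat.Partition.ext (Multiset.ext.mpr fun k => ?_)
  by_cases hk : 1 ≤ k ∧ k ≤ n
  · have h1 := h.count_le h' ⟨k - 1, by omega⟩
    have h2 := h'.count_le h ⟨k - 1, by omega⟩
    have : k - 1 + 1 = k := by omega
    simp only [this] at h1 h2
    omega
  · have h0 (α : n.Partition) : α.parts.count k = 0 := Multiset.count_eq_zero.mpr fun hm =>
      hk ⟨α.parts_pos hm, Nat.Partition.le_of_mem_parts hm⟩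
    rw [h0, h0]

end Rep

/-- Precomposition with a morphism is additive. -/
def compHom {X Y 𝔐 : CSch} [AddMonObj 𝔐] [IsCommAddMonObj 𝔐] (f : X ⟶ Y) :
    (Y ⟶ 𝔐) →+ (X ⟶ 𝔐) where
  toFun k := f ≫ k
  map_zero' := AddMonObj.comp_zero _
  map_add' a b := AddMonObj.comp_add _ a b

/-! ### Complex points of the configuration quotients. -/

section Geometry

variable {𝔐 : CSch} (A : ℕ → RelVar 𝔐) (M : RelVar 𝔐) {n : ℕ} (α : n.Partition)

/-- The spaces of labels. -/
abbrev Labs (i : ℕ) : Type := pts (A i).X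

/-- The tuple of a point of the labelled configuration space. -/
def tupOf (z : pts (labelled A M α)) (q : Parts α) : pts M.X × Labs A (q.1 + 1) :=
  (z ≫ position A M α q, z ≫ state A M α q)

theorem tupOf_injective : Function.Injective (tupOf A M α) := by
  intro z z' h
  refine Limits.Pi.hom_ext _ _ fun q => ?_
  have h := congrFun h q
  refine CartesianMonoidalCategory.hom_ext _ _ ?_ ?_
  · exact (Category.assoc _ _ _).trans ((congrArg Prod.fst h).trans (Category.assoc _ _ _).symm)
  · exact (Category.assoc _ _ _).trans ((congrArg Prod.snd h).trans (Category.assoc _ _ _).symm)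

theorem tupOf_surjective (t : ∀ q : Parts α, pts M.X × Labs A (q.1 + 1)) :
    ∃ z, tupOf A M α z = t := by
  let z : pts (labelled A M α) := Limits.Pi.lift fun q => lift (t q).1 (t q).2
  have h (q : Parts α) : z ≫ Limits.Pi.π (fun q : Parts α => M.X ⊗ (A (q.1 + 1)).X) q =
      lift (t q).1 (t q).2 := Limits.Pi.lift_π _ _
  refine ⟨z, funext fun q => Prod.ext ?_ ?_⟩
  · exact (Category.assoc _ _ _).symm.trans
      ((congrArg (fun k => k ≫ fst M.X (A (q.1 + 1)).X) (h q)).trans (lift_fst _ _))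
  · exact (Category.assoc _ _ _).symm.trans
      ((congrArg (fun k => k ≫ snd M.X (A (q.1 + 1)).X) (h q)).trans (lift_snd _ _))

theorem tupOf_permute (z : pts (labelled A M α)) (g : SGroup α) (q : Parts α) :
    tupOf A M α (z ≫ permute A M α g) q = tupOf A M α z (permPart α g q) :=
  Prod.ext ((Category.assoc _ _ _).trans (congrArg (z ≫ ·) (permute_position A M α g q)))
    ((Category.assoc _ _ _).trans (congrArg (z ≫ ·) (permute_state A M α g q)))

theorem topPt_mem_largeDiagonal (z : pts (labelled A M α)) :
    topPt z ∈ largeDiagonal A M α ↔ ¬ Function.Injective fun q => (tupOf A M α z q).1 := by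
  have key (q r : Parts α) : (lift (position A M α q) (position A M α r)).left (topPt z) ∈
      Set.range (lift (𝟙 M.X) (𝟙 M.X)).left ↔ (tupOf A M α z q).1 = (tupOf A M α z r).1 := by
    rw [← topPt_comp, comp_lift]
    constructor
    · intro h
      obtain ⟨m, hm⟩ := exists_lift_of_mem_range (lift (𝟙 M.X) (𝟙 M.X)) h
      rw [comp_lift, Category.comp_id] at hm
      have h₁ := congrArg (· ≫ fst _ _) hm
      have h₂ := congrArg (· ≫ snd _ _) hm
      simp only [lift_fst, lift_snd] at h₁ h₂
      exact h₁.symm.trans h₂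
    · intro h
      have h : z ≫ position A M α q = z ≫ position A M α r := h
      refine ⟨topPt (z ≫ position A M α q), ?_⟩
      rw [← topPt_comp, comp_lift, Category.comp_id, h]
  simp only [Function.Injective, not_forall]
  constructor
  · rintro ⟨q, r, hqr, h⟩
    exact ⟨q, r, (key q r).mp h, hqr⟩
  · rintro ⟨q, r, h, hqr⟩
    exact ⟨q, r, hqr, (key q r).mpr h⟩

theorem defMap_tupOf : DefMap (tupOf A M α) :=
  DefMap.pi fun q => (Tracked.hom (position A M α q)).defMap.prodMk
    (Tracked.hom (state A M α q)).defMap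

variable [AddMonObj 𝔐] [IsCommAddMonObj 𝔐]

theorem comp_weight (z : pts (labelled A M α)) : z ≫ weight A M α =
    ∑ q : Parts α, (((q.1 : ℕ) + 1) • ((tupOf A M α z q).1 ≫ M.p) +
      (tupOf A M α z q).2 ≫ (A (q.1 + 1)).p) := by
  refine (map_sum (compHom (𝔐 := 𝔐) z) _ Finset.univ).trans (Finset.sum_congr rfl fun q _ => ?_)
  rw [map_add, map_nsmul]
  exact congrArg₂ (fun a b => ((q.1 : ℕ) + 1) • a + b)
    (Category.assoc z (position A M α q) M.p).symm
    (Category.assoc z (state A M α q) (A (q.1 + 1)).p).symm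

variable {A M}

section Conf

variable [Unique (Labs A 0)]

theorem isDef_rep : IsDef (fun z : (∀ q : Parts α, pts M.X × Labs A (q.1 + 1)) ×
    Conf (Labs A) (pts M.X) n => Rep ⟨α, z.1⟩ z.2.1) := by
  have h1 : IsDef (fun t : ∀ q : Parts α, pts M.X × Labs A (q.1 + 1) =>
      Function.Injective fun q => (t q).1) :=
    (Conf.isDef_inj (𝒜 := Labs A) (M := pts M.X) (n := n)).comp
      (Tracked.sigmaMk (S := fun α : n.Partition => ∀ q : Parts α, pts M.X × Labs A (q.1 + 1))
        α).defMap
  refine ((h1.comp DefMap.fst).and ((IsDef.iAll fun q : Parts α => IsDef.eq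
    (Conf.defMap_ev' DefMap.snd (DefMap.fst.comp ((DefMap.eval q).comp DefMap.fst)))
    ((Conf.defMap_tupLab q).comp DefMap.fst)).and (IsDef.all (T := pts M.X) (p := fun z x =>
      (∀ q : Parts α, ¬ (z.1 q).1 = x) → z.2.ev x = Conf.zeroLab)
    (IsDef.imp (IsDef.iAll fun q => (IsDef.eq (DefMap.fst.comp ((DefMap.eval q).comp
      (DefMap.fst.comp DefMap.fst))) DefMap.snd).not) (IsDef.eq (Conf.defMap_ev'
        (DefMap.snd.comp DefMap.fst) DefMap.snd) (DefMap.const _)))))).congr fun z => ?_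
  constructor
  · rintro ⟨h1, h2, h3⟩
    exact ⟨h1, fun q => Conf.ev_eq_iff.mp (h2 q), fun x hx =>
      congrArg Sigma.fst (Conf.ev_eq_iff.mp (h3 x hx))⟩
  · intro h
    exact ⟨h.inj, fun q => Conf.ev_eq_iff.mpr (h.apply_eq q), fun x hx =>
      Conf.ev_eq_iff.mpr (label_eq_of_fst_eq_zero (h.apply_fst x hx))⟩

/-- The total weight of a configuration with labels in varieties over `𝔐`. -/
def confWt (A : ℕ → RelVar 𝔐) (M : RelVar 𝔐) (f : Conf (Labs A) (pts M.X) n) : pts 𝔐 :=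
  f.wt (fun x => x ≫ M.p) (fun i a => a ≫ (A i).p)

/-- A complex point of `B_α` is an orbit of tuples with distinct positions, hence a configuration
whose nonzero degrees form `α`. Each configuration arises from exactly one `α` and one orbit, so the
`B_α` jointly parametrize configurations, with the correct weight. -/
theorem hasClass_conf (hA : ∀ a : Labs A 0, a ≫ (A 0).p = 0)
    (Q : ∀ α : n.Partition, ConfigQuotient A M α) :
    HasClass (Conf (Labs A) (pts M.X) n) (confWt A M) (∑ α, cls (Q α).B) := by
  have hY (α : n.Partition) : IsVar (Q α).Y :=
    have := (Q α).incl_open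
    IsVar.of_isOpenImmersion (Q α).incl
  have hinclY (α : n.Partition) : Function.Injective (Q α).incl.left :=
    have := (Q α).incl_open
    (Q α).incl.left.isOpenEmbedding.injective
  have hinj (α : n.Partition) (y : pts (Q α).Y) :
      Function.Injective fun q => (tupOf A M α (y ≫ (Q α).incl) q).1 := by
    by_contra h
    have h1 := (topPt_mem_largeDiagonal A M α _).mpr h
    have h2 : topPt (y ≫ (Q α).incl) ∈ (largeDiagonal A M α)ᶜ := by
      rw [← (Q α).incl_range, topPt_comp]
      exact ⟨_, rfl⟩
    exact h2 h1
  have hc (α : n.Partition) (y : pts (Q α).Y) : ∃ f : Conf (Labs A) (pts M.X) n,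
      Rep ⟨α, tupOf A M α (y ≫ (Q α).incl)⟩ f.1 := by
    obtain ⟨f, hf, -⟩ := Conf.exists_rep_iff (t := ⟨α, tupOf A M α (y ≫ (Q α).incl)⟩)
      (p := fun _ => True) |>.mpr ⟨hinj α y, fun _ _ => trivial⟩
    exact ⟨f, hf⟩
  choose c hc using hc
  have hs (α : n.Partition) (b : pts (Q α).B.X) : ∃ y : pts (Q α).Y, y ≫ (Q α).proj = b :=
    exists_lift_of_mem_range _ ((Q α).quotient.surjective _)
  choose s hs using hs
  -- The chosen lifts `s` are arbitrary. Two lifts of the same point differ by a permutation, so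
  -- they represent the same configuration.
  have hwd (α : n.Partition) (y y' : pts (Q α).Y) (h : y ≫ (Q α).proj = y' ≫ (Q α).proj) :
      c α y = c α y' := by
    obtain ⟨g, hg⟩ := (Q α).quotient.orbit (topPt y) (topPt y') (by
      rw [← topPt_comp, ← topPt_comp, h])
    have hg : y ≫ (Q α).act g = y' := topPt_inj (by rw [topPt_comp]; exact hg)
    have e : tupOf A M α (y' ≫ (Q α).incl) =
        fun q => tupOf A M α (y ≫ (Q α).incl) (permPart α g q) := funext fun q => by
      rw [← hg, Category.assoc, (Q α).act_comp, ← Category.assoc, tupOf_permute]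
    have h1 := hc α y'
    rw [e] at h1
    exact Subtype.ext (Rep.unique (hc α y) (h1.of_perm g))
  have hcs (α : n.Partition) (y : pts (Q α).Y) : c α (s α (y ≫ (Q α).proj)) = c α y :=
    hwd α _ _ (hs α _)
  refine ⟨n.Partition, inferInstance, fun α => (Q α).B, fun z => c z.1 (s z.1 z.2), ⟨?_, ?_⟩,
    ?_, ?_, rfl⟩
  · rintro ⟨α, b⟩ ⟨α', b'⟩ h
    have h : c α (s α b) = c α' (s α' b') := h
    have h1 := hc α (s α b)
    have h2 := hc α' (s α' b')
    rw [h] at h1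
    obtain rfl : α = α' := h1.fst_eq h2
    obtain ⟨g, hg⟩ := h1.exists_perm h2
    have : s α b' = s α b ≫ (Q α).act g := by
      refine pts_comp_injective (Q α).incl (hinclY α) (tupOf_injective A M α (funext fun q => ?_))
      rw [hg, Category.assoc, (Q α).act_comp, ← Category.assoc, tupOf_permute]
    congr 1
    rw [← hs α b, ← hs α b', this, Category.assoc]
    congr 1
    ext1
    exact ((Q α).quotient.invariant g).symm
  · intro f
    obtain ⟨⟨α, t⟩, ht⟩ := exists_tup f.2.1 f.2.2
    obtain ⟨z, rfl⟩ := tupOf_surjective A M α t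
    have hz : topPt z ∈ Set.range (Q α).incl.left := by
      rw [(Q α).incl_range, Set.mem_compl_iff, topPt_mem_largeDiagonal, not_not]
      exact ht.inj
    obtain ⟨y, rfl⟩ := exists_lift_of_mem_range _ hz
    refine ⟨⟨α, y ≫ (Q α).proj⟩, ?_⟩
    dsimp only
    rw [hcs]
    exact Subtype.ext ((hc α y).unique ht)
  · refine defMap_sigma_iff.mpr fun α => ?_
    -- The choice of lifts is not definable, but the graph is: some lift of the point represents the
    -- configuration.
    have h := IsDef.ex (S := pts (Q α).B.X × Conf (Labs A) (pts M.X) n) (T := pts (Q α).Y)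
      (p := fun z y => y ≫ (Q α).proj = z.1 ∧ Rep ⟨α, tupOf A M α (y ≫ (Q α).incl)⟩ z.2.1)
      ((IsDef.eq ((Tracked.hom (Q α).proj).defMap.comp DefMap.snd)
        (DefMap.fst.comp DefMap.fst)).and ((isDef_rep α).comp
        (((defMap_tupOf A M α).comp ((Tracked.hom (Q α).incl).defMap.comp DefMap.snd)).prodMk
          (DefMap.snd.comp DefMap.fst))))
    refine h.congr fun z => ?_
    constructor
    · rintro ⟨y, hy, hr⟩
      change c α (s α z.1) = z.2
      rw [← hy, hcs]
      exact Subtype.ext ((hc α y).unique hr)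
    · intro hz
      exact ⟨s α z.1, hs α z.1, by rw [← hz]; exact hc α _⟩
  · intro α b
    have h1 := (hc α (s α b)).finsum
      (fun x a => a.1 • (x ≫ M.p) + a.2 ≫ (A a.1).p) (fun x => by rw [zero_smul, zero_add, hA])
    refine h1.trans ?_
    conv_rhs => rw [← hs α b]
    rw [Category.assoc, (Q α).weight_eq, ← Category.assoc, comp_weight]

end Conf

end Geometry

end MotivicPower

namespace MotivicPower

/-! ### Affine models of weighted definable types -/

section AffineModel

variable {𝔐 : CSch}

/-- The disjoint union of finitely many affine varieties over `𝔐`. -/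
def sumVar {J : Type} [Finite J] (V : J → RelVar 𝔐) [∀ j, IsAffine (V j).X.left] : RelVar 𝔐 :=
  have : IsAffine (Over.mk (Limits.Sigma.desc fun j => (V j).X.hom)).left :=
    inferInstanceAs (IsAffine (∐ fun j => (V j).X.left))
  have : IsAffineHom (Over.mk (Limits.Sigma.desc fun j => (V j).X.hom)).hom :=
    inferInstanceAs (IsAffineHom (Limits.Sigma.desc fun j => (V j).X.hom))
  { X := Over.mk (Limits.Sigma.desc fun j => (V j).X.hom)
    p := Over.homMk (Limits.Sigma.desc fun j => (V j).p.left) (by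
      dsimp
      refine Limits.Sigma.hom_ext _ _ fun j => ?_
      simp)
    lft := haveI : IsZariskiLocalAtSource @LocallyOfFiniteType :=
        HasRingHomProperty.instIsZariskiLocalAtSource (Q := RingHom.FiniteType)
      IsZariskiLocalAtSource.sigmaDesc (P := @LocallyOfFiniteType) fun j => (V j).lft
    qc := inferInstance
    sep := inferInstance }

variable {J : Type} [Finite J] (V : J → RelVar 𝔐) [∀ j, IsAffine (V j).X.left]

instance : IsAffine (sumVar V).X.left := inferInstanceAs (IsAffine (∐ fun j => (V j).X.left))

/-- The inclusion of a summand. -/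
def sumVarIncl (j : J) : (V j).X ⟶ (sumVar V).X :=
  Over.homMk (Limits.Sigma.ι (fun j => (V j).X.left) j) (Limits.Sigma.ι_desc _ _)

theorem sumVarIncl_p (j : J) : sumVarIncl V j ≫ (sumVar V).p = (V j).p :=
  Over.OverMorphism.ext (Limits.Sigma.ι_desc _ _)

theorem sumVar_bijective :
    Function.Bijective fun z : Σ j, pts (V j).X => (z.2 ≫ sumVarIncl V z.1 : pts (sumVar V).X) := by
  constructor
  · rintro ⟨j, x⟩ ⟨k, y⟩ h
    have h' := congrArg topPt (show x ≫ sumVarIncl V j = y ≫ sumVarIncl V k from h)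
    rw [topPt_comp, topPt_comp] at h'
    have h' := (sigmaι_eq_iff (fun j => (V j).X.left) j k _ _).mp h'
    obtain ⟨rfl, h'⟩ := Sigma.mk.inj_iff.mp h'
    rw [topPt_inj (eq_of_heq h')]
  · intro x
    obtain ⟨⟨j, y⟩, hy⟩ := (sigmaMk (fun j => (V j).X.left)).surjective (topPt x)
    obtain ⟨z, hz⟩ := exists_lift_of_mem_range (sumVarIncl V j) (y := x)
      ⟨y, by rw [← hy, sigmaMk_mk]; rfl⟩
    exact ⟨⟨j, z⟩, hz⟩

/-- A variety is the disjoint union, on complex points, of finitely many affine varieties. -/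
theorem exists_affine_family (X : CSch) [IsVar X] :
    ∃ (I : Type) (_ : Fintype I) (T : I → CSch) (_ : ∀ i, IsVar (T i))
      (_ : ∀ i, IsAffine (T i).left) (f : ∀ i, T i ⟶ X),
      Function.Bijective fun z : Σ i, pts (T i) => (z.2 ≫ f z.1 : pts X) := by
  classical
  obtain ⟨n, U, hU, hcov⟩ : ∃ (n : ℕ) (U : Fin n → X.left.Opens), (∀ i, IsAffineOpen (U i)) ∧
      ∀ x, ∃ i, x ∈ U i := by
    let 𝒰 := X.left.affineCover.finiteSubcover
    have : Fintype 𝒰.I₀ := inferInstanceAs (Fintype (X.left.affineCover.finiteSubcover).I₀)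
    let e := Fintype.equivFin 𝒰.I₀
    refine ⟨Fintype.card 𝒰.I₀, fun i => (𝒰.f (e.symm i)).opensRange, fun i => ?_, fun x => ?_⟩
    · have : IsAffine (𝒰.X (e.symm i)) := by dsimp [𝒰]; infer_instance
      exact isAffineOpen_opensRange _
    · obtain ⟨i, y, hy⟩ := 𝒰.exists_eq x
      refine ⟨e i, ?_⟩
      change x ∈ (𝒰.f (e.symm (e i))).opensRange
      rw [e.symm_apply_apply]
      exact ⟨y, hy⟩
  -- From each affine open set the earlier ones are removed; what remains is closed in `U i`, hence
  -- affine.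
  let Z (i : Fin n) : TopologicalSpace.Closeds (openSub X (U i)).left :=
    ⟨(openIncl X (U i)).left ⁻¹' (⋃ j : {j // j < i}, (U j.1 : Set X.left))ᶜ,
      (isOpen_iUnion fun j : {j // j < i} => (U j.1).2).isClosed_compl.preimage
        (openIncl X (U i)).left.continuous⟩
  let f (i : Fin n) : closedSub _ (Z i) ⟶ X := closedIncl _ (Z i) ≫ openIncl X (U i)
  have hf (i : Fin n) : Set.range (f i).left = {x | x ∈ U i ∧ ∀ j < i, x ∉ U j} := by
    have h₁ : Set.range (openIncl X (U i)).left = U i := range_openIncl _ _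
    have h₂ : Set.range (closedIncl _ (Z i)).left = Z i := range_closedIncl _ _
    calc Set.range (f i).left = (openIncl X (U i)).left '' Set.range (closedIncl _ (Z i)).left := by
            rw [← Set.range_comp]; simp [f]
      _ = (⋃ j : {j // j < i}, (U j.1 : Set X.left))ᶜ ∩ U i := by
            rw [h₂, ← h₁, ← Set.image_preimage_eq_inter_range]; rfl
      _ = _ := by ext x; simp [and_comm]
  have hinj (i : Fin n) : Function.Injective (f i).left := by
    have := (openIncl X (U i)).left.isOpenEmbedding.injective.comp
      (closedIncl _ (Z i)).left.isClosedEmbedding.injective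
    simpa [f] using this
  have hmem (i : Fin n) (x : pts (closedSub _ (Z i))) :
      topPt (x ≫ f i) ∈ U i ∧ ∀ j < i, topPt (x ≫ f i) ∉ U j := by
    have : topPt (x ≫ f i) ∈ Set.range (f i).left := by rw [topPt_comp]; exact ⟨_, rfl⟩
    rwa [hf] at this
  refine ⟨Fin n, inferInstance, fun i => closedSub _ (Z i), inferInstance, fun i => ?_, f, ?_, ?_⟩
  · have : IsAffine (openSub X (U i)).left := hU i
    exact isAffine_of_isAffineHom (closedIncl _ (Z i)).left
  · rintro ⟨i, x⟩ ⟨j, y⟩ h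
    have h : x ≫ f i = y ≫ f j := h
    have h₁ := hmem i x
    have h₂ := hmem j y
    rw [← h] at h₂
    obtain rfl : i = j := by
      rcases lt_trichotomy i j with hij | hij | hij
      · exact absurd h₁.1 (h₂.2 i hij)
      · exact hij
      · exact absurd h₂.1 (h₁.2 j hij)
    congr 1
    exact pts_comp_injective (f i) (hinj i) h
  · intro x
    obtain ⟨i, hi, hmin⟩ := WellFounded.has_min (wellFounded_lt (α := Fin n))
      {i | topPt x ∈ U i} (hcov _)
    obtain ⟨y, hy⟩ := exists_lift_of_mem_range (f i) (y := x)
      (by rw [hf]; exact ⟨hi, fun j hj h => hmin j h hj⟩)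
    exact ⟨⟨i, y⟩, hy⟩

variable [AddMonObj 𝔐] [IsCommAddMonObj 𝔐]

/-- The weighted definable type `S` is in definable bijection with the points of `V`. -/
def Realizes (S : Type) [DefType S] (w : S → pts 𝔐) (V : RelVar 𝔐) : Prop :=
  ∃ g : pts V.X → S, g.Bijective ∧ DefMap g ∧ ∀ v, w (g v) = v ≫ V.p

variable {S : Type} [DefType S] {w : S → pts 𝔐} {x : K0 𝔐}

/-- Every presenting variety is cut into affine pieces, whose finite disjoint union is again affine.
A single affine model matters because the configuration quotients then exist. -/
theorem HasClass.exists_affine [LocallyOfFiniteType 𝔐.hom] [IsSeparated 𝔐.hom]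
    (h : HasClass S w x) :
    ∃ V : RelVar 𝔐, IsAffine V.X.left ∧ Realizes S w V := by
  obtain ⟨J, _, V, f, hf, hfd, hfw, -⟩ := h
  choose I hI T hT hTa t ht using fun j => exists_affine_family (V j).X
  let T' (i : Σ j, I j) : RelVar 𝔐 := rel (T i.1 i.2) (t i.1 i.2 ≫ (V i.1).p)
  have (i : Σ j, I j) : IsAffine (T' i).X.left := hTa i.1 i.2
  let e := Equiv.ofBijective _ (sumVar_bijective T')
  let k (z : Σ i, pts (T' i).X) : Σ j, pts (V j).X := ⟨z.1.1, z.2 ≫ t z.1.1 z.1.2⟩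
  have hk : k.Bijective := by
    constructor
    · rintro ⟨⟨j, i⟩, x⟩ ⟨⟨j', i'⟩, x'⟩ h
      obtain ⟨rfl, h⟩ := Sigma.mk.inj_iff.mp h
      obtain ⟨rfl, h⟩ := Sigma.mk.inj_iff.mp ((ht j).1 (a₁ := ⟨i, x⟩) (a₂ := ⟨i', x'⟩) (eq_of_heq h))
      rw [eq_of_heq h]
    · rintro ⟨j, x⟩
      obtain ⟨⟨i, y⟩, hy⟩ := (ht j).2 x
      exact ⟨⟨⟨j, i⟩, y⟩, congrArg (Sigma.mk j) hy⟩
  have he : DefMap e := defMap_sigma_iff.mpr fun j => (Tracked.hom (sumVarIncl T' j)).defMap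
  have hkd : DefMap k := defMap_sigma_iff.mpr fun i =>
    (((Tracked.sigmaMk (S := fun j => pts (V j).X) i.1).comp (Tracked.hom (t i.1 i.2)))).defMap
  refine ⟨sumVar T', inferInstance, fun v => f (k (e.symm v)), ?_, ?_, fun v => ?_⟩
  · exact hf.comp (hk.comp e.symm.bijective)
  · exact hfd.comp (hkd.comp he.symm)
  · obtain ⟨⟨i, u⟩, rfl⟩ := e.surjective v
    dsimp only
    rw [e.symm_apply_apply]
    change w (f ⟨i.1, _⟩) = (u ≫ sumVarIncl T' i) ≫ _
    rw [hfw, Category.assoc, sumVarIncl_p]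
    exact Category.assoc _ _ _

end AffineModel

end MotivicPower

namespace MotivicPower

/-! ### The semiring of weighted definable types -/

section Sum

open DefType

variable {S T U : Type} [DefType S] [DefType T] [DefType U]

instance : DefType (S ⊕ T) where
  I := DefType.I S ⊕ DefType.I T
  C := Sum.elim C C
  var := by rintro (i | i) <;> dsimp <;> infer_instance
  code i := match i with
    | .inl i => fun c s => ∃ t, s = .inl t ∧ code i c t
    | .inr i => fun c s => ∃ t, s = .inr t ∧ code i c t
  code_unique := by
    rintro (i | i) c s s' ⟨t, rfl, h⟩ ⟨t', rfl, h'⟩ <;> rw [code_unique h h']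
  code_surj := by
    rintro (s | s)
    · obtain ⟨i, c, h⟩ := code_surj s
      exact ⟨.inl i, c, s, rfl, h⟩
    · obtain ⟨i, c, h⟩ := code_surj s
      exact ⟨.inr i, c, s, rfl, h⟩
  code_ker := by
    rintro (i | i) (j | j)
    · refine Constr.of_iff (code_ker (S := S) i j) fun z => ⟨?_, ?_⟩
      · rintro ⟨s, h₁, h₂⟩
        exact ⟨.inl s, ⟨s, rfl, h₁⟩, s, rfl, h₂⟩
      · rintro ⟨s, ⟨t, rfl, h₁⟩, t', h, h₂⟩
        obtain rfl := Sum.inl_injective h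
        exact ⟨t, h₁, h₂⟩
    · refine Constr.of_iff Constr.empty fun z => ⟨fun h => h.elim, ?_⟩
      rintro ⟨s, ⟨t, rfl, h₁⟩, t', h, h₂⟩
      simp at h
    · refine Constr.of_iff Constr.empty fun z => ⟨fun h => h.elim, ?_⟩
      rintro ⟨s, ⟨t, rfl, h₁⟩, t', h, h₂⟩
      simp at h
    · refine Constr.of_iff (code_ker (S := T) i j) fun z => ⟨?_, ?_⟩
      · rintro ⟨s, h₁, h₂⟩
        exact ⟨.inr s, ⟨s, rfl, h₁⟩, s, rfl, h₂⟩
      · rintro ⟨s, ⟨t, rfl, h₁⟩, t', h, h₂⟩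
        obtain rfl := Sum.inr_injective h
        exact ⟨t, h₁, h₂⟩

theorem DefMap.inl : DefMap (Sum.inl : S → S ⊕ T) :=
  Tracked.defMap fun i => ⟨.inl i, 𝟙 _, fun c t h => ⟨t, rfl, (Category.comp_id c).symm ▸ h⟩⟩

theorem DefMap.inr : DefMap (Sum.inr : T → S ⊕ T) :=
  Tracked.defMap fun i => ⟨.inr i, 𝟙 _, fun c t h => ⟨t, rfl, (Category.comp_id c).symm ▸ h⟩⟩

theorem DefMap.sum {f : S ⊕ T → U} (h₁ : DefMap fun s => f (.inl s))
    (h₂ : DefMap fun t => f (.inr t)) : DefMap f := by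
  refine ((IsDef.ex (p := fun (z : (S ⊕ T) × U) s => .inl s = z.1 ∧ f (.inl s) = z.2) ?_).or
    (IsDef.ex (p := fun (z : (S ⊕ T) × U) s => .inr s = z.1 ∧ f (.inr s) = z.2) ?_)).congr ?_
  · exact (IsDef.eq (DefMap.inl.comp DefMap.snd) (DefMap.fst.comp DefMap.fst)).and
      (IsDef.eq (h₁.comp DefMap.snd) (DefMap.snd.comp DefMap.fst))
  · exact (IsDef.eq (DefMap.inr.comp DefMap.snd) (DefMap.fst.comp DefMap.fst)).and
      (IsDef.eq (h₂.comp DefMap.snd) (DefMap.snd.comp DefMap.fst))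
  · rintro ⟨s | s, u⟩ <;> simp

theorem DefMap.of_isEmpty [IsEmpty S] (f : S → T) : DefMap f :=
  (IsDef.const False).congr fun z => isEmptyElim z.1

end Sum

instance : DefType Empty where
  I := Empty
  C := Empty.elim
  var i := i.elim
  code i := i.elim
  code_unique {i} := i.elim
  code_surj i := i.elim
  code_ker i := i.elim

variable {𝔐 : CSch} [AddMonObj 𝔐] [IsCommAddMonObj 𝔐]

theorem HasClass.sum {S T : Type} [DefType S] [DefType T] {w : S → pts 𝔐} {w' : T → pts 𝔐}
    {x y : K0 𝔐} (hx : HasClass S w x) (hy : HasClass T w' y) :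
    HasClass (S ⊕ T) (Sum.elim w w') (x + y) := by
  obtain ⟨J, _, V, f, hf, hfd, hfw, rfl⟩ := hx
  obtain ⟨K, _, W, g, hg, hgd, hgw, rfl⟩ := hy
  refine ⟨J ⊕ K, inferInstance, Sum.elim V W, fun z => match z with
    | ⟨.inl j, v⟩ => .inl (f ⟨j, v⟩)
    | ⟨.inr j, v⟩ => .inr (g ⟨j, v⟩), ⟨?_, ?_⟩, ?_, ?_, ?_⟩
  · rintro ⟨j | j, v⟩ ⟨j' | j', v'⟩ h
    · obtain ⟨rfl, h⟩ := Sigma.mk.inj_iff.mp (hf.1 (Sum.inl_injective h))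
      obtain rfl := eq_of_heq h
      rfl
    · simp at h
    · simp at h
    · obtain ⟨rfl, h⟩ := Sigma.mk.inj_iff.mp (hg.1 (Sum.inr_injective h))
      obtain rfl := eq_of_heq h
      rfl
  · rintro (s | s)
    · obtain ⟨⟨j, v⟩, rfl⟩ := hf.2 s
      exact ⟨⟨.inl j, v⟩, rfl⟩
    · obtain ⟨⟨j, v⟩, rfl⟩ := hg.2 s
      exact ⟨⟨.inr j, v⟩, rfl⟩
  · refine defMap_sigma_iff.mpr ?_
    rintro (j | j)
    · exact DefMap.inl.comp (defMap_sigma_iff.mp hfd j)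
    · exact DefMap.inr.comp (defMap_sigma_iff.mp hgd j)
  · rintro (j | j) v
    · exact hfw j v
    · exact hgw j v
  · simp

variable (𝔐) in
/-- Definable types with a weight in the complex points of `𝔐`, which have a class. -/
structure WT where
  carrier : Type
  [defType : DefType carrier]
  w : carrier → pts 𝔐
  hasClass : ∃ x, HasClass carrier w x

attribute [instance] WT.defType

namespace WT

/-- Weight preserving definable bijections. -/
def Iso (S T : WT 𝔐) : Prop :=
  ∃ g : S.carrier → T.carrier, g.Bijective ∧ DefMap g ∧ ∀ s, T.w (g s) = S.w s

instance : Setoid (WT 𝔐) where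
  r := Iso
  iseqv :=
    { refl := fun S => ⟨_, Function.bijective_id, DefMap.id, fun _ => rfl⟩
      symm := fun {S T} ⟨g, h, hd, hw⟩ =>
        ⟨(Equiv.ofBijective g h).symm, (Equiv.ofBijective g h).symm.bijective,
          DefMap.symm (e := Equiv.ofBijective g h) hd, fun t => by
            obtain ⟨s, rfl⟩ := (Equiv.ofBijective g h).surjective t
            rw [Equiv.symm_apply_apply]
            exact (hw s).symm⟩
      trans := fun {S T U} ⟨g, h, hd, hw⟩ ⟨g', h', hd', hw'⟩ =>
        ⟨g' ∘ g, h'.comp h, hd'.comp hd, fun s => by simp [hw', hw]⟩ }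

theorem iso_of_equiv {S T : WT 𝔐} (e : S.carrier ≃ T.carrier) (hd : DefMap e)
    (hw : ∀ s, T.w (e s) = S.w s) : S ≈ T := ⟨e, e.bijective, hd, hw⟩

/-- The disjoint union. -/
def sum (S T : WT 𝔐) : WT 𝔐 where
  carrier := S.carrier ⊕ T.carrier
  w := Sum.elim S.w T.w
  hasClass := ⟨_, S.hasClass.choose_spec.sum T.hasClass.choose_spec⟩

/-- The product. -/
def prod (S T : WT 𝔐) : WT 𝔐 where
  carrier := S.carrier × T.carrier
  w z := S.w z.1 + T.w z.2
  hasClass := ⟨_, S.hasClass.choose_spec.prod T.hasClass.choose_spec⟩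

variable (𝔐) in
/-- The empty type. -/
def empty : WT 𝔐 where
  carrier := Empty
  w := Empty.elim
  hasClass := ⟨0, HasClass.of_isEmpty⟩

variable (𝔐) in
/-- The type with one element of weight zero. -/
def unit : WT 𝔐 where
  carrier := Unit
  w _ := 0
  hasClass := ⟨1, HasClass.of_unique fun _ => rfl⟩

/-- The disjoint union of a finite family. -/
def sigma {J : Type} [Fintype J] (S : J → WT 𝔐) : WT 𝔐 where
  carrier := Σ j, (S j).carrier
  w z := (S z.1).w z.2
  hasClass := ⟨_, HasClass.sigma fun j => (S j).hasClass.choose_spec⟩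

/-- The complex points of a variety over `𝔐`. -/
def ofVar (V : RelVar 𝔐) : WT 𝔐 where
  carrier := pts V.X
  w v := v ≫ V.p
  hasClass := ⟨_, HasClass.relVar V⟩

theorem _root_.MotivicPower.HasClass.push {S : Type} [DefType S] {w : S → pts 𝔐} {x : K0 𝔐}
    (h : HasClass S w x) (k : ℕ) : ∃ y, HasClass S (fun s => k • w s) y := by
  obtain ⟨J, _, V, f, hf, hfd, hfw, -⟩ := h
  refine ⟨_, J, inferInstance, fun j => (V j).push k, f, hf, hfd, fun j v => ?_, rfl⟩
  exact (congrArg (k • ·) (hfw j v)).trans ((compHom v).map_nsmul k (V j).p).symm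

/-- Multiplication of the weight by `k`. -/
def push (k : ℕ) (S : WT 𝔐) : WT 𝔐 where
  carrier := S.carrier
  w s := k • S.w s
  hasClass := S.hasClass.choose_spec.push k

theorem sum_congr {S S' T T' : WT 𝔐} (h : S ≈ S') (h' : T ≈ T') : S.sum T ≈ S'.sum T' := by
  obtain ⟨g, hg, hd, hw⟩ := h
  obtain ⟨g', hg', hd', hw'⟩ := h'
  refine iso_of_equiv (Equiv.sumCongr (Equiv.ofBijective g hg) (Equiv.ofBijective g' hg'))
    (DefMap.sum (DefMap.inl.comp hd) (DefMap.inr.comp hd')) ?_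
  rintro (s | s)
  · exact hw s
  · exact hw' s

theorem prod_congr {S S' T T' : WT 𝔐} (h : S ≈ S') (h' : T ≈ T') : S.prod T ≈ S'.prod T' := by
  obtain ⟨g, hg, hd, hw⟩ := h
  obtain ⟨g', hg', hd', hw'⟩ := h'
  exact iso_of_equiv (Equiv.prodCongr (Equiv.ofBijective g hg) (Equiv.ofBijective g' hg'))
    ((hd.comp DefMap.fst).prodMk (hd'.comp DefMap.snd))
    fun s => congrArg₂ (· + ·) (hw s.1) (hw' s.2)

theorem push_congr {S T : WT 𝔐} (k : ℕ) (h : S ≈ T) : S.push k ≈ T.push k := by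
  obtain ⟨g, hg, hd, hw⟩ := h
  exact ⟨g, hg, hd, fun s => congrArg (k • ·) (hw s)⟩

theorem sigma_congr {J : Type} [Fintype J] {S T : J → WT 𝔐} (h : ∀ j, S j ≈ T j) :
    sigma S ≈ sigma T := by
  choose g hg hd hw using h
  exact iso_of_equiv (Equiv.sigmaCongrRight fun j => Equiv.ofBijective _ (hg j))
    (defMap_sigma_iff.mpr fun j =>
      (Tracked.sigmaMk (S := fun j => (T j).carrier) j).defMap.comp (hd j))
    fun s => hw s.1 s.2

end WT

variable (𝔐) in
/-- The semiring of weighted definable types up to definable bijection. -/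
def SK : Type 1 := _root_.Quotient (inferInstance : Setoid (WT 𝔐))

/-- The effective class of a weighted definable type. -/
def ecl (S : WT 𝔐) : SK 𝔐 := Quotient.mk _ S

theorem ecl_eq_iff {S T : WT 𝔐} : ecl S = ecl T ↔ S ≈ T := Quotient.eq

theorem ecl_eq {S T : WT 𝔐} (e : S.carrier ≃ T.carrier) (hd : DefMap e)
    (hw : ∀ s, T.w (e s) = S.w s) : ecl S = ecl T := Quotient.sound (WT.iso_of_equiv e hd hw)

namespace SK

instance : Add (SK 𝔐) := ⟨Quotient.map₂ WT.sum fun _ _ h _ _ h' => WT.sum_congr h h'⟩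
instance : Mul (SK 𝔐) := ⟨Quotient.map₂ WT.prod fun _ _ h _ _ h' => WT.prod_congr h h'⟩
instance : Zero (SK 𝔐) := ⟨ecl (WT.empty 𝔐)⟩
instance : One (SK 𝔐) := ⟨ecl (WT.unit 𝔐)⟩

protected theorem add_comm' (a b : SK 𝔐) : a + b = b + a := by
  obtain ⟨S⟩ := a
  obtain ⟨T⟩ := b
  refine ecl_eq (Equiv.sumComm _ _) (DefMap.sum DefMap.inr DefMap.inl) ?_
  rintro (s | s) <;> rfl

protected theorem add_assoc' (a b c : SK 𝔐) : a + b + c = a + (b + c) := by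
  obtain ⟨S⟩ := a
  obtain ⟨T⟩ := b
  obtain ⟨U⟩ := c
  refine ecl_eq (Equiv.sumAssoc _ _ _) (DefMap.sum (DefMap.sum DefMap.inl
    (DefMap.inr.comp DefMap.inl)) (DefMap.inr.comp DefMap.inr)) ?_
  rintro ((s | s) | s) <;> rfl

protected theorem zero_add' (a : SK 𝔐) : 0 + a = a := by
  obtain ⟨S⟩ := a
  refine (ecl_eq (Equiv.emptySum Empty S.carrier).symm DefMap.inr fun s => rfl).symm

protected theorem mul_comm' (a b : SK 𝔐) : a * b = b * a := by
  obtain ⟨S⟩ := a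
  obtain ⟨T⟩ := b
  exact ecl_eq (Equiv.prodComm _ _) (DefMap.snd.prodMk DefMap.fst) fun s => add_comm _ _

protected theorem mul_assoc' (a b c : SK 𝔐) : a * b * c = a * (b * c) := by
  obtain ⟨S⟩ := a
  obtain ⟨T⟩ := b
  obtain ⟨U⟩ := c
  exact ecl_eq (Equiv.prodAssoc _ _ _) ((DefMap.fst.comp DefMap.fst).prodMk
    ((DefMap.snd.comp DefMap.fst).prodMk DefMap.snd)) fun s => (add_assoc _ _ _).symm

protected theorem one_mul' (a : SK 𝔐) : 1 * a = a := by
  obtain ⟨S⟩ := a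
  exact ecl_eq (Equiv.punitProd _) DefMap.snd fun s => (zero_add _).symm

protected theorem zero_mul' (a : SK 𝔐) : 0 * a = 0 := by
  obtain ⟨S⟩ := a
  have : IsEmpty ((WT.empty 𝔐).prod S).carrier := inferInstanceAs (IsEmpty (Empty × S.carrier))
  exact ecl_eq (T := WT.empty 𝔐) (Equiv.equivOfIsEmpty _ Empty) (DefMap.of_isEmpty _)
    fun s => isEmptyElim s

protected theorem mul_add' (a b c : SK 𝔐) : a * (b + c) = a * b + a * c := by
  obtain ⟨S⟩ := a
  obtain ⟨T⟩ := b
  obtain ⟨U⟩ := c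
  refine (ecl_eq (Equiv.prodSumDistrib _ _ _).symm (DefMap.sum
    (DefMap.fst.prodMk (DefMap.inl.comp DefMap.snd))
    (DefMap.fst.prodMk (DefMap.inr.comp DefMap.snd))) ?_).symm
  rintro (s | s) <;> rfl

instance : CommSemiring (SK 𝔐) where
  add_assoc := SK.add_assoc'
  zero_add := SK.zero_add'
  add_zero a := (SK.add_comm' a 0).trans (SK.zero_add' a)
  add_comm := SK.add_comm'
  nsmul := nsmulRec
  mul_assoc := SK.mul_assoc'
  one_mul := SK.one_mul'
  mul_one a := (SK.mul_comm' a 1).trans (SK.one_mul' a)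
  mul_comm := SK.mul_comm'
  zero_mul := SK.zero_mul'
  mul_zero a := (SK.mul_comm' a 0).trans (SK.zero_mul' a)
  left_distrib := SK.mul_add'
  right_distrib a b c := by
    rw [SK.mul_comm', SK.mul_add', SK.mul_comm' c a, SK.mul_comm' c b]

end SK

theorem ecl_sum (S T : WT 𝔐) : ecl (S.sum T) = ecl S + ecl T := rfl
theorem ecl_prod (S T : WT 𝔐) : ecl (S.prod T) = ecl S * ecl T := rfl
theorem ecl_unit : ecl (WT.unit 𝔐) = 1 := rfl
theorem ecl_empty : ecl (WT.empty 𝔐) = 0 := rfl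

theorem ecl_eq_zero (S : WT 𝔐) [IsEmpty S.carrier] : ecl S = 0 :=
  ecl_eq (Equiv.equivOfIsEmpty _ Empty) (DefMap.of_isEmpty _) fun s => isEmptyElim s

theorem ecl_eq_one (S : WT 𝔐) [Unique S.carrier] (h : S.w default = 0) : ecl S = 1 :=
  ecl_eq (Equiv.ofUnique _ Unit) (DefMap.const _) fun s => by
    rw [Unique.eq_default s, h]; rfl

theorem ecl_sigma {J : Type} [Fintype J] (S : J → WT 𝔐) :
    ecl (WT.sigma S) = ∑ j, ecl (S j) := by
  classical
  suffices H : ∀ (J : Type) [Finite J], ∀ (_ : Fintype J) (S : J → WT 𝔐),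
    ecl (WT.sigma S) = ∑ j, ecl (S j) from H J _ S
  intro J _
  refine Finite.induction_empty_option
    (P := fun J => ∀ (_ : Fintype J) (S : J → WT 𝔐), ecl (WT.sigma S) = ∑ j, ecl (S j)) ?_ ?_ ?_ J
  · intro α β e h _ S
    have : Fintype α := Fintype.ofEquiv β e.symm
    rw [← Equiv.sum_comp e, ← h]
    exact (ecl_eq (S := WT.sigma fun a => S (e a)) (T := WT.sigma S)
      (Equiv.sigmaCongrLeft (β := fun b => (S b).carrier) e)
      (defMap_sigma_iff.mpr fun a =>
        (Tracked.sigmaMk (S := fun b => (S b).carrier) (e a)).defMap) fun s => rfl).symm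
  · intro _ S
    have : IsEmpty (WT.sigma S).carrier := ⟨fun z => z.1.elim⟩
    rw [ecl_eq_zero]
    exact (Finset.sum_eq_zero fun j => j.elim).symm
  · intro α _ h _ S
    have h2 : ∑ j, ecl (S j) = ecl (S none) + ∑ a, ecl (S (some a)) := by
      refine Eq.trans ?_ (Fintype.sum_option fun o => ecl (S o))
      congr!
    rw [h2, ← h, ← ecl_sum]
    symm
    refine ecl_eq (S := (S none).sum (WT.sigma fun a => S (some a))) (T := WT.sigma S)
      ⟨fun z => match z with
        | .inl s => ⟨none, s⟩
        | .inr s => ⟨some s.1, s.2⟩, fun z => match z with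
        | ⟨none, s⟩ => .inl s
        | ⟨some a, s⟩ => .inr ⟨a, s⟩, ?_, ?_⟩ ?_ ?_
    · rintro (s | s) <;> rfl
    · rintro ⟨_ | a, s⟩ <;> rfl
    · refine DefMap.sum ?_ ?_
      · exact (Tracked.sigmaMk (S := fun b => (S b).carrier) none).defMap
      · exact defMap_sigma_iff.mpr fun a =>
          (Tracked.sigmaMk (S := fun b => (S b).carrier) (some a)).defMap
    · rintro (s | s) <;> rfl

/-- Multiplication of the weights by `k`. -/
def SK.push (k : ℕ) : SK 𝔐 →+* SK 𝔐 where
  toFun := Quotient.map (WT.push k) fun _ _ h => WT.push_congr k h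
  map_zero' := ecl_eq (Equiv.refl _) DefMap.id fun s => s.elim
  map_one' := ecl_eq (Equiv.refl _) DefMap.id fun s => (nsmul_zero k).symm
  map_add' := by
    rintro ⟨S⟩ ⟨T⟩
    refine ecl_eq (Equiv.refl _) DefMap.id ?_
    rintro (s | s) <;> rfl
  map_mul' := by
    rintro ⟨S⟩ ⟨T⟩
    exact ecl_eq (Equiv.refl _) DefMap.id fun s => (nsmul_add _ _ k).symm

theorem SK.push_ecl (k : ℕ) (S : WT 𝔐) : SK.push k (ecl S) = ecl (S.push k) := rfl

/-! ### `K0 𝔐` as the group completion of `SK 𝔐`. -/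

section Comparison

theorem ecl_cut {V Z U : RelVar 𝔐} (h : IsCut V Z U) :
    ecl (WT.ofVar V) = ecl (WT.ofVar Z) + ecl (WT.ofVar U) := by
  obtain ⟨i, j, hi, hj, hic, hjo, hr⟩ := h
  rw [← ecl_sum]
  symm
  let g : pts Z.X ⊕ pts U.X → pts V.X := Sum.elim (· ≫ i) (· ≫ j)
  have hdisj (z : pts Z.X) (u : pts U.X) : z ≫ i ≠ u ≫ j := fun e => by
    have h₁ : topPt (z ≫ i) ∈ Set.range i.left := by rw [topPt_comp]; exact ⟨_, rfl⟩
    have h₂ : topPt (u ≫ j) ∈ Set.range j.left := by rw [topPt_comp]; exact ⟨_, rfl⟩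
    rw [hr, ← e] at h₂
    exact h₂ h₁
  have hg : g.Bijective := by
    constructor
    · rintro (z | u) (z' | u') h
      · rw [pts_comp_injective i i.left.isClosedEmbedding.injective h]
      · exact (hdisj _ _ h).elim
      · exact (hdisj _ _ h.symm).elim
      · rw [pts_comp_injective j j.left.isOpenEmbedding.injective h]
    · intro v
      by_cases hv : topPt v ∈ Set.range i.left
      · obtain ⟨z, hz⟩ := exists_lift_of_mem_range i hv
        exact ⟨.inl z, hz⟩
      · obtain ⟨z, hz⟩ := exists_lift_of_mem_range (y := v) j (by rw [hr]; exact hv)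
        exact ⟨.inr z, hz⟩
  refine ecl_eq_iff.mpr ⟨g, hg, DefMap.sum (Tracked.hom i).defMap (Tracked.hom j).defMap, ?_⟩
  rintro (z | u)
  · exact (Category.assoc _ _ _).trans (congrArg (z ≫ ·) hi)
  · exact (Category.assoc _ _ _).trans (congrArg (u ≫ ·) hj)

theorem ecl_mul (V W : RelVar 𝔐) :
    ecl (WT.ofVar (V.mul W)) = ecl (WT.ofVar V) * ecl (WT.ofVar W) := by
  rw [← ecl_prod]
  refine ecl_eq_iff.mpr ⟨fun z => (z ≫ fst _ _, z ≫ snd _ _), ⟨?_, ?_⟩,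
    (Tracked.hom (fst V.X W.X)).defMap.prodMk (Tracked.hom (snd V.X W.X)).defMap, fun z => ?_⟩
  · intro z z' h
    exact CartesianMonoidalCategory.hom_ext _ _ (congrArg Prod.fst h) (congrArg Prod.snd h)
  · rintro ⟨x, y⟩
    exact ⟨lift x y, Prod.ext (lift_fst x y) (lift_snd x y)⟩
  · refine Eq.trans ?_ (AddMonObj.comp_add z (fst _ _ ≫ V.p) (snd _ _ ≫ W.p)).symm
    exact congrArg₂ (· + ·) (Category.assoc _ _ _) (Category.assoc _ _ _)

variable {G : Type*} [AddCommGroup G]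

/-- An additive invariant of weighted definable types, on the free group of varieties. -/
def liftFree (f : SK 𝔐 →+ G) : FreeAbelianGroup (IsoClass 𝔐) →+ G :=
  FreeAbelianGroup.lift (Quotient.lift (fun V => f (ecl (WT.ofVar V))) (by
    rintro V W ⟨e, he⟩
    refine congrArg f (ecl_eq (S := WT.ofVar V) (T := WT.ofVar W)
      ⟨fun v : pts V.X => v ≫ e.hom, fun v : pts W.X => v ≫ e.inv, fun v => ?_, fun v => ?_⟩
      (Tracked.hom e.hom).defMap fun s => ?_)
    · exact (Category.assoc _ _ _).trans 
        ((congrArg (_ ≫ ·) e.hom_inv_id).trans (Category.comp_id _))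
    · exact (Category.assoc _ _ _).trans 
        ((congrArg (_ ≫ ·) e.inv_hom_id).trans (Category.comp_id _))
    · exact (Category.assoc _ _ _).trans (congrArg (s ≫ ·) he)))

theorem liftFree_of (f : SK 𝔐 →+ G) (V : RelVar 𝔐) :
    liftFree f (.of (Quotient.mk _ V)) = f (ecl (WT.ofVar V)) := FreeAbelianGroup.lift_apply_of _ _

/-- The relations generate an ideal, so their multiples by a variety `W` must also vanish. This is
done inside `SK 𝔐`, where `ecl_mul` and distributivity apply, so products of cuts need no geometric
argument. -/
theorem liftFree_eq_zero (f : SK 𝔐 →+ G) {x} (hx : x ∈ cutIdeal 𝔐) : liftFree f x = 0 := by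
  suffices H : ∀ a, liftFree f (a * x) = 0 by simpa using H 1
  refine Submodule.span_induction
    (p := fun x _ => ∀ a, liftFree f (a * x) = 0) ?_ ?_ ?_ ?_ hx
  · rintro y ⟨V, Z, U, h, hy⟩ a
    let c (V : RelVar 𝔐) : FreeAbelianGroup (IsoClass 𝔐) := .of (Quotient.mk _ V)
    have hy : y = c V - (c Z + c U) := hy
    have key (b : IsoClass 𝔐) : liftFree f (.of b * y) = 0 := by
      obtain ⟨W⟩ := b
      have hm (T : RelVar 𝔐) : c W * c T = c (W.mul T) :=
        FreeAbelianGroup.of_mul_of (α := IsoClass 𝔐) _ _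
      have hf (T : RelVar 𝔐) : liftFree f (c T) = f (ecl (WT.ofVar T)) := liftFree_of f T
      change liftFree f (c W * y) = 0
      rw [hy, mul_sub, mul_add, hm, hm, hm, map_sub, map_add, hf, hf, hf,
        ecl_mul, ecl_mul, ecl_mul, ecl_cut h, mul_add, map_add, sub_self]
    induction a using FreeAbelianGroup.induction_on with
    | zero => simp
    | of b => exact key b
    | neg b _ => rw [neg_mul, map_neg, key, neg_zero]
    | add a b ha hb => rw [add_mul, map_add, ha, hb, add_zero]
  · simp
  · intro x y _ _ hx hy a
    rw [mul_add, map_add, hx, hy, add_zero]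
  · intro b x _ hx a
    rw [smul_eq_mul, ← mul_assoc]
    exact hx _

/-- The extension of an additive invariant of weighted definable types to `K0 𝔐`. -/
def liftK0 (f : SK 𝔐 →+ G) : K0 𝔐 →+ G :=
  QuotientAddGroup.lift (cutIdeal 𝔐).toAddSubgroup (liftFree f) fun _ h => liftFree_eq_zero f h

theorem liftK0_cls (f : SK 𝔐 →+ G) (V : RelVar 𝔐) :
    liftK0 f (cls V) = f (ecl (WT.ofVar V)) := liftFree_of f V

theorem K0.induction {p : K0 𝔐 → Prop} (x : K0 𝔐) (hcls : ∀ V, p (cls V)) (hz : p 0)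
    (hadd : ∀ x y, p x → p y → p (x + y)) (hneg : ∀ x, p x → p (-x)) : p x := by
  obtain ⟨x, rfl⟩ := Ideal.Quotient.mk_surjective x
  induction x using FreeAbelianGroup.induction_on with
  | zero => simpa using hz
  | of b => obtain ⟨V⟩ := b; exact hcls V
  | neg b _ => obtain ⟨V⟩ := b; rw [map_neg]; exact hneg _ (hcls V)
  | add a b ha hb => rw [map_add]; exact hadd _ _ ha hb

variable [LocallyOfFiniteType 𝔐.hom] [IsSeparated 𝔐.hom]

theorem WT.class_eq {S T : WT 𝔐} (h : S ≈ T) {x y : K0 𝔐} (hx : HasClass S.carrier S.w x)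
    (hy : HasClass T.carrier T.w y) : x = y := by
  obtain ⟨g, hg, hd, hw⟩ := h
  exact (hx.of_bijective hg hd hw).unique hy

variable (𝔐) in
/-- The class of a weighted definable type in `K0 𝔐`. -/
def toK0 : SK 𝔐 →+* K0 𝔐 where
  toFun := Quotient.lift (fun S => S.hasClass.choose) fun S T h =>
    WT.class_eq h S.hasClass.choose_spec T.hasClass.choose_spec
  map_zero' := (WT.empty 𝔐).hasClass.choose_spec.unique (HasClass.of_isEmpty (S := Empty))
  map_one' := (WT.unit 𝔐).hasClass.choose_spec.unique (HasClass.of_unique (S := Unit) fun _ => rfl)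
  map_add' := by
    rintro ⟨S⟩ ⟨T⟩
    exact (S.sum T).hasClass.choose_spec.unique
      (S.hasClass.choose_spec.sum T.hasClass.choose_spec)
  map_mul' := by
    rintro ⟨S⟩ ⟨T⟩
    exact (S.prod T).hasClass.choose_spec.unique
      (S.hasClass.choose_spec.prod T.hasClass.choose_spec)

theorem toK0_ecl {S : WT 𝔐} {x : K0 𝔐} (hx : HasClass S.carrier S.w x) : toK0 𝔐 (ecl S) = x :=
  S.hasClass.choose_spec.unique hx

theorem toK0_ofVar (V : RelVar 𝔐) : toK0 𝔐 (ecl (WT.ofVar V)) = cls V :=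
  toK0_ecl (HasClass.relVar V)

theorem SK.exists_affine (s : SK 𝔐) :
    ∃ V : RelVar 𝔐, IsAffine V.X.left ∧ ecl (WT.ofVar V) = s := by
  obtain ⟨S⟩ := s
  obtain ⟨x, hx⟩ := S.hasClass
  obtain ⟨V, hV, g, hg, hgd, hgw⟩ := hx.exists_affine
  exact ⟨V, hV, ecl_eq_iff.mpr ⟨g, hg, hgd, hgw⟩⟩

theorem liftK0_toK0 (f : SK 𝔐 →+ G) (s : SK 𝔐) : liftK0 f (toK0 𝔐 s) = f s := by
  obtain ⟨V, -, rfl⟩ := s.exists_affine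
  rw [toK0_ofVar, liftK0_cls]

theorem exists_toK0_sub (x : K0 𝔐) : ∃ a b, x = toK0 𝔐 a - toK0 𝔐 b := by
  refine K0.induction (p := fun x => ∃ a b, x = toK0 𝔐 a - toK0 𝔐 b) x (fun V => ⟨_, 0, by rw [toK0_ofVar V, map_zero, sub_zero]⟩) ⟨0, 0, by simp⟩
    ?_ ?_
  · rintro _ _ ⟨a, b, rfl⟩ ⟨c, d, rfl⟩
    exact ⟨a + c, b + d, by rw [map_add, map_add]; ring⟩
  · rintro _ ⟨a, b, rfl⟩
    exact ⟨b, a, by ring⟩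

/-- The universal additive invariant of `SK 𝔐`, with values in its Grothendieck group, factors
through `K0 𝔐`; equality in that group is equality after adding a common element. -/
theorem toK0_eq_iff {a b : SK 𝔐} : toK0 𝔐 a = toK0 𝔐 b ↔ ∃ c, a + c = b + c := by
  constructor
  · intro h
    have := congrArg (liftK0 (Algebra.GrothendieckAddGroup.of (M := SK 𝔐))) h
    rw [liftK0_toK0, liftK0_toK0] at this
    obtain ⟨c, hc⟩ := ((AddLocalization.addMonoidOf (⊤ : AddSubmonoid (SK 𝔐))).eq_iff_exists).mp this
    exact ⟨c, by rw [add_comm a, add_comm b, hc]⟩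
  · rintro ⟨c, h⟩
    have := congrArg (toK0 𝔐) h
    rwa [map_add, map_add, add_left_inj] at this

end Comparison

end MotivicPower

namespace MotivicPower

/-! ### Generating series of configurations -/

section Basic

namespace Conf

variable {𝒜 : ℕ → Type} [∀ i, DefType (𝒜 i)] [Unique (𝒜 0)] {M : Type} [DefType M] {n : ℕ}

/-- Configurations on a point. -/
def ofLabel (a : 𝒜 n) : Conf 𝒜 Unit n :=
  ⟨fun _ => ⟨n, a⟩, Set.toFinite _, by simp [finsum_unique]⟩

theorem ofLabel_bijective : (ofLabel (𝒜 := 𝒜) (n := n)).Bijective := by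
  constructor
  · intro a b h
    have := congrFun (congrArg Subtype.val h) ()
    exact eq_of_heq (Sigma.mk.inj_iff.mp this).2
  · rintro ⟨f, hf, hn⟩
    rw [finsum_unique] at hn
    subst hn
    exact ⟨(f ()).2, Subtype.ext (funext fun _ => rfl)⟩

theorem defMap_ofLabel : DefMap (ofLabel (𝒜 := 𝒜) (n := n)) :=
  defMap_of_ev (show DefMap fun z : 𝒜 n × Unit => (⟨⟨n, n.lt_succ_self⟩, z.1⟩ : Lab 𝒜 n) from
    (Tracked.sigmaMk (S := fun i : Fin (n + 1) => 𝒜 i) ⟨n, n.lt_succ_self⟩).defMap.comp DefMap.fst)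

open Classical in
/-- The configuration of a single point. -/
def single (x : M) : Conf Pt M 1 :=
  ⟨fun y => ⟨if y = x then 1 else 0, ()⟩, (Set.finite_singleton x).subset fun y hy => by
    by_contra h
    exact hy (if_neg h), by
    rw [finsum_eq_single _ x fun y hy => if_neg hy, if_pos rfl]⟩

theorem single_bijective : (single (M := M)).Bijective := by
  classical
  constructor
  · intro x y h
    have := congrArg Sigma.fst (congrFun (congrArg Subtype.val h) x)
    by_contra hne
    simp [single, hne] at this
  · intro f
    obtain ⟨x, hx⟩ : ∃ x, (f.1 x).1 ≠ 0 := by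
      by_contra! h
      have := f.2.2
      simp [h] at this
    have hx1 : (f.1 x).1 = 1 := le_antisymm (f.le x) (Nat.one_le_iff_ne_zero.mpr hx)
    have hs : ∀ y, y ≠ x → (f.1 y).1 = 0 := fun y hy => by
      have h₁ : ∑ z ∈ {x, y}, (f.1 z).1 ≤ ∑ᶠ z, (f.1 z).1 := by
        rw [finsum_eq_sum_of_support_subset (s := f.2.1.toFinset ∪ {x, y}) _ (by
          intro z hz; simpa using Or.inr (Or.inr hz))]
        exact Finset.sum_le_sum_of_subset Finset.subset_union_right
      rw [f.2.2, Finset.sum_pair hy.symm] at h₁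
      omega
    refine ⟨x, Subtype.ext (funext fun y => Sigma.ext ?_ (heq_of_eq rfl))⟩
    by_cases hy : y = x
    · subst hy
      simp [single, hx1]
    · simp [single, hy, hs y hy]

theorem defMap_single : DefMap (single (M := M)) := by
  classical
  refine defMap_of_ev (show DefMap fun z : M × M => (single z.1).ev z.2 from ?_)
  have : (fun z : M × M => (single z.1).ev z.2) = fun z => if z.2 = z.1 then
      (⟨1, ()⟩ : Lab Pt 1) else ⟨0, ()⟩ := by
    funext z
    refine ev_eq_iff.mpr ?_
    by_cases h : z.2 = z.1 <;> simp [single, h]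
  rw [this]
  exact DefMap.ite' (IsDef.eq DefMap.snd DefMap.fst) (DefMap.const _) (DefMap.const _)

theorem wt_single {N : Type*} [AddCommMonoid N] (w : M → N) (x : M) :
    (single x).wt w (fun _ _ => 0) = w x := by
  classical
  rw [wt, finsum_eq_single _ x fun y hy => by simp [single, hy]]
  simp [single]

end Conf

end Basic

variable {𝔐 : CSch} [AddMonObj 𝔐] [IsCommAddMonObj 𝔐] [LocallyOfFiniteType 𝔐.hom]
  [IsSeparated 𝔐.hom]

variable (𝔐) in
/-- Graded labels, with a single label of degree zero. -/
structure Lbl where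
  L : ℕ → WT 𝔐
  [uniq : Unique (L 0).carrier]
  w_default : (L 0).w default = 0

namespace Lbl

attribute [instance] Lbl.uniq

/-- The underlying types of labels. -/
abbrev T (𝒜 : Lbl 𝔐) (i : ℕ) : Type := (𝒜.L i).carrier

/-- Labels and positions are replaced by affine models. There the quotients exist and
`hasClass_conf` computes a class, which is carried back along the bijections. -/
theorem hasClass_conf (𝒜 : Lbl 𝔐) (M : WT 𝔐) (n : ℕ) :
    ∃ x, HasClass (Conf 𝒜.T M.carrier n) (Conf.wt M.w fun i => (𝒜.L i).w) x := by
  choose A hA g hg hgd hgw using fun i => (𝒜.L i).hasClass.choose_spec.exists_affine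
  obtain ⟨V, hV, e, he, hed, hew⟩ := M.hasClass.choose_spec.exists_affine
  let _ : Unique (Labs A 0) := (Equiv.ofBijective _ (hg 0)).unique
  have h0 (a : Labs A 0) : a ≫ (A 0).p = 0 := by
    rw [← hgw, Unique.eq_default (g 0 a), 𝒜.w_default]
  have h := MotivicPower.hasClass_conf (A := A) (M := V) (n := n) h0
    fun α => (nonempty_configQuotient A V α).some
  have h₁ := h.of_bijective (g := Conf.mapLab (ℬ := 𝒜.T) g) (Conf.mapLab_bijective (fun i => (hg i).1) fun i _ => (hg i).2)
    (Conf.defMap_mapLab hgd) (w' := Conf.wt (fun x => x ≫ V.p) fun i => (𝒜.L i).w)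
    (fun f => Conf.wt_mapLab (fun i a => hgw i a) f)
  exact ⟨_, h₁.of_bijective (g := Conf.mapPos (Equiv.ofBijective e he))
    (Conf.mapPos_bijective _) (Conf.defMap_mapPos hed) (fun f => Conf.wt_mapPos hew f)⟩

end Lbl

/-- The configurations with labels in `𝒜` and positions in `M`. -/
def WT.conf (𝒜 : Lbl 𝔐) (M : WT 𝔐) (n : ℕ) : WT 𝔐 where
  carrier := Conf 𝒜.T M.carrier n
  w := Conf.wt M.w fun i => (𝒜.L i).w
  hasClass := 𝒜.hasClass_conf M n

theorem WT.conf_congr {𝒜 ℬ : Lbl 𝔐} {M M' : WT 𝔐} {n : ℕ} (h : ∀ i, 𝒜.L i ≈ ℬ.L i)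
    (h' : M ≈ M') : WT.conf 𝒜 M n ≈ WT.conf ℬ M' n := by
  obtain ⟨e, he, hed, hew⟩ := h'
  choose g hg hgd hgw using h
  have h₁ : WT.conf ℬ M n ≈ WT.conf ℬ M' n :=
    ⟨Conf.mapPos (𝒜 := ℬ.T) (Equiv.ofBijective e he), Conf.mapPos_bijective _,
      Conf.defMap_mapPos hed, Conf.wt_mapPos (w := M.w) (w' := M'.w) (wA := fun i => (ℬ.L i).w) hew⟩
  have h₂ : WT.conf 𝒜 M n ≈ WT.conf ℬ M n :=
    ⟨Conf.mapLab (𝒜 := 𝒜.T) (ℬ := ℬ.T) g,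
      Conf.mapLab_bijective (fun i => (hg i).1) fun i _ => (hg i).2, Conf.defMap_mapLab hgd,
      Conf.wt_mapLab (w := M.w) (wA := fun i => (𝒜.L i).w) (wB := fun i => (ℬ.L i).w) hgw⟩
  exact Setoid.trans h₂ h₁

/-- The labels of degree at most `n`. -/
def Lbl.trunc (𝒜 : Lbl 𝔐) (n : ℕ) : Lbl 𝔐 where
  L i := WT.sigma (J := PLift (i ≤ n)) fun _ => 𝒜.L i
  uniq :=
    { default := ⟨⟨n.zero_le⟩, (default : (𝒜.L 0).carrier)⟩
      uniq := fun ⟨⟨_⟩, _⟩ => Sigma.ext rfl (heq_of_eq (Subsingleton.elim _ _)) }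
  w_default := 𝒜.w_default

/-- Labels above degree `n` never occur. Hence the coefficient of `t^n` depends only on the label
classes up to degree `n`. -/
theorem WT.conf_trunc (𝒜 : Lbl 𝔐) (M : WT 𝔐) (n : ℕ) :
    WT.conf (𝒜.trunc n) M n ≈ WT.conf 𝒜 M n := by
  let g (i : ℕ) (z : (𝒜.trunc n).T i) : 𝒜.T i := z.2
  have hg (i : ℕ) : (g i).Injective := by
    rintro ⟨⟨_⟩, a⟩ ⟨⟨_⟩, b⟩ h
    exact Sigma.ext rfl (heq_of_eq h)
  exact ⟨Conf.mapLab (𝒜 := (𝒜.trunc n).T) (ℬ := 𝒜.T) g,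
    Conf.mapLab_bijective hg (fun i hi a => ⟨⟨⟨hi⟩, a⟩, rfl⟩),
    Conf.defMap_mapLab fun i => defMap_sigma_iff.mpr fun _ => DefMap.id,
    Conf.wt_mapLab (w := M.w) (wA := fun i => ((𝒜.trunc n).L i).w) (wB := fun i => (𝒜.L i).w)
      fun _ _ => rfl⟩

theorem ecl_conf_congr {𝒜 ℬ : Lbl 𝔐} {M M' : WT 𝔐} {n : ℕ}
    (h : ∀ i ≤ n, i ≠ 0 → ecl (𝒜.L i) = ecl (ℬ.L i)) (h' : ecl M = ecl M') :
    ecl (WT.conf 𝒜 M n) = ecl (WT.conf ℬ M' n) := by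
  rw [← ecl_eq_iff.mpr (WT.conf_trunc 𝒜 M n), ← ecl_eq_iff.mpr (WT.conf_trunc ℬ M' n)]
  refine ecl_eq_iff.mpr (WT.conf_congr (fun i => WT.sigma_congr fun j => ecl_eq_iff.mp ?_)
    (ecl_eq_iff.mp h'))
  rcases eq_or_ne i 0 with rfl | hi
  · rw [ecl_eq_one _ 𝒜.w_default, ecl_eq_one _ ℬ.w_default]
  · exact h i j.down hi

/-- Representatives of a sequence of effective classes. -/
def Lbl.ofSeq (a : ℕ → SK 𝔐) : Lbl 𝔐 where
  L i := if i = 0 then WT.unit 𝔐 else (a i).out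
  uniq := inferInstanceAs (Unique Unit)
  w_default := rfl

theorem Lbl.ecl_ofSeq (a : ℕ → SK 𝔐) {i : ℕ} (hi : i ≠ 0) : ecl ((Lbl.ofSeq a).L i) = a i := by
  have : (Lbl.ofSeq a).L i = (a i).out := if_neg hi
  rw [this]
  exact Quotient.out_eq _

open PowerSeries

/-- The generating series of configurations with labels of given classes. -/
def confSer (A : (SK 𝔐)⟦X⟧) (m : SK 𝔐) : (SK 𝔐)⟦X⟧ :=
  PowerSeries.mk fun n => ecl (WT.conf (Lbl.ofSeq fun i => coeff i A) m.out n)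

theorem coeff_confSer {𝒜 : Lbl 𝔐} {M : WT 𝔐} {A : (SK 𝔐)⟦X⟧} {n : ℕ}
    (h : ∀ i ≤ n, i ≠ 0 → ecl (𝒜.L i) = coeff i A) :
    coeff n (confSer A (ecl M)) = ecl (WT.conf 𝒜 M n) := by
  rw [confSer, coeff_mk]
  refine ecl_conf_congr (fun i hi h0 => ?_) (Quotient.out_eq _)
  rw [Lbl.ecl_ofSeq _ h0, h i hi h0]

theorem coeff_confSer_congr {A B : (SK 𝔐)⟦X⟧} {n : ℕ} (h : ∀ i ≤ n, coeff i A = coeff i B)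
    (m : SK 𝔐) : coeff n (confSer A m) = coeff n (confSer B m) := by
  obtain ⟨M⟩ := m
  change coeff n (confSer A (ecl M)) = coeff n (confSer B (ecl M))
  rw [coeff_confSer (𝒜 := Lbl.ofSeq fun i => coeff i B), coeff_confSer (𝒜 := Lbl.ofSeq fun i => coeff i B)]
  · exact fun i _ h0 => Lbl.ecl_ofSeq _ h0
  · exact fun i hi h0 => (Lbl.ecl_ofSeq _ h0).trans (h i hi).symm

theorem constantCoeff_confSer (A : (SK 𝔐)⟦X⟧) (m : SK 𝔐) :
    constantCoeff (confSer A m) = 1 := by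
  rw [← coeff_zero_eq_constantCoeff_apply, confSer, coeff_mk]
  let 𝒜 := Lbl.ofSeq fun i => coeff i A
  let _ : Unique (WT.conf 𝒜 m.out 0).carrier :=
    inferInstanceAs (Unique (Conf 𝒜.T m.out.carrier 0))
  refine ecl_eq_one _ ?_
  change ∑ᶠ x : m.out.carrier, (0 • m.out.w x + (𝒜.L 0).w default) = 0
  simp [𝒜.w_default]

theorem sum_anti {N : Type*} [AddCommMonoid N] (n : ℕ) (f : ℕ × ℕ → N) :
    ∑ p : anti n, f p.1 = ∑ p ∈ anti n, f p := Finset.sum_coe_sort _ f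

/-- A configuration on a disjoint union is a pair of configurations on its parts, with degrees
adding up to `n`. -/
theorem confSer_add (A : (SK 𝔐)⟦X⟧) (m m' : SK 𝔐) :
    confSer A (m + m') = confSer A m * confSer A m' := by
  ext n
  obtain ⟨Z⟩ := m
  obtain ⟨U⟩ := m'
  let 𝒜 := Lbl.ofSeq fun i => coeff i A
  have h𝒜 (k : ℕ) : ∀ i ≤ k, i ≠ 0 → ecl (𝒜.L i) = coeff i A := fun i _ h0 => Lbl.ecl_ofSeq _ h0
  change coeff n (confSer A (ecl Z + ecl U)) = coeff n (confSer A (ecl Z) * confSer A (ecl U))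
  rw [← ecl_sum, coeff_confSer (h𝒜 n), coeff_mul, ← sum_anti n fun p =>
    coeff p.1 (confSer A (ecl Z)) * coeff p.2 (confSer A (ecl U))]
  simp only [fun k => coeff_confSer (M := Z) (h𝒜 k), fun k => coeff_confSer (M := U) (h𝒜 k),
    ← ecl_prod]
  rw [← ecl_sigma]
  symm
  exact ecl_eq_iff.mpr ⟨Conf.join (𝒜 := 𝒜.T) (Equiv.refl (Z.carrier ⊕ U.carrier)),
    Conf.join_bijective _, Conf.defMap_join DefMap.inl DefMap.inr,
    Conf.wt_join (w := Sum.elim Z.w U.w) (wA := fun i => (𝒜.L i).w) _ 𝒜.w_default⟩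

theorem confSer_zero (A : (SK 𝔐)⟦X⟧) : confSer A 0 = 1 := by
  ext n
  rw [coeff_one]
  split_ifs with h
  · rw [h, coeff_zero_eq_constantCoeff_apply, constantCoeff_confSer]
  · let 𝒜 := Lbl.ofSeq fun i => coeff i A
    rw [← ecl_empty, coeff_confSer (𝒜 := 𝒜) fun i _ h0 => Lbl.ecl_ofSeq _ h0]
    have : IsEmpty (WT.conf 𝒜 (WT.empty 𝔐) n).carrier := ⟨fun f : Conf 𝒜.T Empty n =>
      h (by rw [← f.2.2, finsum_of_isEmpty])⟩
    exact ecl_eq_zero _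

/-- A configuration of degree `n` on a single point is one label of degree `n`. -/
theorem confSer_one {A : (SK 𝔐)⟦X⟧} (hA : constantCoeff A = 1) : confSer A 1 = A := by
  ext n
  rcases eq_or_ne n 0 with rfl | h
  · rw [coeff_zero_eq_constantCoeff_apply, coeff_zero_eq_constantCoeff_apply,
      constantCoeff_confSer, hA]
  · let 𝒜 := Lbl.ofSeq fun i => coeff i A
    rw [← ecl_unit, coeff_confSer (𝒜 := 𝒜) fun i _ h0 => Lbl.ecl_ofSeq _ h0,
      ← Lbl.ecl_ofSeq (fun i => coeff i A) h]
    symm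
    refine ecl_eq_iff.mpr ⟨Conf.ofLabel (𝒜 := 𝒜.T), Conf.ofLabel_bijective, Conf.defMap_ofLabel,
      fun a => ?_⟩
    change ∑ᶠ _ : Unit, (n • (0 : pts 𝔐) + (𝒜.L n).w a) = _
    rw [finsum_unique, nsmul_zero, zero_add]

/-- The Cauchy product of graded labels. -/
def Lbl.star (𝒜 ℬ : Lbl 𝔐) : Lbl 𝔐 where
  L k := WT.sigma fun p : anti k => (𝒜.L p.1.1).prod (ℬ.L p.1.2)
  uniq := inferInstanceAs (Unique (Conf.Star 𝒜.T ℬ.T 0))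
  w_default := by
    change (𝒜.L 0).w default + (ℬ.L 0).w default = 0
    rw [𝒜.w_default, ℬ.w_default, add_zero]

theorem ecl_conf_star (𝒜 ℬ : Lbl 𝔐) (M : WT 𝔐) (n : ℕ) : ecl (WT.conf (𝒜.star ℬ) M n) =
    ∑ p : anti n, ecl ((WT.conf 𝒜 M p.1.1).prod (WT.conf ℬ M p.1.2)) := by
  rw [← ecl_sigma]
  symm
  refine ecl_eq_iff.mpr ⟨Conf.overlay (𝒜 := 𝒜.T) (ℬ := ℬ.T), Conf.overlay_bijective, ?_,
    Conf.wt_overlay (w := M.w) (wA := fun i => (𝒜.L i).w)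
      (wB := fun i => (ℬ.L i).w) 𝒜.w_default ℬ.w_default⟩
  exact Conf.defMap_overlay (𝒜 := 𝒜.T) (ℬ := ℬ.T) (M := M.carrier) (n := n)

/-- A labelling by pairs is the overlay of two labellings. The constant coefficients must be one so
that the label in degree zero is the trivial one in both factors. -/
theorem confSer_mul {A B : (SK 𝔐)⟦X⟧} (hA : constantCoeff A = 1) (hB : constantCoeff B = 1)
    (m : SK 𝔐) : confSer (A * B) m = confSer A m * confSer B m := by
  ext n
  obtain ⟨M⟩ := m
  let 𝒜 := Lbl.ofSeq fun i => coeff i A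
  let ℬ := Lbl.ofSeq fun i => coeff i B
  have h𝒜 (i : ℕ) : ecl (𝒜.L i) = coeff i A := by
    rcases eq_or_ne i 0 with rfl | h
    · rw [coeff_zero_eq_constantCoeff_apply, hA]; rfl
    · exact Lbl.ecl_ofSeq _ h
  have hℬ (i : ℕ) : ecl (ℬ.L i) = coeff i B := by
    rcases eq_or_ne i 0 with rfl | h
    · rw [coeff_zero_eq_constantCoeff_apply, hB]; rfl
    · exact Lbl.ecl_ofSeq _ h
  have hs (i : ℕ) : ecl ((𝒜.star ℬ).L i) = coeff i (A * B) := by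
    rw [coeff_mul, ← sum_anti i fun p => coeff p.1 A * coeff p.2 B, Lbl.star, ecl_sigma]
    simp only [ecl_prod, h𝒜, hℬ]
  change coeff n (confSer (A * B) (ecl M)) = coeff n (confSer A (ecl M) * confSer B (ecl M))
  rw [coeff_confSer (𝒜 := 𝒜.star ℬ) fun i _ _ => hs i, coeff_mul, ← sum_anti n fun p =>
    coeff p.1 (confSer A (ecl M)) * coeff p.2 (confSer B (ecl M))]
  simp only [fun k => coeff_confSer (M := M) (n := k) fun i _ _ => h𝒜 i,
    fun k => coeff_confSer (M := M) (n := k) fun i _ _ => hℬ i, ← ecl_prod]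
  exact ecl_conf_star 𝒜 ℬ M n

/-! ### Symmetric powers -/

variable (𝔐) in
/-- One label in each degree. -/
def Lbl.pt : Lbl 𝔐 where
  L _ := WT.unit 𝔐
  uniq := inferInstanceAs (Unique Unit)
  w_default := rfl

/-- The generating series of the symmetric powers. -/
def symSer (x : SK 𝔐) : (SK 𝔐)⟦X⟧ := confSer (PowerSeries.mk 1) x

theorem coeff_symSer (S : WT 𝔐) (n : ℕ) :
    coeff n (symSer (ecl S)) = ecl (WT.conf (Lbl.pt 𝔐) S n) :=
  coeff_confSer fun i _ _ => by rw [coeff_mk]; rfl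

theorem coeff_one_symSer (x : SK 𝔐) : coeff 1 (symSer x) = x := by
  obtain ⟨S⟩ := x
  refine (coeff_symSer S 1).trans (Eq.symm ?_)
  exact ecl_eq_iff.mpr ⟨Conf.single, Conf.single_bijective, Conf.defMap_single,
    Conf.wt_single S.w⟩

/-- Substitution of `X ^ k`. -/
def expandSer (k : ℕ) (A : (SK 𝔐)⟦X⟧) : (SK 𝔐)⟦X⟧ :=
  PowerSeries.mk fun j => ∑ m : {m : Fin (j + 1) // k * m = j}, coeff (m.1 : ℕ) A

/-- Symmetric powers as labels. -/
def Lbl.sym (k : ℕ) [NeZero k] (S : WT 𝔐) : Lbl 𝔐 where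
  L j := WT.sigma fun m : {m : Fin (j + 1) // k * m = j} => WT.conf (Lbl.pt 𝔐) S m.1
  uniq := inferInstanceAs (Unique (Conf.SymL k S.carrier 0))
  w_default := by
    change ∑ᶠ x : S.carrier, (0 • S.w x + 0) = 0
    simp

/-- Configurations in `M` labelled by symmetric powers of `X`, with degrees multiplied by `k`, are
elements of symmetric powers of `M × X`, with the weight of `M` multiplied by `k`. This formula
determines the geometric power structure. -/
theorem confSer_expandSer (k : ℕ) [NeZero k] (x m : SK 𝔐) :
    confSer (expandSer k (symSer x)) m = expandSer k (symSer (SK.push k m * x)) := by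
  ext n
  obtain ⟨S⟩ := x
  obtain ⟨M⟩ := m
  change coeff n (confSer (expandSer k (symSer (ecl S))) (ecl M)) =
    coeff n (expandSer k (symSer (SK.push k (ecl M) * ecl S)))
  rw [SK.push_ecl, ← ecl_prod, coeff_confSer (𝒜 := Lbl.sym k S), expandSer, coeff_mk]
  · simp only [coeff_symSer]
    rw [← ecl_sigma]
    symm
    exact ecl_eq_iff.mpr ⟨Conf.curry (M := M.carrier) (X := S.carrier), Conf.curry_bijective,
      Conf.defMap_curry, Conf.wt_curry⟩
  · intro i _ _
    rw [expandSer, coeff_mk, Lbl.sym, ecl_sigma]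
    simp only [coeff_symSer]

end MotivicPower

namespace MotivicPower

/-! ### Power structures from zeta functions and Adams operations -/

section ZetaRing

open PowerSeries

variable {R S : Type*} [CommRing R] [CommRing S]

theorem constantCoeff_oneSeries (A : oneSeries R) : constantCoeff A.1 = 1 := A.2

theorem coeff_zero_oneSeries (A : oneSeries R) : coeff 0 A.1 = 1 := by
  rw [coeff_zero_eq_constantCoeff_apply, A.2]

instance : CommGroup (oneSeries R) where
  inv A := ⟨invOfUnit A.1 1, by
    change constantCoeff _ = 1
    rw [constantCoeff_invOfUnit, inv_one, Units.val_one]⟩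
  inv_mul_cancel A := Subtype.ext <| (mul_comm _ _).trans <|
    mul_invOfUnit A.1 1 (constantCoeff_oneSeries A)

theorem oneSeries_ext {A B : oneSeries R} (h : ∀ i, coeff i A.1 = coeff i B.1) : A = B :=
  Subtype.ext (PowerSeries.ext h)

/-- Congruence modulo `t ^ k`. -/
def Cong (k : ℕ) (A B : oneSeries R) : Prop := ∀ i < k, coeff i A.1 = coeff i B.1

namespace Cong

variable {k : ℕ} {A B C D : oneSeries R}

theorem refl (A : oneSeries R) : Cong k A A := fun _ _ => rfl
theorem symm (h : Cong k A B) : Cong k B A := fun i hi => (h i hi).symm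
theorem trans (h : Cong k A B) (h' : Cong k B C) : Cong k A C :=
  fun i hi => (h i hi).trans (h' i hi)
theorem mono {l : ℕ} (h : Cong k A B) (hl : l ≤ k) : Cong l A B := fun i hi => h i (by omega)

theorem mul (h : Cong k A B) (h' : Cong k C D) : Cong k (A * C) (B * D) := fun i hi => by
  change coeff i (A.1 * C.1) = coeff i (B.1 * D.1)
  rw [coeff_mul, coeff_mul]
  refine Finset.sum_congr rfl fun p hp => ?_
  have := Finset.HasAntidiagonal.mem_antidiagonal.mp hp
  rw [h _ (by omega), h' _ (by omega)]

theorem inv (h : Cong k A B) : Cong k A⁻¹ B⁻¹ := by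
  have h₁ : Cong k (A⁻¹ * B⁻¹ * B) (A⁻¹ * B⁻¹ * A) := (refl _).mul h.symm
  rwa [mul_assoc, inv_mul_cancel, mul_one, mul_right_comm, inv_mul_cancel, one_mul] at h₁

theorem eq (h : ∀ k, Cong k A B) : A = B := oneSeries_ext fun i => h (i + 1) i i.lt_succ_self

end Cong

/-- Maps of series whose truncations depend only on truncations. -/
def TruncCont (F : oneSeries R → oneSeries S) : Prop :=
  ∀ N, ∃ k, ∀ A B, Cong k A B → Cong N (F A) (F B)

theorem mapOne_mul (φ : R →+* S) (A B : oneSeries R) :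
    mapOne φ (A * B) = mapOne φ A * mapOne φ B := Subtype.ext (map_mul _ _ _)

theorem expandOne_mul (n : ℕ) (hn : n ≠ 0) (A B : oneSeries R) :
    expandOne n hn (A * B) = expandOne n hn A * expandOne n hn B := Subtype.ext (map_mul _ _ _)

theorem scaleOne_mul (c : R) (A B : oneSeries R) :
    scaleOne c (A * B) = scaleOne c A * scaleOne c B := Subtype.ext (map_mul _ _ _)

theorem scaleOne_scaleOne (c d : R) (A : oneSeries R) :
    scaleOne c (scaleOne d A) = scaleOne (c * d) A :=
  oneSeries_ext fun i => by
    change coeff i (rescale c (rescale d A.1)) = coeff i (rescale (c * d) A.1)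
    simp only [coeff_rescale]; ring

theorem scaleOne_one (A : oneSeries R) : scaleOne 1 A = A :=
  oneSeries_ext fun i => by
    change coeff i (rescale 1 A.1) = _
    simp

theorem mapOne_scaleOne (φ : R →+* S) (c : R) (A : oneSeries R) :
    mapOne φ (scaleOne c A) = scaleOne (φ c) (mapOne φ A) :=
  oneSeries_ext fun i => by
    change coeff i (PowerSeries.map φ (rescale c A.1)) =
      coeff i (rescale (φ c) (PowerSeries.map φ A.1))
    simp

theorem mapOne_expandOne (φ : R →+* S) (n : ℕ) (hn : n ≠ 0) (A : oneSeries R) :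
    mapOne φ (expandOne n hn A) = expandOne n hn (mapOne φ A) :=
  oneSeries_ext fun i => by
    change coeff i (PowerSeries.map φ (expand n hn A.1)) =
      coeff i (expand n hn (PowerSeries.map φ A.1))
    rw [coeff_map, coeff_expand, coeff_expand]
    split_ifs <;> simp

theorem expandOne_expandOne (m n : ℕ) (hm : m ≠ 0) (hn : n ≠ 0) (A : oneSeries R) :
    expandOne m hm (expandOne n hn A) = expandOne (m * n) (mul_ne_zero hm hn) A :=
  oneSeries_ext fun i => by
    change coeff i (expand m hm (expand n hn A.1)) = coeff i (expand (m * n) _ A.1)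
    simp only [coeff_expand]
    by_cases h : m * n ∣ i
    · obtain ⟨q, rfl⟩ := h
      rw [if_pos (Dvd.intro _ (mul_assoc m n q).symm), if_pos (dvd_mul_right _ _),
        mul_assoc, Nat.mul_div_cancel_left _ (Nat.pos_of_ne_zero hm), if_pos (dvd_mul_right _ _),
        Nat.mul_div_cancel_left _ (Nat.pos_of_ne_zero hn), ← mul_assoc,
        Nat.mul_div_cancel_left _ (Nat.pos_of_ne_zero (mul_ne_zero hm hn))]
    · rw [if_neg h]
      split_ifs with h₁ h₂
      · obtain ⟨q, rfl⟩ := h₁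
        rw [Nat.mul_div_cancel_left _ (Nat.pos_of_ne_zero hm)] at h₂
        exact (h (mul_dvd_mul_left m h₂)).elim
      · rfl
      · rfl

theorem mapOne_mkOne_one (φ : R →+* S) : mapOne φ (mkOne fun _ => 1) = mkOne fun _ => 1 :=
  oneSeries_ext fun i => by
    change coeff i (PowerSeries.map φ (PowerSeries.mk fun i => if i = 0 then 1 else 1)) =
      coeff i (PowerSeries.mk fun i => if i = 0 then 1 else 1)
    simp

theorem expandOne_one (A : oneSeries R) : expandOne 1 one_ne_zero A = A :=
  oneSeries_ext fun i => by
    change coeff i (expand 1 _ A.1) = _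
    simp

theorem truncCont_mapOne (φ : R →+* S) : TruncCont (mapOne φ) := fun N => ⟨N, fun A B h i hi => by
  change coeff i (PowerSeries.map φ A.1) = coeff i (PowerSeries.map φ B.1)
  rw [coeff_map, coeff_map, h i hi]⟩

theorem truncCont_expandOne (n : ℕ) (hn : n ≠ 0) : TruncCont (expandOne (R := R) n hn) :=
  fun N => ⟨N, fun A B h i hi => by
    change coeff i (expand n hn A.1) = coeff i (expand n hn B.1)
    rw [coeff_expand, coeff_expand]
    split_ifs
    · exact h _ (lt_of_le_of_lt (Nat.div_le_self _ _) hi)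
    · rfl⟩

theorem TruncCont.comp {T : Type*} [CommRing T] {F : oneSeries R → oneSeries S}
    {G : oneSeries T → oneSeries R} (hF : TruncCont F) (hG : TruncCont G) :
    TruncCont fun A => F (G A) := fun N => by
  obtain ⟨k, hk⟩ := hF N
  obtain ⟨l, hl⟩ := hG k
  exact ⟨l, fun A B h => hk _ _ (hl _ _ h)⟩

variable (R) in
/-- Zeta functions and Adams operations on a commutative ring. -/
structure ZetaRing where
  zeta : R → oneSeries R
  zeta_add : ∀ a b, zeta (a + b) = zeta a * zeta b
  coeff_one_zeta : ∀ a, coeff 1 (zeta a).1 = a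
  zeta_one : zeta 1 = mkOne fun _ => 1
  psi : ℕ → R →+* R
  psi_one : ∀ r, psi 1 r = r
  psi_mul : ∀ m k r, psi (m * k) r = psi m (psi k r)

namespace ZetaRing

variable (Z : ZetaRing R)

/-- `ζ_a(t ^ (k + 1))`. -/
def factor (k : ℕ) (a : R) : oneSeries R := expandOne (k + 1) k.succ_ne_zero (Z.zeta a)

theorem factor_add (k : ℕ) (a b : R) : Z.factor k (a + b) = Z.factor k a * Z.factor k b := by
  rw [factor, zeta_add, expandOne_mul]; rfl

theorem factor_zero (k : ℕ) : Z.factor k 0 = 1 := by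
  have := Z.factor_add k 0 0
  rwa [add_zero, left_eq_mul] at this

theorem factor_neg (k : ℕ) (a : R) : Z.factor k (-a) = (Z.factor k a)⁻¹ :=
  eq_inv_of_mul_eq_one_left (by rw [← factor_add, neg_add_cancel, factor_zero])

theorem zeta_eq_factor (a : R) : Z.zeta a = Z.factor 0 a := (expandOne_one _).symm

theorem factor_cong (k : ℕ) (a : R) : Cong (k + 1) (Z.factor k a) 1 := fun i hi => by
  change coeff i (expand (k + 1) _ _) = coeff i (1 : R⟦X⟧)
  rw [coeff_expand, coeff_one]
  rcases Nat.eq_zero_or_pos i with rfl | h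
  · simp [constantCoeff_oneSeries]
  · rw [if_neg fun h' => (by have := Nat.le_of_dvd h h'; omega), if_neg (by omega)]

theorem coeff_factor (k : ℕ) (a : R) : coeff (k + 1) (Z.factor k a).1 = a := by
  change coeff (k + 1) (expand (k + 1) _ _) = a
  rw [coeff_expand, if_pos dvd_rfl, Nat.div_self k.succ_pos, coeff_one_zeta]

/-- Finite products of zeta functions. -/
def partialProd (n : ℕ) (a : ℕ → R) : oneSeries R := ∏ k ∈ Finset.range n, Z.factor k (a k)

theorem partialProd_succ (n : ℕ) (a : ℕ → R) :
    Z.partialProd (n + 1) a = Z.partialProd n a * Z.factor n (a n) := Finset.prod_range_succ _ _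

theorem partialProd_cong (a : ℕ → R) {m n : ℕ} (h : n ≤ m) :
    Cong (n + 1) (Z.partialProd m a) (Z.partialProd n a) := by
  induction m, h using Nat.le_induction with
  | base => exact Cong.refl _
  | succ m hm ih =>
    rw [partialProd_succ, ← mul_one (Z.partialProd n a)]
    exact ih.mul ((Z.factor_cong m _).mono (by omega))

/-- Infinite products of zeta functions. -/
def prod (a : ℕ → R) : oneSeries R :=
  ⟨PowerSeries.mk fun i => coeff i (Z.partialProd i a).1, by
    change constantCoeff _ = 1
    rw [← coeff_zero_eq_constantCoeff_apply, coeff_mk]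
    exact coeff_zero_oneSeries _⟩

theorem prod_cong (a : ℕ → R) (n : ℕ) : Cong (n + 1) (Z.prod a) (Z.partialProd n a) :=
  fun i hi => by
    change coeff i (PowerSeries.mk fun i => coeff i (Z.partialProd i a).1) = _
    rw [coeff_mk]
    exact (Z.partialProd_cong a (Nat.le_of_lt_succ hi) i i.lt_succ_self).symm

theorem prod_add (a b : ℕ → R) : Z.prod (fun k => a k + b k) = Z.prod a * Z.prod b :=
  Cong.eq fun n => by
    have h : Z.partialProd n (fun k => a k + b k) = Z.partialProd n a * Z.partialProd n b := by
      simp only [partialProd, factor_add, Finset.prod_mul_distrib]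
    refine ((Z.prod_cong _ n).trans ?_).mono n.le_succ
    rw [h]
    exact ((Z.prod_cong a n).mul (Z.prod_cong b n)).symm

/-- Once the first `n` exponents agree, their finite product cancels and the coefficient of
`t^(n+1)` is the next exponent. -/
theorem prod_injective : Function.Injective Z.prod := by
  intro a b h
  funext n
  induction n using Nat.strong_induction_on with
  | _ n ih =>
    have hp : Z.partialProd n a = Z.partialProd n b :=
      Finset.prod_congr rfl fun k hk => by rw [ih k (Finset.mem_range.mp hk)]
    have h₁ : Cong (n + 2) (Z.partialProd (n + 1) a) (Z.partialProd (n + 1) b) :=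
      (Z.prod_cong a (n + 1)).symm.trans (h ▸ Z.prod_cong b (n + 1))
    rw [partialProd_succ, partialProd_succ, hp] at h₁
    have h₂ := (Cong.refl (Z.partialProd n b)⁻¹).mul h₁
    rw [inv_mul_cancel_left, inv_mul_cancel_left] at h₂
    have := h₂ (n + 1) (by omega)
    rwa [coeff_factor, coeff_factor] at this

/-- The remainders of the factorization of a series into zeta functions. -/
def rem (A : oneSeries R) : ℕ → oneSeries R
  | 0 => A
  | n + 1 => rem A n * (Z.factor n (coeff (n + 1) (rem A n).1))⁻¹

/-- The exponents of the factorization of a series into zeta functions. -/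
def log (A : oneSeries R) (n : ℕ) : R := coeff (n + 1) (Z.rem A n).1

theorem coeff_mul_of_cong {n : ℕ} {A B : oneSeries R} (hA : Cong n A 1)
    (hn : n ≠ 0) : coeff n (A * B).1 = coeff n A.1 + coeff n B.1 := by
  change coeff n (A.1 * B.1) = _
  rw [coeff_mul, Finset.sum_eq_add (n, 0) (0, n) (by simp [hn]) _ (by simp) (by simp),
    coeff_zero_oneSeries, coeff_zero_oneSeries, one_mul, mul_one]
  rintro ⟨i, j⟩ hp ⟨h₁, h₂⟩
  have := Finset.HasAntidiagonal.mem_antidiagonal.mp hp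
  dsimp only at this
  have hi : i ≠ 0 := by rintro rfl; exact h₂ (by simp [← this])
  have hj : j ≠ 0 := by rintro rfl; exact h₁ (by simp [← this])
  have h1 : coeff i (1 : oneSeries R).1 = 0 := by
    change coeff i (1 : R⟦X⟧) = 0
    rw [coeff_one, if_neg hi]
  rw [hA i (by omega), h1, zero_mul]

theorem coeff_inv_of_cong {n : ℕ} {A : oneSeries R} (hA : Cong n A 1) (hn : n ≠ 0) :
    coeff n (A⁻¹).1 = - coeff n A.1 := by
  have h := coeff_mul_of_cong (B := A⁻¹) hA hn
  rw [mul_inv_cancel] at h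
  have h1 : coeff n (1 : oneSeries R).1 = 0 := by
    change coeff n (1 : R⟦X⟧) = 0
    rw [coeff_one, if_neg hn]
  rw [h1] at h
  exact (neg_eq_of_add_eq_zero_right h.symm).symm

/-- Dividing by the factor with exponent the leading coefficient removes exactly the term in
`t^(n+1)`. -/
theorem rem_cong (A : oneSeries R) (n : ℕ) : Cong (n + 1) (Z.rem A n) 1 := by
  induction n with
  | zero =>
    intro i hi
    obtain rfl : i = 0 := by omega
    exact (coeff_zero_oneSeries _).trans (coeff_zero_oneSeries _).symm
  | succ n ih =>
    have hf := Z.factor_cong n (coeff (n + 1) (Z.rem A n).1)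
    have hf' : Cong (n + 1) (Z.factor n (coeff (n + 1) (Z.rem A n).1))⁻¹ 1 := by simpa using hf.inv
    intro i hi
    rcases Nat.lt_succ_iff_lt_or_eq.mp hi with h | rfl
    · exact ((ih.mul hf') i h).trans (by rw [one_mul])
    · have h1 : coeff (n + 1) (1 : oneSeries R).1 = 0 := by
        change coeff (n + 1) (1 : R⟦X⟧) = 0
        rw [coeff_one, if_neg (by omega)]
      rw [rem, coeff_mul_of_cong ih (by omega), coeff_inv_of_cong hf (by omega), coeff_factor,
        h1, add_neg_cancel]

theorem rem_mul_partialProd (A : oneSeries R) (n : ℕ) :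
    Z.rem A n * Z.partialProd n (Z.log A) = A := by
  induction n with
  | zero => simp [rem, partialProd]
  | succ n ih =>
    rw [partialProd_succ, rem, mul_mul_mul_comm, ih, log, inv_mul_cancel, mul_one]

theorem log_cong (A : oneSeries R) (n : ℕ) : Cong (n + 1) A (Z.partialProd n (Z.log A)) := by
  have := (Z.rem_cong A n).mul (Cong.refl (Z.partialProd n (Z.log A)))
  rwa [rem_mul_partialProd, one_mul] at this

theorem prod_log (A : oneSeries R) : Z.prod (Z.log A) = A :=
  Cong.eq fun n => ((Z.prod_cong _ n).trans (Z.log_cong A n).symm).mono n.le_succ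

theorem log_prod (a : ℕ → R) : Z.log (Z.prod a) = a := Z.prod_injective (Z.prod_log _)

theorem log_mul (A B : oneSeries R) (k : ℕ) : Z.log (A * B) k = Z.log A k + Z.log B k := by
  have : Z.log (A * B) = fun k => Z.log A k + Z.log B k := Z.prod_injective (by
    rw [prod_log, prod_add, prod_log, prod_log])
  rw [this]

theorem rem_congr {A B : oneSeries R} {N : ℕ} (h : Cong N A B) {n : ℕ} (hn : n < N) :
    Cong N (Z.rem A n) (Z.rem B n) := by
  induction n with
  | zero => exact h
  | succ n ih =>
    have h' := ih (by omega)
    rw [rem, rem, h' (n + 1) hn]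
    exact h'.mul (Cong.refl _)

theorem log_congr {A B : oneSeries R} {N : ℕ} (h : Cong N A B) {n : ℕ} (hn : n + 1 < N) :
    Z.log A n = Z.log B n := Z.rem_congr h (by omega) (n + 1) hn

theorem prod_single (k : ℕ) (a : R) : Z.prod (Pi.single k a) = Z.factor k a := by
  classical
  have h (n : ℕ) (hn : k < n) : Z.partialProd n (Pi.single k a) = Z.factor k a := by
    rw [partialProd, Finset.prod_eq_single k, Pi.single_eq_same]
    · intro j _ hj
      rw [Pi.single_eq_of_ne hj, factor_zero]
    · simp [hn]
  refine Cong.eq fun n => ?_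
  rw [← h (n + k + 1) (by omega)]
  exact (Z.prod_cong _ _).mono (by omega)

/-- Homomorphisms on series are determined by their values on zeta functions. -/
theorem hom_ext {F G : oneSeries R → oneSeries S} (hF : ∀ A B, F (A * B) = F A * F B)
    (hG : ∀ A B, G (A * B) = G A * G B) (hFc : TruncCont F) (hGc : TruncCont G)
    (h : ∀ k a, F (Z.factor k a) = G (Z.factor k a)) (A : oneSeries R) : F A = G A := by
  have one {H : oneSeries R → oneSeries S} (hH : ∀ A B, H (A * B) = H A * H B) : H 1 = 1 := by
    have := hH 1 1
    rwa [mul_one, left_eq_mul] at this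
  have hp (n : ℕ) (a : ℕ → R) : F (Z.partialProd n a) = G (Z.partialProd n a) := by
    induction n with
    | zero => simp [partialProd, one hF, one hG]
    | succ n ih => rw [partialProd_succ, hF, hG, ih, h]
  -- Modulo `t^N`, both maps see only a truncation of `A`, and there `A` is a finite product of
  -- factors; `k + l` of them suffice for both.
  refine Cong.eq fun N => ?_
  obtain ⟨k, hk⟩ := hFc N
  obtain ⟨l, hl⟩ := hGc N
  refine (hk _ _ ((Z.log_cong A (k + l)).mono (by omega))).trans ?_
  rw [hp]
  exact (hl _ _ ((Z.log_cong A (k + l)).mono (by omega))).symm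

/-- The power structure of a system of zeta functions and Adams operations. -/
def power : PowerStructure R where
  pow A r := Z.prod fun k => Z.psi (k + 1) r * Z.log A k
  pow_zero A := by
    simp only [map_zero, zero_mul]
    have := Z.prod_single 0 0
    rw [Pi.single_zero, factor_zero] at this
    exact this
  pow_one A := by simp only [map_one, one_mul, prod_log]
  mul_pow A B r := by simp only [log_mul, mul_add, prod_add]
  pow_add A r s := by simp only [map_add, add_mul, prod_add]
  pow_mul A r s := by
    simp only [log_prod, map_mul]
    congr 1
    funext k
    ring

theorem power_factor (k : ℕ) (a r : R) :
    Z.power.pow (Z.factor k a) r = Z.factor k (Z.psi (k + 1) r * a) := by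
  change Z.prod _ = _
  rw [← prod_single, ← prod_single, log_prod]
  congr 1
  funext j
  rcases eq_or_ne j k with rfl | h
  · simp
  · simp [Pi.single_eq_of_ne h]

theorem power_zeta (a : R) : Z.power.zeta a = Z.zeta a := by
  rw [PowerStructure.zeta, ← Z.zeta_one, zeta_eq_factor, power_factor, zeta_eq_factor, psi_one,
    mul_one]

/-- Below degree `N`, only the exponents with `k + 1 < N` enter, and these depend only on `A` below
degree `N`. -/
theorem power_cong {A B : oneSeries R} {N : ℕ} (h : Cong N A B) (r : R) :
    Cong N (Z.power.pow A r) (Z.power.pow B r) := by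
  rcases N with _ | n
  · exact fun i hi => by omega
  refine (Z.prod_cong _ n).trans (Cong.trans ?_ (Z.prod_cong _ n).symm)
  rw [show Z.partialProd n _ = _ from Finset.prod_congr rfl fun k hk => by
    rw [Z.log_congr h (by simpa using hk)]]
  exact Cong.refl _

theorem finitelyDetermined_power : Z.power.FinitelyDetermined :=
  fun r N => ⟨N, fun _ _ h => Z.power_cong h r⟩

theorem truncCont_power (r : R) : TruncCont fun A => Z.power.pow A r :=
  fun N => ⟨N, fun _ _ h => Z.power_cong h r⟩

/-- It suffices to test factors. Substituting `t^n` turns index `k + 1` into `n * (k + 1)`, so the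
rule is `ψ_{n(k+1)} = ψ_{k+1} ψ_n`. -/
theorem power_expandOne (n : ℕ) (hn : n ≠ 0) (A : oneSeries R) (r : R) :
    Z.power.pow (expandOne n hn A) r = expandOne n hn (Z.power.pow A (Z.psi n r)) := by
  refine Z.hom_ext (F := fun A => Z.power.pow (expandOne n hn A) r)
    (G := fun A => expandOne n hn (Z.power.pow A (Z.psi n r)))
    (fun A B => by rw [expandOne_mul, PowerStructure.mul_pow])
    (fun A B => by rw [PowerStructure.mul_pow, expandOne_mul])
    ((Z.truncCont_power r).comp (truncCont_expandOne n hn))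
    ((truncCont_expandOne n hn).comp (Z.truncCont_power _)) (fun k a => ?_) A
  obtain ⟨m, hm⟩ := Nat.exists_eq_succ_of_ne_zero (mul_ne_zero hn k.succ_ne_zero)
  have key (b : R) : expandOne n hn (Z.factor k b) = Z.factor m b := by
    rw [factor, expandOne_expandOne, factor]
    congr 1
  rw [key, power_factor, power_factor, key, ← psi_mul, mul_comm (k + 1) n]
  congr 3
  exact congrArg Z.psi hm.symm

/-- Compatibility of zeta functions and Adams operations with a ring homomorphism. -/
structure Compat (φ : R →+* S) (Z : ZetaRing R) (W : ZetaRing S) : Prop where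
  zeta : ∀ a, W.zeta (φ a) = mapOne φ (Z.zeta a)
  psi : ∀ k r, k ≠ 0 → W.psi k (φ r) = φ (Z.psi k r)

variable {Z}

theorem Compat.extends {W : ZetaRing S} {φ : R →+* S} (h : Compat φ Z W) :
    PowerStructure.Extends φ Z.power W.power := fun A r => by
  have key (k : ℕ) (a : R) : mapOne φ (Z.factor k a) = W.factor k (φ a) := by
    rw [factor, mapOne_expandOne, ← h.zeta]; rfl
  refine Z.hom_ext (F := fun A => W.power.pow (mapOne φ A) (φ r))
    (G := fun A => mapOne φ (Z.power.pow A r))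
    (fun A B => by rw [mapOne_mul, PowerStructure.mul_pow])
    (fun A B => by rw [PowerStructure.mul_pow, mapOne_mul])
    ((W.truncCont_power _).comp (truncCont_mapOne φ))
    ((truncCont_mapOne φ).comp (Z.truncCont_power _)) (fun k a => ?_) A
  rw [key, power_factor, power_factor, key, h.psi _ _ k.succ_ne_zero, map_mul]

theorem zetaProperty_power {u : Rˣ} (h : ∀ a, Z.zeta (u * a) = scaleOne (u : R) (Z.zeta a)) :
    Z.power.ZetaProperty u := fun a k => by
  have hn (n : ℕ) (a : R) : Z.zeta ((u : R) ^ n * a) = scaleOne ((u : R) ^ n) (Z.zeta a) := by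
    induction n generalizing a with
    | zero => rw [pow_zero, one_mul, scaleOne_one]
    | succ n ih => rw [pow_succ, mul_assoc, ih, h, scaleOne_scaleOne]
  have hz : Z.zeta (((u ^ k : Rˣ) : R) * a) = scaleOne ((u ^ k : Rˣ) : R) (Z.zeta a) := by
    obtain ⟨n, rfl | rfl⟩ := Int.eq_nat_or_neg k
    · simpa using hn n a
    -- For a negative power, the positive case is applied to `u^(-n) a` and the rescaling is then
    -- inverted.
    · have := hn n (((u ^ (-(n : ℤ)) : Rˣ) : R) * a)
      have h1 : (u : R) ^ n * ((u ^ (-(n : ℤ)) : Rˣ) : R) = 1 := by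
        rw [← Units.val_pow_eq_pow_val, ← Units.val_mul, zpow_neg, zpow_natCast, mul_inv_cancel,
          Units.val_one]
      rw [← mul_assoc, h1, one_mul] at this
      rw [this, scaleOne_scaleOne, mul_comm _ ((u : R) ^ n), h1, scaleOne_one]
  simp only [power_zeta]
  refine ⟨?_, hz⟩
  rw [zeta_eq_factor, power_factor, ← zeta_eq_factor, psi_one]

end ZetaRing

theorem PowerStructure.pow_neg (P : PowerStructure R) (A : oneSeries R) (r : R) :
    P.pow A (-r) = (P.pow A r)⁻¹ :=
  eq_inv_of_mul_eq_one_left (by rw [← P.pow_add, neg_add_cancel, P.pow_zero])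

theorem PowerStructure.one_pow (P : PowerStructure R) (r : R) : P.pow 1 r = 1 := by
  have := P.mul_pow 1 1 r
  rwa [mul_one, left_eq_mul] at this

theorem PowerStructure.inv_pow (P : PowerStructure R) (A : oneSeries R) (r : R) :
    P.pow A⁻¹ r = (P.pow A r)⁻¹ :=
  eq_inv_of_mul_eq_one_left (by rw [← P.mul_pow, inv_mul_cancel, P.one_pow])

end ZetaRing

end MotivicPower

namespace MotivicPower

/-! ### The power structure on `K0 𝔐` -/

open PowerSeries

/-- This is `b = (1 - q)⁻¹`, for `q` without constant term, solved recursively because a semiring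
has no subtraction. Multiplying by `b` replaces subtracting `q`. -/
theorem exists_eq_one_add_mul {R : Type*} [CommSemiring R] (q : ℕ → R) :
    ∃ b : R⟦X⟧, constantCoeff b = 1 ∧ b = 1 + PowerSeries.mk (fun i => if i = 0 then 0 else q i) * b := by
  let c : ℕ → R := Nat.strongRec fun n ih =>
    if n = 0 then 1 else ∑ i : Fin n, q (n - i) * ih i i.2
  have hc (n : ℕ) : c n = if n = 0 then 1 else ∑ i : Fin n, q (n - i) * c i := by
    simp only [c]
    rw [Nat.strongRec_eq]
  refine ⟨PowerSeries.mk c, ?_, PowerSeries.ext fun n => ?_⟩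
  · rw [← coeff_zero_eq_constantCoeff_apply, coeff_mk, hc, if_pos rfl]
  · rw [coeff_mk, map_add, coeff_one, coeff_mul, hc]
    split_ifs with h
    · subst h
      simp
    · rw [zero_add, Finset.Nat.sum_antidiagonal_eq_sum_range_succ_mk, ← Finset.sum_range_reflect,
        Finset.sum_range_succ, Finset.sum_range]
      simp only [coeff_mk]
      rw [if_pos (by omega), zero_mul, add_zero]
      refine Finset.sum_congr rfl fun i _ => ?_
      rw [if_neg (by omega)]
      congr 2
      omega

variable {𝔐 : CSch} [AddMonObj 𝔐] [IsCommAddMonObj 𝔐]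

variable (𝔐) in
/-- Series of effective classes with constant coefficient one. -/
def effSeries : Submonoid (SK 𝔐)⟦X⟧ := MonoidHom.mker (constantCoeff (R := SK 𝔐))

variable [LocallyOfFiniteType 𝔐.hom] [IsSeparated 𝔐.hom]

/-- The series of classes in `K0 𝔐`. -/
def effToOne : effSeries 𝔐 →* oneSeries (K0 𝔐) where
  toFun a := ⟨PowerSeries.map (toK0 𝔐) a.1, by
    have h : constantCoeff a.1 = 1 := a.2
    change constantCoeff (PowerSeries.map (toK0 𝔐) a.1) = 1
    rw [← coeff_zero_eq_constantCoeff_apply, coeff_map, coeff_zero_eq_constantCoeff_apply, h,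
      map_one]⟩
  map_one' := Subtype.ext (map_one _)
  map_mul' _ _ := Subtype.ext (map_mul _ _ _)

theorem coeff_effToOne (a : effSeries 𝔐) (n : ℕ) :
    coeff n (effToOne a).1 = toK0 𝔐 (coeff n a.1) := coeff_map _ _ _

/-- Generating series of configurations, as a homomorphism in the labels. -/
def effConf (m : SK 𝔐) : effSeries 𝔐 →* effSeries 𝔐 where
  toFun a := ⟨confSer a.1 m, constantCoeff_confSer _ _⟩
  map_one' := by
    refine Subtype.ext (PowerSeries.ext fun n => ?_)
    change coeff n (confSer 1 m) = coeff n 1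
    rw [coeff_one]
    split_ifs with hn
    · rw [hn, coeff_zero_eq_constantCoeff_apply, constantCoeff_confSer]
    · obtain ⟨M⟩ := m
      let 𝒜 := Lbl.ofSeq fun i => coeff i (1 : (SK 𝔐)⟦X⟧)
      change coeff n (confSer 1 (ecl M)) = 0
      rw [coeff_confSer (𝒜 := 𝒜) fun i _ h0 => Lbl.ecl_ofSeq _ h0]
      -- A configuration of positive degree has a point with a label of positive degree, and there
      -- are no such labels.
      have : IsEmpty (WT.conf 𝒜 M n).carrier := by
        refine ⟨fun f : Conf 𝒜.T M.carrier n => ?_⟩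
        obtain ⟨x, hx⟩ : ∃ x, (f.1 x).1 ≠ 0 := by
          by_contra! h
          have := f.2.2
          simp [h] at this
          exact hn this.symm
        have hz : ecl (𝒜.L (f.1 x).1) = 0 := by
          rw [Lbl.ecl_ofSeq _ hx, coeff_one, if_neg hx]
        obtain ⟨g, -⟩ := ecl_eq_iff.mp hz
        exact (g (f.1 x).2).elim
      exact ecl_eq_zero _
  map_mul' a b := Subtype.ext (confSer_mul a.2 b.2 m)

/-- Generating series of symmetric powers. -/
def effSym (x : SK 𝔐) : effSeries 𝔐 := ⟨symSer x, constantCoeff_confSer _ _⟩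

/-- The class of a configuration space depends only on the classes of the labels. -/
theorem effConf_cong {a b : effSeries 𝔐} {N : ℕ} (h : Cong N (effToOne a) (effToOne b))
    (m : SK 𝔐) : Cong N (effToOne (effConf m a)) (effToOne (effConf m b)) := by
  have h' (i : ℕ) : ∃ c, i < N → coeff i a.1 + c = coeff i b.1 + c := by
    by_cases hi : i < N
    · have := h i hi
      rw [coeff_effToOne, coeff_effToOne, toK0_eq_iff] at this
      obtain ⟨c, hc⟩ := this
      exact ⟨c, fun _ => hc⟩
    · exact ⟨0, fun h => (hi h).elim⟩
  choose c hc using h'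
  -- Equality in `K0 𝔐` is equality in `SK 𝔐` after adding `c i`. With `d = (1 - q)⁻¹`, where `q` is
  -- the series of the `c i`, one has `a d = 1 + (a - 1 + q) d`. So `a d` and `b d` agree below `N`
  -- in `SK 𝔐` itself, and the contribution of `d` cancels at the end.
  obtain ⟨d, hd1, hd⟩ := exists_eq_one_add_mul c
  set q : (SK 𝔐)⟦X⟧ := PowerSeries.mk fun i => if i = 0 then 0 else c i with hq
  let d' : effSeries 𝔐 := ⟨d, hd1⟩
  have key (e : effSeries 𝔐) : e.1 * d = 1 + (PowerSeries.mk fun i => if i = 0 then 0 else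
      coeff i e.1 + c i) * d := by
    have he : e.1 = 1 + PowerSeries.mk fun i => if i = 0 then 0 else coeff i e.1 := by
      ext i
      rw [map_add, coeff_one, coeff_mk]
      split_ifs with h
      · rw [h, coeff_zero_eq_constantCoeff_apply, show constantCoeff e.1 = 1 from e.2, add_zero]
      · rw [zero_add]
    have hs : (PowerSeries.mk fun i => if i = 0 then 0 else coeff i e.1 + c i) =
        (PowerSeries.mk fun i => if i = 0 then 0 else coeff i e.1) + q := by
      ext i
      rw [map_add, hq, coeff_mk, coeff_mk, coeff_mk]
      split_ifs
      · rw [add_zero]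
      · rfl
    rw [hs, add_mul, add_left_comm, ← hd]
    nth_rw 1 [he]
    rw [add_mul, one_mul, add_comm]
  have h₁ (i : ℕ) (hi : i < N) : coeff i (a * d').1 = coeff i (b * d').1 := by
    change coeff i (a.1 * d) = coeff i (b.1 * d)
    rw [key, key, map_add, map_add, coeff_mul, coeff_mul]
    congr 1
    refine Finset.sum_congr rfl fun p hp => ?_
    have := Finset.HasAntidiagonal.mem_antidiagonal.mp hp
    rw [coeff_mk, coeff_mk, hc p.1 (by omega)]
  have h₂ : Cong N (effToOne (effConf m (a * d'))) (effToOne (effConf m (b * d'))) :=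
    fun i hi => by
      rw [coeff_effToOne, coeff_effToOne]
      exact congrArg _ (coeff_confSer_congr (fun j hj => h₁ j (by omega)) m)
  rw [map_mul, map_mul, map_mul, map_mul] at h₂
  have h₃ := h₂.mul (Cong.refl (effToOne (effConf m d'))⁻¹)
  rwa [mul_inv_cancel_right, mul_inv_cancel_right] at h₃

/-- Every series over `K0 𝔐` is a quotient of effective series. -/
theorem exists_effToOne_div (A : oneSeries (K0 𝔐)) :
    ∃ a b : effSeries 𝔐, A = effToOne a * (effToOne b)⁻¹ := by
  choose p q hpq using fun i => exists_toK0_sub (coeff i A.1)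
  obtain ⟨b, hb1, hb⟩ := exists_eq_one_add_mul q
  set q' : (SK 𝔐)⟦X⟧ := PowerSeries.mk fun i => if i = 0 then 0 else q i
  let p' : (SK 𝔐)⟦X⟧ := PowerSeries.mk fun i => if i = 0 then 0 else p i
  -- Here `A = 1 + p' - q'` and `b = (1 - q')⁻¹`, so `A b = 1 + p' b` is effective.
  refine ⟨⟨1 + p' * b, ?_⟩, ⟨b, hb1⟩, ?_⟩
  · change constantCoeff (1 + p' * b) = 1
    rw [map_add, map_mul, ← coeff_zero_eq_constantCoeff_apply p', coeff_mk, if_pos rfl, zero_mul,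
      map_one, add_zero]
  · rw [_root_.eq_mul_inv_iff_mul_eq]
    refine Subtype.ext ?_
    change A.1 * PowerSeries.map (toK0 𝔐) b = PowerSeries.map (toK0 𝔐) (1 + p' * b)
    have hA : A.1 = 1 + PowerSeries.map (toK0 𝔐) p' - PowerSeries.map (toK0 𝔐) q' := by
      ext i
      rw [map_sub, map_add, coeff_map, coeff_map, coeff_mk, coeff_mk, coeff_one]
      split_ifs with h
      · rw [h, coeff_zero_oneSeries]; simp
      · rw [hpq i, zero_add]
    have hb' := congrArg (PowerSeries.map (toK0 𝔐)) hb
    rw [map_add, map_mul, map_one] at hb'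
    rw [map_add, map_mul, map_one, hA, sub_mul, add_mul, one_mul]
    linear_combination hb'

/-- The homomorphism of series given by configurations. -/
def confHom (m : SK 𝔐) (A : oneSeries (K0 𝔐)) : oneSeries (K0 𝔐) :=
  effToOne (effConf m (exists_effToOne_div A).choose) *
    (effToOne (effConf m (exists_effToOne_div A).choose_spec.choose))⁻¹

/-- Independence of the chosen fraction, including its truncated form: cross-multiplication reduces
it to `effConf_cong`, and multiplicativity of `effConf` undoes it. -/
theorem confHom_cong {m : SK 𝔐} {A : oneSeries (K0 𝔐)} {a b : effSeries 𝔐} {N : ℕ}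
    (h : Cong N A (effToOne a * (effToOne b)⁻¹)) :
    Cong N (confHom m A) (effToOne (effConf m a) * (effToOne (effConf m b))⁻¹) := by
  have hA := (exists_effToOne_div A).choose_spec.choose_spec
  set a' := (exists_effToOne_div A).choose
  set b' := (exists_effToOne_div A).choose_spec.choose
  have h₁ : Cong N (effToOne (a' * b)) (effToOne (a * b')) := by
    rw [hA] at h
    have := h.mul (Cong.refl (effToOne b' * effToOne b))
    rw [map_mul, map_mul]
    rwa [mul_assoc, inv_mul_cancel_left, mul_comm (effToOne b'), mul_assoc (effToOne a),
      inv_mul_cancel_left] at this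
  have h₂ := (effConf_cong h₁ m).mul
    (Cong.refl ((effToOne (effConf m b'))⁻¹ * (effToOne (effConf m b))⁻¹))
  rw [map_mul, map_mul, map_mul, map_mul, mul_mul_mul_comm, mul_inv_cancel, mul_one] at h₂
  rwa [mul_assoc (effToOne (effConf m a)), mul_inv_cancel_left] at h₂

theorem confHom_eq (m : SK 𝔐) (a b : effSeries 𝔐) : confHom m (effToOne a * (effToOne b)⁻¹) =
    effToOne (effConf m a) * (effToOne (effConf m b))⁻¹ :=
  Cong.eq fun _ => confHom_cong (Cong.refl _)

theorem confHom_effToOne (m : SK 𝔐) (a : effSeries 𝔐) :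
    confHom m (effToOne a) = effToOne (effConf m a) := by
  simpa using confHom_eq m a 1

theorem confHom_mul (m : SK 𝔐) (A B : oneSeries (K0 𝔐)) :
    confHom m (A * B) = confHom m A * confHom m B := by
  obtain ⟨a, b, rfl⟩ := exists_effToOne_div A
  obtain ⟨c, d, rfl⟩ := exists_effToOne_div B
  rw [mul_mul_mul_comm, ← map_mul, ← mul_inv, ← map_mul, confHom_eq, confHom_eq, confHom_eq,
    map_mul, map_mul, map_mul, map_mul, mul_inv, mul_mul_mul_comm]

theorem truncCont_confHom (m : SK 𝔐) : TruncCont (confHom m) := fun N => ⟨N, fun A B h => by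
  obtain ⟨a, b, rfl⟩ := exists_effToOne_div B
  rw [confHom_eq]
  exact confHom_cong h⟩

/-- The zeta function as a homomorphism. -/
def zetaHom : SK 𝔐 →+ Additive (oneSeries (K0 𝔐)) where
  toFun x := Additive.ofMul (effToOne (effSym x))
  map_zero' := by
    have : effSym (0 : SK 𝔐) = 1 := Subtype.ext (confSer_zero _)
    rw [this, map_one, ofMul_one]
  map_add' x y := by
    have : effSym (x + y) = effSym x * effSym y := Subtype.ext (confSer_add _ x y)
    rw [this, map_mul, ofMul_mul]

/-- The Adams operations. -/
def psiK0 (k : ℕ) : K0 𝔐 →+* K0 𝔐 :=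
  let f : K0 𝔐 →+ K0 𝔐 := liftK0 ((toK0 𝔐).toAddMonoidHom.comp (SK.push k).toAddMonoidHom)
  have hf (s : SK 𝔐) : f (toK0 𝔐 s) = toK0 𝔐 (SK.push k s) := liftK0_toK0 _ s
  { f with
    map_one' := by
      change f 1 = 1
      rw [← map_one (toK0 𝔐), hf, map_one]
    map_mul' := fun x y => by
      change f (x * y) = f x * f y
      obtain ⟨a, b, rfl⟩ := exists_toK0_sub x
      obtain ⟨c, d, rfl⟩ := exists_toK0_sub y
      simp only [sub_mul, mul_sub, ← map_mul, map_sub, hf] }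

theorem psiK0_toK0 (k : ℕ) (s : SK 𝔐) : psiK0 k (toK0 𝔐 s) = toK0 𝔐 (SK.push k s) :=
  liftK0_toK0 _ s

theorem psiK0_cls (k : ℕ) (V : RelVar 𝔐) : psiK0 k (cls V) = cls (V.push k) := by
  rw [← toK0_ofVar, psiK0_toK0, ← toK0_ofVar, SK.push_ecl]
  congr 1
  exact ecl_eq (S := (WT.ofVar V).push k) (T := WT.ofVar (V.push k)) (Equiv.refl _) DefMap.id
    fun v => (compHom (𝔐 := 𝔐) (show pts V.X from v)).map_nsmul k V.p

theorem SK.push_one (s : SK 𝔐) : SK.push 1 s = s := by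
  obtain ⟨S⟩ := s
  exact ecl_eq (S := S.push 1) (T := S) (Equiv.refl _) DefMap.id fun s => (one_nsmul _).symm

theorem SK.push_push (m k : ℕ) (s : SK 𝔐) : SK.push (m * k) s = SK.push m (SK.push k s) := by
  obtain ⟨S⟩ := s
  exact ecl_eq (S := S.push (m * k)) (T := (S.push k).push m) (Equiv.refl _) DefMap.id
    fun s => (mul_nsmul' (S.w s) m k).symm

variable (𝔐) in
/-- The zeta functions and Adams operations of `K0 𝔐`. -/
def zetaK0 : ZetaRing (K0 𝔐) where
  zeta x := (liftK0 (zetaHom (𝔐 := 𝔐)) x).toMul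
  zeta_add x y := by rw [map_add, toMul_add]
  coeff_one_zeta x := by
    obtain ⟨a, b, rfl⟩ := exists_toK0_sub x
    rw [map_sub, liftK0_toK0, liftK0_toK0]
    change coeff 1 (effToOne (effSym a) * (effToOne (effSym b))⁻¹).1 = _
    have h (A : oneSeries (K0 𝔐)) : Cong 1 A 1 := fun i hi => by
      obtain rfl : i = 0 := by omega
      exact (coeff_zero_oneSeries _).trans (coeff_zero_oneSeries _).symm
    rw [ZetaRing.coeff_mul_of_cong (h _) one_ne_zero, ZetaRing.coeff_inv_of_cong (h _) one_ne_zero,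
      coeff_effToOne, coeff_effToOne, effSym, effSym, coeff_one_symSer, coeff_one_symSer,
      sub_eq_add_neg]
  zeta_one := by
    rw [← map_one (toK0 𝔐), liftK0_toK0]
    change effToOne (effSym 1) = _
    refine oneSeries_ext fun i => ?_
    rw [coeff_effToOne, effSym]
    change toK0 𝔐 (coeff i (confSer (PowerSeries.mk 1) 1)) = _
    rw [confSer_one]
    · change toK0 𝔐 (coeff i (PowerSeries.mk 1)) =
        coeff i (PowerSeries.mk fun i => if i = 0 then 1 else toK0 𝔐 1)
      simp
    · rw [← coeff_zero_eq_constantCoeff_apply, coeff_mk]; rfl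
  psi := psiK0
  psi_one r := by
    obtain ⟨a, b, rfl⟩ := exists_toK0_sub r
    rw [map_sub, psiK0_toK0, psiK0_toK0, SK.push_one, SK.push_one]
  psi_mul m k r := by
    obtain ⟨a, b, rfl⟩ := exists_toK0_sub r
    simp only [map_sub, psiK0_toK0, SK.push_push]

theorem zetaK0_toK0 (s : SK 𝔐) : (zetaK0 𝔐).zeta (toK0 𝔐 s) = effToOne (effSym s) :=
  congrArg Additive.toMul (liftK0_toK0 zetaHom s)

/-- Effective series with the exponents multiplied by `k + 1`. -/
def effExpand (k : ℕ) (a : effSeries 𝔐) : effSeries 𝔐 :=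
  ⟨expandSer (k + 1) a.1, by
    change constantCoeff _ = 1
    rw [← coeff_zero_eq_constantCoeff_apply, expandSer, coeff_mk,
      Finset.sum_eq_single (⟨0, by simp⟩ : {m : Fin (0 + 1) // (k + 1) * (m : ℕ) = 0})]
    · exact (coeff_zero_eq_constantCoeff_apply _).trans a.2
    · rintro ⟨m, hm⟩ - h
      exact (h (Subtype.ext (Fin.ext (by omega)))).elim
    · simp⟩

theorem effToOne_effExpand (k : ℕ) (a : effSeries 𝔐) :
    effToOne (effExpand k a) = expandOne (k + 1) k.succ_ne_zero (effToOne a) :=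
  oneSeries_ext fun j => by
    rw [coeff_effToOne]
    change toK0 𝔐 (coeff j (expandSer (k + 1) a.1)) = coeff j (expand (k + 1) _ (effToOne a).1)
    rw [expandSer, coeff_mk, coeff_expand]
    split_ifs with h
    · obtain ⟨q, rfl⟩ := h
      rw [Nat.mul_div_cancel_left _ k.succ_pos, coeff_effToOne,
        Finset.sum_eq_single (⟨⟨q, by nlinarith⟩, rfl⟩ :
          {m : Fin ((k + 1) * q + 1) // (k + 1) * (m : ℕ) = (k + 1) * q})]
      · rintro ⟨m, hm⟩ - h
        exact (h (Subtype.ext (Fin.ext (Nat.eq_of_mul_eq_mul_left k.succ_pos hm)))).elim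
      · simp
    · rw [Finset.sum_eq_zero, map_zero]
      rintro ⟨m, hm⟩ -
      exact (h ⟨m, hm.symm⟩).elim

/-- Both sides are homomorphisms in `A` that respect truncation, so factors suffice. A factor is a
quotient of effective factors, where `confSer_expandSer` gives exactly the rule `a ↦ ψ_{k+1}(m) a`.
-/
theorem confHom_eq_pow (m : SK 𝔐) (A : oneSeries (K0 𝔐)) :
    confHom m A = (zetaK0 𝔐).power.pow A (toK0 𝔐 m) := by
  refine (zetaK0 𝔐).hom_ext (confHom_mul m) (fun A B => PowerStructure.mul_pow _ A B _)
    (truncCont_confHom m) ((zetaK0 𝔐).truncCont_power _) (fun k x => ?_) A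
  have hf (p : SK 𝔐) : (zetaK0 𝔐).factor k (toK0 𝔐 p) = effToOne (effExpand k (effSym p)) := by
    rw [ZetaRing.factor, zetaK0_toK0, effToOne_effExpand]
  have hc (p : SK 𝔐) : effConf m (effExpand k (effSym p)) =
      effExpand k (effSym (SK.push (k + 1) m * p)) := Subtype.ext (confSer_expandSer (k + 1) p m)
  obtain ⟨p, q, rfl⟩ := exists_toK0_sub x
  rw [ZetaRing.power_factor, sub_eq_add_neg, ZetaRing.factor_add, ZetaRing.factor_neg, hf, hf,
    confHom_eq, hc, hc, ← hf, ← hf, ← ZetaRing.factor_neg, ← ZetaRing.factor_add, map_mul, map_mul,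
    ← sub_eq_add_neg, ← sub_eq_add_neg, ← mul_sub]
  congr 2
  exact (psiK0_toK0 _ _).symm

theorem effConf_eq_pow (m : SK 𝔐) (a : effSeries 𝔐) :
    effToOne (effConf m a) = (zetaK0 𝔐).power.pow (effToOne a) (toK0 𝔐 m) := by
  rw [← confHom_effToOne, confHom_eq_pow]

/-! ### Geometric power structures -/

/-- Graded labels from a sequence of varieties. -/
def varSeq (A : ℕ → RelVar 𝔐) (i : ℕ) : RelVar 𝔐 := match i with
  | 0 => RelVar.pt 𝔐
  | i + 1 => A (i + 1)

/-- Graded labels from a sequence of varieties. -/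
def varLbl (A : ℕ → RelVar 𝔐) : Lbl 𝔐 where
  L i := WT.ofVar (varSeq A i)
  uniq := { default := (𝟙 _ : pts (𝟙_ CSch)), uniq := fun a => toUnit_unique a _ }
  w_default := (AddMonObj.comp_zero (𝟙 (𝟙_ CSch)))

/-- The effective series of a sequence of varieties. -/
def varSer (A : ℕ → RelVar 𝔐) : effSeries 𝔐 :=
  ⟨PowerSeries.mk fun i => ecl ((varLbl A).L i), by
    change constantCoeff _ = 1
    rw [← coeff_zero_eq_constantCoeff_apply, coeff_mk]
    exact ecl_eq_one _ (varLbl A).w_default⟩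

theorem effToOne_varSer (A : ℕ → RelVar 𝔐) :
    effToOne (varSer A) = mkOne fun i => cls (A i) := oneSeries_ext fun i => by
  rw [coeff_effToOne]
  change toK0 𝔐 (coeff i (PowerSeries.mk fun i => ecl (WT.ofVar (varSeq A i)))) =
    coeff i (PowerSeries.mk fun i => if i = 0 then 1 else cls (A i))
  rw [coeff_mk, coeff_mk, toK0_ofVar]
  rcases i with _ | i
  · rfl
  · rfl

theorem toK0_conf_varLbl (A : ℕ → RelVar 𝔐) (M : RelVar 𝔐) (n : ℕ)
    (Q : ∀ α : n.Partition, ConfigQuotient A M α) :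
    toK0 𝔐 (ecl (WT.conf (varLbl A) (WT.ofVar M) n)) = ∑ α, cls (Q α).B := by
  -- Parts have positive size, so a configuration quotient never refers to `A 0`, and replacing `A
  -- 0` by a point leaves it unchanged.
  let Q' (α : n.Partition) : ConfigQuotient (varSeq A) M α :=
    ⟨(Q α).Y, (Q α).incl, (Q α).incl_open, (Q α).incl_range, (Q α).act, (Q α).act_comp, (Q α).B,
      (Q α).proj, (Q α).quotient, (Q α).weight_eq⟩
  let _ : Unique (Labs (varSeq A) 0) := (varLbl A).uniq
  refine toK0_ecl ?_
  exact hasClass_conf (A := varSeq A) (M := M) (n := n)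
    (fun a => AddMonObj.comp_zero (show 𝟙_ CSch ⟶ 𝟙_ CSch from a)) Q'

variable (𝔐) in
theorem isGeometric_power : (zetaK0 𝔐).power.IsGeometric := fun A M n Q => by
  rw [← effToOne_varSer, ← toK0_ofVar M, ← effConf_eq_pow, coeff_effToOne,
    ← toK0_conf_varLbl A M n Q]
  congr 1
  exact coeff_confSer fun i _ _ => (coeff_mk i fun i => ecl ((varLbl A).L i)).symm

/-- On effective data, affine representatives are chosen; their quotients exist and both structures
are computed by them. The axioms extend the equality to quotients of series and differences of
exponents. -/
theorem eq_power_of_isGeometric (P : PowerStructure (K0 𝔐)) (h : P.IsGeometric) :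
    P = (zetaK0 𝔐).power := by
  have heff (a : effSeries 𝔐) (m : SK 𝔐) :
      P.pow (effToOne a) (toK0 𝔐 m) = (zetaK0 𝔐).power.pow (effToOne a) (toK0 𝔐 m) := by
    choose V hV hVe using fun i => (coeff i a.1).exists_affine
    obtain ⟨M, hM, rfl⟩ := m.exists_affine
    have ha : effToOne a = mkOne fun i => cls (V i) := oneSeries_ext fun i => by
      rw [coeff_effToOne, ← hVe, toK0_ofVar]
      change _ = coeff i (PowerSeries.mk fun i => if i = 0 then 1 else cls (V i))
      rw [coeff_mk]
      split_ifs with hi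
      · rw [← toK0_ofVar, hVe, hi, coeff_zero_eq_constantCoeff_apply, a.2, map_one]
      · rfl
    rw [toK0_ofVar, ha]
    refine oneSeries_ext fun n => ?_
    rw [h V M n fun α => (nonempty_configQuotient V M α).some,
      isGeometric_power 𝔐 V M n fun α => (nonempty_configQuotient V M α).some]
  refine PowerStructure.ext (funext fun A => funext fun r => ?_)
  obtain ⟨a, b, rfl⟩ := exists_effToOne_div A
  obtain ⟨m, m', rfl⟩ := exists_toK0_sub r
  simp only [PowerStructure.mul_pow, PowerStructure.inv_pow, sub_eq_add_neg,
    PowerStructure.pow_add, PowerStructure.pow_neg, heff]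

end MotivicPower

namespace MotivicPower

/-! ### Extension of zeta functions to localizations and quadratic extensions -/

open PowerSeries

theorem mapOne_mapOne {R S T : Type*} [CommRing R] [CommRing S] [CommRing T] (φ : R →+* S)
    (θ : S →+* T) (A : oneSeries R) : mapOne θ (mapOne φ A) = mapOne (θ.comp φ) A :=
  oneSeries_ext fun i => by
    change coeff i (PowerSeries.map θ (PowerSeries.map φ A.1)) =
      coeff i (PowerSeries.map (θ.comp φ) A.1)
    simp

theorem coeff_one_scaleOne {R : Type*} [CommRing R] (c : R) (A : oneSeries R) :
    coeff 1 (scaleOne c A).1 = c * coeff 1 A.1 := by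
  change coeff 1 (rescale c A.1) = _
  rw [coeff_rescale, pow_one]

theorem coeff_one_mul {R : Type*} [CommRing R] (A B : oneSeries R) :
    coeff 1 (A * B).1 = coeff 1 A.1 + coeff 1 B.1 :=
  ZetaRing.coeff_mul_of_cong (fun i hi => by
    obtain rfl : i = 0 := by omega
    exact (coeff_zero_oneSeries _).trans (coeff_zero_oneSeries _).symm) one_ne_zero

/-- Multiplication by `l` rescales zeta functions, and `l` is fixed by the Adams operations. -/
structure ZetaRing.IsLef {R : Type*} [CommRing R] (Z : ZetaRing R) (l : R) : Prop where
  zeta : ∀ a, Z.zeta (l * a) = scaleOne l (Z.zeta a)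
  psi : ∀ k, Z.psi k l = l

/-! ### Inverting the Lefschetz element. -/

section Localization

variable {R S : Type*} [CommRing R] [CommRing S] [Algebra R S] {Z : ZetaRing R} {l : R}

theorem ZetaRing.IsLef.zeta_pow (hl : Z.IsLef l) (n : ℕ) (a : R) :
    Z.zeta (l ^ n * a) = scaleOne (l ^ n) (Z.zeta a) := by
  induction n generalizing a with
  | zero => rw [pow_zero, one_mul, scaleOne_one]
  | succ n ih => rw [pow_succ, mul_assoc, ih, hl.zeta, scaleOne_scaleOne]

variable [IsLocalization.Away l S] {u : Sˣ}

/-- The zeta function of a localization. -/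
def locZeta (Z : ZetaRing R) (l : R) [IsLocalization.Away l S] (u : Sˣ) (s : S) : oneSeries S :=
  scaleOne ((u⁻¹ : Sˣ) ^ (IsLocalization.Away.surj l s).choose : S)
    (mapOne (algebraMap R S) (Z.zeta (IsLocalization.Away.surj l s).choose_spec.choose))

theorem scaleOne_inv_pow (u : Sˣ) (m n : ℕ) (A : oneSeries S) :
    scaleOne ((u⁻¹ : Sˣ) ^ (m + n) : S) (scaleOne ((u : S) ^ m) A) =
      scaleOne ((u⁻¹ : Sˣ) ^ n : S) A := by
  rw [scaleOne_scaleOne, pow_add, mul_right_comm, ← mul_pow, Units.inv_mul, one_pow, one_mul]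

/-- The definition does not depend on the fraction: two numerators for the same element agree after
multiplication by powers of `l`, and `IsLef.zeta_pow` turns these powers into rescalings, which are
invertible over `S`. -/
theorem locZeta_eq (hu : (u : S) = algebraMap R S l) (hl : Z.IsLef l) {s : S} {n : ℕ} {a : R}
    (h : s * (u : S) ^ n = algebraMap R S a) : locZeta Z l u s =
      scaleOne ((u⁻¹ : Sˣ) ^ n : S) (mapOne (algebraMap R S) (Z.zeta a)) := by
  suffices H : ∀ (m : ℕ) (b : R), s * algebraMap R S l ^ m = algebraMap R S b →
      scaleOne ((u⁻¹ : Sˣ) ^ m : S) (mapOne (algebraMap R S) (Z.zeta b)) =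
        scaleOne ((u⁻¹ : Sˣ) ^ n : S) (mapOne (algebraMap R S) (Z.zeta a)) from
    H _ _ (IsLocalization.Away.surj l s).choose_spec.choose_spec
  intro m b h'
  rw [← hu] at h'
  obtain ⟨c, hc⟩ := IsLocalization.Away.exists_of_eq (S := S) l (a := l ^ m * a) (b := l ^ n * b)
    (by rw [map_mul, map_mul, ← h, ← h', map_pow, map_pow, ← hu]; ring)
  rw [← mul_assoc, ← mul_assoc, ← pow_add, ← pow_add] at hc
  have h₁ := congrArg (fun x => mapOne (algebraMap R S) (Z.zeta x)) hc
  rw [hl.zeta_pow, hl.zeta_pow, mapOne_scaleOne, mapOne_scaleOne, map_pow, map_pow, ← hu] at h₁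
  rw [← scaleOne_inv_pow u (c + m) n, h₁, ← scaleOne_inv_pow u (c + n) m,
    add_right_comm c n m]

/-- The Adams operations of a localization. -/
def locPsi (hu : (u : S) = algebraMap R S l) (hl : Z.IsLef l) (k : ℕ) : S →+* S :=
  IsLocalization.Away.lift l (g := (algebraMap R S).comp (Z.psi k)) (by
    rw [RingHom.comp_apply, hl.psi, ← hu]; exact u.isUnit)

theorem locPsi_algebraMap (hu : (u : S) = algebraMap R S l) (hl : Z.IsLef l) (k : ℕ) (a : R) :
    locPsi hu hl k (algebraMap R S a) = algebraMap R S (Z.psi k a) :=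
  IsLocalization.Away.lift_eq _ _ _

/-- The zeta functions and Adams operations of a localization. -/
def locZetaRing (hu : (u : S) = algebraMap R S l) (hl : Z.IsLef l) : ZetaRing S where
  zeta := locZeta Z l u
  zeta_add s t := by
    obtain ⟨m, a, ha⟩ := IsLocalization.Away.surj l s
    obtain ⟨n, b, hb⟩ := IsLocalization.Away.surj l t
    rw [← hu] at ha hb
    rw [locZeta_eq hu hl ha, locZeta_eq hu hl hb,
      locZeta_eq hu hl (n := m + n) (a := l ^ n * a + l ^ m * b) (by
        rw [map_add, map_mul, map_mul, ← ha, ← hb, map_pow, map_pow, ← hu]; ring),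
      Z.zeta_add, mapOne_mul, scaleOne_mul, hl.zeta_pow, hl.zeta_pow, mapOne_scaleOne,
      mapOne_scaleOne, map_pow, map_pow, ← hu, scaleOne_inv_pow u m n, add_comm m n,
      scaleOne_inv_pow u n m]
  coeff_one_zeta s := by
    obtain ⟨m, a, ha⟩ := IsLocalization.Away.surj l s
    rw [← hu] at ha
    rw [locZeta_eq hu hl ha, coeff_one_scaleOne]
    change _ * coeff 1 (PowerSeries.map (algebraMap R S) (Z.zeta a).1) = _
    rw [coeff_map, Z.coeff_one_zeta, ← ha, mul_left_comm, ← mul_pow, Units.inv_mul, one_pow,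
      mul_one]
  zeta_one := by
    rw [locZeta_eq hu hl (n := 0) (a := 1) (by simp), pow_zero, scaleOne_one, Z.zeta_one,
      mapOne_mkOne_one]
  psi := locPsi hu hl
  psi_one r := by
    refine RingHom.congr_fun (g := RingHom.id S) (IsLocalization.ringHom_ext (Submonoid.powers l)
      (RingHom.ext fun a => ?_)) r
    simp [Z.psi_one, locPsi_algebraMap]
  psi_mul m k r := by
    refine RingHom.congr_fun (g := (locPsi hu hl m).comp (locPsi hu hl k))
      (IsLocalization.ringHom_ext (Submonoid.powers l) (RingHom.ext fun a => ?_)) r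
    simp [Z.psi_mul, locPsi_algebraMap]

theorem compat_locZetaRing (hu : (u : S) = algebraMap R S l) (hl : Z.IsLef l) :
    ZetaRing.Compat (algebraMap R S) Z (locZetaRing hu hl) where
  zeta a := by
    change locZeta Z l u _ = _
    rw [locZeta_eq hu hl (n := 0) (a := a) (by simp), pow_zero, scaleOne_one]
  psi k r _ := locPsi_algebraMap hu hl k r

theorem isLef_locZetaRing (hu : (u : S) = algebraMap R S l) (hl : Z.IsLef l) :
    (locZetaRing hu hl).IsLef (u : S) where
  zeta s := by
    obtain ⟨m, a, ha⟩ := IsLocalization.Away.surj l s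
    rw [← hu] at ha
    change locZeta Z l u _ = scaleOne _ (locZeta Z l u _)
    rw [locZeta_eq hu hl ha, locZeta_eq hu hl (n := m) (a := l * a) (by
      rw [map_mul, ← ha, ← hu]; ring), hl.zeta, mapOne_scaleOne, ← hu, scaleOne_scaleOne,
      scaleOne_scaleOne, mul_comm]
  psi k := by
    rw [hu]
    exact (locPsi_algebraMap hu hl k l).trans (by rw [hl.psi])

end Localization

/-! ### Adjoining a square root. -/

section Quadratic

/-- Coordinates in a quadratic extension. -/
theorem existsUnique_adjoinRoot {R : Type*} [CommRing R] (u : R)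
    (x : AdjoinRoot (Polynomial.X ^ 2 - Polynomial.C u)) :
    ∃! c : R × R, x = AdjoinRoot.of _ c.1 + AdjoinRoot.of _ c.2 * AdjoinRoot.root _ := by
  -- The degree arguments below need a nontrivial ring; over the zero ring there is nothing to
  -- prove.
  rcases subsingleton_or_nontrivial R with hR | hR
  · have h₀ : (0 : AdjoinRoot (Polynomial.X ^ 2 - Polynomial.C u)) = 1 := by
      rw [← map_one (AdjoinRoot.of _), ← map_zero (AdjoinRoot.of _), Subsingleton.elim (0 : R) 1]
    have := subsingleton_of_zero_eq_one h₀
    exact ⟨0, Subsingleton.elim _ _, fun _ _ => Subsingleton.elim _ _⟩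
  have hg : (Polynomial.X ^ 2 - Polynomial.C u : Polynomial R).Monic := Polynomial.monic_X_pow_sub_C u two_ne_zero
  have hd : (Polynomial.X ^ 2 - Polynomial.C u : Polynomial R).degree = 2 := Polynomial.degree_X_pow_sub_C two_pos u
  have hmk (a b : R) : AdjoinRoot.of (Polynomial.X ^ 2 - Polynomial.C u) a + AdjoinRoot.of _ b * AdjoinRoot.root _ =
      AdjoinRoot.mk _ (Polynomial.C a + Polynomial.C b * Polynomial.X) := by simp
  have hdeg (a b : R) : (Polynomial.C a + Polynomial.C b * Polynomial.X).degree < (Polynomial.X ^ 2 - Polynomial.C u : Polynomial R).degree := by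
    rw [hd, add_comm]
    exact Polynomial.degree_linear_lt
  refine ⟨((AdjoinRoot.modByMonicHom hg x).coeff 0, (AdjoinRoot.modByMonicHom hg x).coeff 1),
    ?_, ?_⟩
  · dsimp only
    rw [hmk]
    conv_lhs => rw [← AdjoinRoot.mk_leftInverse hg x]
    congr 1
    have h : (AdjoinRoot.modByMonicHom hg x).degree ≤ 1 := by
      obtain ⟨f, rfl⟩ := AdjoinRoot.mk_surjective x
      rw [AdjoinRoot.modByMonicHom_mk]
      have := Polynomial.degree_modByMonic_lt f hg
      rw [hd] at this
      exact Order.le_of_lt_succ this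
    rw [add_comm]
    exact Polynomial.eq_X_add_C_of_degree_le_one h
  · rintro ⟨a, b⟩ rfl
    dsimp only
    rw [hmk, AdjoinRoot.modByMonicHom_mk, (Polynomial.modByMonic_eq_self_iff hg).mpr (hdeg a b)]
    simp

variable {R S : Type*} [CommRing R] [CommRing S] {Z : ZetaRing R} {u : R} {φ : R →+* S} {s : S}

/-- The zeta function of a quadratic extension. -/
def quadZeta (Z : ZetaRing R) (hs : ∀ x : S, ∃! c : R × R, x = φ c.1 + φ c.2 * s) (x : S) :
    oneSeries S :=
  mapOne φ (Z.zeta (hs x).choose.1) * scaleOne s (mapOne φ (Z.zeta (hs x).choose.2))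

theorem quadZeta_eq {hs : ∀ x : S, ∃! c : R × R, x = φ c.1 + φ c.2 * s} {x : S} {a b : R}
    (h : x = φ a + φ b * s) : quadZeta Z hs x =
      mapOne φ (Z.zeta a) * scaleOne s (mapOne φ (Z.zeta b)) := by
  have : (a, b) = (hs x).choose := (hs x).choose_spec.2 (a, b) h
  rw [quadZeta, ← this]

/-- The zeta functions and Adams operations of a quadratic extension. -/
def quadZetaRing (hs : ∀ x : S, ∃! c : R × R, x = φ c.1 + φ c.2 * s) (psi : ℕ → S →+* S)
    (hψs : ∀ k, psi k s = s) (hψ : ∀ k r, psi k (φ r) = φ (Z.psi k r)) : ZetaRing S where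
  zeta := quadZeta Z hs
  zeta_add x y := by
    obtain ⟨⟨a, b⟩, h, -⟩ := hs x
    obtain ⟨⟨c, d⟩, h', -⟩ := hs y
    dsimp only at h h'
    rw [quadZeta_eq h, quadZeta_eq h', quadZeta_eq (a := a + c) (b := b + d) (by
      rw [h, h', map_add, map_add]; ring), Z.zeta_add, Z.zeta_add, mapOne_mul, mapOne_mul,
      scaleOne_mul, mul_mul_mul_comm]
  coeff_one_zeta x := by
    obtain ⟨⟨a, b⟩, h, -⟩ := hs x
    dsimp only at h
    have hm (a : R) : coeff 1 (mapOne φ (Z.zeta a)).1 = φ a := by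
      change coeff 1 (PowerSeries.map φ (Z.zeta a).1) = _
      rw [coeff_map, Z.coeff_one_zeta]
    rw [quadZeta_eq h, coeff_one_mul, coeff_one_scaleOne, hm, hm, h, mul_comm]
  zeta_one := by
    have h0 : scaleOne s (mapOne φ (Z.zeta 0)) = 1 := by
      have := scaleOne_mul s (mapOne φ (Z.zeta 0)) (mapOne φ (Z.zeta 0))
      rw [← mapOne_mul, ← Z.zeta_add, add_zero] at this
      exact left_eq_mul.mp this
    rw [quadZeta_eq (a := 1) (b := 0) (by simp), h0, mul_one, Z.zeta_one, mapOne_mkOne_one]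
  psi := psi
  psi_one x := by
    obtain ⟨⟨a, b⟩, h, -⟩ := hs x
    dsimp only at h
    rw [h, map_add, map_mul, hψ, hψ, hψs, Z.psi_one, Z.psi_one]
  psi_mul m k x := by
    obtain ⟨⟨a, b⟩, h, -⟩ := hs x
    dsimp only at h
    simp only [h, map_add, map_mul, hψ, hψs, Z.psi_mul]

variable {hs : ∀ x : S, ∃! c : R × R, x = φ c.1 + φ c.2 * s} {psi : ℕ → S →+* S}
    {hψs : ∀ k, psi k s = s} {hψ : ∀ k r, psi k (φ r) = φ (Z.psi k r)}

theorem compat_quadZetaRing : ZetaRing.Compat φ Z (quadZetaRing hs psi hψs hψ) where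
  zeta a := by
    have h0 : scaleOne s (mapOne φ (Z.zeta 0)) = 1 := by
      have := scaleOne_mul s (mapOne φ (Z.zeta 0)) (mapOne φ (Z.zeta 0))
      rw [← mapOne_mul, ← Z.zeta_add, add_zero] at this
      exact left_eq_mul.mp this
    change quadZeta Z hs _ = _
    rw [quadZeta_eq (a := a) (b := 0) (by simp), h0, mul_one]
  psi k r _ := hψ k r

/-- Since `s(a + bs) = ub + as`, multiplication by `s` exchanges the coordinates up to `u = s²`, and
the rescaling by `u` is the rescaling by `s` applied twice. -/
theorem isLef_quadZetaRing (hss : s * s = φ u) (hl : Z.IsLef u) :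
    (quadZetaRing hs psi hψs hψ).IsLef s where
  zeta x := by
    obtain ⟨⟨a, b⟩, h, -⟩ := hs x
    dsimp only at h
    change quadZeta Z hs _ = scaleOne s (quadZeta Z hs _)
    rw [quadZeta_eq h, quadZeta_eq (a := u * b) (b := a) (by
      rw [h, map_mul, ← hss]; ring), hl.zeta, mapOne_scaleOne, scaleOne_mul, scaleOne_scaleOne,
      hss, mul_comm]
  psi := hψs

end Quadratic

/-! ### Characterization of the extensions -/

variable {𝔐 : CSch} [AddMonObj 𝔐] [IsCommAddMonObj 𝔐] [LocallyOfFiniteType 𝔐.hom]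
  [IsSeparated 𝔐.hom] {R : Type*} [CommRing R] {φ : K0 𝔐 →+* R} {u : Rˣ}

/-- The substitution rule for `u^k [V]` holds because the Adams operations fix `u` and restrict to
`n_*` on classes of varieties. -/
theorem isZetaExtension_power {W : ZetaRing R} (h : ZetaRing.Compat φ (zetaK0 𝔐) W)
    (hl : W.IsLef (u : R)) : W.power.IsZetaExtension φ u (zetaK0 𝔐).power where
  extends_base := h.extends
  finitelyDetermined := W.finitelyDetermined_power
  push n hn A V k := by
    rw [W.power_expandOne, map_mul, h.psi n _ hn]
    have h₁ : Units.map (W.psi n).toMonoidHom u = u := Units.ext (hl.psi n)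
    have h₂ : W.psi n ((u ^ k : Rˣ) : R) = ((u ^ k : Rˣ) : R) := by
      have := congrArg Units.val (map_zpow (Units.map (W.psi n).toMonoidHom) u k)
      rw [h₁] at this
      exact this
    rw [h₂]
    congr 4
    exact psiK0_cls n V
  zeta := ZetaRing.zetaProperty_power hl.zeta

/-- Each axiom fixes one layer: the base structure and the zeta identities fix the zeta functions,
the substitution rule fixes the powers of `ζ_a(t^(n+1))`, and finite determinacy passes from finite
products of these to all series. Additivity in the exponent permits checking on the generators `u^k
[V]`. -/
theorem isZetaExtension_unique {P₀ : PowerStructure (K0 𝔐)} {W : ZetaRing R}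
    {Q : PowerStructure R} (hP : W.power.IsZetaExtension φ u P₀) (hQ : Q.IsZetaExtension φ u P₀)
    (hspan : AddSubgroup.closure {r : R | ∃ (k : ℤ) (V : RelVar 𝔐),
      r = ((u ^ k : Rˣ) : R) * φ (cls V)} = ⊤) : Q = W.power := by
  have hadd (F G : R → oneSeries R) (hF : ∀ a b, F (a + b) = F a * F b)
      (hG : ∀ a b, G (a + b) = G a * G b)
      (h : ∀ (k : ℤ) (V : RelVar 𝔐), F (((u ^ k : Rˣ) : R) * φ (cls V)) =
        G (((u ^ k : Rˣ) : R) * φ (cls V))) (r : R) : F r = G r := by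
    have zero {F : R → oneSeries R} (hF : ∀ a b, F (a + b) = F a * F b) : F 0 = 1 := by
      have := hF 0 0
      rwa [add_zero, left_eq_mul] at this
    have hr : r ∈ AddSubgroup.closure {r : R | ∃ (k : ℤ) (V : RelVar 𝔐),
      r = ((u ^ k : Rˣ) : R) * φ (cls V)} := hspan ▸ AddSubgroup.mem_top r
    induction hr using AddSubgroup.closure_induction with
    | mem x hx => obtain ⟨k, V, rfl⟩ := hx; exact h k V
    | zero => rw [zero hF, zero hG]
    | add x y _ _ hx hy => rw [hF, hG, hx, hy]
    | neg x _ hx =>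
      have h₁ := hF (-x) x
      have h₂ := hG (-x) x
      rw [neg_add_cancel, zero hF] at h₁
      rw [neg_add_cancel, zero hG, ← hx, h₁] at h₂
      exact mul_right_cancel h₂
  have hzeta (r : R) : Q.zeta r = W.power.zeta r := by
    refine hadd _ _ (fun a b => Q.pow_add _ a b) (fun a b => W.power.pow_add _ a b)
      (fun k V => ?_) r
    change Q.zeta _ = W.power.zeta _
    rw [(hQ.zeta _ k).2, (hP.zeta _ k).2]
    congr 1
    have h₁ := hQ.extends_base (mkOne fun _ => 1) (cls V)
    have h₂ := hP.extends_base (mkOne fun _ => 1) (cls V)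
    rw [mapOne_mkOne_one] at h₁ h₂
    exact h₁.trans h₂.symm
  -- Powers of zeta functions are again zeta functions, by the axiom for products of exponents.
  have hpow (a r : R) : Q.pow (W.zeta a) r = W.power.pow (W.zeta a) r := by
    have hQ' : Q.pow (Q.zeta a) r = Q.zeta (a * r) := (Q.pow_mul _ a r).symm
    have hW' : W.power.pow (W.power.zeta a) r = W.power.zeta (a * r) :=
      (W.power.pow_mul _ a r).symm
    rw [hzeta, hzeta, W.power_zeta] at hQ'
    rw [W.power_zeta] at hW'
    rw [hQ', hW', W.power_zeta]
  refine PowerStructure.ext (funext fun A => funext fun r => ?_)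
  -- The factors of `W` test the equality of both structures, with finite determinacy supplying the
  -- continuity required of each.
  refine W.hom_ext (F := fun A => Q.pow A r) (G := fun A => W.power.pow A r)
    (fun A B => Q.mul_pow A B r) (fun A B => W.power.mul_pow A B r)
    (hQ.finitelyDetermined r) (hP.finitelyDetermined r) (fun n a => ?_) A
  refine hadd (Q.pow (W.factor n a)) (W.power.pow (W.factor n a)) (Q.pow_add _)
    (W.power.pow_add _) (fun k V => ?_) r
  rw [ZetaRing.factor, hQ.push, hP.push, hpow]

end MotivicPower

namespace MotivicPower

/-! ### Regular functions and the affine line -/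

section AffineLine

/-- The affine line. -/
abbrev line : CSch := Over.mk (𝔸(PUnit; Spec (.of ℂ)) ↘ Spec (.of ℂ))

instance : IsVar line := ⟨by dsimp; infer_instance, by dsimp; infer_instance, by
  dsimp; infer_instance⟩

/-- The morphism to the affine line given by a function. -/
def toLine {Y : CSch} (s : Γ(Y.left, ⊤)) : Y ⟶ line :=
  Over.homMk (AffineSpace.homOfVector Y.hom fun _ => s) (AffineSpace.homOfVector_over _ _)

/-- The coordinate on the affine line. -/
def lineCoord : Γ(line.left, ⊤) := AffineSpace.coord (Spec (.of ℂ)) PUnit.unit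

/-- The value of a function at a point. -/
def evalPt {X : CSch} (x : pts X) : Γ(X.left, ⊤) →+* ℂ :=
  (Scheme.ΓSpecIso (.of ℂ)).hom.hom.comp x.left.appTop.hom

theorem evalPt_comp {X Y : CSch} (x : pts X) (f : X ⟶ Y) (s : Γ(Y.left, ⊤)) :
    evalPt (x ≫ f) s = evalPt x (f.left.appTop s) := by
  change (Scheme.ΓSpecIso (.of ℂ)).hom ((x.left ≫ f.left).appTop s) = _
  rw [Scheme.Hom.comp_appTop]
  rfl

theorem toLine_appTop {Y : CSch} (s : Γ(Y.left, ⊤)) : (toLine s).left.appTop lineCoord = s :=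
  AffineSpace.homOfVector_appTop_coord Y.hom (fun _ => s) PUnit.unit

theorem evalPt_toLine {X : CSch} (x : pts X) (s : Γ(X.left, ⊤)) :
    evalPt (x ≫ toLine s) lineCoord = evalPt x s := by
  rw [evalPt_comp, toLine_appTop]

/-- The complex points of the affine line are the complex numbers. -/
def lineVal (t : pts line) : ℂ := evalPt t lineCoord

theorem lineVal_bijective : lineVal.Bijective := by
  constructor
  · intro t t' h
    refine Over.OverMorphism.ext (AffineSpace.hom_ext ?_ fun _ => ?_)
    · exact (Over.w t).trans (Over.w t').symm
    · exact (ConcreteCategory.injective_of_mono_of_preservesPullback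
        (Scheme.ΓSpecIso (.of ℂ)).hom) h
  · intro z
    refine ⟨toLine (Y := 𝟙_ CSch) ((Scheme.ΓSpecIso (.of ℂ)).inv z), ?_⟩
    change (Scheme.ΓSpecIso (.of ℂ)).hom ((toLine (Y := 𝟙_ CSch) _).left.appTop lineCoord) = z
    rw [toLine_appTop]
    exact congrArg (fun f => f.hom z) (Scheme.ΓSpecIso (.of ℂ)).inv_hom_id

instance : DefType ℂ where
  I := Unit
  C _ := line
  code _ c z := lineVal c = z
  code_unique h h' := h.symm.trans h'
  code_surj z := ⟨(), lineVal_bijective.2 z⟩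
  code_ker _ _ := (Constr.eqOn (fst line line) (snd line line)).of_iff fun _ =>
    ⟨fun h => ⟨_, congrArg lineVal h, rfl⟩,
      fun ⟨_, h, h'⟩ => lineVal_bijective.1 (h.trans h'.symm)⟩

theorem defMap_lineVal : DefMap lineVal :=
  Tracked.defMap fun _ => ⟨(), 𝟙 _, fun c t h => by
    obtain rfl : c = t := h
    exact congrArg lineVal (Category.comp_id _)⟩

theorem defMap_evalPt {X : CSch} [IsVar X] (s : Γ(X.left, ⊤)) :
    DefMap (fun x : pts X => evalPt x s) := by
  simp only [← evalPt_toLine _ s]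
  exact defMap_lineVal.comp (Tracked.hom (toLine s)).defMap

variable {T : Type} [DefType T] {f g : T → ℂ}

theorem exists_lineVal_inverse : ∃ e : ℂ → pts line, (∀ z, lineVal (e z) = z) ∧ DefMap e := by
  have h (z : ℂ) := lineVal_bijective.2 z
  choose e he using h
  exact ⟨e, he, defMap_lineVal.inv (fun t => lineVal_bijective.1 (he _)) he⟩

theorem defMap_evalPt_lift (s : Γ((line ⊗ line).left, ⊤)) : DefMap (fun z : pts line × pts line =>
      evalPt (lift z.1 z.2 : pts (line ⊗ line)) s) := by
  have h₁ : DefMap (fun x : pts (line ⊗ line) => evalPt x s) := defMap_evalPt s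
  have h₂ := (Tracked.pair (X := line) (Y := line)).defMap
  exact h₁.comp h₂

theorem evalPt_lift_fst (a b : pts line) :
    evalPt (lift a b : pts (line ⊗ line)) ((fst line line).left.appTop lineCoord) = lineVal a := by
  rw [← evalPt_comp, lift_fst, lineVal]

theorem evalPt_lift_snd (a b : pts line) :
    evalPt (lift a b : pts (line ⊗ line)) ((snd line line).left.appTop lineCoord) = lineVal b := by
  rw [← evalPt_comp, lift_snd, lineVal]

theorem DefMap.of_lineVal {q : ℂ → ℂ → ℂ}
    (hq : DefMap fun z : pts line × pts line => q (lineVal z.1) (lineVal z.2))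
    (hf : DefMap f) (hg : DefMap g) : DefMap (fun t => q (f t) (g t)) := by
  obtain ⟨e, he, hed⟩ := exists_lineVal_inverse
  have hp : DefMap (fun t => (e (f t), e (g t))) := (hed.comp hf).prodMk (hed.comp hg)
  have := hq.comp hp
  simpa only [he] using this

/-- The sum is the value of a regular function on the product of two lines. -/
theorem DefMap.add (hf : DefMap f) (hg : DefMap g) : DefMap (fun t => f t + g t) := by
  refine DefMap.of_lineVal (q := fun a b => a + b) ?_ hf hg
  have h (z : pts line × pts line) : lineVal z.1 + lineVal z.2 =
      evalPt (lift z.1 z.2 : pts (line ⊗ line))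
        ((CartesianMonoidalCategory.fst line line).left.appTop lineCoord +
          (CartesianMonoidalCategory.snd line line).left.appTop lineCoord) := by
    rw [map_add, evalPt_lift_fst, evalPt_lift_snd]
  rw [funext h]
  exact defMap_evalPt_lift _

theorem DefMap.mul (hf : DefMap f) (hg : DefMap g) : DefMap (fun t => f t * g t) := by
  refine DefMap.of_lineVal (q := fun a b => a * b) ?_ hf hg
  have h (z : pts line × pts line) : lineVal z.1 * lineVal z.2 =
      evalPt (lift z.1 z.2 : pts (line ⊗ line))
        ((CartesianMonoidalCategory.fst line line).left.appTop lineCoord *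
          (CartesianMonoidalCategory.snd line line).left.appTop lineCoord) := by
    rw [map_mul, evalPt_lift_fst, evalPt_lift_snd]
  rw [funext h]
  exact defMap_evalPt_lift _

theorem DefMap.pow (hf : DefMap f) (n : ℕ) : DefMap (fun t => f t ^ n) := by
  induction n with
  | zero => simpa using DefMap.const 1
  | succ n ih => simpa only [pow_succ] using ih.mul hf

theorem DefMap.finsetSum {J : Type*} (s : Finset J) {f : J → T → ℂ} (hf : ∀ j, DefMap (f j)) :
    DefMap (fun t => ∑ j ∈ s, f j t) := by
  classical
  induction s using Finset.induction_on with
  | empty => simpa using DefMap.const 0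
  | insert j s hj ih => simpa only [Finset.sum_insert hj] using (hf j).add ih

end AffineLine

/-! ### Definition by finitely many cases. -/

section Cases

variable {S T : Type} [DefType S] [DefType T]

/-- Maps defined by finitely many cases. -/
theorem DefMap.of_cases {J : Type} [Finite J] {f : S → T} {p : J → S → Prop} {g : J → S → T}
    (hp : ∀ j, IsDef (p j)) (hg : ∀ j, DefMap (g j)) (hex : ∀ s, ∃ j, p j s)
    (h : ∀ j s, p j s → f s = g j s) : DefMap f := by
  have : IsDef (fun z : S × T => ∃ j, p j z.1 ∧ g j z.1 = z.2) :=
    IsDef.iEx fun j => ((hp j).comp DefMap.fst).and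
      (IsDef.eq ((hg j).comp DefMap.fst) DefMap.snd)
  refine this.congr fun z => ⟨?_, fun hz => ?_⟩
  · rintro ⟨j, hj, hz⟩
    exact (h j _ hj).trans hz
  · obtain ⟨j, hj⟩ := hex z.1
    exact ⟨j, hj, (h j _ hj).symm.trans hz⟩

theorem DefMap.of_finite [Finite T] {f : S → T} (h : ∀ t, IsDef fun s => f s = t) : DefMap f :=
  DefMap.of_cases h (fun t => DefMap.const t) (fun s => ⟨f s, rfl⟩) fun _ _ h => h

end Cases

/-- An affine variety is embedded in an affine space by finitely many functions. -/
theorem exists_coordinates (X : CSch) [IsVar X] [IsAffine X.left] :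
    ∃ (N : ℕ) (ξ : pts X → Fin N → ℂ), ξ.Injective ∧ DefMap ξ := by
  have hft : X.hom.appTop.hom.FiniteType := by
    have : LocallyOfFiniteType X.hom := inferInstance
    exact (HasRingHomProperty.iff_of_isAffine (P := @LocallyOfFiniteType)).mp this
  algebraize [X.hom.appTop.hom]
  obtain ⟨s, hs⟩ := (inferInstance : Algebra.FiniteType Γ(Spec (.of ℂ), ⊤) Γ(X.left, ⊤)).out
  let e := s.equivFin
  refine ⟨s.card, fun x i => evalPt x (e.symm i).1, fun x y h => ?_,
    DefMap.pi fun i => defMap_evalPt _⟩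
  refine Over.OverMorphism.ext (ext_of_isAffine ?_)
  -- The ring map of a complex point is fixed on the constants, so it is determined by the values at
  -- finitely many algebra generators.
  have hc (x : pts X) : X.hom.appTop ≫ x.left.appTop = 𝟙 _ := by
    have := congrArg (fun f => Scheme.Hom.appTop f) (Over.w x)
    dsimp at this
    simpa using this
  refine CommRingCat.hom_ext (RingHom.ext fun a => ?_)
  have ha : a ∈ Algebra.adjoin Γ(Spec (.of ℂ), ⊤) (s : Set Γ(X.left, ⊤)) := hs ▸ Algebra.mem_top
  induction ha using Algebra.adjoin_induction with
  | mem a ha =>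
    have := congrFun h (e ⟨a, ha⟩)
    dsimp only at this
    rw [Equiv.symm_apply_apply] at this
    exact (ConcreteCategory.injective_of_mono_of_preservesPullback
        (Scheme.ΓSpecIso (.of ℂ)).hom) this
  | algebraMap r =>
    exact (congrArg (fun f => f.hom r) ((hc x).trans (hc y).symm))
  | add a b _ _ ha hb => rw [map_add, map_add, ha, hb]
  | mul a b _ _ ha hb => rw [map_mul, map_mul, ha, hb]

end MotivicPower

namespace MotivicPower

/-! ### Polynomials with complex coefficients -/

section Polynomials

open Polynomial

/-- The polynomial with given coefficients. -/
def poly {n : ℕ} (c : Fin n → ℂ) : ℂ[X] := ∑ i : Fin n, C (c i) * X ^ (i : ℕ)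

theorem coeff_poly {n : ℕ} (c : Fin n → ℂ) (i : Fin n) : (poly c).coeff i = c i := by
  simp only [poly, finsetSum_coeff, coeff_C_mul_X_pow, Fin.val_inj]
  simp

theorem poly_injective {n : ℕ} : (poly (n := n)).Injective := fun c c' h =>
  funext fun i => by rw [← coeff_poly c, h, coeff_poly]

theorem degree_poly_lt {n : ℕ} (c : Fin n → ℂ) : (poly c).degree < n := by
  refine (degree_sum_le _ _).trans_lt ((Finset.sup_lt_iff (by simp)).mpr fun i _ => ?_)
  exact (degree_C_mul_X_pow_le _ _).trans_lt (by exact_mod_cast i.2)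

theorem poly_sub {n : ℕ} (c c' : Fin n → ℂ) : poly (c - c') = poly c - poly c' := by
  simp [poly, sub_mul, Finset.sum_sub_distrib]

theorem poly_coeff {n : ℕ} {p : ℂ[X]} (hp : p.degree < n) : poly (fun i : Fin n => p.coeff i) = p := by
  ext k
  by_cases hk : k < n
  · exact coeff_poly (fun i : Fin n => p.coeff i) ⟨k, hk⟩
  · push Not at hk
    rw [coeff_eq_zero_of_degree_lt (hp.trans_le (by exact_mod_cast hk)),
      coeff_eq_zero_of_degree_lt ((degree_poly_lt _).trans_le (by exact_mod_cast hk))]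

theorem X_sub_C_pow_dvd_iff_taylor {p : ℂ[X]} {z : ℂ} {m : ℕ} :
    (X - C z) ^ m ∣ p ↔ ∀ k < m, (taylor z p).coeff k = 0 := by
  rw [X_sub_C_pow_dvd_iff, X_pow_dvd_iff, taylor_apply]

theorem coeff_taylor_poly {n : ℕ} (c : Fin n → ℂ) (z : ℂ) (k : ℕ) : (taylor z (poly c)).coeff k =
    ∑ i : Fin n, c i * (z ^ ((i : ℕ) - k) * ((i : ℕ).choose k : ℂ)) := by
  rw [poly, map_sum, finsetSum_coeff]
  simp [taylor_apply, coeff_X_add_C_pow]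

/-- Hermite interpolation. -/
theorem hermite_bijective {J : Type} [Fintype J] {l : J → ℂ} (hl : l.Injective) {m : J → ℕ} {n : ℕ}
    (hm : ∑ j, m j = n) : Function.Bijective fun (c : Fin n → ℂ) (j : J) (i : Fin (m j)) =>
      (taylor (l j) (poly c)).coeff i := by
  let Φ : (Fin n → ℂ) →ₗ[ℂ] ∀ j : J, Fin (m j) → ℂ :=
    { toFun c j i := (taylor (l j) (poly c)).coeff i
      map_add' c c' := by
        funext j i
        simp only [coeff_taylor_poly, Pi.add_apply, add_mul, Finset.sum_add_distrib]
      map_smul' a c := by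
        funext j i
        simp only [coeff_taylor_poly, Pi.smul_apply, smul_eq_mul, mul_assoc, Finset.mul_sum,
          RingHom.id_apply] }
  have hinj : Function.Injective Φ := by
    rw [← LinearMap.ker_eq_bot, LinearMap.ker_eq_bot']
    intro c hc
    have h0 : poly c = 0 := by
      -- Vanishing Taylor coefficients at distinct nodes give divisibility by coprime powers, hence
      -- by a product of degree `n`, while the polynomial has degree less than `n`. Surjectivity
      -- follows by comparing dimensions.
      have hdvd : ∏ j, (X - C (l j)) ^ m j ∣ poly c := by
        refine Finset.prod_dvd_of_coprime (fun i _ j _ hij => ?_) fun j _ => ?_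
        · exact (isCoprime_X_sub_C_of_isUnit_sub
            (sub_ne_zero.mpr (hl.ne hij)).isUnit).pow
        · exact X_sub_C_pow_dvd_iff_taylor.mpr fun k hk => congrFun (congrFun hc j) ⟨k, hk⟩
      by_contra h
      have h₁ := degree_le_of_dvd hdvd h
      rw [degree_prod] at h₁
      simp only [degree_pow, degree_X_sub_C, nsmul_one] at h₁
      have h₂ := h₁.trans_lt (degree_poly_lt c)
      rw [← Nat.cast_sum, hm] at h₂
      exact lt_irrefl _ h₂
    funext i
    rw [← coeff_poly c, h0, coeff_zero, Pi.zero_apply]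
  refine ⟨hinj, (LinearMap.injective_iff_surjective_of_finrank_eq_finrank ?_).mp hinj⟩
  rw [Module.finrank_fin_fun, Module.finrank_pi_fintype, ← hm]
  simp

/-- Linear forms which separate the points of a finite set. -/
theorem exists_separating {N n : ℕ} (F : Finset (Fin N → ℂ)) (hF : F.card ≤ n) :
    ∃ l : Fin (n * n * N + 1), Set.InjOn (fun v => (poly v).eval (l : ℂ)) (F : Set (Fin N → ℂ)) := by
  classical
  -- The linear forms are evaluations at integers of the polynomials with coefficient vector `v`.
  -- The bad values are roots of differences: at most `n * n` pairs with at most `N` roots each, so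
  -- one of the first `n * n * N + 1` integers is good.
  let B := ((F ×ˢ F).filter fun z => z.1 ≠ z.2).biUnion fun z => (poly (z.1 - z.2)).roots.toFinset
  have hB : B.card ≤ n * n * N := by
    refine (Finset.card_biUnion_le_card_mul _ _ N fun z hz => ?_).trans ?_
    · have h0 : poly (z.1 - z.2) ≠ 0 := by
        rw [poly_sub, sub_ne_zero]
        exact poly_injective.ne (Finset.mem_filter.mp hz).2
      refine (Multiset.toFinset_card_le _).trans ?_
      have := (card_roots h0).trans (degree_poly_lt _).le
      exact_mod_cast this
    · refine Nat.mul_le_mul_right _ ((Finset.card_filter_le _ _).trans ?_)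
      rw [Finset.card_product]
      exact Nat.mul_le_mul hF hF
  obtain ⟨z, hz, hzB⟩ := Finset.exists_mem_notMem_of_card_lt_card (s := B)
    (t := (Finset.range (n * n * N + 1)).image fun l : ℕ => (l : ℂ)) (by
      rw [Finset.card_image_of_injective _ Nat.cast_injective, Finset.card_range]
      omega)
  obtain ⟨l, hl, rfl⟩ := Finset.mem_image.mp hz
  refine ⟨⟨l, Finset.mem_range.mp hl⟩, fun v hv w hw h => ?_⟩
  by_contra hne
  refine hzB (Finset.mem_biUnion.mpr ⟨(v, w), Finset.mem_filter.mpr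
    ⟨Finset.mem_product.mpr ⟨hv, hw⟩, hne⟩, ?_⟩)
  rw [Multiset.mem_toFinset, mem_roots', poly_sub]
  refine ⟨?_, ?_⟩
  · rw [sub_ne_zero]
    exact poly_injective.ne hne
  · rw [IsRoot, eval_sub, sub_eq_zero]
    exact h

theorem eval_poly {n : ℕ} (c : Fin n → ℂ) (z : ℂ) :
    (poly c).eval z = ∑ i : Fin n, c i * z ^ (i : ℕ) := by
  simp [poly, eval_finsetSum]

/-- The monic polynomial with given lower coefficients. -/
def monicPoly {n : ℕ} (c : Fin n → ℂ) : ℂ[X] := X ^ n + poly c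

theorem monic_monicPoly {n : ℕ} (c : Fin n → ℂ) : (monicPoly c).Monic :=
  monic_X_pow_add (degree_poly_lt c)

theorem natDegree_monicPoly {n : ℕ} (c : Fin n → ℂ) : (monicPoly c).natDegree = n :=
  natDegree_eq_of_degree_eq_some (by
    rw [monicPoly, degree_add_eq_left_of_degree_lt (by rw [degree_X_pow]; exact degree_poly_lt c),
      degree_X_pow])

theorem exists_monicPoly {n : ℕ} {p : ℂ[X]} (hp : p.Monic) (hn : p.natDegree = n) :
    ∃ c : Fin n → ℂ, monicPoly c = p := by
  have hd : (p - X ^ n).degree < (n : WithBot ℕ) := by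
    have h1 : p.degree = n := by rw [degree_eq_natDegree hp.ne_zero, hn]
    have h2 := degree_sub_lt_left (q := X ^ n) (by rw [h1, degree_X_pow]) hp.ne_zero
      (by rw [hp.leadingCoeff, leadingCoeff_X_pow])
    rwa [h1] at h2
  exact ⟨_, by rw [monicPoly, poly_coeff hd, add_sub_cancel]⟩

theorem coeff_taylor_monicPoly {n : ℕ} (c : Fin n → ℂ) (z : ℂ) (k : ℕ) :
    (taylor z (monicPoly c)).coeff k = z ^ (n - k) * (n.choose k : ℂ) +
      ∑ i : Fin n, c i * (z ^ ((i : ℕ) - k) * ((i : ℕ).choose k : ℂ)) := by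
  rw [monicPoly, map_add, coeff_add, coeff_taylor_poly]
  simp [taylor_apply, coeff_X_add_C_pow]

end Polynomials

/-! ### Definability of Taylor coefficients and root multiplicities. -/

section Definable

variable {T : Type} [DefType T] {n : ℕ} {c : T → Fin n → ℂ} {z : T → ℂ}

theorem defMap_eval_poly (hc : DefMap c) (z : ℂ) : DefMap fun t => (poly (c t)).eval z := by
  simp only [eval_poly]
  exact DefMap.finsetSum _ fun i => ((DefMap.eval i).comp hc).mul (DefMap.const _)

theorem defMap_sum_taylor (hc : DefMap c) (hz : DefMap z) (k : ℕ) :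
    DefMap fun t => ∑ i : Fin n, c t i * (z t ^ ((i : ℕ) - k) * ((i : ℕ).choose k : ℂ)) :=
  DefMap.finsetSum _ fun i => ((DefMap.eval i).comp hc).mul ((hz.pow _).mul (DefMap.const _))

theorem defMap_taylor_poly (hc : DefMap c) (hz : DefMap z) (k : ℕ) :
    DefMap fun t => (Polynomial.taylor (z t) (poly (c t))).coeff k := by
  simp only [coeff_taylor_poly]
  exact defMap_sum_taylor hc hz k

/-- Multiplicity at least `m` means that the first `m` Taylor coefficients vanish, and these are
polynomial expressions in the coefficients and the point. -/
theorem isDef_le_rootMultiplicity (hc : DefMap c) (hz : DefMap z) (m : ℕ) :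
    IsDef fun t => m ≤ (monicPoly (c t)).rootMultiplicity (z t) := by
  have h (k : Fin m) : IsDef fun t => (Polynomial.taylor (z t) (monicPoly (c t))).coeff k = 0 := by
    simp only [coeff_taylor_monicPoly]
    exact IsDef.eq (((hz.pow _).mul (DefMap.const _)).add (defMap_sum_taylor hc hz _))
      (DefMap.const _)
  refine (IsDef.iAll h).congr fun t => ?_
  rw [Polynomial.le_rootMultiplicity_iff (monic_monicPoly _).ne_zero, X_sub_C_pow_dvd_iff_taylor]
  exact ⟨fun h k hk => h ⟨k, hk⟩, fun h k => h k k.2⟩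

end Definable

namespace Conf

/-- The roots of a monic polynomial, with multiplicities. -/
def roots {n : ℕ} (c : Fin n → ℂ) : Conf Pt ℂ n :=
  ⟨fun z => ⟨(monicPoly c).rootMultiplicity z, ()⟩,
    ((monicPoly c).roots.toFinset.finite_toSet).subset fun z hz => by
      rw [Finset.mem_coe, Multiset.mem_toFinset, ← Multiset.count_ne_zero, Polynomial.count_roots]
      exact hz, by
    rw [finsum_eq_sum_of_support_subset (s := (monicPoly c).roots.toFinset) _ fun z hz => by
      rw [Finset.mem_coe, Multiset.mem_toFinset, ← Multiset.count_ne_zero, Polynomial.count_roots]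
      exact hz]
    simp only [← Polynomial.count_roots]
    rw [Multiset.toFinset_sum_count_eq,
      Polynomial.splits_iff_card_roots.mp (IsAlgClosed.splits _), natDegree_monicPoly]⟩

/-- Over an algebraically closed field, a monic polynomial is the product of its linear factors, so
it amounts to its multiset of roots. Thus `Sym^n 𝔸¹ = 𝔸^n` on complex points. -/
theorem roots_bijective {n : ℕ} : (roots (n := n)).Bijective := by
  constructor
  · intro c c' h
    have hr : (monicPoly c).roots = (monicPoly c').roots := by
      ext z
      rw [Polynomial.count_roots, Polynomial.count_roots]
      exact congrArg Sigma.fst (congrFun (congrArg Subtype.val h) z)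
    have hp : monicPoly c = monicPoly c' := by
      rw [(IsAlgClosed.splits (monicPoly c)).eq_prod_roots_of_monic (monic_monicPoly c),
        (IsAlgClosed.splits (monicPoly c')).eq_prod_roots_of_monic (monic_monicPoly c'), hr]
    exact poly_injective (add_left_cancel hp)
  · intro f
    let g : ℂ →₀ ℕ := Finsupp.ofSupportFinite (fun z => (f.1 z).1) f.2.1
    have hg : Multiset.card (Finsupp.toMultiset g) = n := by
      rw [Finsupp.card_toMultiset, Finsupp.sum, ← f.2.2, finsum_eq_sum _ f.2.1]
      rfl
    obtain ⟨c, hc⟩ := exists_monicPoly (n := n)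
      (Polynomial.monic_multisetProd_X_sub_C (Finsupp.toMultiset g)) (by
        rw [Polynomial.natDegree_multiset_prod_X_sub_C_eq_card, hg])
    refine ⟨c, Subtype.ext (funext fun z => Sigma.ext ?_ (heq_of_eq rfl))⟩
    change (monicPoly c).rootMultiplicity z = _
    rw [← Polynomial.count_roots, hc, Polynomial.roots_multiset_prod_X_sub_C,
      Finsupp.count_toMultiset]
    rfl

theorem defMap_roots {n : ℕ} : DefMap (roots (n := n)) := by
  refine defMap_of_ev (show DefMap fun t : (Fin n → ℂ) × ℂ => (roots t.1).ev t.2 from ?_)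
  refine DefMap.of_finite fun l => ?_
  refine ((isDef_le_rootMultiplicity DefMap.fst DefMap.snd l.1).and
    (isDef_le_rootMultiplicity DefMap.fst DefMap.snd (l.1 + 1)).not).congr fun t => ?_
  rw [ev_eq_iff]
  constructor
  · intro h
    exact Sigma.ext (show (monicPoly t.1).rootMultiplicity t.2 = l.1 by omega) (heq_of_eq rfl)
  · intro h
    have : (monicPoly t.1).rootMultiplicity t.2 = l.1 := congrArg Sigma.fst h
    omega

end Conf

end MotivicPower

namespace MotivicPower

/-! ### Symmetric powers of a product with the affine line -/

/-- Coefficient vectors. -/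
abbrev Vec (i : ℕ) : Type := Fin i → ℂ

namespace Conf

variable {M : Type} [DefType M] {n N : ℕ} (ξ : M → Fin N → ℂ)

/-- The `l`-th linear form separates the points of a configuration. -/
def Separates (D : Conf Pt M n) (l : ℕ) : Prop :=
  ∀ x y, (D.1 x).1 ≠ 0 → (D.1 y).1 ≠ 0 →
    (poly (ξ x)).eval (l : ℂ) = (poly (ξ y)).eval (l : ℂ) → x = y

variable {ξ}

theorem card_support_le (D : Conf Pt M n) : D.2.1.toFinset.card ≤ n := by
  rw [Finset.card_eq_sum_ones]
  conv_rhs => rw [← D.2.2, finsum_eq_sum _ D.2.1]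
  exact Finset.sum_le_sum fun x hx => Nat.one_le_iff_ne_zero.mpr (by simpa using hx)

theorem exists_separates (hξ : ξ.Injective) (D : Conf Pt M n) :
    ∃ l : Fin (n * n * N + 1), Separates ξ D l := by
  classical
  obtain ⟨l, hl⟩ := exists_separating (D.2.1.toFinset.image ξ)
    (Finset.card_image_le.trans D.card_support_le)
  refine ⟨l, fun x y hx hy h => hξ (hl ?_ ?_ h)⟩
  · exact Finset.mem_image_of_mem _ (by simpa using hx)
  · exact Finset.mem_image_of_mem _ (by simpa using hy)

theorem ev_eq_zeroLab_iff {D : Conf Pt M n} {x : M} : D.ev x = zeroLab ↔ (D.1 x).1 = 0 := by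
  rw [ev_eq_iff]
  exact ⟨fun h => congrArg Sigma.fst h, fun h => label_eq_of_fst_eq_zero h⟩

theorem isDef_separates (hξ : DefMap ξ) (l : ℕ) :
    IsDef fun D : Conf Pt M n => Separates ξ D l := by
  simp only [Separates, ne_eq, ← ev_eq_zeroLab_iff]
  refine IsDef.all (IsDef.all (IsDef.imp (IsDef.not ?_) (IsDef.imp (IsDef.not ?_)
    (IsDef.imp ?_ ?_))))
  · exact IsDef.eq (defMap_ev' (DefMap.fst.comp DefMap.fst) (DefMap.snd.comp DefMap.fst))
      (DefMap.const _)
  · exact IsDef.eq (defMap_ev' (DefMap.fst.comp DefMap.fst) DefMap.snd) (DefMap.const _)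
  · exact IsDef.eq (defMap_eval_poly (hξ.comp (DefMap.snd.comp DefMap.fst)) _)
      (defMap_eval_poly (hξ.comp DefMap.snd) _)
  · exact IsDef.eq (DefMap.snd.comp DefMap.fst) DefMap.snd

variable (ξ) in
/-- The first linear form which separates the points of a configuration. -/
def sep (D : Conf Pt M n) : ℕ := sInf {l | Separates ξ D l}

theorem separates_sep (hξ : ξ.Injective) (D : Conf Pt M n) : Separates ξ D (sep ξ D) := by
  obtain ⟨l, hl⟩ := exists_separates hξ D
  exact Nat.sInf_mem (s := {l | Separates ξ D l}) ⟨l, hl⟩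

theorem sep_lt (hξ : ξ.Injective) (D : Conf Pt M n) : sep ξ D < n * n * N + 1 := by
  obtain ⟨l, hl⟩ := exists_separates hξ D
  exact (Nat.sInf_le (s := {l | Separates ξ D l}) hl).trans_lt l.2

/-- Separation by a given form is first order, and minimality adds only finitely many negations.
Taking the first separating form makes the choice of nodes definable. -/
theorem isDef_sep_eq (hξ : ξ.Injective) (hd : DefMap ξ) (l : ℕ) :
    IsDef fun D : Conf Pt M n => sep ξ D = l := by
  refine ((isDef_separates hd l).and (IsDef.iAll fun k : Fin l =>
    (isDef_separates hd k).not)).congr fun D => ⟨fun h => ?_, ?_⟩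
  · refine le_antisymm (Nat.sInf_le (s := {l | Separates ξ D l}) h.1) ?_
    by_contra! hlt
    exact h.2 ⟨_, hlt⟩ (separates_sep hξ D)
  · rintro rfl
    exact ⟨separates_sep hξ D, fun k hk => absurd (Nat.sInf_le (s := {l | Separates ξ D l}) hk)
      (not_le.mpr k.2)⟩

variable (ξ) in
/-- The Taylor coefficients of a polynomial at the points of a configuration. -/
def hermite (z : Conf Pt M n × (Fin n → ℂ)) : Conf Vec M n :=
  ⟨fun x => ⟨(z.1.1 x).1, fun i =>
    (Polynomial.taylor ((poly (ξ x)).eval (sep ξ z.1 : ℂ)) (poly z.2)).coeff i⟩, z.1.2⟩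

/-- For a fixed element `D` of the symmetric power, the separating form sends its points to distinct
complex nodes, and the multiplicities add up to `n`, so Hermite interpolation applies. -/
theorem hermite_bijective_aux (hξ : ξ.Injective) (D : Conf Pt M n) :
    Function.Bijective fun (c : Fin n → ℂ) (x : D.2.1.toFinset) (i : Fin (D.1 x.1).1) =>
      (Polynomial.taylor ((poly (ξ x.1)).eval (sep ξ D : ℂ)) (poly c)).coeff i := by
  refine MotivicPower.hermite_bijective (l := fun x : D.2.1.toFinset =>
    (poly (ξ x.1)).eval (sep ξ D : ℂ)) (fun x y h => Subtype.ext ?_) ?_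
  · exact separates_sep hξ D _ _ (D.2.1.mem_toFinset.mp x.2) (D.2.1.mem_toFinset.mp y.2) h
  · rw [Finset.sum_coe_sort _ fun x => (D.1 x).1]
    conv_rhs => rw [← D.2.2, finsum_eq_sum _ D.2.1]

theorem hermite_bijective (hξ : ξ.Injective) : (hermite (n := n) ξ).Bijective := by
  constructor
  · rintro ⟨D, c⟩ ⟨D', c'⟩ h
    have h' (x : M) := congrFun (congrArg Subtype.val h) x
    obtain rfl : D = D' := Subtype.ext (funext fun x =>
      Sigma.ext (Sigma.mk.inj_iff.mp (h' x)).1 (heq_of_eq rfl))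
    refine congrArg (Prod.mk D) ((hermite_bijective_aux hξ D).1 (funext fun x => ?_))
    exact eq_of_heq (Sigma.mk.inj_iff.mp (h' x.1)).2
  · intro f
    let D : Conf Pt M n := ⟨fun x => ⟨(f.1 x).1, ()⟩, f.2⟩
    obtain ⟨c, hc⟩ := (hermite_bijective_aux hξ D).2 fun x => (f.1 x.1).2
    refine ⟨(D, c), Subtype.ext (funext fun x => ?_)⟩
    by_cases hx : (f.1 x).1 = 0
    · rw [label_eq_of_fst_eq_zero (𝒜 := Vec) hx]
      exact label_eq_of_fst_eq_zero (𝒜 := Vec) hx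
    · exact Sigma.ext rfl (heq_of_eq (congrFun hc ⟨x, by simpa [D] using hx⟩))

/-- The degree at the point and the separating form take finitely many values. On each case both are
constants, and the Taylor coefficients are polynomial. -/
theorem defMap_hermite (hξ : ξ.Injective) (hd : DefMap ξ) : DefMap (hermite (n := n) ξ) := by
  refine defMap_of_ev (show DefMap fun t : (Conf Pt M n × (Fin n → ℂ)) × M =>
    (hermite ξ t.1).ev t.2 from ?_)
  refine DefMap.of_cases (J := Fin (n + 1) × Fin (n * n * N + 1))
    (p := fun j t => t.1.1.ev t.2 = (⟨j.1, ()⟩ : Lab Pt n) ∧ sep ξ t.1.1 = j.2)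
    (g := fun j t => (⟨j.1, fun i => (Polynomial.taylor ((poly (ξ t.2)).eval (j.2 : ℂ))
      (poly t.1.2)).coeff i⟩ : Lab Vec n)) (fun j => ?_) (fun j => ?_) (fun t => ?_) ?_
  · exact (IsDef.eq (defMap_ev' (DefMap.fst.comp DefMap.fst) DefMap.snd) (DefMap.const _)).and
      ((isDef_sep_eq hξ hd _).comp (DefMap.fst.comp DefMap.fst))
  · refine (Tracked.sigmaMk (S := fun i : Fin (n + 1) => Vec i) j.1).defMap.comp
      (DefMap.pi fun i => ?_)
    exact defMap_taylor_poly (DefMap.snd.comp DefMap.fst)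
      (defMap_eval_poly (hd.comp DefMap.snd) _) _
  · exact ⟨((t.1.1.ev t.2).1, ⟨_, sep_lt hξ t.1.1⟩), rfl, rfl⟩
  · rintro ⟨i, l⟩ ⟨⟨D, c⟩, x⟩ ⟨h, hl⟩
    rw [ev_eq_iff]
    have hx : (D.1 x).1 = i := congrArg (fun a : Lab Pt n => (a.1 : ℕ)) h
    refine Sigma.ext hx ?_
    dsimp only [hermite] at hl ⊢
    rw [hl, hx]

end Conf

open PowerSeries

variable {𝔐 : CSch} [AddMonObj 𝔐] [IsCommAddMonObj 𝔐] [LocallyOfFiniteType 𝔐.hom]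
  [IsSeparated 𝔐.hom]

theorem hasClass_line : HasClass (𝔐 := 𝔐) ℂ (fun _ => 0) (lef 𝔐) :=
  (HasClass.relVar (RelVar.affineLine 𝔐)).of_bijective lineVal_bijective defMap_lineVal
    fun s => (AddMonObj.comp_zero s).symm

theorem cons_bijective (n : ℕ) :
    Function.Bijective fun z : ℂ × Vec n => (Fin.cons z.1 z.2 : Vec (n + 1)) :=
  (Fin.consEquiv fun _ => ℂ).bijective

theorem defMap_cons (n : ℕ) : DefMap fun z : ℂ × Vec n => (Fin.cons z.1 z.2 : Vec (n + 1)) := by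
  refine DefMap.pi fun i => ?_
  refine Fin.cases ?_ (fun i => ?_) i
  · simpa using DefMap.fst
  · simpa using (DefMap.eval i).comp DefMap.snd

theorem hasClass_vec (n : ℕ) : HasClass (𝔐 := 𝔐) (Vec n) (fun _ => 0) (lef 𝔐 ^ n) := by
  induction n with
  | zero => exact HasClass.of_unique fun _ => rfl
  | succ n ih =>
    rw [pow_succ']
    exact (hasClass_line.prod ih).of_bijective (cons_bijective n) (defMap_cons n)
      fun _ => (add_zero _).symm

variable (𝔐) in
/-- Coefficient vectors, of weight zero. -/
def WT.vec (n : ℕ) : WT 𝔐 where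
  carrier := Vec n
  w _ := 0
  hasClass := ⟨_, hasClass_vec n⟩

variable (𝔐) in
/-- The complex numbers, of weight zero. -/
def WT.complex : WT 𝔐 where
  carrier := ℂ
  w _ := 0
  hasClass := ⟨_, hasClass_line⟩

theorem toK0_complex : toK0 𝔐 (ecl (WT.complex 𝔐)) = lef 𝔐 := toK0_ecl hasClass_line

theorem ecl_vec (n : ℕ) : ecl (WT.vec 𝔐 n) = ecl (WT.complex 𝔐) ^ n := by
  induction n with
  | zero =>
    have : Unique (WT.vec 𝔐 0).carrier := inferInstanceAs (Unique (Vec 0))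
    rw [pow_zero]
    exact ecl_eq_one _ rfl
  | succ n ih =>
    rw [pow_succ', ← ih, ← ecl_prod]
    symm
    exact ecl_eq_iff.mpr ⟨_, cons_bijective n, defMap_cons n, fun _ => (add_zero _).symm⟩

/-- Elements of `Sym^n` of the line correspond to monic polynomials of degree `n`, hence to their
`n` lower coefficients. -/
theorem coeff_symSer_complex (n : ℕ) :
    coeff n (symSer (ecl (WT.complex 𝔐))) = ecl (WT.vec 𝔐 n) := by
  rw [coeff_symSer]
  symm
  refine ecl_eq_iff.mpr ⟨Conf.roots, Conf.roots_bijective, Conf.defMap_roots, fun c => ?_⟩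
  change ∑ᶠ z : ℂ, (_ • (0 : pts 𝔐) + 0) = 0
  simp

variable (𝔐) in
/-- Coefficient vectors as labels. -/
def Lbl.vec : Lbl 𝔐 where
  L n := WT.vec 𝔐 n
  uniq := inferInstanceAs (Unique (Vec 0))
  w_default := rfl

theorem expandSer_one (A : (SK 𝔐)⟦X⟧) : expandSer 1 A = A := by
  ext j
  rw [expandSer, coeff_mk]
  refine (Fintype.sum_eq_single ⟨Fin.last j, one_mul j⟩ fun m hm => ?_).trans rfl
  exact (hm (Subtype.ext (Fin.ext (by simpa using m.2)))).elim

/-- Currying with `k = 1` views `Sym^n(X × 𝔸¹)` as configurations on `X` labelled by `Sym^i 𝔸¹ =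
𝔸^i`. Hermite interpolation replaces the vectors at the points by one polynomial of degree less than
`n`, so the total factor is `𝔸^n`; coordinates on an affine model of `X` provide the nodes. -/
theorem coeff_symSer_complex_mul (x : SK 𝔐) (n : ℕ) :
    coeff n (symSer (x * ecl (WT.complex 𝔐))) =
      coeff n (symSer x) * ecl (WT.complex 𝔐) ^ n := by
  have h := confSer_expandSer 1 (ecl (WT.complex 𝔐)) x
  rw [expandSer_one, expandSer_one, SK.push_one] at h
  rw [← h]
  obtain ⟨V, hV, rfl⟩ := SK.exists_affine x
  obtain ⟨N, ξ, hξ, hd⟩ := exists_coordinates V.X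
  rw [coeff_confSer (𝒜 := Lbl.vec 𝔐) fun i _ _ => (coeff_symSer_complex i).symm, coeff_symSer,
    ← ecl_vec, ← ecl_prod]
  symm
  refine ecl_eq_iff.mpr ⟨Conf.hermite ξ, Conf.hermite_bijective hξ, Conf.defMap_hermite hξ hd,
    fun z => ?_⟩
  change _ = (_ : pts 𝔐) + (0 : pts 𝔐)
  rw [add_zero]
  rfl

variable (𝔐) in
theorem isLef_lef : (zetaK0 𝔐).IsLef (lef 𝔐) where
  zeta a := by
    have h (s : SK 𝔐) : (zetaK0 𝔐).zeta (lef 𝔐 * toK0 𝔐 s) =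
        scaleOne (lef 𝔐) ((zetaK0 𝔐).zeta (toK0 𝔐 s)) := by
      rw [← toK0_complex, ← map_mul, zetaK0_toK0, zetaK0_toK0]
      refine oneSeries_ext fun n => ?_
      rw [coeff_effToOne]
      change _ = coeff n (rescale _ _)
      rw [coeff_rescale, coeff_effToOne, ← map_pow, ← map_mul, mul_comm _ s]
      refine congrArg (toK0 𝔐) ((coeff_symSer_complex_mul s n).trans (mul_comm _ _))
    obtain ⟨s, t, rfl⟩ := exists_toK0_sub a
    have h₁ := (zetaK0 𝔐).zeta_add (lef 𝔐 * (toK0 𝔐 s - toK0 𝔐 t)) (lef 𝔐 * toK0 𝔐 t)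
    have h₂ := (zetaK0 𝔐).zeta_add (toK0 𝔐 s - toK0 𝔐 t) (toK0 𝔐 t)
    rw [← mul_add, sub_add_cancel, h, h] at h₁
    rw [sub_add_cancel] at h₂
    rw [h₂, scaleOne_mul] at h₁
    exact (mul_right_cancel h₁).symm
  psi k := by
    rw [← toK0_complex]
    refine (psiK0_toK0 k _).trans (congrArg (toK0 𝔐) ?_)
    rw [SK.push_ecl]
    refine ecl_eq_iff.mpr ⟨id, Function.bijective_id, DefMap.id, fun _ => ?_⟩
    exact (nsmul_zero k).symm

end MotivicPower

namespace MotivicPower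

/-! ### The localized Grothendieck rings -/

section Span

variable {𝔐 : CSch} [AddMonObj 𝔐] [IsCommAddMonObj 𝔐] [LocallyOfFiniteType 𝔐.hom]
  [IsSeparated 𝔐.hom]

theorem mul_mem_closure {R : Type*} [CommRing R] (φ : K0 𝔐 →+* R) (u : Rˣ) (k : ℤ) (a : K0 𝔐) :
    ((u ^ k : Rˣ) : R) * φ a ∈ AddSubgroup.closure {r : R | ∃ (k : ℤ) (V : RelVar 𝔐),
      r = ((u ^ k : Rˣ) : R) * φ (cls V)} := by
  induction a using K0.induction with
  | hcls V => exact AddSubgroup.subset_closure ⟨k, V, rfl⟩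
  | hz => simp
  | hadd a b ha hb => rw [map_add, mul_add]; exact add_mem ha hb
  | hneg a ha => rw [map_neg, mul_neg]; exact neg_mem ha

theorem coe_lefUnit : ((lefUnit 𝔐 : (K0Loc 𝔐)ˣ) : K0Loc 𝔐) = algebraMap _ _ (lef 𝔐) := rfl

theorem exists_lefUnit_zpow_mul (s : K0Loc 𝔐) :
    ∃ (k : ℤ) (a : K0 𝔐), s = ((lefUnit 𝔐 ^ k : (K0Loc 𝔐)ˣ) : K0Loc 𝔐) * toLoc 𝔐 a := by
  obtain ⟨n, a, h⟩ := IsLocalization.Away.surj (S := K0Loc 𝔐) (lef 𝔐) s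
  refine ⟨-n, a, ?_⟩
  rw [toLoc, ← h, ← coe_lefUnit, zpow_neg, zpow_natCast, mul_left_comm, ← Units.val_pow_eq_pow_val,
    Units.inv_mul, mul_one]

variable (𝔐) in
theorem closure_loc : AddSubgroup.closure {r : K0Loc 𝔐 | ∃ (k : ℤ) (V : RelVar 𝔐),
    r = ((lefUnit 𝔐 ^ k : (K0Loc 𝔐)ˣ) : K0Loc 𝔐) * toLoc 𝔐 (cls V)} = ⊤ := by
  refine eq_top_iff.mpr fun s _ => ?_
  obtain ⟨k, a, rfl⟩ := exists_lefUnit_zpow_mul s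
  exact mul_mem_closure _ _ _ _

theorem map_lefUnit : Units.map (locToHalf 𝔐).toMonoidHom (lefUnit 𝔐) = lefHalfUnit 𝔐 ^ (2 : ℤ) :=
  Units.ext ((root_mul_root 𝔐).symm.trans
    (congrArg Units.val (zpow_two (lefHalfUnit 𝔐)).symm))

theorem locToHalf_zpow (k : ℤ) : locToHalf 𝔐 ((lefUnit 𝔐 ^ k : (K0Loc 𝔐)ˣ) : K0Loc 𝔐) =
    ((lefHalfUnit 𝔐 ^ (2 * k) : (K0Half 𝔐)ˣ) : K0Half 𝔐) := by
  rw [zpow_mul, ← map_lefUnit, ← map_zpow]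
  rfl

variable (𝔐) in
-- In the coordinates `x + y 𝕃^{1/2}`, the first term is a multiple of an even power of `𝕃^{1/2}`
-- and the second of an odd one.
theorem closure_half : AddSubgroup.closure {r : K0Half 𝔐 | ∃ (k : ℤ) (V : RelVar 𝔐),
    r = ((lefHalfUnit 𝔐 ^ k : (K0Half 𝔐)ˣ) : K0Half 𝔐) *
      ((locToHalf 𝔐).comp (toLoc 𝔐)) (cls V)} = ⊤ := by
  refine eq_top_iff.mpr fun s _ => ?_
  obtain ⟨⟨x, y⟩, hs, -⟩ := existsUnique_adjoinRoot (lefUnit 𝔐 : K0Loc 𝔐) s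
  obtain ⟨k, a, rfl⟩ := exists_lefUnit_zpow_mul x
  obtain ⟨m, b, rfl⟩ := exists_lefUnit_zpow_mul y
  have h₁ := mul_mem_closure ((locToHalf 𝔐).comp (toLoc 𝔐)) (lefHalfUnit 𝔐) (2 * k) a
  have h₂ := mul_mem_closure ((locToHalf 𝔐).comp (toLoc 𝔐)) (lefHalfUnit 𝔐) (2 * m + 1) b
  rw [← locToHalf_zpow, RingHom.comp_apply, ← map_mul] at h₁
  rw [zpow_add_one, Units.val_mul, ← locToHalf_zpow, RingHom.comp_apply, mul_right_comm,
    ← map_mul] at h₂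
  rw [hs]
  exact add_mem h₁ h₂

end Span

variable (𝔐 : CSch) [AddMonObj 𝔐] [IsCommAddMonObj 𝔐] [LocallyOfFiniteType 𝔐.hom]
  [IsSeparated 𝔐.hom]

/-- The zeta functions of `K₀(Var/𝔐)[𝕃⁻¹]`. -/
def zetaLoc : ZetaRing (K0Loc 𝔐) := locZetaRing (coe_lefUnit (𝔐 := 𝔐)) (isLef_lef 𝔐)

theorem compat_zetaLoc : ZetaRing.Compat (toLoc 𝔐) (zetaK0 𝔐) (zetaLoc 𝔐) :=
  compat_locZetaRing _ _

theorem isLef_zetaLoc : (zetaLoc 𝔐).IsLef (lefUnit 𝔐 : K0Loc 𝔐) := isLef_locZetaRing _ _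

/-- The Adams operations of `K₀(Var/𝔐)[𝕃^{-1/2}]`. -/
def psiHalf (k : ℕ) : K0Half 𝔐 →+* K0Half 𝔐 :=
  AdjoinRoot.lift ((locToHalf 𝔐).comp ((zetaLoc 𝔐).psi k)) (AdjoinRoot.root _) (by
    rw [Polynomial.eval₂_sub, Polynomial.eval₂_X_pow, Polynomial.eval₂_C, RingHom.comp_apply,
      (isLef_zetaLoc 𝔐).psi]
    exact sub_eq_zero.mpr ((pow_two _).trans (root_mul_root 𝔐)))

/-- The zeta functions of `K₀(Var/𝔐)[𝕃^{-1/2}]`. -/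
def zetaHalf : ZetaRing (K0Half 𝔐) :=
  quadZetaRing (Z := zetaLoc 𝔐) (φ := locToHalf 𝔐) (s := AdjoinRoot.root _)
    (existsUnique_adjoinRoot (lefUnit 𝔐 : K0Loc 𝔐)) (psiHalf 𝔐) (fun _ => AdjoinRoot.lift_root _)
    (fun _ _ => AdjoinRoot.lift_of _)

theorem compat_zetaHalf : ZetaRing.Compat (locToHalf 𝔐) (zetaLoc 𝔐) (zetaHalf 𝔐) :=
  compat_quadZetaRing

theorem isLef_zetaHalf : (zetaHalf 𝔐).IsLef (lefHalfUnit 𝔐 : K0Half 𝔐) :=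
  isLef_quadZetaRing (root_mul_root 𝔐) (isLef_zetaLoc 𝔐)

theorem compat_zetaHalf_comp :
    ZetaRing.Compat ((locToHalf 𝔐).comp (toLoc 𝔐)) (zetaK0 𝔐) (zetaHalf 𝔐) where
  zeta a := by
    rw [RingHom.comp_apply, (compat_zetaHalf 𝔐).zeta, (compat_zetaLoc 𝔐).zeta, mapOne_mapOne]
  psi k r hk := by
    rw [RingHom.comp_apply, RingHom.comp_apply, (compat_zetaHalf 𝔐).psi k _ hk,
      (compat_zetaLoc 𝔐).psi k _ hk]

end MotivicPower

end

theorem mainTheorem8 (𝔐 : MotivicPower.CSch) [AddMonObj 𝔐] [IsCommAddMonObj 𝔐]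
    [LocallyOfFiniteType 𝔐.hom] [IsSeparated 𝔐.hom] :
    ∃ P₀ : MotivicPower.PowerStructure (MotivicPower.K0 𝔐),
      (P₀.IsGeometric ∧
        ∀ Q : MotivicPower.PowerStructure (MotivicPower.K0 𝔐), Q.IsGeometric → Q = P₀) ∧
      ∃ P₁ : MotivicPower.PowerStructure (MotivicPower.K0Loc 𝔐),
        (P₁.IsZetaExtension (MotivicPower.toLoc 𝔐) (MotivicPower.lefUnit 𝔐) P₀ ∧
          ∀ Q : MotivicPower.PowerStructure (MotivicPower.K0Loc 𝔐),
            Q.IsZetaExtension (MotivicPower.toLoc 𝔐) (MotivicPower.lefUnit 𝔐) P₀ → Q = P₁) ∧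
        ∃ P₂ : MotivicPower.PowerStructure (MotivicPower.K0Half 𝔐),
          MotivicPower.PowerStructure.Extends (MotivicPower.locToHalf 𝔐) P₁ P₂ ∧
          P₂.IsZetaExtension ((MotivicPower.locToHalf 𝔐).comp (MotivicPower.toLoc 𝔐))
            (MotivicPower.lefHalfUnit 𝔐) P₀ ∧
          ∀ Q : MotivicPower.PowerStructure (MotivicPower.K0Half 𝔐),
            Q.IsZetaExtension ((MotivicPower.locToHalf 𝔐).comp (MotivicPower.toLoc 𝔐))
              (MotivicPower.lefHalfUnit 𝔐) P₀ → Q = P₂ := by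
  have h₁ := MotivicPower.isZetaExtension_power (MotivicPower.compat_zetaLoc 𝔐)
    (MotivicPower.isLef_zetaLoc 𝔐)
  have h₂ := MotivicPower.isZetaExtension_power (MotivicPower.compat_zetaHalf_comp 𝔐)
    (MotivicPower.isLef_zetaHalf 𝔐)
  exact ⟨(MotivicPower.zetaK0 𝔐).power,
    ⟨MotivicPower.isGeometric_power 𝔐, MotivicPower.eq_power_of_isGeometric⟩,
    (MotivicPower.zetaLoc 𝔐).power,
    ⟨h₁, fun _ hQ => MotivicPower.isZetaExtension_unique h₁ hQ (MotivicPower.closure_loc 𝔐)⟩,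
    (MotivicPower.zetaHalf 𝔐).power, (MotivicPower.compat_zetaHalf 𝔐).extends, h₂,
    fun _ hQ => MotivicPower.isZetaExtension_unique h₂ hQ (MotivicPower.closure_half 𝔐)⟩
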